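/- Let $M$ be a connected complex $3$-manifold with a locally homogeneous holomorphic Riemannian metric $g$ (a holomorphic field of nondegenerate complex symmetric bilinear forms on the holomorphic tangent spaces such that any two points are exchanged by a local biholomorphic isometry). For $x\in M$ let $\mathcal G_x$ be the Lie algebra of germs at $x$ of holomorphic Killing fields of $g$, and let $\mathcal I_x\subset\mathcal G_x$ be the isotropy subalgebra of germs vanishing at $x$. Assume that for some $x_0\in M$ the Killing algebra $\mathcal G_{x_0}$ has dimension $4$ and that its semisimple part is nontrivial (that is, its solvable radical is a proper ideal). Then $\mathcal G_x\cong\mathbb C\oplus\mathfrak{sl}(2,\mathbb C)$ (direct product of Lie algebras) for every $x\in M$, and exactly one of the following two local models occurs. (1) There are a nondegenerate symmetric bilinear form $q$ on $\mathfrak{sl}(2,\mathbb C)$, with associated left-invariant metric $g_q$ on $SL(2,\mathbb C)$, and an element $v\ne0$ of $\mathfrak{sl}(2,\mathbb C)$, with one-parameter subgroup $h^t=\exp(tv)$, $t\in\mathbb C$, such that: - every point of $M$ has a neighbourhood isometric to an open subset of $(SL(2,\mathbb C),g_q)$; - the identity component of the group of holomorphic isometries of $(SL(2,\mathbb C),g_q)$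 (with the compact-open topology) consists exactly of the maps $x\mapsto a\,x\,(h^{t})^{-1}$ with $a\in SL(2,\mathbb C)$ and $t\in\mathbb C$, and the elements of this component fixing the neutral element are exactly the maps $x\mapsto h^t\,x\,(h^t)^{-1}$; - for every $x\in M$ there is an isomorphism $\mathcal G_x\cong\mathbb C\oplus\mathfrak{sl}(2,\mathbb C)$ that carries $\mathcal I_x$ onto the diagonal line $\mathbb C\,(1,v)$; - there is a holomorphic Riemannian metric $\kappa$ on $M$ of nonzero constant sectional curvature such that every local Killing field of $g$ is a Killing field of $\kappa$; it comes from the Killing form of $\mathfrak{sl}(2,\mathbb C)$, in the sense that every local isometry from $(M,g)$ to $(SL(2,\mathbb C),g_q)$ carries $\kappa$ to the left-invariant metric on $SL(2,\mathbb C)$ given by the Killing form. In this case $(M,g)$ is not locally isometric to any of the products in (2). (2) Let $S_2$ be the holomorphic sphere, realized as the quadric $\{A\in\mathfrak{sl}(2,\mathbb C):\det A=-1\}$ with the metric $\sigma$ induced by the quadratic form $\tfrac12\operatorname{tr}(A^2)$. There is $c\in\mathbb C$, $c\ne0$, such that: - every point of $M$ has a neighbourhood isometric to an open subset of $\mathbb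 C\times S_2$ with the product metric $dz^2+c\,\sigma$; - the identity component of the group of holomorphic isometries of $(\mathbb C\times S_2,\,dz^2+c\,\sigma)$ consists exactly of the maps $(z,A)\mapsto(z+t,\,aAa^{-1})$ with $t\in\mathbb C$ and $a\in SL(2,\mathbb C)$, and the elements of this component fixing the point $(0,\operatorname{diag}(1,-1))$ are exactly those given by $t=0$ and $a=\operatorname{diag}(e^s,e^{-s})$, $s\in\mathbb C$; - for every $x\in M$ there is an isomorphism $\mathcal G_x\cong\mathbb C\oplus\mathfrak{sl}(2,\mathbb C)$ that carries $\mathcal I_x$ onto the line $\mathbb C\,(0,\operatorname{diag}(1,-1))$. In this case $(M,g)$ is not locally isometric to any left-invariant holomorphic Riemannian metric on $SL(2,\mathbb C)$. -/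

import Mathlib

open scoped Manifold ContDiff Topology
open Filter VectorField

-- the bracket of an associative algebra is the commutator (so `ℂ` is an abelian Lie algebra)
attribute [local instance] LieRing.ofAssociativeRing

noncomputable section

namespace HolRiem

section General

variable {E : Type*} [NormedAddCommGroup E] [NormedSpace ℂ E]
variable {M : Type*} [TopologicalSpace M] [ChartedSpace E M] [IsManifold 𝓘(ℂ, E) ω M]

/-- The vector field `V` is holomorphic (complex analytic) near the point `x`. -/
def HolAt (V : ∀ y : M, TangentSpace 𝓘(ℂ, E) y) (x : M) : Prop :=
  ContMDiffAt 𝓘(ℂ, E) 𝓘(ℂ, E).tangent ω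
    (fun y => (⟨y, V y⟩ : TangentBundle 𝓘(ℂ, E) M)) x

lemma HolAt.eventually {V : ∀ y : M, TangentSpace 𝓘(ℂ, E) y} {x : M}
    (h : HolAt V x) : ∀ᶠ y in 𝓝 x, HolAt V y := by
  have : IsManifold 𝓘(ℂ, E) (ω + 1) M := IsManifold.of_le (n := ω) le_top
  have : IsManifold 𝓘(ℂ, E) 1 M := IsManifold.of_le (n := ω) le_top
  have : IsManifold 𝓘(ℂ, E).tangent ω (TangentBundle 𝓘(ℂ, E) M) := inferInstance
  exact (contMDiffAt_iff_contMDiffAt_nhds (by simp)).1 h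

lemma HolAt.congr {V W : ∀ y : M, TangentSpace 𝓘(ℂ, E) y} {x : M}
    (h : HolAt V x) (hW : ∀ᶠ y in 𝓝 x, W y = V y) : HolAt W x :=
  ContMDiffAt.congr_of_eventuallyEq h (by filter_upwards [hW] with y hy; rw [hy])

lemma HolAt.mlieBracket [CompleteSpace E]
    {V W : ∀ y : M, TangentSpace 𝓘(ℂ, E) y} {x : M}
    (hV : HolAt V x) (hW : HolAt W x) : HolAt (mlieBracket 𝓘(ℂ, E) V W) x := by
  have : IsManifold 𝓘(ℂ, E) (ω + 1) M := IsManifold.of_le (n := ω) le_top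
  have : IsManifold 𝓘(ℂ, E) (minSmoothness ℂ 3) M := IsManifold.of_le (n := ω) le_top
  have := ContMDiffWithinAt.mlieBracketWithin_vectorField (I := 𝓘(ℂ, E)) (n := ω) (m := ω)
    (s := Set.univ) (U := V) (V := W) (x := x) hV hW uniqueMDiffOn_univ (Set.mem_univ _)
    le_top
  rw [mlieBracketWithin_univ] at this
  exact contMDiffWithinAt_univ.1 this

lemma HolAt.mdiff {V : ∀ y : M, TangentSpace 𝓘(ℂ, E) y} {x : M} (h : HolAt V x) :
    MDifferentiableAt 𝓘(ℂ, E) 𝓘(ℂ, E).tangent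
      (fun y => (⟨y, V y⟩ : TangentBundle 𝓘(ℂ, E) M)) x :=
  ContMDiffAt.mdifferentiableAt h (by simp)

/-- The derivative at `x` of the function `f` along the tangent vector `v`. -/
def dirDeriv (f : M → ℂ) (x : M) (v : TangentSpace 𝓘(ℂ, E) x) : ℂ :=
  mfderiv 𝓘(ℂ, E) 𝓘(ℂ, ℂ) f x v

lemma chart_aux (x : M) {z : E} (hz : z ∈ (extChartAt 𝓘(ℂ, E) x).target) :
    (extChartAt 𝓘(ℂ, E) x).target ∈ 𝓝 z ∧
    ContMDiffAt 𝓘(ℂ, E) 𝓘(ℂ, E) ω (extChartAt 𝓘(ℂ, E) x).symm z ∧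
    (mfderiv 𝓘(ℂ, E) 𝓘(ℂ, E) (extChartAt 𝓘(ℂ, E) x).symm z).IsInvertible := by
  have h1 : (extChartAt 𝓘(ℂ, E) x).target ∈ 𝓝 z := (isOpen_extChartAt_target x).mem_nhds hz
  refine ⟨h1, (contMDiffOn_extChartAt_symm x).contMDiffAt h1, ?_⟩
  have := isInvertible_mfderivWithin_extChartAt_symm (I := 𝓘(ℂ, E)) hz
  simpa using this

lemma dirDeriv_chart (x : M) {z : E} (hz : z ∈ (extChartAt 𝓘(ℂ, E) x).target) (F : M → ℂ)
    (hF : MDifferentiableAt 𝓘(ℂ, E) 𝓘(ℂ, ℂ) F ((extChartAt 𝓘(ℂ, E) x).symm z))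
    (V : ∀ y : M, TangentSpace 𝓘(ℂ, E) y) :
    fderiv ℂ (F ∘ (extChartAt 𝓘(ℂ, E) x).symm) z
      (mpullback 𝓘(ℂ, E) 𝓘(ℂ, E) (extChartAt 𝓘(ℂ, E) x).symm V z) =
    dirDeriv F ((extChartAt 𝓘(ℂ, E) x).symm z) (V ((extChartAt 𝓘(ℂ, E) x).symm z)) := by
  obtain ⟨-, h2, h3⟩ := chart_aux x hz
  have hc : fderiv ℂ (F ∘ (extChartAt 𝓘(ℂ, E) x).symm) z =
      (mfderiv 𝓘(ℂ, E) 𝓘(ℂ, ℂ) F ((extChartAt 𝓘(ℂ, E) x).symm z)).comp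
      (mfderiv 𝓘(ℂ, E) 𝓘(ℂ, E) (extChartAt 𝓘(ℂ, E) x).symm z) := by
    rw [← mfderiv_eq_fderiv]
    exact mfderiv_comp z hF (h2.mdifferentiableAt (by simp))
  have he : mfderiv 𝓘(ℂ, E) 𝓘(ℂ, E) (extChartAt 𝓘(ℂ, E) x).symm z
      (mpullback 𝓘(ℂ, E) 𝓘(ℂ, E) (extChartAt 𝓘(ℂ, E) x).symm V z) =
      V ((extChartAt 𝓘(ℂ, E) x).symm z) := by
    obtain ⟨e, he⟩ := h3
    rw [mpullback_apply, ← he, ContinuousLinearMap.inverse_equiv]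
    exact e.apply_symm_apply _
  rw [hc]
  exact congrArg (mfderiv 𝓘(ℂ, E) 𝓘(ℂ, ℂ) F ((extChartAt 𝓘(ℂ, E) x).symm z)) he

lemma HolAt.chart [CompleteSpace E] {V : ∀ y : M, TangentSpace 𝓘(ℂ, E) y} {x : M}
    (hV : HolAt V x) :
    DifferentiableAt ℂ (mpullback 𝓘(ℂ, E) 𝓘(ℂ, E) (extChartAt 𝓘(ℂ, E) x).symm V : E → E)
      (extChartAt 𝓘(ℂ, E) x x) := by
  have := contMDiffWithinAt_mpullbackWithin_extChartAt_symm (I := 𝓘(ℂ, E)) (n := ω) (m := ω)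
    (s := Set.univ) (x := x) hV uniqueMDiffOn_univ (Set.mem_univ _) le_top
  have h2 := contMDiffWithinAt_vectorSpace_iff_contDiffWithinAt.1 this
  simp only [Set.preimage_univ, Set.inter_univ, modelWithCornersSelf_coe, Set.range_id,
    mpullbackWithin_univ] at h2
  exact (h2.contDiffAt ((isOpen_extChartAt_target x).mem_nhds
    (mem_extChartAt_target x))).differentiableAt (by simp)

/-- The operator of derivation along a Lie bracket is the commutator. -/
lemma dirDeriv_mlieBracket [CompleteSpace E]
    {V W : ∀ y : M, TangentSpace 𝓘(ℂ, E) y} {x : M} {f : M → ℂ}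
    (hV : HolAt V x) (hW : HolAt W x) (hf : ContMDiffAt 𝓘(ℂ, E) 𝓘(ℂ, ℂ) ω f x) :
    dirDeriv f x (mlieBracket 𝓘(ℂ, E) V W x) =
      dirDeriv (fun y => dirDeriv f y (W y)) x (V x) -
      dirDeriv (fun y => dirDeriv f y (V y)) x (W x) := by
  set φ := extChartAt 𝓘(ℂ, E) x with hφ
  have hz : φ x ∈ φ.target := mem_extChartAt_target x
  have hx : φ.symm (φ x) = x := extChartAt_to_inv x
  obtain ⟨h1, h2, h3⟩ := chart_aux x hz
  have hfψ : ContDiffAt ℂ ω (f ∘ φ.symm) (φ x) := by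
    rw [← contMDiffAt_iff_contDiffAt]
    exact ContMDiffAt.comp _ (by rw [hx]; exact hf) h2
  -- the derivative of `f` along a field, read in the chart
  have key : ∀ U : (∀ y : M, TangentSpace 𝓘(ℂ, E) y),
      ((fun y => dirDeriv f y (U y)) ∘ φ.symm) =ᶠ[𝓝 (φ x)]
      fun z => fderiv ℂ (f ∘ φ.symm) z (mpullback 𝓘(ℂ, E) 𝓘(ℂ, E) φ.symm U z) := by
    intro U
    have hf' : ∀ᶠ y in 𝓝 x, ContMDiffAt 𝓘(ℂ, E) 𝓘(ℂ, ℂ) ω f y :=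
      (contMDiffAt_iff_contMDiffAt_nhds (by simp)).1 hf
    have hc : Tendsto φ.symm (𝓝 (φ x)) (𝓝 x) := by
      have := h2.continuousAt
      rwa [ContinuousAt, hx] at this
    filter_upwards [h1, hc.eventually hf'] with z hz' hfz
    exact (dirDeriv_chart x hz' f (hfz.mdifferentiableAt (by simp)) U).symm
  have key2 : ∀ U : (∀ y : M, TangentSpace 𝓘(ℂ, E) y), HolAt U x →
      MDifferentiableAt 𝓘(ℂ, E) 𝓘(ℂ, ℂ) (fun y => dirDeriv f y (U y)) x := by
    intro U hU
    have hd : DifferentiableAt ℂ ((fun y => dirDeriv f y (U y)) ∘ φ.symm) (φ x) := by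
      refine DifferentiableAt.congr_of_eventuallyEq ?_ (key U)
      exact DifferentiableAt.clm_apply
        ((hfψ.fderiv_right (m := 1) le_top).differentiableAt (by simp)) hU.chart
    have hm : MDifferentiableAt 𝓘(ℂ, E) 𝓘(ℂ, ℂ)
        (((fun y => dirDeriv f y (U y)) ∘ φ.symm) ∘ φ) x :=
      MDifferentiableAt.comp x hd.mdifferentiableAt (mdifferentiableAt_extChartAt (by simp))
    refine hm.congr_of_eventuallyEq ?_
    filter_upwards [extChartAt_source_mem_nhds (I := 𝓘(ℂ, E)) x] with y hy
    simp only [Function.comp_apply]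
    rw [φ.left_inv hy]
  have main : ∀ U U' : (∀ y : M, TangentSpace 𝓘(ℂ, E) y), HolAt U x →
      dirDeriv (fun y => dirDeriv f y (U y)) x (U' x) =
      fderiv ℂ (fun z => fderiv ℂ (f ∘ φ.symm) z (mpullback 𝓘(ℂ, E) 𝓘(ℂ, E) φ.symm U z)) (φ x)
        (mpullback 𝓘(ℂ, E) 𝓘(ℂ, E) φ.symm U' (φ x)) := by
    intro U U' hU
    have := dirDeriv_chart x hz (fun y => dirDeriv f y (U y)) (by rw [hx]; exact key2 U hU) U'
    rw [← (key U).fderiv_eq, this, hx]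
  rw [main W V hW, main V W hV]
  have hb := mpullback_mlieBracket (I := 𝓘(ℂ, E)) (I' := 𝓘(ℂ, E)) (n := ω) (f := φ.symm)
    (x₀ := φ x) (V := V) (W := W) (by rw [hx]; exact hV.mdiff) (by rw [hx]; exact hW.mdiff) h2
    le_top
  have hc := dirDeriv_chart x hz f (by rw [hx]; exact hf.mdifferentiableAt (by simp))
    (mlieBracket 𝓘(ℂ, E) V W)
  rw [hx] at hc
  rw [← hc, hb]
  have := fderiv_apply_lieBracket (𝕜 := ℂ) (n := ω) hfψ le_top hW.chart hV.chart
  rw [← this]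
  have hl : ∀ (A B : ∀ x : E, TangentSpace 𝓘(ℂ, E) x) (z : E),
      mlieBracket 𝓘(ℂ, E) A B z = lieBracket ℂ A B z := by
    intro A B z
    have h := congrFun (mlieBracketWithin_eq_lieBracketWithin (V := A) (W := B)
      (s := Set.univ)) z
    rw [mlieBracketWithin_univ] at h
    exact h.trans (congrFun lieBracketWithin_univ z)
  exact congrArg (fderiv ℂ (f ∘ φ.symm) (φ x)) (hl _ _ _)

variable (E M) in
/-- A holomorphic Riemannian metric: a holomorphic field of nondegenerate complex
symmetric bilinear forms on the holomorphic tangent spaces.  The field is holomorphic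
in the sense that its values on holomorphic vector fields are holomorphic functions. -/
structure Metric where
  val : ∀ x : M, TangentSpace 𝓘(ℂ, E) x →ₗ[ℂ] TangentSpace 𝓘(ℂ, E) x →ₗ[ℂ] ℂ
  symm : ∀ x v w, val x v w = val x w v
  nondeg : ∀ x v, (∀ w, val x v w = 0) → v = 0
  holo : ∀ (V W : ∀ y : M, TangentSpace 𝓘(ℂ, E) y) (x : M), HolAt V x → HolAt W x →
    ContMDiffAt 𝓘(ℂ, E) 𝓘(ℂ, ℂ) ω (fun y => val y (V y) (W y)) x

/-- `V` satisfies the Killing equation `L_V g = 0` at the point `x`. -/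
def KillingAt (g : Metric E M) (V : ∀ y : M, TangentSpace 𝓘(ℂ, E) y) (x : M) : Prop :=
  ∀ W Z : ∀ y : M, TangentSpace 𝓘(ℂ, E) y, HolAt W x → HolAt Z x →
    dirDeriv (fun y => g.val y (W y) (Z y)) x (V x) =
      g.val x (mlieBracket 𝓘(ℂ, E) V W x) (Z x) + g.val x (W x) (mlieBracket 𝓘(ℂ, E) V Z x)


lemma Metric.holo_mdiff (g : Metric E M) {V W : ∀ y : M, TangentSpace 𝓘(ℂ, E) y} {x : M}
    (hV : HolAt V x) (hW : HolAt W x) :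
    MDifferentiableAt 𝓘(ℂ, E) 𝓘(ℂ, ℂ) (fun y => g.val y (V y) (W y)) x :=
  (g.holo V W x hV hW).mdifferentiableAt (by simp)

lemma dirDeriv_congr {f f' : M → ℂ} {x : M} (h : f =ᶠ[𝓝 x] f') (v : TangentSpace 𝓘(ℂ, E) x) :
    dirDeriv f x v = dirDeriv f' x v := by
  simp only [dirDeriv]
  rw [h.mfderiv_eq]
  rfl

lemma dirDeriv_add {f f' : M → ℂ} {x : M} (h : MDifferentiableAt 𝓘(ℂ, E) 𝓘(ℂ, ℂ) f x)
    (h' : MDifferentiableAt 𝓘(ℂ, E) 𝓘(ℂ, ℂ) f' x) (v : TangentSpace 𝓘(ℂ, E) x) :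
    dirDeriv (fun y => f y + f' y) x v = dirDeriv f x v + dirDeriv f' x v := by
  simp only [dirDeriv]
  have := mfderiv_add h h'
  exact congrArg (fun L => L v) this

/-- If `V` and `V'` are Killing fields near `x`, so is their bracket. -/
lemma KillingAt.mlieBracket [CompleteSpace E] {g : Metric E M}
    {V V' : ∀ y : M, TangentSpace 𝓘(ℂ, E) y} {x : M}
    (hV : ∀ᶠ y in 𝓝 x, HolAt V y ∧ KillingAt g V y)
    (hV' : ∀ᶠ y in 𝓝 x, HolAt V' y ∧ KillingAt g V' y) :
    KillingAt g (mlieBracket 𝓘(ℂ, E) V V') x := by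
  intro W Z hW hZ
  have : IsManifold 𝓘(ℂ, E) (minSmoothness ℂ 3) M := IsManifold.of_le (n := ω) le_top
  have jac : ∀ U : (∀ y : M, TangentSpace 𝓘(ℂ, E) y), HolAt U x →
      VectorField.mlieBracket 𝓘(ℂ, E) (VectorField.mlieBracket 𝓘(ℂ, E) V V') U x =
      VectorField.mlieBracket 𝓘(ℂ, E) V (VectorField.mlieBracket 𝓘(ℂ, E) V' U) x -
      VectorField.mlieBracket 𝓘(ℂ, E) V' (VectorField.mlieBracket 𝓘(ℂ, E) V U) x := by
    intro U hU
    have := leibniz_identity_mlieBracket_apply (I := 𝓘(ℂ, E)) (x := x) (U := V) (V := V') (W := U)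
      (ContMDiffAt.of_le hV.self_of_nhds.1 le_top) (ContMDiffAt.of_le hV'.self_of_nhds.1 le_top)
      (ContMDiffAt.of_le hU le_top)
    rw [this, add_sub_cancel_right]
  have step : ∀ U U' : (∀ y : M, TangentSpace 𝓘(ℂ, E) y),
      (∀ᶠ y in 𝓝 x, HolAt U y ∧ KillingAt g U y) → (HolAt U' x ∧ KillingAt g U' x) →
      dirDeriv (fun y => dirDeriv (fun y => g.val y (W y) (Z y)) y (U y)) x (U' x) =
      (g.val x (VectorField.mlieBracket 𝓘(ℂ, E) U' (VectorField.mlieBracket 𝓘(ℂ, E) U W) x) (Z x) +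
       g.val x (VectorField.mlieBracket 𝓘(ℂ, E) U W x) (VectorField.mlieBracket 𝓘(ℂ, E) U' Z x)) +
      (g.val x (VectorField.mlieBracket 𝓘(ℂ, E) U' W x) (VectorField.mlieBracket 𝓘(ℂ, E) U Z x) +
       g.val x (W x) (VectorField.mlieBracket 𝓘(ℂ, E) U' (VectorField.mlieBracket 𝓘(ℂ, E) U Z) x)) := by
    intro U U' hU hU'
    have hUW := hU.self_of_nhds.1.mlieBracket hW
    have hUZ := hU.self_of_nhds.1.mlieBracket hZ
    rw [dirDeriv_congr (f' := fun y => g.val y (VectorField.mlieBracket 𝓘(ℂ, E) U W y) (Z y) +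
      g.val y (W y) (VectorField.mlieBracket 𝓘(ℂ, E) U Z y)),
      dirDeriv_add (g.holo_mdiff hUW hZ) (g.holo_mdiff hW hUZ)]
    · rw [hU'.2 _ _ hUW hZ, hU'.2 _ _ hW hUZ]
    · filter_upwards [hU, hW.eventually, hZ.eventually] with y hy hyW hyZ
      exact hy.2 W Z hyW hyZ
  rw [dirDeriv_mlieBracket hV.self_of_nhds.1 hV'.self_of_nhds.1 (g.holo W Z x hW hZ),
    step V' V hV' hV.self_of_nhds, step V V' hV hV'.self_of_nhds, jac W hW, jac Z hZ]
  simp only [map_sub, LinearMap.sub_apply]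
  ring


/-! ### The Lie algebra of germs of Killing fields -/

variable [CompleteSpace E]

/-- Vector fields that are holomorphic and satisfy the Killing equation near `x`. -/
def localKilling (g : Metric E M) (x : M) : Submodule ℂ (∀ y : M, TangentSpace 𝓘(ℂ, E) y) where
  carrier := {V | ∀ᶠ y in 𝓝 x, HolAt V y ∧ KillingAt g V y}
  zero_mem' := by
    refine Eventually.of_forall fun y => ⟨(Bundle.contMDiff_zeroSection ℂ
      (TangentSpace 𝓘(ℂ, E) : M → Type _)).contMDiffAt, fun W Z _ _ => ?_⟩
    simp only [mlieBracket_zero_left, Pi.zero_apply, map_zero, LinearMap.zero_apply, add_zero,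
      dirDeriv]
    rfl
  add_mem' := by
    intro V V' hV hV'
    filter_upwards [hV, hV'] with y hy hy'
    refine ⟨ContMDiffAt.add_section hy.1 hy'.1, fun W Z hW hZ => ?_⟩
    rw [mlieBracket_add_left hy.1.mdiff hy'.1.mdiff, mlieBracket_add_left hy.1.mdiff hy'.1.mdiff]
    have h1 := hy.2 W Z hW hZ
    have h2 := hy'.2 W Z hW hZ
    have h3 : dirDeriv (fun y => g.val y (W y) (Z y)) y ((V + V') y) =
      dirDeriv (fun y => g.val y (W y) (Z y)) y (V y) +
      dirDeriv (fun y => g.val y (W y) (Z y)) y (V' y) :=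
      map_add (mfderiv 𝓘(ℂ, E) 𝓘(ℂ, ℂ) (fun y => g.val y (W y) (Z y)) y) _ _
    rw [h3, h1, h2]
    simp only [map_add, LinearMap.add_apply]
    ring
  smul_mem' := by
    intro c V hV
    filter_upwards [hV] with y hy
    refine ⟨ContMDiffAt.const_smul_section hy.1, fun W Z hW hZ => ?_⟩
    rw [mlieBracket_const_smul_left hy.1.mdiff, mlieBracket_const_smul_left hy.1.mdiff]
    have h1 := hy.2 W Z hW hZ
    have h3 : dirDeriv (fun y => g.val y (W y) (Z y)) y ((c • V) y) =
      c * dirDeriv (fun y => g.val y (W y) (Z y)) y (V y) :=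
      map_smul (mfderiv 𝓘(ℂ, E) 𝓘(ℂ, ℂ) (fun y => g.val y (W y) (Z y)) y) c _
    rw [h3, h1]
    simp only [map_smul, LinearMap.smul_apply, smul_eq_mul]
    ring

/-- The fields whose germ at `x` is zero. -/
def zeroGerm (g : Metric E M) (x : M) : Submodule ℂ (localKilling g x) where
  carrier := {V | ∀ᶠ y in 𝓝 x, V.1 y = 0}
  zero_mem' := Eventually.of_forall fun _ => rfl
  add_mem' := by
    intro V V' hV hV'
    filter_upwards [hV, hV'] with y hy hy'
    simp [hy, hy']
  smul_mem' := by
    intro c V hV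
    filter_upwards [hV] with y hy
    simp [hy]

/-- The Killing algebra of `g` at `x`: germs at `x` of local holomorphic Killing fields. -/
def KillingAlgebra (g : Metric E M) (x : M) : Type _ := localKilling g x ⧸ zeroGerm g x

namespace KillingAlgebra

instance (g : Metric E M) (x : M) : AddCommGroup (KillingAlgebra g x) :=
  inferInstanceAs (AddCommGroup (localKilling g x ⧸ zeroGerm g x))

instance (g : Metric E M) (x : M) : Module ℂ (KillingAlgebra g x) :=
  inferInstanceAs (Module ℂ (localKilling g x ⧸ zeroGerm g x))

/-- The germ of a local Killing field. -/
def germ (g : Metric E M) (x : M) : localKilling g x →ₗ[ℂ] KillingAlgebra g x :=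
  (zeroGerm g x).mkQ

lemma germ_surjective (g : Metric E M) (x : M) : Function.Surjective (germ g x) :=
  Submodule.mkQ_surjective _

lemma germ_eq_iff {g : Metric E M} {x : M} {V W : localKilling g x} :
    germ g x V = germ g x W ↔ ∀ᶠ y in 𝓝 x, V.1 y = W.1 y := by
  refine (Submodule.Quotient.eq (zeroGerm g x)).trans ?_
  change (∀ᶠ y in 𝓝 x, V.1 y - W.1 y = 0) ↔ _
  simp only [sub_eq_zero]

/-- The value at `x` of a germ of Killing field. -/
def eval (g : Metric E M) (x : M) : KillingAlgebra g x →ₗ[ℂ] TangentSpace 𝓘(ℂ, E) x :=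
  (zeroGerm g x).liftQ ((LinearMap.proj x).comp (localKilling g x).subtype)
    (fun V hV => by
      have h : ∀ᶠ y in 𝓝 x, V.1 y = 0 := hV
      exact h.self_of_nhds)

lemma eval_germ (g : Metric E M) (x : M) (V : localKilling g x) :
    eval g x (germ g x V) = V.1 x := rfl

/-- The Lie bracket of local Killing fields. -/
def fieldBracket {g : Metric E M} {x : M} (V W : localKilling g x) : localKilling g x :=
  ⟨mlieBracket 𝓘(ℂ, E) V.1 W.1, by
    have hV := V.2
    have hW := W.2
    filter_upwards [eventually_eventually_nhds.2 hV, eventually_eventually_nhds.2 hW]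
      with y hy hy'
    exact ⟨hy.self_of_nhds.1.mlieBracket hy'.self_of_nhds.1, KillingAt.mlieBracket hy hy'⟩⟩

/-- The Lie bracket of germs of Killing fields. -/
def bracket (g : Metric E M) (x : M) (a b : KillingAlgebra g x) : KillingAlgebra g x :=
  germ g x (fieldBracket (Function.surjInv (germ_surjective g x) a)
    (Function.surjInv (germ_surjective g x) b))

lemma bracket_germ {g : Metric E M} {x : M} (V W : localKilling g x) :
    bracket g x (germ g x V) (germ g x W) = germ g x (fieldBracket V W) := by
  refine germ_eq_iff.2 ?_
  have h1 := germ_eq_iff.1 (Function.surjInv_eq (germ_surjective g x) (germ g x V))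
  have h2 := germ_eq_iff.1 (Function.surjInv_eq (germ_surjective g x) (germ g x W))
  exact Filter.EventuallyEq.mlieBracket_vectorField h1 h2

instance (g : Metric E M) (x : M) : LieRing (KillingAlgebra g x) where
  bracket := bracket g x
  add_lie := by
    intro a b c
    obtain ⟨a, rfl⟩ := germ_surjective g x a
    obtain ⟨b, rfl⟩ := germ_surjective g x b
    obtain ⟨c, rfl⟩ := germ_surjective g x c
    change bracket g x (germ g x a + germ g x b) _ = bracket g x _ _ + bracket g x _ _
    rw [← map_add, bracket_germ, bracket_germ, bracket_germ, ← map_add, germ_eq_iff]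
    filter_upwards [a.2, b.2] with y hy hy'
    exact mlieBracket_add_left hy.1.mdiff hy'.1.mdiff
  lie_add := by
    intro a b c
    obtain ⟨a, rfl⟩ := germ_surjective g x a
    obtain ⟨b, rfl⟩ := germ_surjective g x b
    obtain ⟨c, rfl⟩ := germ_surjective g x c
    change bracket g x _ (germ g x b + germ g x c) = bracket g x _ _ + bracket g x _ _
    rw [← map_add, bracket_germ, bracket_germ, bracket_germ, ← map_add, germ_eq_iff]
    filter_upwards [b.2, c.2] with y hy hy'
    exact mlieBracket_add_right hy.1.mdiff hy'.1.mdiff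
  lie_self := by
    intro a
    obtain ⟨a, rfl⟩ := germ_surjective g x a
    change bracket g x _ _ = 0
    rw [bracket_germ, ← map_zero (germ g x), germ_eq_iff]
    refine Eventually.of_forall fun y => ?_
    have h := mlieBracket_swap_apply (I := 𝓘(ℂ, E)) (V := a.1) (W := a.1) (x := y)
    have h0 : ∀ v : E, v = -v → v = 0 := by
      intro v hv
      have h2 : (2 : ℂ) • v = 0 := by rw [two_smul]; exact add_eq_zero_iff_eq_neg.2 hv
      exact (smul_eq_zero.1 h2).resolve_left two_ne_zero
    exact h0 _ h
  leibniz_lie := by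
    intro a b c
    obtain ⟨a, rfl⟩ := germ_surjective g x a
    obtain ⟨b, rfl⟩ := germ_surjective g x b
    obtain ⟨c, rfl⟩ := germ_surjective g x c
    change bracket g x _ (bracket g x _ _) =
      bracket g x (bracket g x _ _) _ + bracket g x _ (bracket g x _ _)
    rw [bracket_germ, bracket_germ, bracket_germ, bracket_germ, bracket_germ, bracket_germ,
      ← map_add, germ_eq_iff]
    have : IsManifold 𝓘(ℂ, E) (minSmoothness ℂ 3) M := IsManifold.of_le (n := ω) le_top
    filter_upwards [a.2, b.2, c.2] with y hy hy' hy''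
    exact leibniz_identity_mlieBracket_apply (ContMDiffAt.of_le hy.1 le_top)
      (ContMDiffAt.of_le hy'.1 le_top) (ContMDiffAt.of_le hy''.1 le_top)

lemma germ_lie {g : Metric E M} {x : M} (V W : localKilling g x) :
    ⁅germ g x V, germ g x W⁆ = germ g x (fieldBracket V W) := bracket_germ V W

instance (g : Metric E M) (x : M) : LieAlgebra ℂ (KillingAlgebra g x) where
  lie_smul := by
    intro c a b
    obtain ⟨a, rfl⟩ := germ_surjective g x a
    obtain ⟨b, rfl⟩ := germ_surjective g x b
    rw [← map_smul, germ_lie, germ_lie, ← map_smul, germ_eq_iff]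
    filter_upwards [b.2] with y hy
    exact mlieBracket_const_smul_right hy.1.mdiff

/-- The isotropy algebra at `x`: the germs of Killing fields vanishing at `x`. -/
def isotropy (g : Metric E M) (x : M) : LieSubalgebra ℂ (KillingAlgebra g x) where
  toSubmodule := LinearMap.ker (eval g x)
  lie_mem' := by
    intro a b ha hb
    obtain ⟨a, rfl⟩ := germ_surjective g x a
    obtain ⟨b, rfl⟩ := germ_surjective g x b
    change eval g x _ = 0 at ha hb
    change eval g x _ = 0
    rw [eval_germ] at ha hb
    rw [germ_lie, eval_germ]
    have := mlieBracketWithin_eq_zero_of_eq_zero (I := 𝓘(ℂ, E)) (s := Set.univ) ha hb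
    rwa [mlieBracketWithin_univ] at this

end KillingAlgebra

end General
section Isometries

variable {E E' : Type*} [NormedAddCommGroup E] [NormedSpace ℂ E]
  [NormedAddCommGroup E'] [NormedSpace ℂ E']
variable {M M' : Type*} [TopologicalSpace M] [ChartedSpace E M] [IsManifold 𝓘(ℂ, E) ω M]
  [TopologicalSpace M'] [ChartedSpace E' M'] [IsManifold 𝓘(ℂ, E') ω M']

/-- `f` is a biholomorphism from an open set of `M` onto an open set of `M'` carrying the
metric `g` to the metric `g'`. -/
structure IsLocalIsometry (g : Metric E M) (g' : Metric E' M') (f : OpenPartialHomeomorph M M') :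
    Prop where
  holo : ContMDiffOn 𝓘(ℂ, E) 𝓘(ℂ, E') ω f f.source
  holo_symm : ContMDiffOn 𝓘(ℂ, E') 𝓘(ℂ, E) ω f.symm f.target
  isometry : ∀ x ∈ f.source, ∀ v w : TangentSpace 𝓘(ℂ, E) x,
    g'.val (f x) (mfderiv 𝓘(ℂ, E) 𝓘(ℂ, E') f x v) (mfderiv 𝓘(ℂ, E) 𝓘(ℂ, E') f x w) =
      g.val x v w

/-- Any two points are exchanged by a local isometry. -/
def LocallyHomogeneous (g : Metric E M) : Prop :=
  ∀ x y : M, ∃ f : OpenPartialHomeomorph M M, IsLocalIsometry g g f ∧ x ∈ f.source ∧ f x = y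

/-- `(M, g)` is locally isometric to `(M', g')`: every point of `M` has a neighbourhood isometric
to an open set of `M'`. -/
def LocallyModelledOn (g : Metric E M) (g' : Metric E' M') : Prop :=
  ∀ x : M, ∃ f : OpenPartialHomeomorph M M', IsLocalIsometry g g' f ∧ x ∈ f.source

/-- The set of global holomorphic isometries, inside the space of continuous maps
with the compact-open topology. -/
def isometries (g : Metric E M) : Set C(M, M) :=
  {f | ∃ φ : Diffeomorph 𝓘(ℂ, E) 𝓘(ℂ, E) M M ω, (∀ x, φ x = f x) ∧
    ∀ x (v w : TangentSpace 𝓘(ℂ, E) x),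
      g.val (φ x) (mfderiv 𝓘(ℂ, E) 𝓘(ℂ, E) φ x v) (mfderiv 𝓘(ℂ, E) 𝓘(ℂ, E) φ x w) = g.val x v w}

/-- The connected component of the identity in the isometry group. -/
def isometryComponent (g : Metric E M) : Set C(M, M) :=
  connectedComponentIn (isometries g) (ContinuousMap.id M)

/-- The metric read in the chart centered at `x`. -/
def chartMetric (g : Metric E M) (x : M) (z u v : E) : ℂ :=
  g.val ((extChartAt 𝓘(ℂ, E) x).symm z)
    (mfderiv 𝓘(ℂ, E) 𝓘(ℂ, E) (extChartAt 𝓘(ℂ, E) x).symm z u)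
    (mfderiv 𝓘(ℂ, E) 𝓘(ℂ, E) (extChartAt 𝓘(ℂ, E) x).symm z v)

/-- `Γ` gives the Christoffel symbols `Γ z u v = ∇_u v` (for constant fields `u`, `v`) of the
Levi-Civita connection in the chart centered at `x`. -/
def IsChristoffel (g : Metric E M) (x : M) (Γ : E → E → E → E) : Prop :=
  ∀ z ∈ (extChartAt 𝓘(ℂ, E) x).target, ∀ u v w : E,
    2 * chartMetric g x z (Γ z u v) w =
      fderiv ℂ (fun z => chartMetric g x z v w) z u +
      fderiv ℂ (fun z => chartMetric g x z u w) z v -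
      fderiv ℂ (fun z => chartMetric g x z u v) z w

/-- The curvature `R(u, v) w = ∇_u ∇_v w - ∇_v ∇_u w` of constant fields in a chart. -/
def chartCurvature (Γ : E → E → E → E) (z u v w : E) : E :=
  fderiv ℂ (fun z => Γ z v w) z u - fderiv ℂ (fun z => Γ z u w) z v +
    Γ z u (Γ z v w) - Γ z v (Γ z u w)

/-- Every nondegenerate tangent plane has sectional curvature
`g(R(u, v) v, u) / (g(u, u) g(v, v) - g(u, v) ^ 2) = k`. -/
def HasConstantSectionalCurvature (g : Metric E M) (k : ℂ) : Prop :=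
  ∀ x : M, ∃ Γ : E → E → E → E, IsChristoffel g x Γ ∧ ∀ z, z = extChartAt 𝓘(ℂ, E) x x →
    ∀ u v : E,
      chartMetric g x z u u * chartMetric g x z v v - chartMetric g x z u v ^ 2 ≠ 0 →
      chartMetric g x z (chartCurvature Γ z u v v) u /
        (chartMetric g x z u u * chartMetric g x z v v - chartMetric g x z u v ^ 2) = k

end Isometries

/-- The semisimple part of a finite-dimensional Lie algebra `L`, isomorphic to `L` modulo its
solvable radical, is nontrivial. -/
def HasNontrivialSemisimplePart (L : Type*) [LieRing L] [LieAlgebra ℂ L] : Prop :=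
  Nontrivial (L ⧸ LieAlgebra.radical ℂ L)

section Embedded

variable {E V X : Type*} [NormedAddCommGroup E] [NormedSpace ℂ E]
  [NormedAddCommGroup V] [NormedSpace ℂ V] [TopologicalSpace X]

/-- A holomorphic parametrization `ψ` (with holomorphic inverse `φ`) of an open part of a
space `X` embedded in a complex vector space `V` by `ι`. -/
structure EmbChart (E : Type*) [NormedAddCommGroup E] [NormedSpace ℂ E] (ι : X → V) where
  φ : V → E
  ψ : E → V
  U : Set V
  W : Set E
  isOpen_U : IsOpen U
  isOpen_W : IsOpen W
  holo_φ : ContDiffOn ℂ ω φ U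
  holo_ψ : ContDiffOn ℂ ω ψ W
  maps : ∀ x, ι x ∈ U → φ (ι x) ∈ W
  left : ∀ x, ι x ∈ U → ψ (φ (ι x)) = ι x
  right : ∀ z ∈ W, φ (ψ z) = z
  mem_U : ∀ z ∈ W, ψ z ∈ U
  lift : ∀ z ∈ W, ∃ x, ι x = ψ z

namespace EmbChart

variable {ι : X → V} [Nonempty X]

lemma ι_inv (c : EmbChart E ι) {z : E} (hz : z ∈ c.W) : ι (Function.invFun ι (c.ψ z)) = c.ψ z :=
  Function.invFun_eq (c.lift z hz)

/-- The chart of `X` with inverse `ψ`. -/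
def chart (hι : Topology.IsEmbedding ι) (c : EmbChart E ι) : OpenPartialHomeomorph X E where
  toFun x := c.φ (ι x)
  invFun z := Function.invFun ι (c.ψ z)
  source := ι ⁻¹' c.U
  target := c.W
  map_source' := c.maps
  map_target' z hz := by
    rw [Set.mem_preimage, c.ι_inv hz]
    exact c.mem_U z hz
  left_inv' x hx := hι.injective (by rw [c.ι_inv (c.maps x hx), c.left x hx])
  right_inv' z hz := by rw [c.ι_inv hz, c.right z hz]
  open_source := c.isOpen_U.preimage hι.continuous
  open_target := c.isOpen_W
  continuousOn_toFun := c.holo_φ.continuousOn.comp hι.continuous.continuousOn fun _ hx => hx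
  continuousOn_invFun := by
    rw [hι.continuousOn_iff]
    exact c.holo_ψ.continuousOn.congr fun z hz => c.ι_inv hz

/-- The charted space structure given by a covering family of embedded charts. -/
abbrev chartedSpace (hι : Topology.IsEmbedding ι) {J : Type*} (c : J → EmbChart E ι)
    (hc : ∀ x, ∃ j, ι x ∈ (c j).U) : ChartedSpace E X where
  atlas := Set.range fun j => (c j).chart hι
  chartAt x := (c (hc x).choose).chart hι
  mem_chart_source x := (hc x).choose_spec
  chart_mem_atlas _ := ⟨_, rfl⟩

lemma isManifold (hι : Topology.IsEmbedding ι) {J : Type*} (c : J → EmbChart E ι)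
    (hc : ∀ x, ∃ j, ι x ∈ (c j).U) :
    @IsManifold ℂ _ E _ _ E _ 𝓘(ℂ, E) ω X _ (chartedSpace hι c hc) := by
  letI := chartedSpace hι c hc
  apply isManifold_of_contDiffOn
  rintro _ _ ⟨i, rfl⟩ ⟨j, rfl⟩
  simp only [modelWithCornersSelf_coe, modelWithCornersSelf_coe_symm, Function.comp_id,
    Function.id_comp, Set.preimage_id, Set.range_id, Set.inter_univ]
  have h1 : ContDiffOn ℂ ω ((c j).φ ∘ (c i).ψ)
      ((c i).W ∩ (c i).ψ ⁻¹' (c j).U) :=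
    (c j).holo_φ.comp ((c i).holo_ψ.mono Set.inter_subset_left) fun z hz => hz.2
  have hs : (((c i).chart hι).symm ≫ₕ (c j).chart hι).source ⊆
      (c i).W ∩ (c i).ψ ⁻¹' (c j).U := by
    intro z hz
    rw [OpenPartialHomeomorph.trans_source] at hz
    have hz1 : z ∈ (c i).W := hz.1
    have hz2 : ι (Function.invFun ι ((c i).ψ z)) ∈ (c j).U := hz.2
    rw [(c i).ι_inv hz1] at hz2
    exact ⟨hz1, hz2⟩
  refine (h1.mono hs).congr fun z hz => ?_
  change (c j).φ (ι (Function.invFun ι ((c i).ψ z))) = (c j).φ ((c i).ψ z)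
  rw [(c i).ι_inv (hs hz).1]

/-- The embedding is holomorphic. -/
lemma contMDiff_ι (hι : Topology.IsEmbedding ι) {J : Type*} (c : J → EmbChart E ι)
    (hc : ∀ x, ∃ j, ι x ∈ (c j).U) :
    letI := chartedSpace hι c hc
    ContMDiff 𝓘(ℂ, E) 𝓘(ℂ, V) ω ι := by
  letI := chartedSpace hι c hc
  intro x
  have h : ContDiffOn ℂ ω (ι ∘ (chartAt E x).symm) (chartAt E x).target :=
    (c (hc x).choose).holo_ψ.congr fun z hz => (c (hc x).choose).ι_inv hz
  rw [contMDiffAt_iff]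
  refine ⟨hι.continuous.continuousAt, ?_⟩
  simp only [mfld_simps, contDiffWithinAt_univ]
  exact h.contDiffAt ((chartAt E x).open_target.mem_nhds ((chartAt E x).map_source
    (mem_chart_source E x)))

/-- The differential of the embedding is injective. -/
lemma mfderiv_ι_injective (hι : Topology.IsEmbedding ι) {J : Type*} (c : J → EmbChart E ι)
    (hc : ∀ x, ∃ j, ι x ∈ (c j).U) (x : X) :
    letI := chartedSpace hι c hc
    Function.Injective (mfderiv 𝓘(ℂ, E) 𝓘(ℂ, V) ι x) := by
  letI := chartedSpace hι c hc
  haveI := isManifold hι c hc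
  have hx : ι x ∈ (c (hc x).choose).U := (hc x).choose_spec
  have h1 : MDifferentiableAt 𝓘(ℂ, V) 𝓘(ℂ, E) (c (hc x).choose).φ (ι x) :=
    (((c (hc x).choose).holo_φ.contDiffAt ((c _).isOpen_U.mem_nhds hx)).differentiableAt
      (by simp)).mdifferentiableAt
  have h2 : MDifferentiableAt 𝓘(ℂ, E) 𝓘(ℂ, V) ι x :=
    ((contMDiff_ι hι c hc) x).mdifferentiableAt (by simp)
  have h3 := mfderiv_comp x h1 h2
  have h4 : (mfderiv 𝓘(ℂ, E) 𝓘(ℂ, E) (extChartAt 𝓘(ℂ, E) x) x).IsInvertible :=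
    isInvertible_mfderiv_extChartAt (mem_extChartAt_source x)
  have h5 : ((c (hc x).choose).φ ∘ ι) = extChartAt 𝓘(ℂ, E) x := by
    ext y
    simp only [mfld_simps]
    rfl
  rw [h5] at h3
  rw [h3] at h4
  exact Function.Injective.of_comp (f := mfderiv 𝓘(ℂ, V) 𝓘(ℂ, E) (c (hc x).choose).φ (ι x))
    h4.injective

end EmbChart
end Embedded

/-! ### The group `SL(2, ℂ)` as a complex manifold -/

/-- The group `SL(2, ℂ)`. -/
abbrev SL2 : Type := Matrix.SpecialLinearGroup (Fin 2) ℂ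

/-- The Lie algebra `sl(2, ℂ)` of traceless matrices. -/
abbrev sl2 : Type := LieAlgebra.SpecialLinear.sl (Fin 2) ℂ

/-- The space of complex two-by-two matrices, as a normed space. -/
abbrev Mat2 : Type := Fin 2 → Fin 2 → ℂ

/-- The inclusion of `SL(2, ℂ)` in the space of matrices. -/
def ιSL (a : SL2) : Mat2 := fun i j => a i j

lemma ιSL_embedding : Topology.IsEmbedding ιSL := Topology.IsEmbedding.subtypeVal

lemma contDiff_entry (i j : Fin 2) : ContDiff ℂ ω fun A : Mat2 => A i j :=
  contDiff_apply_apply ℂ ℂ i j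

lemma contDiffOn_mat {E : Type*} [NormedAddCommGroup E] [NormedSpace ℂ E] {s : Set E}
    {a b c d : E → ℂ} (ha : ContDiffOn ℂ ω a s) (hb : ContDiffOn ℂ ω b s)
    (hc : ContDiffOn ℂ ω c s) (hd : ContDiffOn ℂ ω d s) :
    ContDiffOn ℂ ω (fun z => (![![a z, b z], ![c z, d z]] : Mat2)) s := by
  refine contDiffOn_pi.2 fun i => contDiffOn_pi.2 fun j => ?_
  fin_cases i <;> fin_cases j <;> simpa

/-- The chart `(a, b, c)` of `SL(2, ℂ)` on the open set `a ≠ 0`. -/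
def chartSL₁ : EmbChart (ℂ × ℂ × ℂ) ιSL where
  φ A := (A 0 0, A 0 1, A 1 0)
  ψ z := ![![z.1, z.2.1], ![z.2.2, (1 + z.2.1 * z.2.2) / z.1]]
  U := {A | A 0 0 ≠ 0}
  W := {z | z.1 ≠ 0}
  isOpen_U := isOpen_ne_fun (contDiff_entry 0 0).continuous continuous_const
  isOpen_W := isOpen_ne_fun continuous_fst continuous_const
  holo_φ := ((contDiff_entry 0 0).prodMk
    ((contDiff_entry 0 1).prodMk (contDiff_entry 1 0))).contDiffOn
  holo_ψ := contDiffOn_mat (by fun_prop) (by fun_prop) (by fun_prop)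
    (ContDiffOn.div (by fun_prop) (by fun_prop) fun z hz => hz)
  maps x hx := hx
  left x hx := by
    have hd := x.2
    rw [Matrix.det_fin_two] at hd
    have hx' : x.1 0 0 ≠ 0 := hx
    ext i j
    fin_cases i <;> fin_cases j <;> simp [ιSL]
    field_simp
    linear_combination -hd
  right z hz := by simp
  mem_U z hz := by simpa using hz
  lift z hz := by
    have hz' : z.1 ≠ 0 := hz
    refine ⟨⟨!![z.1, z.2.1; z.2.2, (1 + z.2.1 * z.2.2) / z.1], ?_⟩, rfl⟩
    rw [Matrix.det_fin_two_of]
    field_simp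
    ring

/-- The chart `(a, c, d)` of `SL(2, ℂ)` on the open set `c ≠ 0`. -/
def chartSL₂ : EmbChart (ℂ × ℂ × ℂ) ιSL where
  φ A := (A 0 0, A 1 0, A 1 1)
  ψ z := ![![z.1, (z.1 * z.2.2 - 1) / z.2.1], ![z.2.1, z.2.2]]
  U := {A | A 1 0 ≠ 0}
  W := {z | z.2.1 ≠ 0}
  isOpen_U := isOpen_ne_fun (contDiff_entry 1 0).continuous continuous_const
  isOpen_W := isOpen_ne_fun (by fun_prop) continuous_const
  holo_φ := ((contDiff_entry 0 0).prodMk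
    ((contDiff_entry 1 0).prodMk (contDiff_entry 1 1))).contDiffOn
  holo_ψ := contDiffOn_mat (by fun_prop)
    (ContDiffOn.div (by fun_prop) (by fun_prop) fun z hz => hz) (by fun_prop) (by fun_prop)
  maps x hx := hx
  left x hx := by
    have hd := x.2
    rw [Matrix.det_fin_two] at hd
    have hx' : x.1 1 0 ≠ 0 := hx
    ext i j
    fin_cases i <;> fin_cases j <;> simp [ιSL]
    field_simp
    linear_combination hd
  right z hz := by simp
  mem_U z hz := by simpa using hz
  lift z hz := by
    have hz' : z.2.1 ≠ 0 := hz
    refine ⟨⟨!![z.1, (z.1 * z.2.2 - 1) / z.2.1; z.2.1, z.2.2], ?_⟩, rfl⟩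
    rw [Matrix.det_fin_two_of]
    field_simp
    ring

/-- The two charts of `SL(2, ℂ)`. -/
def chartsSL (j : Bool) : EmbChart (ℂ × ℂ × ℂ) ιSL := if j then chartSL₁ else chartSL₂

lemma chartsSL_cover (a : SL2) : ∃ j, ιSL a ∈ (chartsSL j).U := by
  by_cases h : a.1 0 0 = 0
  · refine ⟨false, fun h' => ?_⟩
    have h'' : a.1 1 0 = 0 := h'
    have hd := a.2
    rw [Matrix.det_fin_two] at hd
    simp [h, h''] at hd
  · exact ⟨true, h⟩

instance : ChartedSpace (ℂ × ℂ × ℂ) SL2 :=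
  EmbChart.chartedSpace ιSL_embedding chartsSL chartsSL_cover

instance : IsManifold 𝓘(ℂ, ℂ × ℂ × ℂ) ω SL2 :=
  EmbChart.isManifold ιSL_embedding chartsSL chartsSL_cover

/-! ### The product of `ℂ` with the holomorphic sphere as a complex manifold -/

/-- The holomorphic sphere `S₂`: the affine quadric `w ^ 2 + x * y = 1` of traceless matrices
`(w, x; y, -w)` of determinant `-1`. -/
abbrev S2 : Type := {A : Matrix (Fin 2) (Fin 2) ℂ // A.trace = 0 ∧ A.det = -1}

/-- The inclusion of `ℂ × S₂` in a vector space. -/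
def ιCS (p : ℂ × S2) : ℂ × Mat2 := (p.1, fun i j => p.2.1 i j)

lemma ιCS_embedding : Topology.IsEmbedding ιCS :=
  Topology.IsEmbedding.prodMap Topology.IsEmbedding.id Topology.IsEmbedding.subtypeVal

/-- The matrix with diagonal `(1, -1)`, as a point of `S₂`. -/
def S2.base : S2 := ⟨!![1, 0; 0, -1], by simp [Matrix.trace_fin_two], by simp⟩

instance : Nonempty S2 := ⟨S2.base⟩

lemma S2.eqs (A : S2) : A.1 1 1 = - A.1 0 0 ∧ A.1 0 1 * A.1 1 0 = 1 - A.1 0 0 ^ 2 := by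
  have h1 := A.2.1
  have h2 := A.2.2
  rw [Matrix.trace_fin_two] at h1
  rw [Matrix.det_fin_two] at h2
  refine ⟨by linear_combination h1, by linear_combination -h2 + A.1 0 0 * h1⟩

/-- The stereographic chart of `ℂ × S₂` on the open set `1 + s * w ≠ 0`, for `s = 1` or `s = -1`. -/
def chartCS (s : ℂ) (hs : s * s = 1) : EmbChart (ℂ × ℂ × ℂ) ιCS where
  φ p := (p.1, p.2 0 1 / (1 + s * p.2 0 0), p.2 1 0 / (1 + s * p.2 0 0))
  ψ z := (z.1, ![![s * ((1 - z.2.1 * z.2.2) / (1 + z.2.1 * z.2.2)),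
      2 * z.2.1 / (1 + z.2.1 * z.2.2)],
    ![2 * z.2.2 / (1 + z.2.1 * z.2.2), -(s * ((1 - z.2.1 * z.2.2) / (1 + z.2.1 * z.2.2)))]])
  U := {p | 1 + s * p.2 0 0 ≠ 0}
  W := {z | 1 + z.2.1 * z.2.2 ≠ 0}
  isOpen_U := isOpen_ne_fun (by fun_prop) continuous_const
  isOpen_W := isOpen_ne_fun (by fun_prop) continuous_const
  holo_φ := by
    have h : ∀ i j : Fin 2, ContDiff ℂ ω fun p : ℂ × Mat2 => p.2 i j :=
      fun i j => (contDiff_entry i j).comp contDiff_snd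
    exact contDiff_fst.contDiffOn.prodMk
      (((h 0 1).contDiffOn.div (contDiff_const.add (contDiff_const.mul (h 0 0))).contDiffOn
        fun z hz => hz).prodMk
      ((h 1 0).contDiffOn.div (contDiff_const.add (contDiff_const.mul (h 0 0))).contDiffOn
        fun z hz => hz))
  holo_ψ := by
    have hd : ∀ f : ℂ × ℂ × ℂ → ℂ, ContDiff ℂ ω f →
        ContDiffOn ℂ ω (fun z : ℂ × ℂ × ℂ => f z / (1 + z.2.1 * z.2.2))
        {z | 1 + z.2.1 * z.2.2 ≠ 0} :=
      fun f hf => hf.contDiffOn.div (by fun_prop) fun z hz => hz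
    have h1 := hd (fun z => 1 - z.2.1 * z.2.2) (by fun_prop)
    exact contDiff_fst.contDiffOn.prodMk (contDiffOn_mat (contDiffOn_const.mul h1)
      (hd _ (by fun_prop)) (hd _ (by fun_prop)) (contDiffOn_const.mul h1).neg)
  maps p hp := by
    obtain ⟨-, h⟩ := p.2.eqs
    have hp' : 1 + s * p.2.1 0 0 ≠ 0 := hp
    have : (1 + p.2.1 0 1 / (1 + s * p.2.1 0 0) * (p.2.1 1 0 / (1 + s * p.2.1 0 0))) *
        (1 + s * p.2.1 0 0) = 2 := by
      field_simp
      linear_combination h + p.2.1 0 0 ^ 2 * hs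
    intro h0
    have h0' : 1 + p.2.1 0 1 / (1 + s * p.2.1 0 0) * (p.2.1 1 0 / (1 + s * p.2.1 0 0)) = 0 := h0
    rw [h0', zero_mul] at this
    norm_num at this
  left p hp := by
    obtain ⟨h1, h⟩ := p.2.eqs
    have hp' : 1 + s * p.2.1 0 0 ≠ 0 := hp
    have key : 1 + p.2.1 0 1 / (1 + s * p.2.1 0 0) * (p.2.1 1 0 / (1 + s * p.2.1 0 0)) =
        2 / (1 + s * p.2.1 0 0) := by
      field_simp
      linear_combination h + p.2.1 0 0 ^ 2 * hs
    have key' : 1 - p.2.1 0 1 / (1 + s * p.2.1 0 0) * (p.2.1 1 0 / (1 + s * p.2.1 0 0)) =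
        2 * s * p.2.1 0 0 / (1 + s * p.2.1 0 0) := by
      field_simp
      linear_combination -h - p.2.1 0 0 ^ 2 * hs
    have e1 : s * (2 * s * p.2.1 0 0 / (1 + s * p.2.1 0 0) / (2 / (1 + s * p.2.1 0 0))) =
        p.2.1 0 0 := by
      field_simp
      linear_combination p.2.1 0 0 * hs
    have e2 : ∀ x : ℂ, 2 * (x / (1 + s * p.2.1 0 0)) / (2 / (1 + s * p.2.1 0 0)) = x := by
      intro x
      field_simp
    simp only [ιCS]
    rw [key, key', e1, e2, e2]
    refine Prod.ext rfl ?_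
    ext i j
    fin_cases i <;> fin_cases j <;> simp [h1]
  right z hz := by
    have hz' : 1 + z.2.1 * z.2.2 ≠ 0 := hz
    have h2 : 1 + s * (s * ((1 - z.2.1 * z.2.2) / (1 + z.2.1 * z.2.2))) =
        2 / (1 + z.2.1 * z.2.2) := by
      rw [← mul_assoc, hs]
      field_simp
      ring
    have e : ∀ x : ℂ, 2 * x / (1 + z.2.1 * z.2.2) / (2 / (1 + z.2.1 * z.2.2)) = x := by
      intro x
      field_simp
    refine Prod.ext rfl (Prod.ext ?_ ?_)
    · change 2 * z.2.1 / (1 + z.2.1 * z.2.2) /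
        (1 + s * (s * ((1 - z.2.1 * z.2.2) / (1 + z.2.1 * z.2.2)))) = z.2.1
      rw [h2, e]
    · change 2 * z.2.2 / (1 + z.2.1 * z.2.2) /
        (1 + s * (s * ((1 - z.2.1 * z.2.2) / (1 + z.2.1 * z.2.2)))) = z.2.2
      rw [h2, e]
  mem_U z hz := by
    have hz' : 1 + z.2.1 * z.2.2 ≠ 0 := hz
    have h2 : 1 + s * (s * ((1 - z.2.1 * z.2.2) / (1 + z.2.1 * z.2.2))) =
        2 / (1 + z.2.1 * z.2.2) := by
      rw [← mul_assoc, hs]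
      field_simp
      ring
    simp [h2, hz']
  lift z hz := by
    have hz' : 1 + z.2.1 * z.2.2 ≠ 0 := hz
    refine ⟨(z.1, ⟨!![s * ((1 - z.2.1 * z.2.2) / (1 + z.2.1 * z.2.2)),
      2 * z.2.1 / (1 + z.2.1 * z.2.2); 2 * z.2.2 / (1 + z.2.1 * z.2.2),
      -(s * ((1 - z.2.1 * z.2.2) / (1 + z.2.1 * z.2.2)))], ?_, ?_⟩), rfl⟩
    · simp [Matrix.trace_fin_two]
    · rw [Matrix.det_fin_two_of]
      field_simp
      linear_combination -(1 - z.2.1 * z.2.2) ^ 2 * hs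

/-- The two charts of `ℂ × S₂`. -/
def chartsCS (j : Bool) : EmbChart (ℂ × ℂ × ℂ) ιCS :=
  if j then chartCS 1 (by norm_num) else chartCS (-1) (by norm_num)

lemma chartsCS_cover (p : ℂ × S2) : ∃ j, ιCS p ∈ (chartsCS j).U := by
  by_cases h : 1 + p.2.1 0 0 = 0
  · refine ⟨false, fun h' => ?_⟩
    have h'' : 1 + (-1) * p.2.1 0 0 = 0 := h'
    have : (2 : ℂ) = 0 := by linear_combination h + h''
    norm_num at this
  · refine ⟨true, fun h' => h ?_⟩
    have h'' : 1 + 1 * p.2.1 0 0 = 0 := h'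
    linear_combination h''

instance : ChartedSpace (ℂ × ℂ × ℂ) (ℂ × S2) :=
  EmbChart.chartedSpace ιCS_embedding chartsCS chartsCS_cover

instance : IsManifold 𝓘(ℂ, ℂ × ℂ × ℂ) ω (ℂ × S2) :=
  EmbChart.isManifold ιCS_embedding chartsCS chartsCS_cover


lemma ιSL_contMDiff : ContMDiff 𝓘(ℂ, ℂ × ℂ × ℂ) 𝓘(ℂ, Mat2) ω ιSL :=
  EmbChart.contMDiff_ι ιSL_embedding chartsSL chartsSL_cover

lemma ιCS_contMDiff : ContMDiff 𝓘(ℂ, ℂ × ℂ × ℂ) 𝓘(ℂ, ℂ × Mat2) ω ιCS :=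
  EmbChart.contMDiff_ι ιCS_embedding chartsCS chartsCS_cover

/-- The differential at `a` of the inclusion of `SL(2, ℂ)` in the space of matrices. -/
def dιSL (a : SL2) : TangentSpace 𝓘(ℂ, ℂ × ℂ × ℂ) a →ₗ[ℂ] Mat2 :=
  (mfderiv 𝓘(ℂ, ℂ × ℂ × ℂ) 𝓘(ℂ, Mat2) ιSL a).toLinearMap

/-- The differential at `p` of the inclusion of `ℂ × S₂` in `ℂ × Mat2`. -/
def dιCS (p : ℂ × S2) : TangentSpace 𝓘(ℂ, ℂ × ℂ × ℂ) p →ₗ[ℂ] ℂ × Mat2 :=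
  (mfderiv 𝓘(ℂ, ℂ × ℂ × ℂ) 𝓘(ℂ, ℂ × Mat2) ιCS p).toLinearMap

lemma dιSL_injective (a : SL2) : Function.Injective (dιSL a) :=
  EmbChart.mfderiv_ι_injective ιSL_embedding chartsSL chartsSL_cover a

lemma dιCS_injective (p : ℂ × S2) : Function.Injective (dιCS p) :=
  EmbChart.mfderiv_ι_injective ιCS_embedding chartsCS chartsCS_cover p

lemma HolAt.push {E V X : Type*} [NormedAddCommGroup E] [NormedSpace ℂ E]
    [NormedAddCommGroup V] [NormedSpace ℂ V] [TopologicalSpace X] [ChartedSpace E X]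
    [IsManifold 𝓘(ℂ, E) ω X] {ι : X → V} (hι : ContMDiff 𝓘(ℂ, E) 𝓘(ℂ, V) ω ι)
    {U : ∀ y : X, TangentSpace 𝓘(ℂ, E) y} {x : X} (hU : HolAt U x) :
    ContMDiffAt 𝓘(ℂ, E) 𝓘(ℂ, V) ω (fun y => (mfderiv 𝓘(ℂ, E) 𝓘(ℂ, V) ι y (U y) : V)) x := by
  have h1 := hι.contMDiff_tangentMap (m := ω) le_top
  have h2 := h1.contMDiffAt.comp x hU
  exact (contMDiff_snd_tangentBundle_modelSpace V 𝓘(ℂ, V)).contMDiffAt.comp x h2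

lemma dιSL_trace (a : SL2) (v : TangentSpace 𝓘(ℂ, ℂ × ℂ × ℂ) a) :
    a 1 1 * dιSL a v 0 0 - a 0 1 * dιSL a v 1 0 - a 1 0 * dιSL a v 0 1
      + a 0 0 * dιSL a v 1 1 = 0 := by
  let D : Mat2 → ℂ := fun A => A 0 0 * A 1 1 - A 0 1 * A 1 0
  have hp : ∀ i j : Fin 2, HasFDerivAt (fun A : Mat2 => A i j)
      ((ContinuousLinearMap.proj j).comp (ContinuousLinearMap.proj i : Mat2 →L[ℂ] (Fin 2 → ℂ)))
      (ιSL a) := fun i j =>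
    ((ContinuousLinearMap.proj j).comp
      (ContinuousLinearMap.proj i : Mat2 →L[ℂ] (Fin 2 → ℂ))).hasFDerivAt
  have hD := ((hp 0 0).mul (hp 1 1)).sub ((hp 0 1).mul (hp 1 0))
  have h1 : (D ∘ ιSL) = fun _ => 1 := by
    ext b
    have := b.2
    rw [Matrix.det_fin_two] at this
    exact this
  have h2 := mfderiv_comp a (I := 𝓘(ℂ, ℂ × ℂ × ℂ)) (I' := 𝓘(ℂ, Mat2)) (I'' := 𝓘(ℂ, ℂ))
    (g := D) (f := ιSL) hD.differentiableAt.mdifferentiableAt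
    (ιSL_contMDiff.mdifferentiableAt (by simp))
  rw [h1, mfderiv_const] at h2
  have h3 := congrArg (fun L => (L v : ℂ)) h2
  have h4 : fderiv ℂ D (ιSL a) (dιSL a v) = 0 := by
    rw [← mfderiv_eq_fderiv]
    exact h3.symm
  have h5 : fderiv ℂ D (ιSL a) = _ := hD.fderiv
  rw [h5] at h4
  simp at h4
  simp only [ιSL] at h4
  linear_combination h4

/-- The left Maurer-Cartan form of `SL(2, ℂ)`: the tangent vector `v` at `a` is sent to the
element `a⁻¹ v` of the Lie algebra. -/
def maurerCartan (a : SL2) : TangentSpace 𝓘(ℂ, ℂ × ℂ × ℂ) a →ₗ[ℂ] sl2 :=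
  LinearMap.codRestrict (LieAlgebra.SpecialLinear.sl (Fin 2) ℂ).toSubmodule
    ((LinearMap.mulLeft ℂ ((a⁻¹ : SL2) : Matrix (Fin 2) (Fin 2) ℂ)).comp
      ((Matrix.ofLinearEquiv ℂ).toLinearMap.comp (dιSL a)))
    (fun v => by
      change Matrix.trace (((a⁻¹ : SL2) : Matrix (Fin 2) (Fin 2) ℂ) * Matrix.of (dιSL a v)) = 0
      have := dιSL_trace a v
      rw [Matrix.trace_fin_two, Matrix.mul_apply, Matrix.mul_apply, Fin.sum_univ_two,
        Fin.sum_univ_two, Matrix.SpecialLinearGroup.SL2_inv_expl]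
      change a 1 1 * dιSL a v 0 0 + -a 0 1 * dιSL a v 1 0
        + (-a 1 0 * dιSL a v 0 1 + a 0 0 * dιSL a v 1 1) = 0
      linear_combination this)

lemma maurerCartan_val (a : SL2) (v : TangentSpace 𝓘(ℂ, ℂ × ℂ × ℂ) a) :
    (maurerCartan a v).1 =
      ((a⁻¹ : SL2) : Matrix (Fin 2) (Fin 2) ℂ) * Matrix.of (dιSL a v) := rfl

lemma maurerCartan_bijective (a : SL2) : Function.Bijective (maurerCartan a) := by
  have hinj : Function.Injective (maurerCartan a) := by
    intro v w h
    have h1 := congrArg (fun X : sl2 => (a : Matrix (Fin 2) (Fin 2) ℂ) * X.1) h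
    simp only [maurerCartan_val, ← Matrix.mul_assoc] at h1
    rw [← Matrix.SpecialLinearGroup.coe_mul, mul_inv_cancel, Matrix.SpecialLinearGroup.coe_one,
      one_mul, one_mul] at h1
    exact dιSL_injective a h1
  refine ⟨hinj, ?_⟩
  let T : sl2 →ₗ[ℂ] ℂ × ℂ × ℂ :=
    { toFun := fun X => (X.1 0 0, X.1 0 1, X.1 1 0)
      map_add' := fun _ _ => rfl
      map_smul' := fun _ _ => rfl }
  have hT : Function.Injective T := by
    intro X Y h
    have hX : X.1.trace = 0 := X.2
    have hY : Y.1.trace = 0 := Y.2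
    rw [Matrix.trace_fin_two] at hX hY
    obtain ⟨h1, h2, h3⟩ : X.1 0 0 = Y.1 0 0 ∧ X.1 0 1 = Y.1 0 1 ∧ X.1 1 0 = Y.1 1 0 := by
      exact ⟨congrArg (fun z => z.1) h, congrArg (fun z => z.2.1) h, congrArg (fun z => z.2.2) h⟩
    ext i j
    fin_cases i <;> fin_cases j
    · exact h1
    · exact h2
    · exact h3
    · change X.1 1 1 = Y.1 1 1
      linear_combination hX - hY - h1
  have h3 : Module.finrank ℂ (ℂ × ℂ × ℂ) = 3 := by simp
  have h4 : Module.finrank ℂ sl2 ≤ 3 := h3 ▸ LinearMap.finrank_le_finrank_of_injective hT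
  have h5 := LinearMap.finrank_le_finrank_of_injective hinj
  have h6 : Module.finrank ℂ (TangentSpace 𝓘(ℂ, ℂ × ℂ × ℂ) a) = 3 := h3
  have : FiniteDimensional ℂ (TangentSpace 𝓘(ℂ, ℂ × ℂ × ℂ) a) :=
    inferInstanceAs (FiniteDimensional ℂ (ℂ × ℂ × ℂ))
  exact (LinearMap.injective_iff_surjective_of_finrank_eq_finrank (by omega)).1 hinj

lemma contMDiffAt_bilin {E V X : Type*} [NormedAddCommGroup E] [NormedSpace ℂ E]
    [NormedAddCommGroup V] [NormedSpace ℂ V] [FiniteDimensional ℂ V]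
    [TopologicalSpace X] [ChartedSpace E X]
    (B : V →ₗ[ℂ] V →ₗ[ℂ] ℂ) {f h : X → V} {x : X}
    (hf : ContMDiffAt 𝓘(ℂ, E) 𝓘(ℂ, V) ω f x) (hh : ContMDiffAt 𝓘(ℂ, E) 𝓘(ℂ, V) ω h x) :
    ContMDiffAt 𝓘(ℂ, E) 𝓘(ℂ, ℂ) ω (fun y => B (f y) (h y)) x := by
  let C : V →L[ℂ] V →L[ℂ] ℂ := LinearMap.toContinuousLinearMap
    ((LinearMap.toContinuousLinearMap (𝕜 := ℂ) (E := V) (F' := ℂ)).toLinearMap.comp B)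
  exact (C.contMDiff.contMDiffAt.comp x hf).clm_apply hh

/-- The left invariant holomorphic Riemannian metric on `SL(2, ℂ)` which equals the
nondegenerate symmetric bilinear form `q` on `sl(2, ℂ)` at the identity. -/
def leftInvariant (q : LinearMap.BilinForm ℂ sl2) (hs : ∀ X Y, q X Y = q Y X)
    (hn : ∀ X, (∀ Y, q X Y = 0) → X = 0) : Metric (ℂ × ℂ × ℂ) SL2 where
  val a := q.compl₁₂ (maurerCartan a) (maurerCartan a)
  symm a v w := hs _ _
  nondeg a v h := by
    refine (maurerCartan_bijective a).1 ((hn _ fun Y => ?_).trans (map_zero _).symm)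
    obtain ⟨w, rfl⟩ := (maurerCartan_bijective a).2 Y
    exact h w
  holo := by
    intro V W a hV hW
    obtain ⟨P, hP⟩ := (LieAlgebra.SpecialLinear.sl (Fin 2) ℂ).toSubmodule.subtype.exists_leftInverse_of_injective
      (Submodule.ker_subtype _)
    have hP' : ∀ X : sl2, P X.1 = X := fun X => congrArg (fun L => L X) hP
    let P' : Mat2 →ₗ[ℂ] sl2 := P.comp (Matrix.ofLinearEquiv ℂ).toLinearMap
    have hent : ∀ i j, ContMDiffAt 𝓘(ℂ, ℂ × ℂ × ℂ) 𝓘(ℂ, ℂ) ω (fun b : SL2 => b.1 i j) a :=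
      fun i j => (contDiff_entry i j).contMDiff.contMDiffAt.comp a ιSL_contMDiff.contMDiffAt
    have hmc : ∀ U : (∀ y : SL2, TangentSpace 𝓘(ℂ, ℂ × ℂ × ℂ) y), HolAt U a →
        ContMDiffAt 𝓘(ℂ, ℂ × ℂ × ℂ) 𝓘(ℂ, Mat2) ω
          (fun y => (fun i j => (maurerCartan y (U y)).1 i j : Mat2)) a := by
      intro U hU
      have h1 := hU.push ιSL_contMDiff
      have h2 : ∀ i j, ContMDiffAt 𝓘(ℂ, ℂ × ℂ × ℂ) 𝓘(ℂ, ℂ) ω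
          (fun y : SL2 => dιSL y (U y) i j) a :=
        fun i j => (contDiff_entry i j).contMDiff.contMDiffAt.comp a h1
      refine contMDiffAt_pi_space.2 fun i => contMDiffAt_pi_space.2 fun j => ?_
      have h3 : ∀ k, ContMDiffAt 𝓘(ℂ, ℂ × ℂ × ℂ) 𝓘(ℂ, ℂ) ω
          (fun y : SL2 => (y⁻¹).1 i k) a := by
        intro k
        simp only [Matrix.SpecialLinearGroup.SL2_inv_expl]
        fin_cases i <;> fin_cases k
        · exact hent 1 1
        · exact (hent 0 1).neg
        · exact (hent 1 0).neg
        · exact hent 0 0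
      refine (((h3 0).mul (h2 0 j)).add ((h3 1).mul (h2 1 j))).congr_of_eventuallyEq
        (Eventually.of_forall fun y => ?_)
      simp only [maurerCartan_val, Matrix.mul_apply, Fin.sum_univ_two]
      rfl
    have := contMDiffAt_bilin (q.compl₁₂ P' P') (hmc V hV) (hmc W hW)
    refine this.congr_of_eventuallyEq (Eventually.of_forall fun y => ?_)
    have e : ∀ X : sl2, P' (fun i j => X.1 i j) = X := hP'
    simp only [LinearMap.compl₁₂_apply, e]


lemma dιCS_mem (p : ℂ × S2) (v : TangentSpace 𝓘(ℂ, ℂ × ℂ × ℂ) p) :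
    (dιCS p v).2 0 0 + (dιCS p v).2 1 1 = 0 ∧
    p.2.1 0 0 * (dιCS p v).2 0 0 + p.2.1 0 1 * (dιCS p v).2 1 0 + p.2.1 1 0 * (dιCS p v).2 0 1
      + p.2.1 1 1 * (dιCS p v).2 1 1 = 0 := by
  have hp : ∀ i j : Fin 2, HasFDerivAt (fun A : ℂ × Mat2 => A.2 i j)
      ((ContinuousLinearMap.proj j).comp ((ContinuousLinearMap.proj i : Mat2 →L[ℂ] (Fin 2 → ℂ)).comp
        (ContinuousLinearMap.snd ℂ ℂ Mat2)))
      (ιCS p) := fun i j =>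
    ((ContinuousLinearMap.proj j).comp ((ContinuousLinearMap.proj i : Mat2 →L[ℂ] (Fin 2 → ℂ)).comp
        (ContinuousLinearMap.snd ℂ ℂ Mat2))).hasFDerivAt
  have main : ∀ (D : ℂ × Mat2 → ℂ) (D' : ℂ × Mat2 →L[ℂ] ℂ) (k : ℂ),
      HasFDerivAt D D' (ιCS p) → (D ∘ ιCS = fun _ => k) → D' (dιCS p v) = 0 := by
    intro D D' k hD h1
    have h2 := mfderiv_comp p (I := 𝓘(ℂ, ℂ × ℂ × ℂ)) (I' := 𝓘(ℂ, ℂ × Mat2)) (I'' := 𝓘(ℂ, ℂ))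
      (g := D) (f := ιCS) hD.differentiableAt.mdifferentiableAt
      (ιCS_contMDiff.mdifferentiableAt (by simp))
    rw [h1, mfderiv_const] at h2
    have h3 := congrArg (fun L => (L v : ℂ)) h2
    rw [← hD.fderiv, ← mfderiv_eq_fderiv]
    exact h3.symm
  have h1 := main _ _ 0 ((hp 0 0).add (hp 1 1)) (by
    ext b
    have := b.2.2.1
    rw [Matrix.trace_fin_two] at this
    exact this)
  have h2 := main _ _ (-1) (((hp 0 0).mul (hp 1 1)).sub ((hp 0 1).mul (hp 1 0))) (by
    ext b
    have := b.2.2.2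
    rw [Matrix.det_fin_two] at this
    exact this)
  simp at h1 h2
  simp only [ιCS] at h2
  obtain ⟨h3, -⟩ := p.2.eqs
  refine ⟨h1, ?_⟩
  rw [h3] at h2 ⊢
  linear_combination -h2

/-- The tangent spaces of `ℂ × S₂`. -/
lemma dιCS_surj (p : ℂ × S2) (u : ℂ × Mat2) (h1 : u.2 0 0 + u.2 1 1 = 0)
    (h2 : p.2.1 0 0 * u.2 0 0 + p.2.1 0 1 * u.2 1 0 + p.2.1 1 0 * u.2 0 1
      + p.2.1 1 1 * u.2 1 1 = 0) : ∃ v, dιCS p v = u := by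
  let T : ℂ × Mat2 →ₗ[ℂ] ℂ × ℂ :=
    { toFun := fun u => (u.2 0 0 + u.2 1 1, p.2.1 0 0 * u.2 0 0 + p.2.1 0 1 * u.2 1 0
        + p.2.1 1 0 * u.2 0 1 + p.2.1 1 1 * u.2 1 1)
      map_add' := fun a b => by
        refine Prod.ext ?_ ?_
        · change (a.2 0 0 + b.2 0 0) + (a.2 1 1 + b.2 1 1) = _ + _
          ring
        · change p.2.1 0 0 * (a.2 0 0 + b.2 0 0) + p.2.1 0 1 * (a.2 1 0 + b.2 1 0)
            + p.2.1 1 0 * (a.2 0 1 + b.2 0 1) + p.2.1 1 1 * (a.2 1 1 + b.2 1 1) = _ + _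
          ring
      map_smul' := fun c a => by
        refine Prod.ext ?_ ?_
        · change c * a.2 0 0 + c * a.2 1 1 = c * _
          ring
        · change p.2.1 0 0 * (c * a.2 0 0) + p.2.1 0 1 * (c * a.2 1 0)
            + p.2.1 1 0 * (c * a.2 0 1) + p.2.1 1 1 * (c * a.2 1 1) = c * _
          ring }
  obtain ⟨e1, e2⟩ := p.2.eqs
  have hT : Function.Surjective T := by
    intro z
    refine ⟨(0, ![![z.1 / 2 + z.2 / 2 * p.2.1 0 0, z.2 / 2 * p.2.1 0 1],
      ![z.2 / 2 * p.2.1 1 0, z.1 / 2 + z.2 / 2 * p.2.1 1 1]]), Prod.ext ?_ ?_⟩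
    · change (z.1 / 2 + z.2 / 2 * p.2.1 0 0) + (z.1 / 2 + z.2 / 2 * p.2.1 1 1) = z.1
      rw [e1]
      ring
    · change p.2.1 0 0 * (z.1 / 2 + z.2 / 2 * p.2.1 0 0) + p.2.1 0 1 * (z.2 / 2 * p.2.1 1 0)
        + p.2.1 1 0 * (z.2 / 2 * p.2.1 0 1) + p.2.1 1 1 * (z.1 / 2 + z.2 / 2 * p.2.1 1 1) = z.2
      rw [e1]
      linear_combination z.2 * e2
  have hr := LinearMap.finrank_range_add_finrank_ker T
  rw [LinearMap.range_eq_top.2 hT, finrank_top] at hr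
  have h5 : Module.finrank ℂ (ℂ × Mat2) = 5 := by
    simp [Module.finrank_prod, Module.finrank_pi_fintype]
  have h6 : Module.finrank ℂ (ℂ × ℂ) = 2 := by simp
  have h7 : Module.finrank ℂ (TangentSpace 𝓘(ℂ, ℂ × ℂ × ℂ) p) = 3 := by
    change Module.finrank ℂ (ℂ × ℂ × ℂ) = 3
    simp
  have h8 := LinearMap.finrank_range_of_inj (dιCS_injective p)
  have hle : LinearMap.range (dιCS p) ≤ LinearMap.ker T := by
    rintro _ ⟨v, rfl⟩
    exact LinearMap.mem_ker.2 (Prod.ext (dιCS_mem p v).1 (dιCS_mem p v).2)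
  have heq := Submodule.eq_of_le_of_finrank_le hle (by omega)
  have hu : u ∈ LinearMap.ker T := LinearMap.mem_ker.2 (Prod.ext h1 h2)
  rw [← heq] at hu
  exact hu

/-- The bilinear form `t t' + (c / 2) tr (A A')` on `ℂ × Mat2`. -/
def ambientForm (c : ℂ) : (ℂ × Mat2) →ₗ[ℂ] (ℂ × Mat2) →ₗ[ℂ] ℂ :=
  LinearMap.mk₂ ℂ (fun u v => u.1 * v.1 + c / 2 * (Matrix.of u.2 * Matrix.of v.2).trace)
    (fun a b v => by
      simp only [Matrix.trace_fin_two, Matrix.mul_apply, Fin.sum_univ_two, Matrix.of_apply,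
        Prod.fst_add, Prod.snd_add, Pi.add_apply]
      ring)
    (fun k a v => by
      simp only [Matrix.trace_fin_two, Matrix.mul_apply, Fin.sum_univ_two, Matrix.of_apply,
        Prod.smul_fst, Prod.smul_snd, Pi.smul_apply, smul_eq_mul]
      ring)
    (fun a v w => by
      simp only [Matrix.trace_fin_two, Matrix.mul_apply, Fin.sum_univ_two, Matrix.of_apply,
        Prod.fst_add, Prod.snd_add, Pi.add_apply]
      ring)
    (fun k a v => by
      simp only [Matrix.trace_fin_two, Matrix.mul_apply, Fin.sum_univ_two, Matrix.of_apply,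
        Prod.smul_fst, Prod.smul_snd, Pi.smul_apply, smul_eq_mul]
      ring)

lemma ambientForm_apply (c : ℂ) (u v : ℂ × Mat2) : ambientForm c u v = u.1 * v.1 +
    c / 2 * (u.2 0 0 * v.2 0 0 + u.2 0 1 * v.2 1 0 + (u.2 1 0 * v.2 0 1 + u.2 1 1 * v.2 1 1)) := by
  simp only [ambientForm, LinearMap.mk₂_apply, Matrix.trace_fin_two, Matrix.mul_apply,
    Fin.sum_univ_two, Matrix.of_apply]

/-- The product metric `dz² + c h` on `ℂ × S₂`, where `h` is the restriction to the quadric `S₂`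
of the quadratic form `A ↦ tr (A²) / 2 = w² + x y`, and `c ≠ 0`. -/
def productMetric (c : ℂ) (hc : c ≠ 0) : Metric (ℂ × ℂ × ℂ) (ℂ × S2) where
  val p := (ambientForm c).compl₁₂ (dιCS p) (dιCS p)
  symm p v w := by
    simp only [LinearMap.compl₁₂_apply, ambientForm_apply]
    ring
  nondeg p v h := by
    refine dιCS_injective p (Eq.trans ?_ (map_zero _).symm)
    obtain ⟨m1, m2⟩ := dιCS_mem p v
    obtain ⟨e1, e2⟩ := p.2.eqs
    have h1 : ∀ u : ℂ × Mat2, u.2 0 0 + u.2 1 1 = 0 →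
        p.2.1 0 0 * u.2 0 0 + p.2.1 0 1 * u.2 1 0 + p.2.1 1 0 * u.2 0 1
        + p.2.1 1 1 * u.2 1 1 = 0 → ambientForm c (dιCS p v) u = 0 := by
      intro u hu hu'
      obtain ⟨w, rfl⟩ := dιCS_surj p u hu hu'
      exact h w
    have h2 : (dιCS p v).1 = 0 := by
      have := h1 (1, 0) (by simp) (by simp)
      rw [ambientForm_apply] at this
      simpa using this
    have h3 : ∀ z : Mat2, (dιCS p v).2 0 0 * z 0 0 + (dιCS p v).2 0 1 * z 1 0
        + ((dιCS p v).2 1 0 * z 0 1 + (dιCS p v).2 1 1 * z 1 1) = 0 := by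
      intro z
      let a := (z 0 0 + z 1 1) / 2
      let b := (p.2.1 0 0 * z 0 0 + p.2.1 0 1 * z 1 0 + p.2.1 1 0 * z 0 1 + p.2.1 1 1 * z 1 1) / 2
      have := h1 (0, ![![z 0 0 - a - b * p.2.1 0 0, z 0 1 - b * p.2.1 0 1],
        ![z 1 0 - b * p.2.1 1 0, z 1 1 - a - b * p.2.1 1 1]])
        (by
          change (z 0 0 - a - b * p.2.1 0 0) + (z 1 1 - a - b * p.2.1 1 1) = 0
          rw [e1]
          simp only [a]
          ring)
        (by
          change p.2.1 0 0 * (z 0 0 - a - b * p.2.1 0 0) + p.2.1 0 1 * (z 1 0 - b * p.2.1 1 0)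
            + p.2.1 1 0 * (z 0 1 - b * p.2.1 0 1) + p.2.1 1 1 * (z 1 1 - a - b * p.2.1 1 1) = 0
          have hb : p.2.1 0 0 * z 0 0 + p.2.1 0 1 * z 1 0 + p.2.1 1 0 * z 0 1 + p.2.1 1 1 * z 1 1
            = 2 * b := by simp only [b]; ring
          rw [e1] at hb ⊢
          linear_combination hb - 2 * b * e2)
      rw [ambientForm_apply] at this
      have h4 : c / 2 * ((dιCS p v).2 0 0 * (z 0 0 - a - b * p.2.1 0 0)
        + (dιCS p v).2 0 1 * (z 1 0 - b * p.2.1 1 0)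
        + ((dιCS p v).2 1 0 * (z 0 1 - b * p.2.1 0 1)
        + (dιCS p v).2 1 1 * (z 1 1 - a - b * p.2.1 1 1))) = 0 := by
        simpa using this
      have h5 := (mul_eq_zero.1 h4).resolve_left (div_ne_zero hc two_ne_zero)
      linear_combination h5 + a * m1 + b * m2
    refine Prod.ext h2 ?_
    ext i j
    fin_cases i <;> fin_cases j
    · simpa using h3 ![![1, 0], ![0, 0]]
    · simpa using h3 ![![0, 0], ![1, 0]]
    · simpa using h3 ![![0, 1], ![0, 0]]
    · simpa using h3 ![![0, 0], ![0, 1]]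
  holo V W p hV hW :=
    contMDiffAt_bilin (ambientForm c) (hV.push ιCS_contMDiff) (hW.push ιCS_contMDiff)


/-- `h` is the one-parameter subgroup `t ↦ exp (t v)` of `SL(2, ℂ)`. -/
def IsOneParameterSubgroup (h : ℂ → SL2) (v : sl2) : Prop :=
  ∀ t : ℂ, (h t : Matrix (Fin 2) (Fin 2) ℂ) = NormedSpace.exp (t • v.1)

/-- The element `diag(1, -1)` of `sl(2, ℂ)`. -/
def sl2H : sl2 := ⟨!![1, 0; 0, -1], by
  change Matrix.trace (!![1, 0; 0, -1] : Matrix (Fin 2) (Fin 2) ℂ) = 0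
  simp [Matrix.trace_fin_two]⟩

/-- The one-parameter subgroup `diag(e^t, e^{-t})` of `SL(2, ℂ)`. -/
def diagSL (t : ℂ) : SL2 := ⟨!![Complex.exp t, 0; 0, Complex.exp (-t)], by
  rw [Matrix.det_fin_two_of, ← Complex.exp_add]
  simp⟩

/-- The action of `SL(2, ℂ)` on `S₂` by conjugation. -/
def S2.conj (a : SL2) (A : S2) : S2 :=
  ⟨(a : Matrix (Fin 2) (Fin 2) ℂ) * A.1 * ((a⁻¹ : SL2) : Matrix (Fin 2) (Fin 2) ℂ), by
    have h : ((a⁻¹ : SL2) : Matrix (Fin 2) (Fin 2) ℂ) * (a : Matrix (Fin 2) (Fin 2) ℂ) = 1 := by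
      rw [← Matrix.SpecialLinearGroup.coe_mul, inv_mul_cancel, Matrix.SpecialLinearGroup.coe_one]
    refine ⟨?_, ?_⟩
    · rw [Matrix.trace_mul_comm, ← Matrix.mul_assoc, h, Matrix.one_mul, A.2.1]
    · rw [Matrix.det_mul, Matrix.det_mul, a.2, (a⁻¹).2, A.2.2]
      norm_num⟩

section Models

/-- The complex vector space on which complex threefolds are modelled. -/
abbrev C3 : Type := EuclideanSpace ℂ (Fin 3)

variable {M : Type*} [TopologicalSpace M] [ChartedSpace C3 M] [IsManifold 𝓘(ℂ, C3) ω M]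

/-- First local model: `g` is locally isometric to the left invariant metric `q` on `SL(2, ℂ)`, the
identity component of whose isometry group consists of the left translations composed with
the right translations by a one-parameter subgroup `h t = exp (t v)`, with diagonal isotropy. -/
structure IsFirstModel (g : Metric C3 M) (q : Metric (ℂ × ℂ × ℂ) SL2) (v : sl2) (h : ℂ → SL2) :
    Prop where
  v_ne_zero : v ≠ 0
  oneParameter : IsOneParameterSubgroup h v
  modelled : LocallyModelledOn g q
  isometryComponent_iff : ∀ f : C(SL2, SL2), f ∈ isometryComponent q ↔
    ∃ (t : ℂ) (a : SL2), ∀ x, f x = a * x * (h t)⁻¹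
  stabilizer_iff : ∀ f ∈ isometryComponent q, f 1 = 1 ↔ ∃ t : ℂ, ∀ x, f x = h t * x * (h t)⁻¹
  isotropy_diagonal : ∀ x : M, ∃ ψ : KillingAlgebra g x ≃ₗ⁅ℂ⁆ ℂ × sl2,
    ∀ X, X ∈ KillingAlgebra.isotropy g x ↔ ∃ s : ℂ, ψ X = (s, s • v)

/-- Second local model: `g` is locally isometric to the product metric `q` on `ℂ × S₂`, the identity
component of whose isometry group is given by the split action of `ℂ × SL(2, ℂ)`, the isotropy
being the diagonal subgroup of `SL(2, ℂ)`. -/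
structure IsSecondModel (g : Metric C3 M) (q : Metric (ℂ × ℂ × ℂ) (ℂ × S2)) : Prop where
  modelled : LocallyModelledOn g q
  isometryComponent_iff : ∀ f : C(ℂ × S2, ℂ × S2), f ∈ isometryComponent q ↔
    ∃ (t : ℂ) (a : SL2), ∀ p, f p = (p.1 + t, S2.conj a p.2)
  stabilizer_iff : ∀ f ∈ isometryComponent q, f (0, S2.base) = (0, S2.base) ↔
    ∃ t : ℂ, ∀ p, f p = (p.1, S2.conj (diagSL t) p.2)
  isotropy_split : ∀ x : M, ∃ ψ : KillingAlgebra g x ≃ₗ⁅ℂ⁆ ℂ × sl2,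
    ∀ X, X ∈ KillingAlgebra.isotropy g x ↔ ∃ s : ℂ, ψ X = (0, s • sl2H)

/-- `κ` is the metric on `M` coming from the Killing form of `sl(2, ℂ)`: every local isometry from
`g` to the left invariant metric `q` carries `κ` to the left invariant metric on `SL(2, ℂ)`
given by the Killing form. -/
def ComesFromKillingForm (g : Metric C3 M) (q : Metric (ℂ × ℂ × ℂ) SL2) (κ : Metric C3 M) : Prop :=
  ∀ f : OpenPartialHomeomorph M SL2, IsLocalIsometry g q f → ∀ x ∈ f.source,
    ∀ v w : TangentSpace 𝓘(ℂ, C3) x,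
      κ.val x v w = killingForm ℂ sl2
        (maurerCartan (f x) (mfderiv 𝓘(ℂ, C3) 𝓘(ℂ, ℂ × ℂ × ℂ) f x v))
        (maurerCartan (f x) (mfderiv 𝓘(ℂ, C3) 𝓘(ℂ, ℂ × ℂ × ℂ) f x w))

end Models

end HolRiem

end

noncomputable section

namespace HolRiem

set_option linter.unusedSectionVars false

/-! ### Coordinates on `sl(2, ℂ)` -/

/-- The traceless matrix `(a, b; c, -a)`. -/
def sl2mk (a b c : ℂ) : sl2 := ⟨!![a, b; c, -a], by
  change Matrix.trace (!![a, b; c, -a] : Matrix (Fin 2) (Fin 2) ℂ) = 0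
  simp [Matrix.trace_fin_two]⟩

lemma sl2_trace (u : sl2) : u.1.trace = 0 := u.2

lemma sl2_11 (u : sl2) : u.1 1 1 = -u.1 0 0 := by
  have := sl2_trace u
  rw [Matrix.trace_fin_two] at this
  linear_combination this

@[simp] lemma sl2mk_00 (a b c : ℂ) : (sl2mk a b c).1 0 0 = a := rfl
@[simp] lemma sl2mk_01 (a b c : ℂ) : (sl2mk a b c).1 0 1 = b := rfl
@[simp] lemma sl2mk_10 (a b c : ℂ) : (sl2mk a b c).1 1 0 = c := rfl
@[simp] lemma sl2mk_11 (a b c : ℂ) : (sl2mk a b c).1 1 1 = -a := rfl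

lemma sl2_ext {u w : sl2} (h1 : u.1 0 0 = w.1 0 0) (h2 : u.1 0 1 = w.1 0 1)
    (h3 : u.1 1 0 = w.1 1 0) : u = w := by
  ext i j
  fin_cases i <;> fin_cases j
  · exact h1
  · exact h2
  · exact h3
  · change u.1 1 1 = w.1 1 1
    rw [sl2_11, sl2_11, h1]

lemma sl2mk_eta (u : sl2) : sl2mk (u.1 0 0) (u.1 0 1) (u.1 1 0) = u := sl2_ext rfl rfl rfl

lemma sl2_lie_val (u w : sl2) : (⁅u, w⁆ : sl2).1 = u.1 * w.1 - w.1 * u.1 := rfl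

lemma sl2mk_lie (a b c a' b' c' : ℂ) : ⁅sl2mk a b c, sl2mk a' b' c'⁆ =
    sl2mk (b * c' - b' * c) (2 * (a * b' - a' * b)) (2 * (c * a' - c' * a)) := by
  apply sl2_ext <;>
  · rw [sl2_lie_val]
    simp only [Matrix.sub_apply, Matrix.mul_apply, Fin.sum_univ_two, sl2mk_00, sl2mk_01, sl2mk_10,
      sl2mk_11]
    ring

lemma sl2mk_add (a b c a' b' c' : ℂ) :
    sl2mk a b c + sl2mk a' b' c' = sl2mk (a + a') (b + b') (c + c') := sl2_ext rfl rfl rfl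

lemma sl2mk_smul (t a b c : ℂ) : t • sl2mk a b c = sl2mk (t * a) (t * b) (t * c) :=
  sl2_ext rfl rfl rfl

lemma sl2_add_val (u w : sl2) (i j : Fin 2) : (u + w).1 i j = u.1 i j + w.1 i j := rfl

lemma sl2_smul_val (c : ℂ) (u : sl2) (i j : Fin 2) : (c • u).1 i j = c * u.1 i j := rfl

lemma sl2mk_zero : sl2mk 0 0 0 = 0 := sl2_ext rfl rfl rfl

lemma sl2H_eq : sl2H = sl2mk 1 0 0 := sl2_ext rfl rfl rfl

/-- The linear coordinates on `sl(2, ℂ)`. -/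
def sl2Equiv : sl2 ≃ₗ[ℂ] ℂ × ℂ × ℂ where
  toFun u := (u.1 0 0, u.1 0 1, u.1 1 0)
  invFun z := sl2mk z.1 z.2.1 z.2.2
  left_inv u := sl2mk_eta u
  right_inv _ := rfl
  map_add' _ _ := rfl
  map_smul' _ _ := rfl

lemma finrank_sl2 : Module.finrank ℂ sl2 = 3 := by
  rw [sl2Equiv.finrank_eq]
  simp

lemma sl2_induction {p : sl2 → Prop} (h : ∀ a b c, p (sl2mk a b c)) (u : sl2) : p u := by
  rw [← sl2mk_eta u]
  exact h _ _ _

section Triple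

variable {L : Type*} [LieRing L] [LieAlgebra ℂ L]

/-- The Lie algebra homomorphism `ℂ ⊕ sl(2, ℂ) → L` given by a central element and a triple. -/
def homOfTriple (r h e f : L) (hr : ∀ x : L, ⁅r, x⁆ = 0) (hef : ⁅e, f⁆ = h)
    (hhe : ⁅h, e⁆ = (2 : ℂ) • e) (hhf : ⁅h, f⁆ = -((2 : ℂ) • f)) : ℂ × sl2 →ₗ⁅ℂ⁆ L where
  toFun p := p.1 • r + (p.2.1 0 0 • h + p.2.1 0 1 • e + p.2.1 1 0 • f)
  map_add' p q := by
    simp only [Prod.fst_add, Prod.snd_add, sl2_add_val, add_smul]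
    abel
  map_smul' c p := by
    simp only [Prod.smul_fst, Prod.smul_snd, sl2_smul_val, smul_eq_mul,
      mul_smul, smul_add, RingHom.id_apply]
  map_lie' := by
    rintro ⟨s, u⟩ ⟨t, w⟩
    induction u using sl2_induction with | h a b c => ?_
    induction w using sl2_induction with | h a' b' c' => ?_
    have hr' : ∀ x : L, ⁅x, r⁆ = 0 := fun x => by rw [← lie_skew, hr, neg_zero]
    have hfe : ⁅f, e⁆ = -h := by rw [← lie_skew, hef]
    have heh : ⁅e, h⁆ = -((2 : ℂ) • e) := by rw [← lie_skew, hhe]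
    have hfh : ⁅f, h⁆ = (2 : ℂ) • f := by rw [← lie_skew, hhf, neg_neg]
    have h0 : (⁅((s, sl2mk a b c) : ℂ × sl2), (t, sl2mk a' b' c')⁆ : ℂ × sl2) =
        (0, ⁅sl2mk a b c, sl2mk a' b' c'⁆) := by
      refine Prod.ext ?_ rfl
      change ⁅s, t⁆ = 0
      rw [LieRing.of_associative_ring_bracket]
      ring
    rw [h0, sl2mk_lie]
    simp only [sl2mk_00, sl2mk_01, sl2mk_10, lie_add, add_lie, lie_smul, smul_lie, hr, hr', hef,
      hhe, hhf, hfe, heh, hfh, lie_self]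
    module

lemma homOfTriple_apply {r h e f : L} (hr : ∀ x : L, ⁅r, x⁆ = 0) (hef : ⁅e, f⁆ = h)
    (hhe : ⁅h, e⁆ = (2 : ℂ) • e) (hhf : ⁅h, f⁆ = -((2 : ℂ) • f)) (p : ℂ × sl2) :
    homOfTriple r h e f hr hef hhe hhf p =
      p.1 • r + (p.2.1 0 0 • h + p.2.1 0 1 • e + p.2.1 1 0 • f) := rfl

/-- An ideal of `sl(2, ℂ)` that contains a nonzero element is everything; here in the form: a linear
map on `sl(2, ℂ)` whose kernel is stable under brackets is injective or zero. -/
lemma sl2_injective_or_zero {V : Type*} [AddCommGroup V] [Module ℂ V] (T : sl2 →ₗ[ℂ] V)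
    (h : ∀ u w : sl2, T w = 0 → T ⁅u, w⁆ = 0) : Function.Injective T ∨ T = 0 := by
  by_cases hinj : Function.Injective T
  · exact Or.inl hinj
  right
  rw [injective_iff_map_eq_zero] at hinj
  push Not at hinj
  obtain ⟨w, hw, hw0⟩ := hinj
  have hs : ∀ (k : ℂ) (w : sl2), k ≠ 0 → T (k • w) = 0 → T w = 0 := fun k w hk h' => by
    rw [map_smul] at h'
    exact (smul_eq_zero.1 h').resolve_left hk
  have e1 : T (sl2mk 0 1 0) = 0 → T = 0 := by
    intro h1
    have h2 := h (sl2mk 0 0 1) _ h1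
    have h3 := h (sl2mk 0 0 1) _ h2
    rw [sl2mk_lie] at h2
    rw [sl2mk_lie, sl2mk_lie] at h3
    have h2' := hs (-1) (sl2mk 1 0 0) (by norm_num) (by
      rw [sl2mk_smul]; convert h2 using 2; norm_num)
    have h3' := hs (-2) (sl2mk 0 0 1) (by norm_num) (by
      rw [sl2mk_smul]; convert h3 using 2; norm_num)
    ext u
    induction u using sl2_induction with | h a b c => ?_
    have : sl2mk a b c = a • sl2mk 1 0 0 + b • sl2mk 0 1 0 + c • sl2mk 0 0 1 := by
      simp only [sl2mk_smul, sl2mk_add]; congr 1 <;> ring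
    rw [this]
    simp [h1, h2', h3']
  induction w using sl2_induction with | h a b c => ?_
  have hE := h (sl2mk 0 1 0) _ hw
  have hEE := h (sl2mk 0 1 0) _ hE
  rw [sl2mk_lie, sl2mk_lie] at hEE
  rw [sl2mk_lie] at hE
  apply e1
  by_cases hc : c = 0
  · by_cases ha : a = 0
    · subst hc ha
      have hb : b ≠ 0 := fun hb => hw0 (by rw [hb, sl2mk_zero])
      exact hs b _ hb (by rw [sl2mk_smul]; convert hw using 2; simp)
    · subst hc
      exact hs (-2 * a) _ (by simpa using ha) (by rw [sl2mk_smul]; convert hE using 2; norm_num)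
  · exact hs (-2 * c) _ (by simpa using hc) (by rw [sl2mk_smul]; convert hEE using 2; norm_num)

end Triple

/-! ### Four-dimensional Lie algebras that are not solvable -/

section Classification

open LieAlgebra

variable {L : Type*} [LieRing L] [LieAlgebra ℂ L]

/-- The projection of a Lie algebra to its quotient by an ideal. -/
def quotHom (I : LieIdeal ℂ L) : L →ₗ⁅ℂ⁆ L ⧸ I where
  toLinearMap := (LieSubmodule.Quotient.mk' I : L →ₗ⁅ℂ,L⁆ L ⧸ I)
  map_lie' := by
    intro x y
    exact LieSubmodule.Quotient.mk_bracket I x y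

lemma quotHom_surjective (I : LieIdeal ℂ L) : Function.Surjective (quotHom I) :=
  LieSubmodule.Quotient.surjective_mk' I

lemma quotHom_eq_zero {I : LieIdeal ℂ L} {x : L} : quotHom I x = 0 ↔ x ∈ I :=
  LieSubmodule.Quotient.mk_eq_zero I

lemma hasTrivialRadical_quotient [FiniteDimensional ℂ L] :
    HasTrivialRadical ℂ (L ⧸ radical ℂ L) := by
  refine ⟨?_⟩
  set R := radical ℂ L
  have : FiniteDimensional ℂ (L ⧸ R) :=
    Module.Finite.of_surjective (quotHom R).toLinearMap (quotHom_surjective R)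
  set I := radical ℂ (L ⧸ R)
  have hI : IsSolvable I := inferInstance
  have hR : IsSolvable R := inferInstance
  obtain ⟨k, hk⟩ := hI.solvable (R := ℂ)
  obtain ⟨l, hl⟩ := hR.solvable (R := ℂ)
  rw [LieIdeal.derivedSeries_eq_bot_iff] at hk hl
  let J := LieIdeal.comap (quotHom R) I
  have h1 : ∀ n, LieIdeal.map (quotHom R) (derivedSeriesOfIdeal ℂ L n J) ≤
      derivedSeriesOfIdeal ℂ (L ⧸ R) n I := by
    intro n
    induction n with
    | zero => exact LieIdeal.map_comap_le
    | succ n ih =>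
      rw [derivedSeriesOfIdeal_succ, derivedSeriesOfIdeal_succ]
      exact le_trans (LieIdeal.map_bracket_le _) (LieSubmodule.mono_lie ih ih)
  have h2 : derivedSeriesOfIdeal ℂ L k J ≤ R := by
    intro x hx
    have := h1 k (LieIdeal.mem_map hx)
    rw [hk, LieSubmodule.mem_bot] at this
    exact quotHom_eq_zero.1 this
  have h3 : derivedSeriesOfIdeal ℂ L (l + k) J = ⊥ := by
    rw [derivedSeriesOfIdeal_add, eq_bot_iff, ← hl]
    exact derivedSeriesOfIdeal_mono h2 l
  have hJ : IsSolvable J := IsSolvable.mk (R := ℂ) (k := l + k)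
    ((LieIdeal.derivedSeries_eq_bot_iff _ _).2 h3)
  have h4 : J ≤ R := (LieIdeal.solvable_iff_le_radical ℂ L J).1 hJ
  rw [eq_bot_iff]
  intro y hy
  obtain ⟨x, rfl⟩ := quotHom_surjective R y
  rw [LieSubmodule.mem_bot, quotHom_eq_zero]
  exact h4 hy

lemma exists_sl2Triple [FiniteDimensional ℂ L] [Nontrivial L] [IsKilling ℂ L] :
    ∃ h e f : L, IsSl2Triple h e f := by
  obtain ⟨x, hx⟩ := exists_isCartanSubalgebra_engel ℂ L
  set H := LieSubalgebra.engel ℂ x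
  by_cases hw : ∃ α : LieModule.Weight ℂ H L, α.IsNonZero
  · obtain ⟨α, hα⟩ := hw
    obtain ⟨h, e, f, ht, -, -⟩ := IsKilling.exists_isSl2Triple_of_weight_isNonZero hα
    exact ⟨h, e, f, ht⟩
  exfalso
  push Not at hw
  have h1 := IsKilling.span_weight_isNonZero_eq_top ℂ L H
  have h2 : {α : LieModule.Weight ℂ H L | α.IsNonZero} = ∅ := by
    ext α
    simpa using hw α
  rw [h2, Set.image_empty, Submodule.span_empty] at h1
  have h3 : Subsingleton H := by
    have : Subsingleton (Module.Dual ℂ H) :=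
      (Submodule.subsingleton_iff ℂ).1 (subsingleton_of_bot_eq_top h1)
    exact ⟨fun a b => sub_eq_zero.1 ((Module.forall_dual_apply_eq_zero_iff ℂ (a - b)).1 fun φ => by
      rw [Subsingleton.elim φ 0, LinearMap.zero_apply])⟩
  have h4 : H = ⊥ := by
    rw [eq_bot_iff]
    intro y hy
    have := congrArg Subtype.val (Subsingleton.elim (⟨y, hy⟩ : H) 0)
    exact this
  have h5 := hx.self_normalizing
  have h6 : (⊥ : LieSubalgebra ℂ L).normalizer = ⊥ := h4 ▸ h5
  have h8 : (⊤ : LieSubalgebra ℂ L) ≤ (⊥ : LieSubalgebra ℂ L).normalizer := by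
    intro y _
    rw [LieSubalgebra.mem_normalizer_iff]
    intro z hz
    rw [LieSubalgebra.mem_bot] at hz
    simp [hz]
  rw [h6] at h8
  obtain ⟨y, hy⟩ := exists_ne (0 : L)
  exact hy ((LieSubalgebra.mem_bot y).1 (h8 (LieSubalgebra.mem_top y)))

/-- The homomorphism from `sl(2, ℂ)` given by a triple. -/
lemma exists_injective_of_sl2Triple {h e f : L} (t : IsSl2Triple h e f) :
    ∃ T : sl2 →ₗ⁅ℂ⁆ L, Function.Injective T ∧ T (sl2mk 1 0 0) = h ∧ T (sl2mk 0 1 0) = e ∧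
      T (sl2mk 0 0 1) = f := by
  let T₀ := homOfTriple (0 : L) h e f (fun x => by simp) t.lie_e_f (t.lie_h_e_smul ℂ)
    (t.lie_lie_smul_f ℂ)
  let T : sl2 →ₗ⁅ℂ⁆ L :=
    { toLinearMap := T₀.toLinearMap.comp (LinearMap.inr ℂ ℂ sl2)
      map_lie' := by
        intro u w
        change T₀ (0, ⁅u, w⁆) = ⁅T₀ (0, u), T₀ (0, w)⁆
        rw [← LieHom.map_lie]
        congr 1
        refine Prod.ext ?_ rfl
        change (0 : ℂ) = ⁅(0 : ℂ), (0 : ℂ)⁆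
        simp }
  have hT : ∀ u, T u = (0 : ℂ) • (0 : L) + (u.1 0 0 • h + u.1 0 1 • e + u.1 1 0 • f) :=
    fun u => rfl
  have hh : T (sl2mk 1 0 0) = h := by simp [hT]
  refine ⟨T, ?_, hh, by simp [hT], by simp [hT]⟩
  refine (sl2_injective_or_zero T.toLinearMap fun u w hw => ?_).resolve_right fun h0 => ?_
  · have hw' : T w = 0 := hw
    change T ⁅u, w⁆ = 0
    rw [LieHom.map_lie, hw', lie_zero]
  · exact t.h_ne_zero (hh.symm.trans (congrArg (fun l => l (sl2mk 1 0 0)) h0))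

lemma finrank_ne_four_of_isKilling [FiniteDimensional ℂ L] [IsKilling ℂ L]
    {h e f : L} (t : IsSl2Triple h e f) : Module.finrank ℂ L ≠ 4 := by
  intro h4
  obtain ⟨T, hT, -⟩ := exists_injective_of_sl2Triple t
  set S := LinearMap.range T.toLinearMap
  have hS : Module.finrank ℂ S = 3 := by
    rw [LinearMap.finrank_range_of_inj hT, finrank_sl2]
  have hSL : ∀ s ∈ S, ∀ s' ∈ S, ⁅s, s'⁆ ∈ S := by
    rintro _ ⟨a, rfl⟩ _ ⟨b, rfl⟩
    exact ⟨⁅a, b⁆, T.map_lie a b⟩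
  have hlt : S < ⊤ := by
    rw [lt_top_iff_ne_top]
    intro htop
    rw [htop, finrank_top] at hS
    omega
  obtain ⟨l, hl0, hl⟩ := Submodule.exists_le_ker_of_lt_top S hlt
  have hker : LinearMap.ker l = S := by
    symm
    apply Submodule.eq_of_le_of_finrank_le hl
    have h1 := LinearMap.finrank_range_add_finrank_ker l
    have h2 : LinearMap.range l = ⊤ := LinearMap.range_eq_top.2 (LinearMap.surjective hl0)
    rw [h2, finrank_top, Module.finrank_self] at h1
    omega
  obtain ⟨z, hz⟩ : ∃ z, l z = 1 := LinearMap.surjective hl0 1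
  have hmem : ∀ x, l x = 0 ↔ x ∈ S := fun x => by rw [← hker, LinearMap.mem_ker]
  have hdec : ∀ x, ∃ s ∈ S, x = s + l x • z := fun x =>
    ⟨x - l x • z, (hmem _).1 (by simp [hz]), by simp⟩
  have hact : ∀ s ∈ S, ∀ x, l ⁅s, x⁆ = l ⁅s, z⁆ * l x := by
    intro s hs x
    obtain ⟨s', hs', hx⟩ := hdec x
    conv_lhs => rw [hx]
    rw [lie_add, lie_smul, map_add, map_smul, (hmem _).2 (hSL s hs s' hs'), smul_eq_mul]
    ring
  have hχ : ∀ s ∈ S, ∀ s' ∈ S, l ⁅⁅s, s'⁆, z⁆ = 0 := by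
    intro s hs s' hs'
    rw [lie_lie, map_sub, hact s hs, hact s' hs' ⁅s, z⁆]
    ring
  have hχ' : ∀ s ∈ S, l ⁅s, z⁆ = 0 := by
    have hb : ∀ u w : sl2, l ⁅T ⁅u, w⁆, z⁆ = 0 := fun u w => by
      rw [LieHom.map_lie]
      exact hχ _ ⟨u, rfl⟩ _ ⟨w, rfl⟩
    rintro _ ⟨u, rfl⟩
    change l ⁅T u, z⁆ = 0
    induction u using sl2_induction with | h a b c => ?_
    have : sl2mk a b c = ⁅sl2mk 0 a 0, sl2mk 0 0 1⁆ + ⁅sl2mk 1 0 0, sl2mk 0 (b / 2) (-c / 2)⁆ := by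
      rw [sl2mk_lie, sl2mk_lie, sl2mk_add]
      congr 1 <;> ring
    rw [this, map_add, add_lie, map_add, hb, hb, add_zero]
  have hall : ∀ x y : L, l ⁅x, y⁆ = 0 := by
    intro x y
    obtain ⟨s, hs, hx⟩ := hdec x
    obtain ⟨s', hs', hy⟩ := hdec y
    rw [hx, hy]
    simp only [add_lie, lie_add, smul_lie, lie_smul, lie_self, smul_zero, add_zero, map_add,
      map_smul, hχ' s hs, (hmem _).2 (hSL s hs s' hs'), smul_eq_mul]
    rw [← lie_skew, map_neg, hχ' s' hs']
    simp
  -- a vector orthogonal to the kernel of `l` for the Killing form is central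
  have hnd := IsKilling.killingForm_nondegenerate ℂ L
  obtain ⟨x, hx⟩ := (LinearMap.BilinForm.toDual (killingForm ℂ L) hnd).surjective l
  have hx' : ∀ y, killingForm ℂ L x y = l y := fun y => by
    rw [← hx, LinearMap.BilinForm.toDual_def]
  have hc : ∀ y : L, ⁅x, y⁆ = 0 := by
    intro y
    refine hnd.1 _ fun w => ?_
    rw [LieModule.traceForm_apply_lie_apply]
    exact (hx' _).trans (hall _ _)
  have hx0 : x = 0 := by
    have h1 : x ∈ center ℂ L := by
      rw [LieModule.mem_maxTrivSubmodule]
      intro y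
      rw [← lie_skew, hc, neg_zero]
    rw [center_eq_bot, LieSubmodule.mem_bot] at h1
    exact h1
  apply hl0
  refine LinearMap.ext fun y => ?_
  rw [← hx', hx0]
  simp

/-- A Lie algebra of dimension `4` with nontrivial semisimple part is `ℂ ⊕ sl(2, ℂ)`. -/
theorem nonempty_equiv_of_finrank_four (h4 : Module.finrank ℂ L = 4)
    (hs : HasNontrivialSemisimplePart L) : Nonempty (L ≃ₗ⁅ℂ⁆ ℂ × sl2) := by
  have : FiniteDimensional ℂ L := FiniteDimensional.of_finrank_pos (by omega)
  set R := radical ℂ L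
  have hs' : Nontrivial (L ⧸ R) := hs
  have : FiniteDimensional ℂ (L ⧸ R) :=
    Module.Finite.of_surjective (quotHom R).toLinearMap (quotHom_surjective R)
  have : HasTrivialRadical ℂ (L ⧸ R) := hasTrivialRadical_quotient
  obtain ⟨h₀, e₀, f₀, t⟩ := exists_sl2Triple (L := L ⧸ R)
  obtain ⟨T, hT, hTh, hTe, hTf⟩ := exists_injective_of_sl2Triple t
  have h3 : 3 ≤ Module.finrank ℂ (L ⧸ R) := by
    rw [← finrank_sl2]
    exact LinearMap.finrank_le_finrank_of_injective (f := T.toLinearMap) hT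
  have hne := finrank_ne_four_of_isKilling t
  have hker : LinearMap.ker (quotHom R).toLinearMap = R.toSubmodule := by
    ext x
    exact quotHom_eq_zero
  have hsum := LinearMap.finrank_range_add_finrank_ker (quotHom R).toLinearMap
  rw [LinearMap.range_eq_top.2 (quotHom_surjective R), finrank_top, hker] at hsum
  have hR1 : Module.finrank ℂ R.toSubmodule = 1 := by omega
  obtain ⟨⟨r, hrR⟩, hr0, hr⟩ := finrank_eq_one_iff'.1 hR1
  have hr0' : r ≠ 0 := fun h => hr0 (Subtype.ext h)
  have hspan : ∀ x ∈ R, ∃ a : ℂ, x = a • r := by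
    intro x hx
    obtain ⟨a, ha⟩ := hr ⟨x, hx⟩
    exact ⟨a, (congrArg Subtype.val ha).symm⟩
  have hact : ∀ x : L, ∃ a : ℂ, ⁅x, r⁆ = a • r := fun x => hspan _ (lie_mem_right ℂ L R x r hrR)
  choose χ hχ using hact
  have hχlie : ∀ x y : L, ⁅⁅x, y⁆, r⁆ = 0 := by
    intro x y
    rw [lie_lie, hχ y, hχ x, lie_smul, lie_smul, hχ x, hχ y, smul_smul, smul_smul, mul_comm,
      sub_self]
  obtain ⟨h₁, hh₁⟩ := quotHom_surjective R h₀
  obtain ⟨e₁, he₁⟩ := quotHom_surjective R e₀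
  obtain ⟨f₁, hf₁⟩ := quotHom_surjective R f₀
  have hmod : ∀ x y : L, quotHom R x = quotHom R y → ∃ a : ℂ, x = y + a • r := by
    intro x y hxy
    obtain ⟨a, ha⟩ := hspan (x - y) (quotHom_eq_zero.1 (by rw [map_sub, hxy, sub_self]))
    exact ⟨a, by rw [← ha]; abel⟩
  obtain ⟨a, ha⟩ := hmod ⁅h₁, e₁⁆ ((2 : ℂ) • e₁) (by
    rw [LieHom.map_lie, map_smul, hh₁, he₁, t.lie_h_e_smul ℂ])
  obtain ⟨b, hb⟩ := hmod ⁅h₁, f₁⁆ (-((2 : ℂ) • f₁)) (by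
    rw [LieHom.map_lie, map_neg, map_smul, hh₁, hf₁, t.lie_lie_smul_f ℂ])
  obtain ⟨d, hd⟩ := hmod ⁅e₁, f₁⁆ h₁ (by
    rw [LieHom.map_lie, he₁, hf₁, hh₁, t.lie_e_f])
  -- `r` is central
  have hre : ⁅e₁, r⁆ = 0 := by
    have := hχlie h₁ e₁
    rw [ha, add_lie, smul_lie, smul_lie, lie_self, smul_zero, add_zero] at this
    exact (smul_eq_zero.1 this).resolve_left two_ne_zero
  have hrf : ⁅f₁, r⁆ = 0 := by
    have := hχlie h₁ f₁
    rw [hb, add_lie, neg_lie, smul_lie, smul_lie, lie_self, smul_zero, add_zero, neg_eq_zero] at this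
    exact (smul_eq_zero.1 this).resolve_left two_ne_zero
  have hrh : ⁅h₁, r⁆ = 0 := by
    have := hχlie e₁ f₁
    rwa [hd, add_lie, smul_lie, lie_self, smul_zero, add_zero] at this
  have hsurj : Function.Surjective T :=
    (LinearMap.injective_iff_surjective_of_finrank_eq_finrank (f := T.toLinearMap)
      (by rw [finrank_sl2]; omega)).1 hT
  have hgen : ∀ x : L, ∃ α β γ δ : ℂ, x = α • h₁ + β • e₁ + γ • f₁ + δ • r := by
    intro x
    obtain ⟨u, hu⟩ := hsurj (quotHom R x)
    obtain ⟨δ, hδ⟩ := hmod x (u.1 0 0 • h₁ + u.1 0 1 • e₁ + u.1 1 0 • f₁) (by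
      rw [← hu, map_add, map_add, map_smul, map_smul, map_smul, hh₁, he₁, hf₁, ← hTh, ← hTe, ← hTf,
        ← map_smul, ← map_smul, ← map_smul, ← map_add, ← map_add, sl2mk_smul, sl2mk_smul,
        sl2mk_smul, sl2mk_add, sl2mk_add]
      congr 1
      conv_lhs => rw [← sl2mk_eta u]
      congr 1 <;> ring)
    exact ⟨_, _, _, δ, hδ⟩
  have hc : ∀ x : L, ⁅r, x⁆ = 0 := by
    intro x
    obtain ⟨α, β, γ, δ, rfl⟩ := hgen x
    rw [← lie_skew]
    simp [add_lie, hrh, hre, hrf]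
  have hc' : ∀ x : L, ⁅x, r⁆ = 0 := fun x => by rw [← lie_skew, hc, neg_zero]
  let e₂ := e₁ + (a / 2) • r
  let f₂ := f₁ - (b / 2) • r
  let h₂ := h₁ + d • r
  have hef : ⁅e₂, f₂⁆ = h₂ := by
    simp only [e₂, f₂, h₂, lie_sub, add_lie, lie_smul, smul_lie, hc, hc', hd]
    simp
  have hhe : ⁅h₂, e₂⁆ = (2 : ℂ) • e₂ := by
    simp only [e₂, h₂, lie_add, add_lie, lie_smul, smul_lie, hc, hc', ha]
    module
  have hhf : ⁅h₂, f₂⁆ = -((2 : ℂ) • f₂) := by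
    simp only [f₂, h₂, lie_sub, add_lie, lie_smul, smul_lie, hc, hc', hb]
    module
  let Φ := homOfTriple r h₂ e₂ f₂ hc hef hhe hhf
  have hΦs : Function.Surjective Φ := by
    intro x
    obtain ⟨α, β, γ, δ, rfl⟩ := hgen x
    refine ⟨(δ - α * d - β * (a / 2) + γ * (b / 2), sl2mk α β γ), ?_⟩
    rw [homOfTriple_apply]
    simp only [sl2mk_00, sl2mk_01, sl2mk_10, e₂, f₂, h₂]
    module
  have hfin : Module.finrank ℂ (ℂ × sl2) = Module.finrank ℂ L := by
    rw [h4, Module.finrank_prod, finrank_sl2, Module.finrank_self]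
  have hΦi : Function.Injective Φ :=
    (LinearMap.injective_iff_surjective_of_finrank_eq_finrank (f := Φ.toLinearMap) hfin).2 hΦs
  exact ⟨(LieEquiv.ofBijective Φ ⟨hΦi, hΦs⟩).symm⟩

end Classification

/-! ### Linear differential equations and primitives -/

section Analysis

variable {E W : Type*} [NormedAddCommGroup E] [NormedSpace ℂ E]
  [NormedAddCommGroup W] [NormedSpace ℂ W]

lemma hasDerivAt_comp_segment {φ : E → W} {φ' : E →L[ℂ] W} {z₀ y : E} {t : ℝ}
    (h : HasFDerivAt φ φ' (z₀ + (t : ℂ) • y)) :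
    HasDerivAt (fun t : ℝ => φ (z₀ + (t : ℂ) • y)) (φ' y) t := by
  have h2 : HasDerivAt (fun s : ℝ => z₀ + (s : ℂ) • y) y t := by
    simpa using (Complex.ofRealCLM.hasDerivAt (x := t)).smul_const y |>.const_add z₀
  exact (h.restrictScalars ℝ).comp_hasDerivAt t h2

/-- Uniqueness for linear total differential equations. -/
lemma eventually_eq_zero_of_norm_fderiv_le {φ : E → W} {z₀ : E} {C : ℝ} (h0 : φ z₀ = 0)
    (hd : ∀ᶠ z in 𝓝 z₀, DifferentiableAt ℂ φ z)
    (hb : ∀ᶠ z in 𝓝 z₀, ‖fderiv ℂ φ z‖ ≤ C * ‖φ z‖) : ∀ᶠ z in 𝓝 z₀, φ z = 0 := by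
  obtain ⟨r, hr, hball⟩ := Metric.eventually_nhds_iff_ball.1 (hd.and hb)
  filter_upwards [Metric.ball_mem_nhds z₀ hr] with z hz
  set y := z - z₀
  have hy : ‖y‖ < r := by simpa [y, dist_eq_norm] using hz
  have hmem : ∀ t : ℝ, t ∈ Set.Icc (0 : ℝ) 1 → z₀ + (t : ℂ) • y ∈ Metric.ball z₀ r := by
    intro t ht
    rw [Metric.mem_ball, dist_eq_norm, add_sub_cancel_left, norm_smul, Complex.norm_real,
      Real.norm_of_nonneg ht.1]
    nlinarith [norm_nonneg y, ht.2]
  have hderiv : ∀ t : ℝ, t ∈ Set.Icc (0 : ℝ) 1 →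
      HasDerivAt (fun t : ℝ => φ (z₀ + (t : ℂ) • y)) (fderiv ℂ φ (z₀ + (t : ℂ) • y) y) t := by
    intro t ht
    have h1 := (hball _ (hmem t ht)).1.hasFDerivAt
    exact hasDerivAt_comp_segment h1
  have hz1 : z₀ + ((1 : ℝ) : ℂ) • y = z := by simp [y]
  have key := eq_zero_of_abs_deriv_le_mul_abs_self_of_eq_zero_right (a := (0 : ℝ)) (b := 1)
    (K := |C| * ‖y‖) (f := fun t : ℝ => φ (z₀ + (t : ℂ) • y))
    (f' := fun t : ℝ => fderiv ℂ φ (z₀ + (t : ℂ) • y) y)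
    (fun t ht => (hderiv t ht).continuousAt.continuousWithinAt)
    (fun t ht => (hderiv t ⟨ht.1, ht.2.le⟩).hasDerivWithinAt) (by simpa using h0)
    (fun t ht => by
      have h1 := (hball _ (hmem t ⟨ht.1, ht.2.le⟩)).2
      refine (ContinuousLinearMap.le_opNorm _ _).trans ?_
      have h2 : C * ‖φ (z₀ + (t : ℂ) • y)‖ ≤ |C| * ‖φ (z₀ + (t : ℂ) • y)‖ :=
        mul_le_mul_of_nonneg_right (le_abs_self C) (norm_nonneg _)
      calc _ ≤ (|C| * ‖φ (z₀ + (t : ℂ) • y)‖) * ‖y‖ :=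
            mul_le_mul_of_nonneg_right (h1.trans h2) (norm_nonneg _)
        _ = _ := by ring)
    1 (by simp)
  rwa [hz1] at key

lemma eventually_eq_const_of_fderiv_eq_zero {φ : E → W} {z₀ : E}
    (hd : ∀ᶠ z in 𝓝 z₀, DifferentiableAt ℂ φ z)
    (hb : ∀ᶠ z in 𝓝 z₀, fderiv ℂ φ z = 0) : ∀ᶠ z in 𝓝 z₀, φ z = φ z₀ := by
  have := eventually_eq_zero_of_norm_fderiv_le (φ := fun z => φ z - φ z₀) (z₀ := z₀) (C := 0)
    (sub_self _) (by filter_upwards [hd] with z hz using hz.sub_const _)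
    (by filter_upwards [hb] with z hz; rw [fderiv_sub_const, hz]; simp)
  filter_upwards [this] with z hz using sub_eq_zero.1 hz

/-- The term by term integral of the power series of a one-form. -/
def primitiveSeries (q : FormalMultilinearSeries ℂ E (E →L[ℂ] W)) (c : W) :
    FormalMultilinearSeries ℂ E W
  | 0 => ContinuousMultilinearMap.uncurry0 ℂ E c
  | n + 1 => ((n + 1 : ℕ) : ℂ)⁻¹ • ContinuousMultilinearMap.uncurryRight (Ei := fun _ => E) (q n)

lemma norm_primitiveSeries_succ_le (q : FormalMultilinearSeries ℂ E (E →L[ℂ] W)) (c : W) (n : ℕ) :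
    ‖primitiveSeries q c (n + 1)‖ ≤ ‖q n‖ := by
  change ‖((n + 1 : ℕ) : ℂ)⁻¹ • ContinuousMultilinearMap.uncurryRight (Ei := fun _ => E) (q n)‖ ≤ _
  rw [norm_smul, ContinuousMultilinearMap.uncurryRight_norm, norm_inv, Complex.norm_natCast]
  refine mul_le_of_le_one_left (norm_nonneg (q n)) (inv_le_one_of_one_le₀ ?_)
  push_cast
  linarith [(Nat.cast_nonneg n : (0 : ℝ) ≤ n)]

lemma primitiveSeries_succ_apply (q : FormalMultilinearSeries ℂ E (E →L[ℂ] W)) (c : W) (n : ℕ)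
    (y : E) : primitiveSeries q c (n + 1) (fun _ => y) =
      ((n + 1 : ℕ) : ℂ)⁻¹ • q n (fun _ => y) y := rfl

/-- A primitive of an analytic one-form is analytic. -/
lemma analyticAt_of_hasFDerivAt [CompleteSpace W] {τ : E → W} {β : E → E →L[ℂ] W} {z₀ : E}
    (hβ : AnalyticAt ℂ β z₀) (hτ : ∀ᶠ z in 𝓝 z₀, HasFDerivAt τ (β z) z) : AnalyticAt ℂ τ z₀ := by
  obtain ⟨q, r₁, hq₁⟩ := hβ
  obtain ⟨ε, hε, hball⟩ := Metric.eventually_nhds_iff_ball.1 hτ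
  set r : ENNReal := min r₁ (ENNReal.ofReal ε)
  have hr0 : 0 < r := lt_min hq₁.r_pos (ENNReal.ofReal_pos.2 hε)
  have hq := hq₁.mono hr0 (min_le_left _ _)
  refine ⟨primitiveSeries q (τ z₀), r, ?_, hr0, ?_⟩
  · refine ENNReal.le_of_forall_nnreal_lt fun s hs => ?_
    apply FormalMultilinearSeries.le_radius_of_summable_norm
    rw [← summable_nat_add_iff 1]
    have h1 := q.summable_norm_mul_pow (hs.trans_le hq.r_le)
    refine Summable.of_nonneg_of_le (fun n => by positivity) (fun n => ?_) (h1.mul_right (s : ℝ))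
    calc ‖primitiveSeries q (τ z₀) (n + 1)‖ * (s : ℝ) ^ (n + 1) ≤ ‖q n‖ * (s : ℝ) ^ (n + 1) :=
          mul_le_mul_of_nonneg_right 
            (norm_primitiveSeries_succ_le q _ n) (by positivity)
      _ = ‖q n‖ * (s : ℝ) ^ n * s := by ring
  · intro y hy
    have hyr : (‖y‖₊ : ENNReal) < r := by
      rw [Metric.mem_eball, edist_zero_right] at hy
      exact hy
    have hyε : ‖y‖ < ε := by
      have h1 : (‖y‖₊ : ENNReal) < ENNReal.ofReal ε := hyr.trans_le (min_le_right _ _)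
      rw [ENNReal.lt_ofReal_iff_toReal_lt ENNReal.coe_ne_top] at h1
      simpa using h1
    have hmem : ∀ t : ℝ, t ∈ Set.Icc (0 : ℝ) 1 → ‖(t : ℂ) • y‖ ≤ ‖y‖ := by
      intro t ht
      rw [norm_smul, Complex.norm_real, Real.norm_of_nonneg ht.1]
      nlinarith [norm_nonneg y, ht.2]
    have hderiv : ∀ t : ℝ, t ∈ Set.Icc (0 : ℝ) 1 →
        HasDerivAt (fun t : ℝ => τ (z₀ + (t : ℂ) • y)) (β (z₀ + (t : ℂ) • y) y) t := by
      intro t ht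
      have h1 := hball (z₀ + (t : ℂ) • y) (by
        rw [Metric.mem_ball, dist_eq_norm, add_sub_cancel_left]
        exact (hmem t ht).trans_lt hyε)
      exact hasDerivAt_comp_segment h1
    have hsum : ∀ t : ℝ, t ∈ Set.Icc (0 : ℝ) 1 →
        HasSum (fun n => ((t : ℂ) ^ n) • q n (fun _ => y) y) (β (z₀ + (t : ℂ) • y) y) := by
      intro t ht
      have h1 := hq.hasSum (y := (t : ℂ) • y) (by
        rw [Metric.mem_eball, edist_zero_right]
        refine lt_of_le_of_lt ?_ hyr
        exact_mod_cast (hmem t ht))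
      have h2 := h1.mapL (ContinuousLinearMap.apply ℂ W y)
      have h3 : ∀ n, q n (fun _ => (t : ℂ) • y) = ((t : ℂ) ^ n) • q n (fun _ => y) := by
        intro n
        rw [ContinuousMultilinearMap.map_smul_univ (q n) (fun _ => (t : ℂ)) (fun _ => y)]
        simp
      simp only [h3] at h2
      exact h2
    have hqs := q.summable_norm_mul_pow (hyr.trans_le hq.r_le)
    have hInt := intervalIntegral.hasSum_integral_of_dominated_convergence (a := 0) (b := 1)
      (μ := MeasureTheory.volume)
      (F := fun n (t : ℝ) => ((t : ℂ) ^ n) • q n (fun _ => y) y)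
      (f := fun t : ℝ => β (z₀ + (t : ℂ) • y) y)
      (fun n _ => ‖q n‖ * ‖y‖ ^ n * ‖y‖)
      (fun n => Continuous.aestronglyMeasurable (by fun_prop))
      (fun n => Eventually.of_forall fun t ht => by
        rw [Set.uIoc_of_le zero_le_one] at ht
        rw [norm_smul, norm_pow, Complex.norm_real, Real.norm_of_nonneg ht.1.le]
        have h1 : ‖q n (fun _ => y) y‖ ≤ ‖q n‖ * ‖y‖ ^ n * ‖y‖ :=
          (ContinuousLinearMap.le_opNorm _ _).trans (mul_le_mul_of_nonneg_right
            (by simpa using (q n).le_opNorm fun _ => y) (norm_nonneg _))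
        exact (mul_le_of_le_one_left (norm_nonneg _) (pow_le_one₀ ht.1.le ht.2)).trans h1)
      (Eventually.of_forall fun t _ => hqs.mul_right _)
      intervalIntegrable_const
      (Eventually.of_forall fun t ht => by
        rw [Set.uIoc_of_le zero_le_one] at ht
        exact hsum t ⟨ht.1.le, ht.2⟩)
    have hcont : ContinuousOn (fun t : ℝ => β (z₀ + (t : ℂ) • y) y) (Set.uIcc 0 1) := by
      rw [Set.uIcc_of_le zero_le_one]
      intro t ht
      refine ContinuousAt.continuousWithinAt ?_
      have h1 : ContinuousAt β (z₀ + (t : ℂ) • y) := by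
        refine (hq.continuousOn.continuousAt (Metric.isOpen_eball.mem_nhds ?_))
        rw [Metric.mem_eball, edist_comm, edist_eq_enorm_sub, sub_add_cancel_left, enorm_neg]
        refine lt_of_le_of_lt ?_ hyr
        exact_mod_cast (hmem t ht)
      have h2 : ContinuousAt (fun t : ℝ => z₀ + (t : ℂ) • y) t := by fun_prop
      exact (ContinuousAt.comp (f := fun t : ℝ => z₀ + (t : ℂ) • y) h1 h2).clm_apply
        continuousAt_const
    rw [intervalIntegral.integral_eq_sub_of_hasDerivAt
      (fun t ht => hderiv t (by rwa [Set.uIcc_of_le zero_le_one] at ht))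
      (hcont.intervalIntegrable)] at hInt
    rw [← hasSum_nat_add_iff' 1]
    convert hInt using 1
    · ext n
      rw [primitiveSeries_succ_apply, intervalIntegral.integral_smul_const]
      congr 1
      have : ∫ t in (0 : ℝ)..1, (t : ℂ) ^ n = ((∫ t in (0 : ℝ)..1, t ^ n : ℝ) : ℂ) := by
        rw [← intervalIntegral.integral_ofReal]
        simp
      rw [this, integral_pow]
      simp
    · simp [primitiveSeries]

/-- The Poincaré lemma for analytic one-forms. -/
lemma exists_primitive {β : E → E →L[ℂ] ℂ} {z₀ : E} (hβ : AnalyticAt ℂ β z₀)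
    (hs : ∀ᶠ z in 𝓝 z₀, ∀ x y, fderiv ℂ β z x y = fderiv ℂ β z y x) :
    ∃ τ : E → ℂ, AnalyticAt ℂ τ z₀ ∧ τ z₀ = 0 ∧ ∀ᶠ z in 𝓝 z₀, HasFDerivAt τ (β z) z := by
  obtain ⟨r, hr, hball⟩ := Metric.eventually_nhds_iff_ball.1 (hs.and hβ.eventually_analyticAt)
  have hd : ∀ z ∈ Metric.ball z₀ r, DifferentiableAt ℂ β z :=
    fun z hz => (hball z hz).2.differentiableAt
  obtain ⟨τ, hτ⟩ := Convex.exists_forall_hasFDerivAt_of_fderiv_symmetric (𝕜 := ℂ)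
    (convex_ball z₀ r) Metric.isOpen_ball
    (fun z hz => ((hd z hz).restrictScalars ℝ).differentiableWithinAt :
      DifferentiableOn ℝ β (Metric.ball z₀ r))
    (fun z hz x y => by
      rw [(hd z hz).fderiv_restrictScalars ℝ]
      exact (hball z hz).1 x y)
  have h1 : ∀ᶠ z in 𝓝 z₀, HasFDerivAt (fun z => τ z - τ z₀) (β z) z := by
    filter_upwards [Metric.ball_mem_nhds z₀ hr] with z hz using (hτ z hz).sub_const _
  exact ⟨fun z => τ z - τ z₀, analyticAt_of_hasFDerivAt hβ h1, sub_self _, h1⟩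

end Analysis

/-! ### Transport by biholomorphic maps -/

section Transport

variable {E E' : Type*} [NormedAddCommGroup E] [NormedSpace ℂ E]
  [NormedAddCommGroup E'] [NormedSpace ℂ E']
variable {M M' : Type*} [TopologicalSpace M] [ChartedSpace E M] [IsManifold 𝓘(ℂ, E) ω M]
  [TopologicalSpace M'] [ChartedSpace E' M'] [IsManifold 𝓘(ℂ, E') ω M']

lemma isManifold_one : IsManifold 𝓘(ℂ, E) 1 M := IsManifold.of_le (n := ω) le_top

lemma dirDeriv_comp {f : M → M'} {F : M' → ℂ} {x : M}
    (hF : MDifferentiableAt 𝓘(ℂ, E') 𝓘(ℂ, ℂ) F (f x))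
    (hf : MDifferentiableAt 𝓘(ℂ, E) 𝓘(ℂ, E') f x) (v : TangentSpace 𝓘(ℂ, E) x) :
    dirDeriv (F ∘ f) x v = dirDeriv F (f x) (mfderiv 𝓘(ℂ, E) 𝓘(ℂ, E') f x v) := by
  have h := mfderiv_comp x hF hf
  exact congrArg (fun L => L v) h

lemma HolAt.mpullback [CompleteSpace E] {f : M → M'} {V : ∀ y : M', TangentSpace 𝓘(ℂ, E') y}
    {x : M} (hV : HolAt V (f x)) (hf : ContMDiffAt 𝓘(ℂ, E) 𝓘(ℂ, E') ω f x)
    (hf' : (mfderiv 𝓘(ℂ, E) 𝓘(ℂ, E') f x).IsInvertible) :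
    HolAt (mpullback 𝓘(ℂ, E) 𝓘(ℂ, E') f V) x := by
  have : IsManifold 𝓘(ℂ, E) 1 M := isManifold_one
  have : IsManifold 𝓘(ℂ, E') 1 M' := isManifold_one
  exact ContMDiffAt.mpullback_vectorField_preimage hV hf hf' le_top

lemma HolAt.mpullback_mlieBracket [CompleteSpace E] [CompleteSpace E'] {f : M → M'}
    {V W : ∀ y : M', TangentSpace 𝓘(ℂ, E') y}
    {x : M} (hV : HolAt V (f x)) (hW : HolAt W (f x))
    (hf : ContMDiffAt 𝓘(ℂ, E) 𝓘(ℂ, E') ω f x) :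
    VectorField.mpullback 𝓘(ℂ, E) 𝓘(ℂ, E') f (VectorField.mlieBracket 𝓘(ℂ, E') V W) x =
      VectorField.mlieBracket 𝓘(ℂ, E) (VectorField.mpullback 𝓘(ℂ, E) 𝓘(ℂ, E') f V)
        (VectorField.mpullback 𝓘(ℂ, E) 𝓘(ℂ, E') f W) x := by
  have : IsManifold 𝓘(ℂ, E) (minSmoothness ℂ 3) M := IsManifold.of_le (n := ω) le_top
  have : IsManifold 𝓘(ℂ, E') (minSmoothness ℂ 3) M' := IsManifold.of_le (n := ω) le_top
  exact VectorField.mpullback_mlieBracket hV.mdiff hW.mdiff hf le_top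

/-- A biholomorphic map between open sets. -/
structure IsBihol (f : OpenPartialHomeomorph M M') : Prop where
  holo : ContMDiffOn 𝓘(ℂ, E) 𝓘(ℂ, E') ω f f.source
  holo_symm : ContMDiffOn 𝓘(ℂ, E') 𝓘(ℂ, E) ω f.symm f.target

namespace IsBihol

variable {f : OpenPartialHomeomorph M M'}

lemma symm (h : IsBihol (E := E) (E' := E') f) : IsBihol (E := E') (E' := E) f.symm :=
  ⟨h.holo_symm, by simpa using h.holo⟩

lemma contMDiffAt (h : IsBihol (E := E) (E' := E') f) {x : M} (hx : x ∈ f.source) :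
    ContMDiffAt 𝓘(ℂ, E) 𝓘(ℂ, E') ω f x :=
  h.holo.contMDiffAt (f.open_source.mem_nhds hx)

lemma mdiff (h : IsBihol (E := E) (E' := E') f) {x : M} (hx : x ∈ f.source) :
    MDifferentiableAt 𝓘(ℂ, E) 𝓘(ℂ, E') f x :=
  (h.contMDiffAt hx).mdifferentiableAt (by simp)

lemma symm_comp (h : IsBihol (E := E) (E' := E') f) {x : M} (hx : x ∈ f.source) (v : E) :
    (mfderiv 𝓘(ℂ, E') 𝓘(ℂ, E) f.symm (f x) (mfderiv 𝓘(ℂ, E) 𝓘(ℂ, E') f x v) : E) = v := by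
  have h1 := mfderiv_comp x (h.symm.mdiff (x := f x) (f.map_source hx)) (h.mdiff hx)
  have h2 : (f.symm ∘ f) =ᶠ[𝓝 x] id := by
    filter_upwards [f.open_source.mem_nhds hx] with y hy using f.left_inv hy
  have h3 : mfderiv 𝓘(ℂ, E) 𝓘(ℂ, E) (f.symm ∘ f) x = ContinuousLinearMap.id ℂ E := by
    have := h2.mfderiv_eq (I := 𝓘(ℂ, E)) (I' := 𝓘(ℂ, E))
    rw [mfderiv_id] at this
    exact this
  exact (congrArg (fun L : E →L[ℂ] E => L v) (h1.symm.trans h3))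

lemma comp_symm (h : IsBihol (E := E) (E' := E') f) {x : M} (hx : x ∈ f.source) (v : E') :
    (mfderiv 𝓘(ℂ, E) 𝓘(ℂ, E') f x (mfderiv 𝓘(ℂ, E') 𝓘(ℂ, E) f.symm (f x) v) : E') = v := by
  have h1 := h.symm.symm_comp (x := f x) (f.map_source hx) v
  have e : f.symm (f x) = x := f.left_inv hx
  have h2 := congrArg (fun p : M => (mfderiv 𝓘(ℂ, E) 𝓘(ℂ, E') f p
    (mfderiv 𝓘(ℂ, E') 𝓘(ℂ, E) f.symm (f x) v : E) : E')) e
  exact h2.symm.trans h1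

lemma isInvertible (h : IsBihol (E := E) (E' := E') f) {x : M} (hx : x ∈ f.source) :
    (mfderiv 𝓘(ℂ, E) 𝓘(ℂ, E') f x).IsInvertible := by
  apply ContinuousLinearMap.IsInvertible.of_inverse
    (g := (mfderiv 𝓘(ℂ, E') 𝓘(ℂ, E) f.symm (f x) : E' →L[ℂ] E))
  · ext v
    exact h.comp_symm hx v
  · ext v
    exact h.symm_comp hx v

lemma mfderiv_injective (h : IsBihol (E := E) (E' := E') f) {x : M} (hx : x ∈ f.source) :
    Function.Injective (mfderiv 𝓘(ℂ, E) 𝓘(ℂ, E') f x) := (h.isInvertible hx).injective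

lemma mfderiv_mpullback (h : IsBihol (E := E) (E' := E') f) {x : M} (hx : x ∈ f.source)
    (V : ∀ y : M', TangentSpace 𝓘(ℂ, E') y) :
    mfderiv 𝓘(ℂ, E) 𝓘(ℂ, E') f x (mpullback 𝓘(ℂ, E) 𝓘(ℂ, E') f V x) = V (f x) := by
  obtain ⟨e, he⟩ := h.isInvertible hx
  rw [mpullback_apply, ← he, ContinuousLinearMap.inverse_equiv]
  exact e.apply_symm_apply _

lemma mpullback_eq_iff (h : IsBihol (E := E) (E' := E') f) {x : M} (hx : x ∈ f.source)
    {V : ∀ y : M', TangentSpace 𝓘(ℂ, E') y} {v : TangentSpace 𝓘(ℂ, E) x} :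
    mpullback 𝓘(ℂ, E) 𝓘(ℂ, E') f V x = v ↔ mfderiv 𝓘(ℂ, E) 𝓘(ℂ, E') f x v = V (f x) := by
  rw [← h.mfderiv_mpullback hx V, (h.mfderiv_injective hx).eq_iff, eq_comm]

lemma mpullback_symm_apply (h : IsBihol (E := E) (E' := E') f) {x : M} (hx : x ∈ f.source)
    (V : ∀ y : M, TangentSpace 𝓘(ℂ, E) y) :
    (mpullback 𝓘(ℂ, E') 𝓘(ℂ, E) f.symm V (f x) : E') = mfderiv 𝓘(ℂ, E) 𝓘(ℂ, E') f x (V x) := by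
  refine (h.symm.mpullback_eq_iff (x := f x) (f.map_source hx)).2 ?_
  have e : f.symm (f x) = x := f.left_inv hx
  have h2 := congrArg (fun p : M => (V p : E)) e
  exact (h.symm_comp hx (V x)).trans h2.symm

lemma mpullback_mpullback_symm (h : IsBihol (E := E) (E' := E') f) {x : M} (hx : x ∈ f.source)
    (V : ∀ y : M, TangentSpace 𝓘(ℂ, E) y) :
    mpullback 𝓘(ℂ, E) 𝓘(ℂ, E') f (mpullback 𝓘(ℂ, E') 𝓘(ℂ, E) f.symm V) x = V x :=
  (h.mpullback_eq_iff hx).2 (h.mpullback_symm_apply hx V).symm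

end IsBihol

lemma IsLocalIsometry.isBihol {g : Metric E M} {g' : Metric E' M'}
    {f : OpenPartialHomeomorph M M'} (h : IsLocalIsometry g g' f) : IsBihol (E := E) (E' := E') f :=
  ⟨h.holo, h.holo_symm⟩

lemma IsLocalIsometry.symm {g : Metric E M} {g' : Metric E' M'}
    {f : OpenPartialHomeomorph M M'} (h : IsLocalIsometry g g' f) :
    IsLocalIsometry g' g f.symm where
  holo := h.holo_symm
  holo_symm := by simpa using h.holo
  isometry y hy v w := by
    have hx : f.symm y ∈ f.source := f.map_target hy
    have h1 := h.isometry _ hx (mfderiv 𝓘(ℂ, E') 𝓘(ℂ, E) f.symm y v)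
      (mfderiv 𝓘(ℂ, E') 𝓘(ℂ, E) f.symm y w)
    refine h1.symm.trans ?_
    have e : f (f.symm y) = y := f.right_inv hy
    have e1 : ∀ v : E', (mfderiv 𝓘(ℂ, E) 𝓘(ℂ, E') f (f.symm y)
        (mfderiv 𝓘(ℂ, E') 𝓘(ℂ, E) f.symm y v) : E') = v := fun v =>
      h.isBihol.symm.symm_comp (x := y) hy v
    have e2 := congrArg (fun p : M' => (g'.val p : E' →ₗ[ℂ] E' →ₗ[ℂ] ℂ) v w) e
    refine Eq.trans ?_ e2
    exact congrArg₂ (fun a b => (g'.val (f (f.symm y)) : E' →ₗ[ℂ] E' →ₗ[ℂ] ℂ) a b) (e1 v) (e1 w)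

lemma IsLocalIsometry.trans {E'' M'' : Type*} [NormedAddCommGroup E''] [NormedSpace ℂ E'']
    [TopologicalSpace M''] [ChartedSpace E'' M''] [IsManifold 𝓘(ℂ, E'') ω M'']
    {g : Metric E M} {g' : Metric E' M'} {g'' : Metric E'' M''}
    {f : OpenPartialHomeomorph M M'} {f' : OpenPartialHomeomorph M' M''}
    (h : IsLocalIsometry g g' f) (h' : IsLocalIsometry g' g'' f') :
    IsLocalIsometry g g'' (f.trans f') where
  holo := by
    rw [OpenPartialHomeomorph.trans_source]
    exact h'.holo.comp (h.holo.mono Set.inter_subset_left) fun x hx => hx.2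
  holo_symm := by
    rw [OpenPartialHomeomorph.trans_target]
    exact h.holo_symm.comp (h'.holo_symm.mono Set.inter_subset_left) fun x hx => hx.2
  isometry x hx v w := by
    rw [OpenPartialHomeomorph.trans_source] at hx
    have e : mfderiv 𝓘(ℂ, E) 𝓘(ℂ, E'') (f.trans f') x =
        (mfderiv 𝓘(ℂ, E') 𝓘(ℂ, E'') f' (f x)).comp (mfderiv 𝓘(ℂ, E) 𝓘(ℂ, E') f x) :=
      mfderiv_comp x (h'.isBihol.mdiff hx.2) (h.isBihol.mdiff hx.1)
    rw [e]
    exact (h'.isometry _ hx.2 _ _).trans (h.isometry _ hx.1 _ _)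

/-- Isometric maps pull Killing fields back to Killing fields. -/
lemma IsLocalIsometry.killingAt [CompleteSpace E] [CompleteSpace E'] {g : Metric E M}
    {g' : Metric E' M'} {f : OpenPartialHomeomorph M M'} (h : IsLocalIsometry g g' f) {x : M}
    (hx : x ∈ f.source) {V : ∀ y : M', TangentSpace 𝓘(ℂ, E') y} (hV : HolAt V (f x))
    (hK : KillingAt g' V (f x)) : KillingAt g (mpullback 𝓘(ℂ, E) 𝓘(ℂ, E') f V) x := by
  intro W Z hW hZ
  have hb := h.isBihol
  have hsrc : ∀ᶠ y in 𝓝 x, y ∈ f.source := f.open_source.mem_nhds hx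
  have e : f.symm (f x) = x := f.left_inv hx
  have push : ∀ U : (∀ y : M, TangentSpace 𝓘(ℂ, E) y), HolAt U x →
      HolAt (mpullback 𝓘(ℂ, E') 𝓘(ℂ, E) f.symm U) (f x) := fun U hU =>
    HolAt.mpullback (by rw [e]; exact hU) (hb.symm.contMDiffAt (x := f x) (f.map_source hx))
      (hb.symm.isInvertible (x := f x) (f.map_source hx))
  have br : ∀ U : (∀ y : M, TangentSpace 𝓘(ℂ, E) y), HolAt U x →
      mlieBracket 𝓘(ℂ, E) (mpullback 𝓘(ℂ, E) 𝓘(ℂ, E') f V) U x =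
      mpullback 𝓘(ℂ, E) 𝓘(ℂ, E') f
        (mlieBracket 𝓘(ℂ, E') V (mpullback 𝓘(ℂ, E') 𝓘(ℂ, E) f.symm U)) x := by
    intro U hU
    rw [HolAt.mpullback_mlieBracket hV (push U hU) (hb.contMDiffAt hx)]
    refine Filter.EventuallyEq.mlieBracket_vectorField_eq (EventuallyEq.refl _ _) ?_
    filter_upwards [hsrc] with y hy
    exact (hb.mpullback_mpullback_symm hy U).symm
  set W' := mpullback 𝓘(ℂ, E') 𝓘(ℂ, E) f.symm W with hW'
  set Z' := mpullback 𝓘(ℂ, E') 𝓘(ℂ, E) f.symm Z with hZ'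
  have hfun : (fun y => g.val y (W y) (Z y)) =ᶠ[𝓝 x] (fun y => g'.val y (W' y) (Z' y)) ∘ f := by
    filter_upwards [hsrc] with y hy
    rw [← h.isometry y hy]
    exact (congrArg₂ (fun a b => (g'.val (f y) : E' →ₗ[ℂ] E' →ₗ[ℂ] ℂ) a b)
      (hb.mpullback_symm_apply hy W) (hb.mpullback_symm_apply hy Z)).symm
  rw [dirDeriv_congr hfun, dirDeriv_comp (g'.holo_mdiff (push W hW) (push Z hZ)) (hb.mdiff hx),
    hb.mfderiv_mpullback hx, hK W' Z' (push W hW) (push Z hZ), br W hW, br Z hZ,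
    ← h.isometry x hx, ← h.isometry x hx, hb.mfderiv_mpullback hx, hb.mfderiv_mpullback hx]
  congr 1
  · exact congrArg (fun b => (g'.val (f x) : E' →ₗ[ℂ] E' →ₗ[ℂ] ℂ)
      (mlieBracket 𝓘(ℂ, E') V W' (f x)) b) (hb.mpullback_symm_apply hx Z)
  · exact congrArg (fun b => (g'.val (f x) : E' →ₗ[ℂ] E' →ₗ[ℂ] ℂ) b
      (mlieBracket 𝓘(ℂ, E') V Z' (f x))) (hb.mpullback_symm_apply hx W)

section KillingTransport

variable [CompleteSpace E] [CompleteSpace E'] {g : Metric E M}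
    {g' : Metric E' M'} {f : OpenPartialHomeomorph M M'}

lemma IsLocalIsometry.mpullback_mem (h : IsLocalIsometry g g' f) {x : M}
    (hx : x ∈ f.source) {V : ∀ y : M', TangentSpace 𝓘(ℂ, E') y} (hV : V ∈ localKilling g' (f x)) :
    mpullback 𝓘(ℂ, E) 𝓘(ℂ, E') f V ∈ localKilling g x := by
  have hV' : ∀ᶠ y in 𝓝 (f x), HolAt V y ∧ KillingAt g' V y := hV
  have hc : ContinuousAt f x := f.continuousAt hx
  change ∀ᶠ y in 𝓝 x, _
  filter_upwards [f.open_source.mem_nhds hx, hc.eventually hV'] with y hy hy'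
  exact ⟨hy'.1.mpullback (h.isBihol.contMDiffAt hy) (h.isBihol.isInvertible hy),
    h.killingAt hy hy'.1 hy'.2⟩

/-- The pullback of Killing fields by a local isometry. -/
def IsLocalIsometry.pullField (h : IsLocalIsometry g g' f) {x : M}
    (hx : x ∈ f.source) : localKilling g' (f x) →ₗ[ℂ] localKilling g x where
  toFun V := ⟨mpullback 𝓘(ℂ, E) 𝓘(ℂ, E') f V.1, h.mpullback_mem hx V.2⟩
  map_add' _ _ := Subtype.ext mpullback_add
  map_smul' _ _ := Subtype.ext mpullback_const_smul

/-- The pullback of germs of Killing fields by a local isometry. -/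
def IsLocalIsometry.pullHom (h : IsLocalIsometry g g' f) {x : M}
    (hx : x ∈ f.source) : KillingAlgebra g' (f x) →ₗ⁅ℂ⁆ KillingAlgebra g x where
  toLinearMap := (zeroGerm g' (f x)).liftQ
    ((KillingAlgebra.germ g x).comp (h.pullField hx))
    (fun V hV => by
      have hV' : ∀ᶠ y in 𝓝 (f x), V.1 y = 0 := hV
      rw [LinearMap.mem_ker, LinearMap.comp_apply, ← map_zero (KillingAlgebra.germ g x)]
      refine KillingAlgebra.germ_eq_iff.2 ?_
      filter_upwards [(f.continuousAt hx).eventually hV'] with y hy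
      change mpullback 𝓘(ℂ, E) 𝓘(ℂ, E') f V.1 y = 0
      rw [mpullback_apply, hy, map_zero])
  map_lie' := by
    intro a b
    obtain ⟨V, rfl⟩ := KillingAlgebra.germ_surjective g' (f x) a
    obtain ⟨W, rfl⟩ := KillingAlgebra.germ_surjective g' (f x) b
    rw [KillingAlgebra.germ_lie]
    change KillingAlgebra.germ g x ⟨_, _⟩ = ⁅KillingAlgebra.germ g x ⟨_, _⟩,
      KillingAlgebra.germ g x ⟨_, _⟩⁆
    rw [KillingAlgebra.germ_lie, KillingAlgebra.germ_eq_iff]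
    have hV' : ∀ᶠ y in 𝓝 (f x), HolAt V.1 y ∧ KillingAt g' V.1 y := V.2
    have hW' : ∀ᶠ y in 𝓝 (f x), HolAt W.1 y ∧ KillingAt g' W.1 y := W.2
    filter_upwards [f.open_source.mem_nhds hx, (f.continuousAt hx).eventually hV',
      (f.continuousAt hx).eventually hW'] with y hy hy1 hy2
    exact HolAt.mpullback_mlieBracket hy1.1 hy2.1 (h.isBihol.contMDiffAt hy)

lemma IsLocalIsometry.pullHom_germ (h : IsLocalIsometry g g' f) {x : M}
    (hx : x ∈ f.source) (V : localKilling g' (f x)) :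
    h.pullHom hx (KillingAlgebra.germ g' (f x) V) =
      KillingAlgebra.germ g x ⟨mpullback 𝓘(ℂ, E) 𝓘(ℂ, E') f V.1, h.mpullback_mem hx V.2⟩ := rfl

lemma IsLocalIsometry.pullHom_bijective (h : IsLocalIsometry g g' f) {x : M}
    (hx : x ∈ f.source) : Function.Bijective (h.pullHom hx) := by
  constructor
  · rw [injective_iff_map_eq_zero]
    intro a ha
    obtain ⟨V, rfl⟩ := KillingAlgebra.germ_surjective g' (f x) a
    rw [pullHom_germ, ← map_zero (KillingAlgebra.germ g x), KillingAlgebra.germ_eq_iff] at ha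
    rw [← map_zero (KillingAlgebra.germ g' (f x)), KillingAlgebra.germ_eq_iff]
    have hc : Tendsto f.symm (𝓝 (f x)) (𝓝 x) := by
      have := f.symm.continuousAt (x := f x) (f.map_source hx)
      rwa [ContinuousAt, f.left_inv hx] at this
    filter_upwards [hc.eventually ha, f.open_target.mem_nhds (f.map_source hx)] with y hy hyt
    have hy' : mpullback 𝓘(ℂ, E) 𝓘(ℂ, E') f V.1 (f.symm y) = 0 := hy
    rw [h.isBihol.mpullback_eq_iff (f.map_target hyt), map_zero, f.right_inv hyt] at hy'
    exact hy'.symm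
  · intro b
    obtain ⟨V, rfl⟩ := KillingAlgebra.germ_surjective g x b
    have hm : mpullback 𝓘(ℂ, E') 𝓘(ℂ, E) f.symm V.1 ∈ localKilling g' (f x) :=
      h.symm.mpullback_mem (x := f x) (f.map_source hx) (by rw [f.left_inv hx]; exact V.2)
    refine ⟨KillingAlgebra.germ g' (f x) ⟨_, hm⟩, ?_⟩
    rw [pullHom_germ, KillingAlgebra.germ_eq_iff]
    filter_upwards [f.open_source.mem_nhds hx] with y hy
    exact h.isBihol.mpullback_mpullback_symm hy V.1

/-- Local isometries induce isomorphisms of the Killing algebras. -/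
def IsLocalIsometry.pullEquiv (h : IsLocalIsometry g g' f) {x : M}
    (hx : x ∈ f.source) : KillingAlgebra g' (f x) ≃ₗ⁅ℂ⁆ KillingAlgebra g x :=
  LieEquiv.ofBijective (h.pullHom hx) (h.pullHom_bijective hx)

lemma IsLocalIsometry.pullEquiv_germ (h : IsLocalIsometry g g' f) {x : M}
    (hx : x ∈ f.source) (V : localKilling g' (f x)) :
    h.pullEquiv hx (KillingAlgebra.germ g' (f x) V) =
      KillingAlgebra.germ g x ⟨mpullback 𝓘(ℂ, E) 𝓘(ℂ, E') f V.1, h.mpullback_mem hx V.2⟩ := rfl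

lemma IsLocalIsometry.mfderiv_eval_pullEquiv (h : IsLocalIsometry g g' f) {x : M}
    (hx : x ∈ f.source) (a : KillingAlgebra g' (f x)) :
    mfderiv 𝓘(ℂ, E) 𝓘(ℂ, E') f x (KillingAlgebra.eval g x (h.pullEquiv hx a)) =
      KillingAlgebra.eval g' (f x) a := by
  obtain ⟨V, rfl⟩ := KillingAlgebra.germ_surjective g' (f x) a
  rw [pullEquiv_germ, KillingAlgebra.eval_germ, KillingAlgebra.eval_germ]
  exact h.isBihol.mfderiv_mpullback hx V.1

lemma IsLocalIsometry.pullEquiv_mem_isotropy (h : IsLocalIsometry g g' f) {x : M}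
    (hx : x ∈ f.source) (a : KillingAlgebra g' (f x)) :
    h.pullEquiv hx a ∈ KillingAlgebra.isotropy g x ↔ a ∈ KillingAlgebra.isotropy g' (f x) := by
  change KillingAlgebra.eval g x (h.pullEquiv hx a) = 0 ↔ KillingAlgebra.eval g' (f x) a = 0
  rw [← h.mfderiv_eval_pullEquiv hx a]
  constructor
  · intro h0
    rw [h0, map_zero]
  · intro h0
    exact h.isBihol.mfderiv_injective hx (h0.trans (map_zero _).symm)

end KillingTransport

end Transport

/-! ### Killing fields in a chart -/

section KillingUniqueness

set_option synthInstance.maxHeartbeats 200000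
set_option maxSynthPendingDepth 3

variable {E : Type*} [NormedAddCommGroup E] [NormedSpace ℂ E] [FiniteDimensional ℂ E]

/-- A Killing field on an open set of a vector space is determined by its one-jet at a point. -/
lemma killing_eq_zero_of_jet {G : E → E →L[ℂ] E →L[ℂ] ℂ} {X : E → E} {z₀ : E}
    (hG : ContDiffAt ℂ ω G z₀) (hGs : ∀ᶠ z in 𝓝 z₀, ∀ u w, G z u w = G z w u)
    (hnd : ∀ v, (∀ w, G z₀ v w = 0) → v = 0)
    (hX : ContDiffAt ℂ ω X z₀)
    (hK : ∀ᶠ z in 𝓝 z₀, ∀ u w, fderiv ℂ G z (X z) u w + G z (fderiv ℂ X z u) w +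
      G z u (fderiv ℂ X z w) = 0)
    (h0 : X z₀ = 0) (h1 : fderiv ℂ X z₀ = 0) : ∀ᶠ z in 𝓝 z₀, X z = 0 := by
  have hGe : ∀ᶠ z in 𝓝 z₀, ContDiffAt ℂ ω G z := hG.eventually (by simp)
  have hXe : ∀ᶠ z in 𝓝 z₀, ContDiffAt ℂ ω X z := hX.eventually (by simp)
  set H := fderiv ℂ G with hH
  set D := fderiv ℂ X with hD
  have hHc : ∀ z, ContDiffAt ℂ ω G z → ContDiffAt ℂ ω H z := fun z h => h.fderiv_right le_top
  have hDc : ∀ z, ContDiffAt ℂ ω X z → ContDiffAt ℂ ω D z := fun z h => h.fderiv_right le_top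
  -- bounds near `z₀`
  obtain ⟨K, hK1, hK2⟩ : ∃ K : ℝ, (∀ᶠ z in 𝓝 z₀, ‖H z‖ ≤ K) ∧ ∀ᶠ z in 𝓝 z₀, ‖fderiv ℂ H z‖ ≤ K := by
    have c1 : ContinuousAt (fun z => ‖H z‖) z₀ := (hHc _ hG).continuousAt.norm
    have c2 : ContinuousAt (fun z => ‖fderiv ℂ H z‖) z₀ :=
      ((hHc _ hG).fderiv_right (m := ω) le_top).continuousAt.norm
    refine ⟨max (‖H z₀‖ + 1) (‖fderiv ℂ H z₀‖ + 1), ?_, ?_⟩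
    · filter_upwards [c1.eventually (eventually_le_nhds (lt_add_one _))] with z hz
      exact hz.trans (le_max_left _ _)
    · filter_upwards [c2.eventually (eventually_le_nhds (lt_add_one _))] with z hz
      exact hz.trans (le_max_right _ _)
  obtain ⟨m, hm, hlow⟩ : ∃ m : ℝ, 0 < m ∧ ∀ᶠ z in 𝓝 z₀, ∀ v, m * ‖v‖ ≤ ‖G z v‖ := by
    have hinj : Function.Injective (G z₀) := by
      rw [injective_iff_map_eq_zero]
      intro v hv
      exact hnd v fun w => by rw [hv]; rfl
    obtain ⟨k, hk, hanti⟩ := (G z₀).toLinearMap.exists_antilipschitzWith (LinearMap.ker_eq_bot.2 hinj)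
    have hk' : (0 : ℝ) < k := hk
    refine ⟨(k : ℝ)⁻¹ / 2, by positivity, ?_⟩
    have c1 : ∀ᶠ z in 𝓝 z₀, ‖G z - G z₀‖ < (k : ℝ)⁻¹ / 2 := by
      have := hG.continuousAt.sub (continuousAt_const (y := G z₀)) |>.norm
      refine this.eventually (gt_mem_nhds ?_)
      simp [hk']
    filter_upwards [c1] with z hz v
    have e1 : ‖v‖ ≤ k * ‖G z₀ v‖ := by
      simpa using hanti.le_mul_dist v 0
    have e2 : ‖(G z - G z₀) v‖ ≤ (k : ℝ)⁻¹ / 2 * ‖v‖ :=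
      ((G z - G z₀).le_opNorm v).trans (mul_le_mul_of_nonneg_right hz.le (norm_nonneg _))
    have e3 : ‖G z₀ v‖ ≤ ‖G z v‖ + ‖(G z - G z₀) v‖ := by
      have : G z₀ v = G z v - (G z - G z₀) v := by simp
      rw [this]
      exact norm_sub_le _ _
    have e4 : (k : ℝ)⁻¹ * ‖v‖ ≤ ‖G z₀ v‖ := by
      rw [inv_mul_le_iff₀ hk']
      exact e1
    linarith
  have hK' := hK.eventually_nhds
  have key : ∀ᶠ z in 𝓝 z₀, ‖fderiv ℂ D z‖ ≤ (3 * (4 * K) / (2 * m)) * ‖(X z, D z)‖ := by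
    filter_upwards [hGe, hXe, hK1, hK2, hlow, hK', hGs] with z hGz hXz k1 k2 hlz hKz hsy
    have hKn : 0 ≤ K := (norm_nonneg _).trans k1
    have dG : HasFDerivAt G (H z) z := (hGz.differentiableAt (by simp)).hasFDerivAt
    have dX : HasFDerivAt X (D z) z := (hXz.differentiableAt (by simp)).hasFDerivAt
    have dH : HasFDerivAt H (fderiv ℂ H z) z := ((hHc z hGz).differentiableAt (by simp)).hasFDerivAt
    have dD : HasFDerivAt D (fderiv ℂ D z) z := ((hDc z hXz).differentiableAt (by simp)).hasFDerivAt
    set N := ‖(X z, D z)‖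
    have hXN : ‖X z‖ ≤ N := norm_fst_le (X z, D z)
    have hDN : ‖D z‖ ≤ N := norm_snd_le (X z, D z)
    have hN : 0 ≤ N := norm_nonneg _
    have hsymm : ∀ t u, fderiv ℂ D z t u = fderiv ℂ D z u t := fun t u =>
      (hXz.isSymmSndFDerivAt (by simp)).eq t u
    have eqn : ∀ t u w, (fderiv ℂ H z t (X z) u w + H z (D z t) u w) +
        (H z t (D z u) w + G z (fderiv ℂ D z t u) w) +
        (H z t u (D z w) + G z u (fderiv ℂ D z t w)) = 0 := by
      intro t u w
      have a1 := ((dH.clm_apply dX).clm_apply (hasFDerivAt_const u z)).clm_apply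
        (hasFDerivAt_const w z)
      have a2 := (dG.clm_apply (dD.clm_apply (hasFDerivAt_const u z))).clm_apply
        (hasFDerivAt_const w z)
      have a3 := (dG.clm_apply (hasFDerivAt_const u z)).clm_apply
        (dD.clm_apply (hasFDerivAt_const w z))
      have a4 := (a1.add a2).add a3
      have a5 : HasFDerivAt (fun _ : E => (0 : ℂ)) (0 : E →L[ℂ] ℂ) z := hasFDerivAt_const 0 z
      have a6 := a4.unique (a5.congr_of_eventuallyEq (by
        filter_upwards [hKz] with y hy
        exact hy u w))
      have a7 := congrArg (fun L : E →L[ℂ] ℂ => L t) a6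
      simp at a7
      linear_combination a7
    have bR : ∀ t u w, ‖G z (fderiv ℂ D z t u) w + G z u (fderiv ℂ D z t w)‖ ≤
        4 * K * N * ‖t‖ * ‖u‖ * ‖w‖ := by
      intro t u w
      have e : G z (fderiv ℂ D z t u) w + G z u (fderiv ℂ D z t w) =
          -(fderiv ℂ H z t (X z) u w + H z (D z t) u w + H z t (D z u) w + H z t u (D z w)) := by
        linear_combination eqn t u w
      have b3 : ∀ a b c, ‖H z a b c‖ ≤ K * ‖a‖ * ‖b‖ * ‖c‖ := fun a b c =>
        calc ‖H z a b c‖ ≤ ‖H z a b‖ * ‖c‖ := (H z a b).le_opNorm c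
          _ ≤ (‖H z a‖ * ‖b‖) * ‖c‖ := by gcongr; exact (H z a).le_opNorm b
          _ ≤ (‖H z‖ * ‖a‖ * ‖b‖) * ‖c‖ := by gcongr; exact (H z).le_opNorm a
          _ ≤ _ := by gcongr
      have b4 : ‖fderiv ℂ H z t (X z) u w‖ ≤ K * ‖t‖ * ‖X z‖ * ‖u‖ * ‖w‖ :=
        calc _ ≤ ‖fderiv ℂ H z t (X z) u‖ * ‖w‖ := (fderiv ℂ H z t (X z) u).le_opNorm w
          _ ≤ (‖fderiv ℂ H z t (X z)‖ * ‖u‖) * ‖w‖ := by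
            gcongr; exact (fderiv ℂ H z t (X z)).le_opNorm u
          _ ≤ (‖fderiv ℂ H z t‖ * ‖X z‖ * ‖u‖) * ‖w‖ := by
            gcongr; exact (fderiv ℂ H z t).le_opNorm (X z)
          _ ≤ (‖fderiv ℂ H z‖ * ‖t‖ * ‖X z‖ * ‖u‖) * ‖w‖ := by
            gcongr; exact (fderiv ℂ H z).le_opNorm t
          _ ≤ _ := by gcongr
      have bD : ∀ a, ‖D z a‖ ≤ N * ‖a‖ := fun a => ((D z).le_opNorm a).trans (by gcongr)
      have c1 : ‖fderiv ℂ H z t (X z) u w‖ ≤ K * N * ‖t‖ * ‖u‖ * ‖w‖ :=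
        b4.trans (le_of_le_of_eq (by gcongr) (by ring : K * ‖t‖ * N * ‖u‖ * ‖w‖ = _))
      have c2 : ‖H z (D z t) u w‖ ≤ K * N * ‖t‖ * ‖u‖ * ‖w‖ :=
        (b3 _ _ _).trans (le_of_le_of_eq (by gcongr; exact bD t)
          (by ring : K * (N * ‖t‖) * ‖u‖ * ‖w‖ = _))
      have c3 : ‖H z t (D z u) w‖ ≤ K * N * ‖t‖ * ‖u‖ * ‖w‖ :=
        (b3 _ _ _).trans (le_of_le_of_eq (by gcongr; exact bD u)
          (by ring : K * ‖t‖ * (N * ‖u‖) * ‖w‖ = _))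
      have c4 : ‖H z t u (D z w)‖ ≤ K * N * ‖t‖ * ‖u‖ * ‖w‖ :=
        (b3 _ _ _).trans (le_of_le_of_eq (by gcongr; exact bD w)
          (by ring : K * ‖t‖ * ‖u‖ * (N * ‖w‖) = _))
      rw [e, norm_neg]
      refine (norm_add₄_le).trans ?_
      linarith
    refine ContinuousLinearMap.opNorm_le_bound _ (by positivity) fun t =>
      ContinuousLinearMap.opNorm_le_bound _ (by positivity) fun u => ?_
    have c6 : ‖G z (fderiv ℂ D z t u)‖ ≤ 6 * K * N * ‖t‖ * ‖u‖ := by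
      refine ContinuousLinearMap.opNorm_le_bound _ (by positivity) fun w => ?_
      have e : G z (fderiv ℂ D z t u) w =
          ((G z (fderiv ℂ D z t u) w + G z u (fderiv ℂ D z t w)) +
          (G z (fderiv ℂ D z u w) t + G z w (fderiv ℂ D z u t)) -
          (G z (fderiv ℂ D z w t) u + G z t (fderiv ℂ D z w u))) / 2 := by
        rw [hsymm u t, hsymm w t, hsymm w u, hsy u, hsy w, hsy t]
        ring
      have n1 := bR t u w
      have n2 := bR u w t
      have n3 := bR w t u
      rw [e, norm_div, Complex.norm_ofNat]
      have n4 := (norm_sub_le ((G z (fderiv ℂ D z t u) w + G z u (fderiv ℂ D z t w)) +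
          (G z (fderiv ℂ D z u w) t + G z w (fderiv ℂ D z u t)))
          (G z (fderiv ℂ D z w t) u + G z t (fderiv ℂ D z w u)))
      have n5 := norm_add_le (G z (fderiv ℂ D z t u) w + G z u (fderiv ℂ D z t w))
          (G z (fderiv ℂ D z u w) t + G z w (fderiv ℂ D z u t))
      rw [div_le_iff₀ two_pos]
      have r2 : 4 * K * N * ‖u‖ * ‖w‖ * ‖t‖ = 4 * K * N * ‖t‖ * ‖u‖ * ‖w‖ := by ring
      have r3 : 4 * K * N * ‖w‖ * ‖t‖ * ‖u‖ = 4 * K * N * ‖t‖ * ‖u‖ * ‖w‖ := by ring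
      linarith
    have c7 := (hlz (fderiv ℂ D z t u)).trans c6
    rw [← le_div_iff₀' hm] at c7
    refine c7.trans (le_of_eq ?_)
    field_simp
    ring
  have hfin := eventually_eq_zero_of_norm_fderiv_le (φ := fun z => (X z, D z)) (z₀ := z₀)
    (C := max 1 (3 * (4 * K) / (2 * m))) (by simp [h0, h1])
    (by filter_upwards [hXe] with z hz
        exact (hz.differentiableAt (by simp)).prodMk ((hDc z hz).differentiableAt (by simp)))
    (by filter_upwards [hXe, key] with z hz hk
        have dX : HasFDerivAt X (D z) z := (hz.differentiableAt (by simp)).hasFDerivAt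
        have dD : HasFDerivAt D (fderiv ℂ D z) z :=
          ((hDc z hz).differentiableAt (by simp)).hasFDerivAt
        rw [(dX.prodMk dD).fderiv, ContinuousLinearMap.opNorm_prod]
        refine (max_le ?_ ?_ : max ‖D z‖ ‖fderiv ℂ D z‖ ≤ _)
        · calc ‖D z‖ ≤ 1 * ‖(X z, D z)‖ := by rw [one_mul]; exact norm_snd_le (X z, D z)
            _ ≤ _ := by gcongr; exact le_max_left _ _
        · exact hk.trans (by gcongr; exact le_max_right _ _))
  filter_upwards [hfin] with z hz using congrArg Prod.fst hz

end KillingUniqueness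

/-! ### Reading fields and metrics in a chart -/

section Reading

variable {E : Type*} [NormedAddCommGroup E] [NormedSpace ℂ E] [FiniteDimensional ℂ E]
variable {M : Type*} [TopologicalSpace M] [ChartedSpace E M] [IsManifold 𝓘(ℂ, E) ω M]

lemma contDiffAt_clm_of_apply {D F : Type*} [NormedAddCommGroup D] [NormedSpace ℂ D]
    [NormedAddCommGroup F] [NormedSpace ℂ F] {f : D → E →L[ℂ] F} {z : D}
    (h : ∀ y, ContDiffAt ℂ ω (fun x => f x y) z) : ContDiffAt ℂ ω f z := by
  let e₁ : E ≃L[ℂ] (Fin (Module.finrank ℂ E) → ℂ) :=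
    ContinuousLinearEquiv.ofFinrankEq (Module.finrank_fin_fun ℂ).symm
  let e₂ := (e₁.arrowCongr (1 : F ≃L[ℂ] F)).trans (ContinuousLinearEquiv.piRing _)
  rw [← Function.id_comp f, ← e₂.symm_comp_self]
  exact e₂.symm.contDiff.contDiffAt.comp z (contDiffAt_pi.2 fun i => h _)

lemma isBihol_chartAt_symm (x : M) :
    IsBihol (E := E) (E' := E) ((chartAt E x).symm : OpenPartialHomeomorph E M) :=
  ⟨contMDiffOn_chart_symm, by simpa using contMDiffOn_chart⟩

lemma mlieBracket_eq_lieBracket (A B : ∀ x : E, TangentSpace 𝓘(ℂ, E) x) (z : E) :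
    mlieBracket 𝓘(ℂ, E) A B z = lieBracket ℂ A B z := by
  have h := congrFun (mlieBracketWithin_eq_lieBracketWithin (V := A) (W := B)
    (s := Set.univ)) z
  rw [mlieBracketWithin_univ] at h
  exact h.trans (congrFun lieBracketWithin_univ z)

lemma dirDeriv_eq_fderiv (f : E → ℂ) (z v : E) :
    dirDeriv (E := E) (M := E) f z v = fderiv ℂ f z v := by
  unfold dirDeriv
  rw [mfderiv_eq_fderiv]
  rfl

lemma holAt_const (u z : E) : HolAt (M := E) (fun _ => u) z :=
  contMDiffAt_vectorSpace_iff_contDiffAt.2 contDiffAt_const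

end Reading

section ReadingGeneral

variable {E E' : Type*} [NormedAddCommGroup E] [NormedSpace ℂ E] [FiniteDimensional ℂ E]
  [NormedAddCommGroup E'] [NormedSpace ℂ E'] [FiniteDimensional ℂ E']
variable {M : Type*} [TopologicalSpace M] [ChartedSpace E' M] [IsManifold 𝓘(ℂ, E') ω M]

/-- A vector field on `M` read in the coordinates given by `ψ`. -/
def readField (ψ : OpenPartialHomeomorph E M) (V : ∀ y : M, TangentSpace 𝓘(ℂ, E') y) : E → E :=
  fun z => mpullback 𝓘(ℂ, E) 𝓘(ℂ, E') ψ V z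

/-- The vector field which is constant, equal to `u`, in the coordinates given by `ψ`. -/
def constField (ψ : OpenPartialHomeomorph E M) (u : E) : ∀ y : M, TangentSpace 𝓘(ℂ, E') y :=
  mpullback 𝓘(ℂ, E') 𝓘(ℂ, E) ψ.symm (fun _ => u)

/-- The metric read in the coordinates given by `ψ`. -/
def readMetric (g : Metric E' M) (ψ : OpenPartialHomeomorph E M) (z : E) : E →L[ℂ] E →L[ℂ] ℂ :=
  LinearMap.toContinuousLinearMap
    ((LinearMap.toContinuousLinearMap (𝕜 := ℂ) (E := E) (F' := ℂ)).toLinearMap.comp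
      ((g.val (ψ z)).compl₁₂ (mfderiv 𝓘(ℂ, E) 𝓘(ℂ, E') ψ z).toLinearMap
        (mfderiv 𝓘(ℂ, E) 𝓘(ℂ, E') ψ z).toLinearMap))

lemma readMetric_apply (g : Metric E' M) (ψ : OpenPartialHomeomorph E M) (z u w : E) :
    readMetric g ψ z u w = g.val (ψ z) (mfderiv 𝓘(ℂ, E) 𝓘(ℂ, E') ψ z u)
      (mfderiv 𝓘(ℂ, E) 𝓘(ℂ, E') ψ z w) := rfl

variable {ψ : OpenPartialHomeomorph E M} {z : E}

lemma IsBihol.contDiffAt_readField (h : IsBihol (E := E) (E' := E') ψ) (hz : z ∈ ψ.source)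
    {V : ∀ y : M, TangentSpace 𝓘(ℂ, E') y} (hV : HolAt V (ψ z)) :
    ContDiffAt ℂ ω (readField ψ V) z :=
  contMDiffAt_vectorSpace_iff_contDiffAt.1
    (HolAt.mpullback hV (h.contMDiffAt hz) (h.isInvertible hz))

lemma IsBihol.readField_mlieBracket (h : IsBihol (E := E) (E' := E') ψ) (hz : z ∈ ψ.source)
    {V W : ∀ y : M, TangentSpace 𝓘(ℂ, E') y} (hV : HolAt V (ψ z)) (hW : HolAt W (ψ z)) :
    readField ψ (mlieBracket 𝓘(ℂ, E') V W) z =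
      fderiv ℂ (readField ψ W) z (readField ψ V z) -
      fderiv ℂ (readField ψ V) z (readField ψ W z) :=
  (HolAt.mpullback_mlieBracket hV hW (h.contMDiffAt hz)).trans (mlieBracket_eq_lieBracket _ _ _)

lemma IsBihol.holAt_constField (h : IsBihol (E := E) (E' := E') ψ) (hz : z ∈ ψ.source) (u : E) :
    HolAt (E := E') (constField ψ u) (ψ z) :=
  HolAt.mpullback (holAt_const _ _) (h.symm.contMDiffAt (x := ψ z) (ψ.map_source hz))
    (h.symm.isInvertible (x := ψ z) (ψ.map_source hz))

lemma IsBihol.readField_constField (h : IsBihol (E := E) (E' := E') ψ) (hz : z ∈ ψ.source) (u : E) :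
    readField ψ (constField (E' := E') ψ u) z = u :=
  h.mpullback_mpullback_symm hz (fun _ => u)

lemma IsBihol.mfderiv_readField (h : IsBihol (E := E) (E' := E') ψ) (hz : z ∈ ψ.source)
    (V : ∀ y : M, TangentSpace 𝓘(ℂ, E') y) :
    mfderiv 𝓘(ℂ, E) 𝓘(ℂ, E') ψ z (readField (E := E) ψ V z) = V (ψ z) := h.mfderiv_mpullback hz V

lemma IsBihol.constField_apply (h : IsBihol (E := E) (E' := E') ψ) (hz : z ∈ ψ.source) (u : E) :
    constField ψ u (ψ z) = mfderiv 𝓘(ℂ, E) 𝓘(ℂ, E') ψ z u := by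
  rw [← h.mfderiv_readField hz (constField ψ u), h.readField_constField hz]

lemma IsBihol.readMetric_readField (h : IsBihol (E := E) (E' := E') ψ) (hz : z ∈ ψ.source)
    (g : Metric E' M) (V W : ∀ y : M, TangentSpace 𝓘(ℂ, E') y) :
    readMetric g ψ z (readField ψ V z) (readField ψ W z) = g.val (ψ z) (V (ψ z)) (W (ψ z)) := by
  rw [readMetric_apply, h.mfderiv_readField hz, h.mfderiv_readField hz]

lemma IsBihol.contDiffAt_readMetric (h : IsBihol (E := E) (E' := E') ψ) (hz : z ∈ ψ.source)
    (g : Metric E' M) : ContDiffAt ℂ ω (readMetric g ψ) z := by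
  refine contDiffAt_clm_of_apply fun u => contDiffAt_clm_of_apply fun w => ?_
  have h1 := (g.holo _ _ (ψ z) (h.holAt_constField hz u) (h.holAt_constField hz w)).comp z
    (h.contMDiffAt hz)
  refine (contMDiffAt_iff_contDiffAt.1 h1).congr_of_eventuallyEq ?_
  filter_upwards [ψ.open_source.mem_nhds hz] with y hy
  simp only [Function.comp_apply]
  rw [h.constField_apply hy, h.constField_apply hy, readMetric_apply]

lemma readMetric_symm (g : Metric E' M) (u w : E) :
    readMetric g ψ z u w = readMetric g ψ z w u := g.symm _ _ _

lemma IsBihol.readMetric_nondeg (h : IsBihol (E := E) (E' := E') ψ) (hz : z ∈ ψ.source)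
    (g : Metric E' M) (u : E) (hu : ∀ w, readMetric g ψ z u w = 0) : u = 0 := by
  refine h.mfderiv_injective hz (Eq.trans (g.nondeg _ _ fun w => ?_) (map_zero _).symm)
  obtain ⟨w, rfl⟩ := (h.isInvertible hz).surjective w
  exact hu w

lemma IsBihol.readMetric_killing (h : IsBihol (E := E) (E' := E') ψ) (hz : z ∈ ψ.source)
    {g : Metric E' M} {V : ∀ y : M, TangentSpace 𝓘(ℂ, E') y} (hV : HolAt V (ψ z))
    (hK : KillingAt g V (ψ z)) (u w : E) :
    fderiv ℂ (readMetric g ψ) z (readField ψ V z) u w +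
      readMetric g ψ z (fderiv ℂ (readField ψ V) z u) w +
      readMetric g ψ z u (fderiv ℂ (readField ψ V) z w) = 0 := by
  have hU := h.holAt_constField hz u
  have hW := h.holAt_constField hz w
  have h1 := hK _ _ hU hW
  have h2 : ∀ t : E, readField ψ (mlieBracket 𝓘(ℂ, E') V (constField ψ t)) z =
      -fderiv ℂ (readField ψ V) z t := by
    intro t
    have e : readField ψ (constField (E' := E') ψ t) =ᶠ[𝓝 z] fun _ => t := by
      filter_upwards [ψ.open_source.mem_nhds hz] with y hy using h.readField_constField hy t
    rw [h.readField_mlieBracket hz hV (h.holAt_constField hz t), e.fderiv_eq, e.eq_of_nhds]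
    simp
  rw [← h.readMetric_readField hz, ← h.readMetric_readField hz, h2, h2,
    h.readField_constField hz, h.readField_constField hz] at h1
  have h3 : (fun y => g.val y (constField ψ u y) (constField ψ w y)) ∘ ψ =ᶠ[𝓝 z]
      fun z => readMetric g ψ z u w := by
    filter_upwards [ψ.open_source.mem_nhds hz] with y hy
    simp only [Function.comp_apply]
    rw [h.constField_apply hy, h.constField_apply hy, readMetric_apply]
  have h4 := dirDeriv_comp (g.holo_mdiff hU hW) (h.mdiff hz) (readField (E := E) ψ V z)
  rw [h.mfderiv_readField hz, h1] at h4
  have h5 : fderiv ℂ (readMetric g ψ) z (readField ψ V z) u w =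
      dirDeriv ((fun y => g.val y (constField ψ u y) (constField ψ w y)) ∘ ψ) z
        (readField (E := E) ψ V z) := by
    refine Eq.trans ?_ (dirDeriv_congr h3 _).symm
    refine Eq.trans ?_ (dirDeriv_eq_fderiv _ z (readField ψ V z)).symm
    have hd := ((h.contDiffAt_readMetric hz g).differentiableAt (by simp)).hasFDerivAt
    have := ((hd.clm_apply (hasFDerivAt_const u z)).clm_apply (hasFDerivAt_const w z)).fderiv
    have h6 := congrArg (fun L : E →L[ℂ] ℂ => L (readField ψ V z)) this
    simp at h6
    exact h6.symm
  rw [h5, h4]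
  simp only [map_neg, neg_apply]
  ring

end ReadingGeneral

/-! ### Lie algebras of Killing fields on a vector space -/

section KillingAction

variable {E : Type*} [NormedAddCommGroup E] [NormedSpace ℂ E] [FiniteDimensional ℂ E]

/-- A faithful action of the Lie algebra `L`, near the point `z₀` of a vector space, by Killing
fields of the metric `G`. -/
structure KillingAction {L : Type*} [LieRing L] [LieAlgebra ℂ L] (X : L →ₗ[ℂ] E → E)
    (G : E → E →L[ℂ] E →L[ℂ] ℂ) (z₀ : E) : Prop where
  smooth : ∀ a, ContDiffAt ℂ ω (X a) z₀
  bracket : ∀ a b, ∀ᶠ z in 𝓝 z₀,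
    X ⁅a, b⁆ z = fderiv ℂ (X b) z (X a z) - fderiv ℂ (X a) z (X b z)
  smooth_metric : ContDiffAt ℂ ω G z₀
  symm : ∀ z u w, G z u w = G z w u
  nondeg : ∀ u, (∀ w, G z₀ u w = 0) → u = 0
  killing : ∀ a, ∀ᶠ z in 𝓝 z₀, ∀ u w, fderiv ℂ G z (X a z) u w + G z (fderiv ℂ (X a) z u) w +
      G z u (fderiv ℂ (X a) z w) = 0
  faithful : ∀ a, (∀ᶠ z in 𝓝 z₀, X a z = 0) → a = 0

section Chart

variable {M : Type*} [TopologicalSpace M] [ChartedSpace E M] [IsManifold 𝓘(ℂ, E) ω M]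
  [CompleteSpace E]

/-- A linear choice of local Killing fields with given germs. -/
def KillingAlgebra.rep (g : Metric E M) (x : M) : KillingAlgebra g x →ₗ[ℂ] localKilling g x :=
  ((KillingAlgebra.germ g x).exists_rightInverse_of_surjective
    (LinearMap.range_eq_top.2 (KillingAlgebra.germ_surjective g x))).choose

lemma KillingAlgebra.germ_rep {g : Metric E M} {x : M} (a : KillingAlgebra g x) :
    KillingAlgebra.germ g x (KillingAlgebra.rep g x a) = a :=
  congrArg (fun T => T a) ((KillingAlgebra.germ g x).exists_rightInverse_of_surjective
    (LinearMap.range_eq_top.2 (KillingAlgebra.germ_surjective g x))).choose_spec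

/-- The Killing fields read in the chart at `x`. -/
def KillingAlgebra.read (g : Metric E M) (x : M) : KillingAlgebra g x →ₗ[ℂ] E → E where
  toFun a := readField (chartAt E x).symm (KillingAlgebra.rep g x a).1
  map_add' a b := by
    rw [map_add]
    exact mpullback_add
  map_smul' c a := by
    rw [map_smul]
    exact mpullback_const_smul

lemma chartAt_symm_self (x : M) : (chartAt E x).symm (chartAt E x x) = x :=
  (chartAt E x).left_inv (mem_chart_source E x)

lemma chartAt_mem_symm_source (x : M) : chartAt E x x ∈ (chartAt E x).symm.source :=
  mem_chart_target E x

lemma tendsto_chartAt_symm (x : M) : Tendsto (chartAt E x).symm (𝓝 (chartAt E x x)) (𝓝 x) := by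
  have := (chartAt E x).symm.continuousAt (chartAt_mem_symm_source (E := E) x)
  rwa [ContinuousAt, chartAt_symm_self] at this

lemma KillingAlgebra.read_eq_zero_iff {g : Metric E M} {x : M} (a : KillingAlgebra g x) :
    KillingAlgebra.read g x a (chartAt E x x) = 0 ↔ KillingAlgebra.eval g x a = 0 := by
  have h1 := (isBihol_chartAt_symm (E := E) x).mfderiv_readField (chartAt_mem_symm_source x)
    (KillingAlgebra.rep g x a).1
  have h2 : (KillingAlgebra.eval g x a : E) =
      (KillingAlgebra.rep g x a).1 ((chartAt E x).symm (chartAt E x x)) := by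
    conv_lhs => rw [← KillingAlgebra.germ_rep a, KillingAlgebra.eval_germ]
    exact congrArg (fun p : M => ((KillingAlgebra.rep g x a).1 p : E)) (chartAt_symm_self x).symm
  have h3 := (isBihol_chartAt_symm (E := E) x).mfderiv_injective (chartAt_mem_symm_source (E := E) x)
  constructor
  · intro h
    refine h2.trans (h1.symm.trans ?_)
    have h' : readField (E := E) (chartAt E x).symm (KillingAlgebra.rep g x a).1
      (chartAt E x x) = 0 := h
    rw [h']
    exact map_zero _
  · intro h
    exact h3 ((h1.trans (h2.symm.trans h)).trans (map_zero _).symm)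

/-- The Killing algebra at `x` acts by Killing fields in the chart at `x`. -/
lemma killingAction_read (g : Metric E M) (x : M) :
    KillingAction (KillingAlgebra.read g x) (readMetric g (chartAt E x).symm) (chartAt E x x) where
  smooth a := by
    refine (isBihol_chartAt_symm (E := E) x).contDiffAt_readField (chartAt_mem_symm_source x) ?_
    rw [chartAt_symm_self]
    have h : ∀ᶠ y in 𝓝 x, _ := (KillingAlgebra.rep g x a).2
    exact h.self_of_nhds.1
  bracket a b := by
    have h1 : KillingAlgebra.germ g x (KillingAlgebra.rep g x ⁅a, b⁆) =
        KillingAlgebra.germ g x (KillingAlgebra.fieldBracket (KillingAlgebra.rep g x a)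
          (KillingAlgebra.rep g x b)) := by
      rw [← KillingAlgebra.germ_lie, KillingAlgebra.germ_rep, KillingAlgebra.germ_rep,
        KillingAlgebra.germ_rep]
    have ha : ∀ᶠ y in 𝓝 x, _ := (KillingAlgebra.rep g x a).2
    have hb : ∀ᶠ y in 𝓝 x, _ := (KillingAlgebra.rep g x b).2
    have ht := tendsto_chartAt_symm (E := E) x
    filter_upwards [ht.eventually (KillingAlgebra.germ_eq_iff.1 h1), ht.eventually ha,
      ht.eventually hb, (chartAt E x).symm.open_source.mem_nhds (chartAt_mem_symm_source x)]
      with z hz hza hzb hs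
    refine Eq.trans ?_ ((isBihol_chartAt_symm (E := E) x).readField_mlieBracket hs hza.1 hzb.1)
    change readField _ _ z = readField _ _ z
    simp only [readField, mpullback_apply]
    rw [hz]
    rfl
  smooth_metric := (isBihol_chartAt_symm (E := E) x).contDiffAt_readMetric
    (chartAt_mem_symm_source x) g
  symm _ := readMetric_symm g
  nondeg := (isBihol_chartAt_symm (E := E) x).readMetric_nondeg (chartAt_mem_symm_source x) g
  killing a := by
    have ha : ∀ᶠ y in 𝓝 x, _ := (KillingAlgebra.rep g x a).2
    filter_upwards [(tendsto_chartAt_symm (E := E) x).eventually ha,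
      (chartAt E x).symm.open_source.mem_nhds (chartAt_mem_symm_source x)] with z hza hs u w
    exact (isBihol_chartAt_symm (E := E) x).readMetric_killing hs hza.1 hza.2 u w
  faithful a ha := by
    rw [← KillingAlgebra.germ_rep a, ← map_zero (KillingAlgebra.germ g x),
      KillingAlgebra.germ_eq_iff]
    have h1 := ((chartAt E x).continuousAt (mem_chart_source E x)).eventually ha
    filter_upwards [h1, (chartAt E x).open_source.mem_nhds (mem_chart_source E x)] with y hy hs
    have hb := isBihol_chartAt_symm (E := E) x
    have hs' : chartAt E x y ∈ (chartAt E x).symm.source := (chartAt E x).map_source hs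
    have h2 := hb.mfderiv_readField hs' (KillingAlgebra.rep g x a).1
    have hy' : readField (E := E) (chartAt E x).symm (KillingAlgebra.rep g x a).1
      (chartAt E x y) = 0 := hy
    rw [hy', (chartAt E x).left_inv hs] at h2
    exact h2.symm.trans (map_zero _)

end Chart

namespace KillingAction

variable {L : Type*} [LieRing L] [LieAlgebra ℂ L] {X : L →ₗ[ℂ] E → E}
  {G : E → E →L[ℂ] E →L[ℂ] ℂ} {z₀ : E}

lemma comp {L' : Type*} [LieRing L'] [LieAlgebra ℂ L'] (h : KillingAction X G z₀)
    (Φ : L' ≃ₗ⁅ℂ⁆ L) : KillingAction (X ∘ₗ (Φ : L' →ₗ[ℂ] L)) G z₀ where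
  smooth a := h.smooth _
  bracket a b := by
    have := h.bracket (Φ a) (Φ b)
    rw [← LieEquiv.map_lie] at this
    exact this
  smooth_metric := h.smooth_metric
  symm := h.symm
  nondeg := h.nondeg
  killing a := h.killing _
  faithful a ha := by
    have := h.faithful (Φ a) ha
    exact Φ.injective (this.trans (map_zero Φ).symm)

lemma skew (h : KillingAction X G z₀) {a : L} (ha : X a z₀ = 0) (u w : E) :
    G z₀ (fderiv ℂ (X a) z₀ u) w + G z₀ u (fderiv ℂ (X a) z₀ w) = 0 := by
  have := (h.killing a).self_of_nhds u w
  rw [ha] at this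
  simpa using this

lemma fderiv_apply (h : KillingAction X G z₀) {a : L} (ha : X a z₀ = 0) (b : L) :
    fderiv ℂ (X a) z₀ (X b z₀) = -X ⁅a, b⁆ z₀ := by
  rw [(h.bracket a b).self_of_nhds, ha]
  simp

lemma eq_zero_of_jet (h : KillingAction X G z₀) {a : L} (ha : X a z₀ = 0)
    (hD : fderiv ℂ (X a) z₀ = 0) : a = 0 :=
  h.faithful a (killing_eq_zero_of_jet h.smooth_metric (Eventually.of_forall h.symm) h.nondeg
    (h.smooth a) (h.killing a) ha hD)

end KillingAction

end KillingAction

/-! ### Skew maps in dimension three -/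

section Skew

/-- The vector product on `ℂ³`. -/
def cross (u w : Fin 3 → ℂ) : Fin 3 → ℂ :=
  ![u 1 * w 2 - u 2 * w 1, u 2 * w 0 - u 0 * w 2, u 0 * w 1 - u 1 * w 0]

lemma cross_smul_right (c : ℂ) (u w : Fin 3 → ℂ) : cross u (c • w) = c • cross u w := by
  ext i
  fin_cases i <;> simp [cross] <;> ring

/-- Vectors with vanishing vector product with a nonzero vector are proportional to it. -/
lemma exists_smul_of_cross_eq_zero {u p : Fin 3 → ℂ} (hp : p ≠ 0) (h : cross u p = 0) :
    ∃ t : ℂ, u = t • p := by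
  have h0 := congrFun h 0
  have h1 := congrFun h 1
  have h2 := congrFun h 2
  simp [cross] at h0 h1 h2
  obtain ⟨i, hi⟩ := Function.ne_iff.1 hp
  refine ⟨u i / p i, ?_⟩
  have hi' : p i ≠ 0 := hi
  ext j
  simp only [Pi.smul_apply, smul_eq_mul]
  rw [div_mul_eq_mul_div, eq_div_iff hi']
  fin_cases i <;> fin_cases j <;> simp <;>
  first
  | ring1
  | linear_combination h0
  | linear_combination h1
  | linear_combination h2
  | linear_combination -h0
  | linear_combination -h1
  | linear_combination -h2

/-- A line of `ℂ³` is not stable under all infinitesimal rotations. -/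
lemma eq_zero_of_forall_cross {p : Fin 3 → ℂ} (h : ∀ v, ∃ t : ℂ, cross v p = t • p) : p = 0 := by
  have key : ∀ (v : Fin 3 → ℂ) (i : Fin 3), p i * (v 0 * p 0 + v 1 * p 1 + v 2 * p 2) =
      v i * (p 0 * p 0 + p 1 * p 1 + p 2 * p 2) := by
    intro v i
    obtain ⟨t, ht⟩ := h v
    have h0 := congrFun ht 0
    have h1 := congrFun ht 1
    have h2 := congrFun ht 2
    simp [cross] at h0 h1 h2
    fin_cases i <;> simp
    · linear_combination p 2 * h1 - p 1 * h2
    · linear_combination p 0 * h2 - p 2 * h0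
    · linear_combination p 1 * h0 - p 0 * h1
  have e00 := key ![1, 0, 0] 0
  have e11 := key ![0, 1, 0] 1
  have e22 := key ![0, 0, 1] 2
  simp at e00 e11 e22
  have k0 : p 0 * p 0 + p 1 * p 1 + p 2 * p 2 = 0 := by
    linear_combination (e22 - e00 - e11) / 2
  have hp0 : p 0 = 0 := mul_self_eq_zero.1 (e00.trans k0)
  have hp1 : p 1 = 0 := mul_self_eq_zero.1 (e11.trans k0)
  have hp2 : p 2 = 0 := mul_self_eq_zero.1 (by linear_combination k0 - p 0 * hp0 - p 1 * hp1)
  ext i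
  fin_cases i
  · exact hp0
  · exact hp1
  · exact hp2

variable {E : Type*} [AddCommGroup E] [Module ℂ E] [FiniteDimensional ℂ E]

lemma exists_orthonormal_coordinates (hE : Module.finrank ℂ E = 3) (B : E →ₗ[ℂ] E →ₗ[ℂ] ℂ)
    (hs : ∀ u w, B u w = B w u) (hn : ∀ u, (∀ w, B u w = 0) → u = 0) :
    ∃ e : E ≃ₗ[ℂ] (Fin 3 → ℂ), ∀ u w, B u w = e u 0 * e w 0 + e u 1 * e w 1 + e u 2 * e w 2 := by
  let Q : QuadraticForm ℂ E := LinearMap.BilinMap.toQuadraticMap B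
  have hQ : ∀ u, Q u = B u u := fun u => rfl
  have hass : ∀ u w, QuadraticMap.associated (R := ℂ) Q u w = B u w := by
    intro u w
    have h2 := QuadraticMap.two_nsmul_associated ℂ Q
    have h3 := congrArg (fun T => T u w) h2
    have h4 : QuadraticMap.polarBilin Q u w = Q (u + w) - Q u - Q w := rfl
    simp only [LinearMap.smul_apply, h4, hQ, map_add, LinearMap.add_apply, hs w u] at h3
    rw [two_smul] at h3
    linear_combination h3 / 2
  have h := QuadraticForm.equivalent_weightedSumSquares_of_isAlgClosed Q (by
    intro u hu
    refine hn u fun w => ?_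
    rw [← hass]
    exact hu w)
  rw [hE] at h
  obtain ⟨i⟩ := h
  have hi : ∀ u, B u u = i u 0 * i u 0 + i u 1 * i u 1 + i u 2 * i u 2 := by
    intro u
    have h1 := i.map_app u
    rw [QuadraticMap.weightedSumSquares_apply, Fin.sum_univ_three, hQ] at h1
    rw [← h1]
    simp
  refine ⟨i.toLinearEquiv, fun u w => ?_⟩
  have h1 := hi (u + w)
  have h2 : i (u + w) = i u + i w := map_add i.toLinearEquiv u w
  rw [h2] at h1
  simp only [map_add, LinearMap.add_apply, hs w u, Pi.add_apply, hi u, hi w] at h1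
  change B u w = i u 0 * i w 0 + i u 1 * i w 1 + i u 2 * i w 2
  linear_combination h1 / 2

/-- The vector of an infinitesimal rotation. -/
def axisOf (e : E ≃ₗ[ℂ] (Fin 3 → ℂ)) : (E →ₗ[ℂ] E) →ₗ[ℂ] (Fin 3 → ℂ) where
  toFun D := ![e (D (e.symm (Pi.single 1 1))) 2, e (D (e.symm (Pi.single 2 1))) 0,
    e (D (e.symm (Pi.single 0 1))) 1]
  map_add' D D' := by
    ext i
    fin_cases i <;> simp
  map_smul' c D := by
    ext i
    fin_cases i <;> simp

lemma axisOf_spec {B : E →ₗ[ℂ] E →ₗ[ℂ] ℂ} {e : E ≃ₗ[ℂ] (Fin 3 → ℂ)}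
    (he : ∀ u w, B u w = e u 0 * e w 0 + e u 1 * e w 1 + e u 2 * e w 2) {D : E →ₗ[ℂ] E}
    (hD : ∀ u w, B (D u) w + B u (D w) = 0) (u : E) : e (D u) = cross (axisOf e D) (e u) := by
  set b : Fin 3 → E := fun i => e.symm (Pi.single i 1) with hb
  have hu : u = e u 0 • b 0 + e u 1 • b 1 + e u 2 • b 2 := by
    apply e.injective
    simp only [map_add, map_smul, hb, LinearEquiv.apply_symm_apply]
    ext i
    fin_cases i <;> simp
  have hDb : ∀ i j, e (D (b i)) j + e (D (b j)) i = 0 := by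
    intro i j
    have := hD (b i) (b j)
    rw [he, he] at this
    simp only [hb, LinearEquiv.apply_symm_apply] at this ⊢
    fin_cases i <;> fin_cases j <;> simpa using this
  have h2 : e (D u) = e u 0 • e (D (b 0)) + e u 1 • e (D (b 1)) + e u 2 • e (D (b 2)) := by
    conv_lhs => rw [hu]
    simp only [map_add, map_smul]
  have a0 : axisOf e D 0 = e (D (b 1)) 2 := rfl
  have a1 : axisOf e D 1 = e (D (b 2)) 0 := rfl
  have a2 : axisOf e D 2 = e (D (b 0)) 1 := rfl
  have h00 := hDb 0 0
  have h11 := hDb 1 1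
  have h22 := hDb 2 2
  have h01 := hDb 0 1
  have h02 := hDb 0 2
  have h12 := hDb 1 2
  ext i
  rw [h2]
  fin_cases i <;> simp [cross, a0, a1, a2]
  · linear_combination e u 0 / 2 * h00 + e u 1 * h01
  · linear_combination e u 1 / 2 * h11 + e u 2 * h12
  · linear_combination e u 2 / 2 * h22 + e u 0 * h02

end Skew

/-! ### The isotropy of a four-dimensional Killing algebra -/

section Isotropy

variable {E : Type*} [NormedAddCommGroup E] [NormedSpace ℂ E] [FiniteDimensional ℂ E]
variable {L : Type*} [LieRing L] [LieAlgebra ℂ L] {X : L →ₗ[ℂ] E → E}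
  {G : E → E →L[ℂ] E →L[ℂ] ℂ} {z₀ : E}

/-- The values at `z` of the fields of an action. -/
def evalAt (X : L →ₗ[ℂ] E → E) (z : E) : L →ₗ[ℂ] E := (LinearMap.proj z).comp X

lemma KillingAction.fderiv_add (h : KillingAction X G z₀) (a b : L) :
    fderiv ℂ (X (a + b)) z₀ = fderiv ℂ (X a) z₀ + fderiv ℂ (X b) z₀ := by
  rw [map_add]
  exact _root_.fderiv_add ((h.smooth a).differentiableAt (by simp))
    ((h.smooth b).differentiableAt (by simp))

lemma KillingAction.fderiv_smul (h : KillingAction X G z₀) (c : ℂ) (a : L) :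
    fderiv ℂ (X (c • a)) z₀ = c • fderiv ℂ (X a) z₀ := by
  rw [map_smul]
  exact fderiv_const_smul ((h.smooth a).differentiableAt (by simp)) c

/-- If a four-dimensional Lie algebra of Killing fields in dimension three has a nonzero central
element, then this element does not vanish at `z₀`, and the isotropy is a line. -/
lemma KillingAction.isotropy_line (h : KillingAction X G z₀) (hE : Module.finrank ℂ E = 3)
    (hL : Module.finrank ℂ L = 4) {c : L} (hc : c ≠ 0) (hcc : ∀ a : L, ⁅a, c⁆ = 0) :
    X c z₀ ≠ 0 ∧ Function.Surjective (evalAt X z₀) ∧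
      ∃ k ≠ 0, ∀ a, X a z₀ = 0 ↔ ∃ t : ℂ, a = t • k := by
  have : FiniteDimensional ℂ L := Module.finite_of_finrank_pos (by omega)
  let B : E →ₗ[ℂ] E →ₗ[ℂ] ℂ := LinearMap.mk₂ ℂ (fun u w => G z₀ u w) (by simp) (by simp)
    (by simp) (by simp)
  obtain ⟨e, he⟩ := exists_orthonormal_coordinates hE B (h.symm z₀) h.nondeg
  let I := LinearMap.ker (evalAt X z₀)
  have hI : ∀ {a : L}, X a z₀ = 0 ↔ a ∈ I := Iff.rfl
  let ρ : L →ₗ[ℂ] (E →ₗ[ℂ] E) :=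
    { toFun := fun a => (fderiv ℂ (X a) z₀).toLinearMap
      map_add' := fun a b => by rw [h.fderiv_add]; rfl
      map_smul' := fun t a => by rw [h.fderiv_smul]; rfl }
  let α : L →ₗ[ℂ] (Fin 3 → ℂ) := (axisOf e).comp ρ
  have hα : ∀ {a : L}, X a z₀ = 0 → ∀ b, cross (α a) (e (X b z₀)) = -e (X ⁅a, b⁆ z₀) := by
    intro a ha b
    have h1 := axisOf_spec he (D := ρ a) (fun u w => h.skew ha u w) (X b z₀)
    have h2 : ρ a (X b z₀) = -X ⁅a, b⁆ z₀ := h.fderiv_apply ha b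
    rw [h2, map_neg] at h1
    exact h1.symm
  have hinj : ∀ {a : L}, X a z₀ = 0 → α a = 0 → a = 0 := by
    intro a ha h0
    refine h.eq_zero_of_jet ha ?_
    ext u
    have h1 := axisOf_spec he (D := ρ a) (fun u w => h.skew ha u w) u
    have h2 : axisOf e (ρ a) = 0 := h0
    rw [h2] at h1
    have h3 : e (ρ a u) = 0 := by
      rw [h1]
      ext i
      fin_cases i <;> simp [cross]
    exact (map_eq_zero_iff e e.injective).1 h3
  have hrank := LinearMap.finrank_range_add_finrank_ker (evalAt X z₀)
  have hcI : X c z₀ ≠ 0 := by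
    intro hc0
    have hp : α c ≠ 0 := fun h0 => hc (hinj hc0 h0)
    have hc' : ∀ b, cross (e (X b z₀)) (α c) = 0 := by
      intro b
      have h1 := hα hc0 b
      rw [← lie_skew, hcc, neg_zero, map_zero, Pi.zero_apply, map_zero, neg_zero] at h1
      have h2 := congrFun h1
      ext i
      have k0 := h2 0
      have k1 := h2 1
      have k2 := h2 2
      fin_cases i <;> simp [cross] at k0 k1 k2 ⊢
      · linear_combination -k0
      · linear_combination -k1
      · linear_combination -k2
    have hline : ∀ b, ∃ t : ℂ, e (X b z₀) = t • α c := fun b =>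
      exists_smul_of_cross_eq_zero hp (hc' b)
    have hr : Module.finrank ℂ (LinearMap.range (evalAt X z₀)) ≤ 1 := by
      have hle : LinearMap.range (evalAt X z₀) ≤ Submodule.span ℂ {e.symm (α c)} := by
        rintro _ ⟨b, rfl⟩
        obtain ⟨t, ht⟩ := hline b
        refine Submodule.mem_span_singleton.2 ⟨t, ?_⟩
        rw [← map_smul, ← ht, LinearEquiv.symm_apply_apply]
        rfl
      exact (Submodule.finrank_mono hle).trans (finrank_span_le_card _ |>.trans (by simp))
    let αI : I →ₗ[ℂ] (Fin 3 → ℂ) := α.domRestrict I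
    have hαI : Function.Injective αI := by
      rw [injective_iff_map_eq_zero]
      intro a ha
      exact Subtype.ext (hinj (hI.2 a.2) ha)
    have h3 : Module.finrank ℂ (Fin 3 → ℂ) = 3 := by simp
    have hle3 := LinearMap.finrank_le_finrank_of_injective hαI
    change _ + Module.finrank ℂ I = _ at hrank
    have hsurj := (LinearMap.injective_iff_surjective_of_finrank_eq_finrank
      (show Module.finrank ℂ I = Module.finrank ℂ (Fin 3 → ℂ) by omega)).1 hαI
    obtain ⟨b, hb⟩ : ∃ b, X b z₀ ≠ 0 := by
      by_contra hno
      push Not at hno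
      have h0 : LinearMap.range (evalAt X z₀) = ⊥ := by
        rw [LinearMap.range_eq_bot]
        ext b
        exact hno b
      rw [h0, finrank_bot] at hrank
      omega
    obtain ⟨s, hs⟩ := hline b
    have hs0 : s ≠ 0 := by
      rintro rfl
      rw [zero_smul] at hs
      exact hb (by simpa using hs)
    refine hp (eq_zero_of_forall_cross fun v => ?_)
    obtain ⟨a, rfl⟩ := hsurj v
    obtain ⟨t, ht⟩ := hline ⁅(a : L), b⁆
    have h1 := hα (hI.2 a.2) b
    rw [hs, ht, cross_smul_right] at h1
    refine ⟨s⁻¹ * -t, ?_⟩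
    change cross (α a) (α c) = _
    rw [mul_smul, neg_smul, ← h1, smul_smul, inv_mul_cancel₀ hs0, one_smul]
  have hcz : ∀ a, X a z₀ = 0 → ∃ t : ℂ, α a = t • e (X c z₀) := by
    intro a ha
    refine exists_smul_of_cross_eq_zero (fun h0 => hcI (by simpa using h0)) ?_
    rw [hα ha, hcc, map_zero, Pi.zero_apply, map_zero, neg_zero]
  have hle3 : Module.finrank ℂ (LinearMap.range (evalAt X z₀)) ≤ 3 :=
    hE ▸ Submodule.finrank_le _
  change _ + Module.finrank ℂ I = _ at hrank
  have : Nontrivial I := Module.nontrivial_of_finrank_pos (R := ℂ) (by omega)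
  obtain ⟨k, hk⟩ := exists_ne (0 : I)
  have hk0 : (k : L) ≠ 0 := fun h0 => hk (Subtype.ext h0)
  have hkI : X k z₀ = 0 := hI.2 k.2
  obtain ⟨s, hs⟩ := hcz k hkI
  have hs0 : s ≠ 0 := by
    rintro rfl
    rw [zero_smul] at hs
    exact hk0 (hinj hkI hs)
  have hspan : ∀ a, X a z₀ = 0 → ∃ t : ℂ, a = t • (k : L) := by
    intro a ha
    obtain ⟨t, ht⟩ := hcz a ha
    refine ⟨t / s, ?_⟩
    have h1 : X (a - (t / s) • (k : L)) z₀ = 0 := by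
      rw [map_sub, map_smul, Pi.sub_apply, Pi.smul_apply, ha, hkI, smul_zero, sub_zero]
    refine sub_eq_zero.1 (hinj h1 ?_)
    rw [map_sub, map_smul, ht, hs, smul_smul, div_mul_cancel₀ _ hs0, sub_self]
  refine ⟨hcI, ?_, k, hk0, fun a => ⟨hspan a, ?_⟩⟩
  · have h1 : Module.finrank ℂ I ≤ 1 := finrank_le_one k fun a => by
      obtain ⟨t, ht⟩ := hspan a (hI.2 a.2)
      exact ⟨t, Subtype.ext ht.symm⟩
    exact LinearMap.range_eq_top.1 (Submodule.eq_top_of_finrank_eq (by omega))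
  · rintro ⟨t, rfl⟩
    rw [map_smul, Pi.smul_apply, hkI, smul_zero]

end Isotropy

/-! ### Conjugation in `sl(2, ℂ)` -/

section Conj

/-- The element `(0, 1; 0, 0)` of `sl(2, ℂ)`. -/
def sl2E : sl2 := sl2mk 0 1 0

/-- The element `(0, 0; 1, 0)` of `sl(2, ℂ)`. -/
def sl2F : sl2 := sl2mk 0 0 1

lemma SL2_mul_inv (b : SL2) : b.1 * (b⁻¹).1 = 1 := by
  rw [← Matrix.SpecialLinearGroup.coe_mul, mul_inv_cancel, Matrix.SpecialLinearGroup.coe_one]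

lemma SL2_inv_mul (b : SL2) : (b⁻¹).1 * b.1 = 1 := by
  rw [← Matrix.SpecialLinearGroup.coe_mul, inv_mul_cancel, Matrix.SpecialLinearGroup.coe_one]

/-- The adjoint action of `SL(2, ℂ)`. -/
def AdSL (b : SL2) : sl2 ≃ₗ⁅ℂ⁆ sl2 where
  toFun u := ⟨b.1 * u.1 * (b⁻¹).1, by
    change Matrix.trace (b.1 * u.1 * (b⁻¹).1) = 0
    rw [Matrix.trace_mul_comm, ← Matrix.mul_assoc, SL2_inv_mul, Matrix.one_mul, sl2_trace]⟩
  invFun u := ⟨(b⁻¹).1 * u.1 * b.1, by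
    change Matrix.trace ((b⁻¹).1 * u.1 * b.1) = 0
    rw [Matrix.trace_mul_comm, ← Matrix.mul_assoc, SL2_mul_inv, Matrix.one_mul, sl2_trace]⟩
  map_add' u w := Subtype.ext (by
    change b.1 * (u.1 + w.1) * (b⁻¹).1 = b.1 * u.1 * (b⁻¹).1 + b.1 * w.1 * (b⁻¹).1
    rw [Matrix.mul_add, Matrix.add_mul])
  map_smul' c u := Subtype.ext (by
    change b.1 * (c • u.1) * (b⁻¹).1 = c • (b.1 * u.1 * (b⁻¹).1)
    rw [Matrix.mul_smul, Matrix.smul_mul])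
  map_lie' {u w} := Subtype.ext (by
    change b.1 * (u.1 * w.1 - w.1 * u.1) * (b⁻¹).1 = (b.1 * u.1 * (b⁻¹).1) * (b.1 * w.1 * (b⁻¹).1) -
      (b.1 * w.1 * (b⁻¹).1) * (b.1 * u.1 * (b⁻¹).1)
    have e : ∀ x y : Matrix (Fin 2) (Fin 2) ℂ, (b.1 * x * (b⁻¹).1) * (b.1 * y * (b⁻¹).1) =
        b.1 * (x * y) * (b⁻¹).1 := by
      intro x y
      calc _ = b.1 * x * ((b⁻¹).1 * b.1) * y * (b⁻¹).1 := by simp only [Matrix.mul_assoc]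
        _ = _ := by rw [SL2_inv_mul, Matrix.mul_one]; simp only [Matrix.mul_assoc]
    rw [e, e, Matrix.mul_sub, Matrix.sub_mul])
  left_inv u := Subtype.ext (by
    change (b⁻¹).1 * (b.1 * u.1 * (b⁻¹).1) * b.1 = u.1
    calc _ = ((b⁻¹).1 * b.1) * u.1 * ((b⁻¹).1 * b.1) := by simp only [Matrix.mul_assoc]
      _ = u.1 := by rw [SL2_inv_mul, Matrix.one_mul, Matrix.mul_one])
  right_inv u := Subtype.ext (by
    change b.1 * ((b⁻¹).1 * u.1 * b.1) * (b⁻¹).1 = u.1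
    calc _ = (b.1 * (b⁻¹).1) * u.1 * (b.1 * (b⁻¹).1) := by simp only [Matrix.mul_assoc]
      _ = u.1 := by rw [SL2_mul_inv, Matrix.one_mul, Matrix.mul_one])

lemma AdSL_val (b : SL2) (u : sl2) : (AdSL b u).1 = b.1 * u.1 * (b⁻¹).1 := rfl

/-- Matrices intertwined by an invertible matrix are conjugate under `SL(2, ℂ)`. -/
lemma exists_AdSL_eq {u w : sl2} (S : Matrix (Fin 2) (Fin 2) ℂ) (hS : S.det ≠ 0)
    (h : u.1 * S = S * w.1) : ∃ b : SL2, AdSL b u = w := by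
  obtain ⟨r, hr⟩ := IsAlgClosed.exists_eq_mul_self S.det
  have hr0 : r ≠ 0 := by
    rintro rfl
    exact hS (by simpa using hr)
  let s : SL2 := ⟨r⁻¹ • S, by
    rw [Matrix.det_smul, hr]
    simp
    field_simp⟩
  have hs : u.1 * s.1 = s.1 * w.1 := by
    change u.1 * (r⁻¹ • S) = (r⁻¹ • S) * w.1
    rw [Matrix.mul_smul, Matrix.smul_mul, h]
  refine ⟨s⁻¹, Subtype.ext ?_⟩
  rw [AdSL_val, inv_inv, Matrix.mul_assoc, hs, ← Matrix.mul_assoc, SL2_inv_mul, Matrix.one_mul]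

lemma exists_AdSL_eq_H {u : sl2} (hu : u.1 0 0 ^ 2 + u.1 0 1 * u.1 1 0 = 1) :
    ∃ b : SL2, AdSL b u = sl2H := by
  induction u using sl2_induction with | h a b c => ?_
  simp at hu
  by_cases ha : 1 + a = 0
  · refine exists_AdSL_eq !![b, -1 + a; 1 - a, c] ?_ ?_
    · rw [Matrix.det_fin_two_of]
      have : a = -1 := by linear_combination ha
      subst this
      intro h0
      have : (4 : ℂ) = 0 := by linear_combination h0 - hu
      norm_num at this
    · ext i j
      fin_cases i <;> fin_cases j <;> simp [sl2mk, sl2H, Matrix.mul_apply, Fin.sum_univ_two]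
      · ring
      · linear_combination hu
      · linear_combination hu
      · ring
  · refine exists_AdSL_eq !![a + 1, b; c, -a - 1] ?_ ?_
    · rw [Matrix.det_fin_two_of]
      intro h0
      refine ha ?_
      linear_combination (-1/2) * (h0 + hu)
    · ext i j
      fin_cases i <;> fin_cases j <;> simp [sl2mk, sl2H, Matrix.mul_apply, Fin.sum_univ_two]
      · linear_combination hu
      · ring
      · ring
      · linear_combination hu

lemma exists_AdSL_eq_E {u : sl2} (hu0 : u ≠ 0) (hu : u.1 0 0 ^ 2 + u.1 0 1 * u.1 1 0 = 0) :
    ∃ b : SL2, AdSL b u = sl2E := by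
  induction u using sl2_induction with | h a b c => ?_
  simp at hu
  by_cases hc : c = 0
  · subst hc
    have ha : a = 0 := by simpa using hu
    subst ha
    refine exists_AdSL_eq !![b, 0; 0, 1] ?_ ?_
    · rw [Matrix.det_fin_two_of]
      intro h0
      have : b = 0 := by simpa using h0
      exact hu0 (by rw [this, sl2mk_zero])
    · ext i j
      fin_cases i <;> fin_cases j <;> simp [sl2mk, sl2E, Matrix.mul_apply, Fin.sum_univ_two]
  · refine exists_AdSL_eq !![a, b + 1; c, -a] ?_ ?_
    · rw [Matrix.det_fin_two_of]
      intro h0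
      exact hc (by linear_combination -h0 - hu)
    · ext i j
      fin_cases i <;> fin_cases j <;> simp [sl2mk, sl2E, Matrix.mul_apply, Fin.sum_univ_two]
      · linear_combination hu
      · ring
      · ring
      · linear_combination hu

/-- Every nonzero element of `sl(2, ℂ)` is conjugate to a multiple of `H`, or to `E`. -/
lemma exists_AdSL_normal {u : sl2} (hu : u ≠ 0) : ∃ (b : SL2) (t : ℂ), t ≠ 0 ∧
    (AdSL b u = t • sl2H ∨ AdSL b u = t • sl2E) := by
  by_cases hd : u.1 0 0 ^ 2 + u.1 0 1 * u.1 1 0 = 0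
  · obtain ⟨b, hb⟩ := exists_AdSL_eq_E hu hd
    exact ⟨b, 1, one_ne_zero, Or.inr (by rw [hb, one_smul])⟩
  · obtain ⟨r, hr⟩ := IsAlgClosed.exists_eq_mul_self (u.1 0 0 ^ 2 + u.1 0 1 * u.1 1 0)
    have hr0 : r ≠ 0 := by
      rintro rfl
      exact hd (by simpa using hr)
    obtain ⟨b, hb⟩ := exists_AdSL_eq_H (u := r⁻¹ • u) (by
      simp only [sl2_smul_val]
      field_simp
      linear_combination hr)
    refine ⟨b, r, hr0, Or.inl ?_⟩
    rw [← hb, map_smul, smul_smul, mul_inv_cancel₀ hr0, one_smul]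

end Conj

/-! ### Normal forms of the isotropy -/

section NormalForm

lemma prod_lie (p r : ℂ × sl2) : ⁅p, r⁆ = (0, ⁅p.2, r.2⁆) := by
  refine Prod.ext ?_ rfl
  change ⁅p.1, r.1⁆ = 0
  rw [LieRing.of_associative_ring_bracket, mul_comm, sub_self]

lemma finrank_prod_sl2 : Module.finrank ℂ (ℂ × sl2) = 4 := by
  rw [Module.finrank_prod, finrank_sl2, Module.finrank_self]

/-- The automorphisms of `ℂ × sl(2, ℂ)` given by a scalar and an automorphism of `sl(2, ℂ)`. -/
def prodEquiv (t : ℂ) (ht : t ≠ 0) (α : sl2 ≃ₗ⁅ℂ⁆ sl2) : (ℂ × sl2) ≃ₗ⁅ℂ⁆ (ℂ × sl2) where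
  toFun p := (t * p.1, α p.2)
  invFun p := (t⁻¹ * p.1, α.symm p.2)
  map_add' p r := Prod.ext (mul_add _ _ _) (map_add α _ _)
  map_smul' c p := Prod.ext (mul_left_comm _ _ _) (map_smul α _ _)
  map_lie' {p r} := by
    rw [prod_lie, prod_lie]
    exact Prod.ext (mul_zero t) (LieEquiv.map_lie α _ _)
  left_inv p := Prod.ext (inv_mul_cancel_left₀ ht _) (α.symm_apply_apply _)
  right_inv p := Prod.ext (mul_inv_cancel_left₀ ht _) (α.apply_symm_apply _)

lemma prodEquiv_apply (t : ℂ) (ht : t ≠ 0) (α : sl2 ≃ₗ⁅ℂ⁆ sl2) (p : ℂ × sl2) :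
    prodEquiv t ht α p = (t * p.1, α p.2) := rfl

lemma prodEquiv_symm_apply (t : ℂ) (ht : t ≠ 0) (α : sl2 ≃ₗ⁅ℂ⁆ sl2) (p : ℂ × sl2) :
    (prodEquiv t ht α).symm p = (t⁻¹ * p.1, α.symm p.2) := rfl

variable {E : Type*} [NormedAddCommGroup E] [NormedSpace ℂ E] [FiniteDimensional ℂ E]

lemma KillingAction.invariant {L : Type*} [LieRing L] [LieAlgebra ℂ L] {X : L →ₗ[ℂ] E → E}
    {G : E → E →L[ℂ] E →L[ℂ] ℂ} {z₀ : E} (h : KillingAction X G z₀) {a : L}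
    (ha : X a z₀ = 0) (u w : L) :
    G z₀ (X ⁅a, u⁆ z₀) (X w z₀) + G z₀ (X u z₀) (X ⁅a, w⁆ z₀) = 0 := by
  have := h.skew ha (X u z₀) (X w z₀)
  rw [h.fderiv_apply ha, h.fderiv_apply ha] at this
  simp only [map_neg, neg_apply] at this
  linear_combination -this

variable {X : (ℂ × sl2) →ₗ[ℂ] E → E} {G : E → E →L[ℂ] E →L[ℂ] ℂ} {z₀ : E}

lemma KillingAction.decomp (p : ℂ × sl2) (z : E) : X p z = p.1 • X (1, 0) z +
    (p.2.1 0 0 • X (0, sl2H) z + p.2.1 0 1 • X (0, sl2E) z + p.2.1 1 0 • X (0, sl2F) z) := by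
  have h : p = p.1 • ((1, 0) : ℂ × sl2) + (p.2.1 0 0 • ((0, sl2H) : ℂ × sl2) +
      p.2.1 0 1 • ((0, sl2E) : ℂ × sl2) + p.2.1 1 0 • ((0, sl2F) : ℂ × sl2)) := by
    refine Prod.ext ?_ ?_
    · simp
    · simp only [Prod.snd_add, Prod.smul_snd, smul_zero, zero_add, sl2H_eq, sl2E, sl2F, sl2mk_smul,
        sl2mk_add]
      apply sl2_ext <;> simp
  conv_lhs => rw [h]
  simp only [map_add, map_smul, Pi.add_apply, Pi.smul_apply]

lemma sl2E_ne_zero : sl2E ≠ 0 := fun h => one_ne_zero (congrArg (fun u : sl2 => u.1 0 1) h)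

lemma sl2H_ne_zero : sl2H ≠ 0 := fun h => one_ne_zero (congrArg (fun u : sl2 => u.1 0 0) h)

lemma lie_H_E : ⁅sl2H, sl2E⁆ = (2 : ℂ) • sl2E := by
  rw [sl2H_eq, sl2E, sl2mk_lie, sl2mk_smul]
  apply sl2_ext <;> simp

lemma lie_H_F : ⁅sl2H, sl2F⁆ = (-2 : ℂ) • sl2F := by
  rw [sl2H_eq, sl2F, sl2mk_lie, sl2mk_smul]
  apply sl2_ext <;> simp

lemma lie_E_F : ⁅sl2E, sl2F⁆ = sl2H := by
  rw [sl2H_eq, sl2F, sl2E, sl2mk_lie]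
  apply sl2_ext <;> simp

lemma lie_E_H : ⁅sl2E, sl2H⁆ = (-2 : ℂ) • sl2E := by
  rw [← lie_skew, lie_H_E, neg_smul]

/-- The isotropy cannot be spanned by a nilpotent element of `sl(2, ℂ)`. -/
lemma KillingAction.isotropy_ne_E (h : KillingAction X G z₀)
    (hsurj : Function.Surjective (evalAt X z₀))
    (hk : ∀ a, X a z₀ = 0 ↔ ∃ t : ℂ, a = t • ((0, sl2E) : ℂ × sl2)) : False := by
  have hE : X (0, sl2E) z₀ = 0 := (hk _).2 ⟨1, (one_smul _ _).symm⟩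
  have inv := h.invariant hE
  have eF : ⁅((0, sl2E) : ℂ × sl2), ((0, sl2F) : ℂ × sl2)⁆ = (0, sl2H) := by
    rw [prod_lie, lie_E_F]
  have eH : X ⁅((0, sl2E) : ℂ × sl2), ((0, sl2H) : ℂ × sl2)⁆ z₀ = 0 := by
    refine (hk _).2 ⟨-2, ?_⟩
    rw [prod_lie, lie_E_H]
    exact Prod.ext (smul_zero _).symm rfl
  have eC : ⁅((0, sl2E) : ℂ × sl2), ((1, 0) : ℂ × sl2)⁆ = 0 := by
    rw [prod_lie, lie_zero]
    rfl
  have h1 := inv (0, sl2F) (0, sl2F)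
  have h2 := inv (0, sl2F) (1, 0)
  have h3 := inv (0, sl2F) (0, sl2H)
  rw [eF] at h1 h2 h3
  rw [eC, map_zero, Pi.zero_apply, map_zero, add_zero] at h2
  rw [eH, map_zero, add_zero] at h3
  rw [h.symm z₀ (X (0, sl2F) z₀)] at h1
  have h1' : G z₀ (X (0, sl2H) z₀) (X (0, sl2F) z₀) = 0 := by linear_combination h1 / 2
  have h0 : X (0, sl2H) z₀ = 0 := by
    refine h.nondeg _ fun w => ?_
    obtain ⟨p, rfl⟩ := hsurj w
    change G z₀ (X (0, sl2H) z₀) (X p z₀) = 0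
    rw [KillingAction.decomp p z₀]
    simp only [map_add, map_smul, h1', h2, h3, hE, smul_zero, add_zero]
  obtain ⟨t, ht⟩ := (hk _).1 h0
  have := congrArg (fun p : ℂ × sl2 => p.2.1 0 0) ht
  simp [sl2_smul_val, sl2E, sl2H] at this

/-- The metric at a point with isotropy spanned by `H`. -/
lemma KillingAction.metric_of_isotropy_H (h : KillingAction X G z₀)
    (hk : ∀ a, X a z₀ = 0 ↔ ∃ t : ℂ, a = t • ((0, sl2H) : ℂ × sl2)) :
    G z₀ (X (1, 0) z₀) (X (0, sl2E) z₀) = 0 ∧ G z₀ (X (1, 0) z₀) (X (0, sl2F) z₀) = 0 ∧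
    G z₀ (X (0, sl2E) z₀) (X (0, sl2E) z₀) = 0 ∧ G z₀ (X (0, sl2F) z₀) (X (0, sl2F) z₀) = 0 ∧
    X (0, sl2H) z₀ = 0 := by
  have hH : X (0, sl2H) z₀ = 0 := (hk _).2 ⟨1, (one_smul _ _).symm⟩
  have inv := h.invariant hH
  have eE : ⁅((0, sl2H) : ℂ × sl2), ((0, sl2E) : ℂ × sl2)⁆ = (2 : ℂ) • (0, sl2E) := by
    rw [prod_lie, lie_H_E]
    exact Prod.ext (smul_zero _).symm rfl
  have eF : ⁅((0, sl2H) : ℂ × sl2), ((0, sl2F) : ℂ × sl2)⁆ = (-2 : ℂ) • (0, sl2F) := by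
    rw [prod_lie, lie_H_F]
    exact Prod.ext (smul_zero _).symm rfl
  have eC : ⁅((0, sl2H) : ℂ × sl2), ((1, 0) : ℂ × sl2)⁆ = 0 := by
    rw [prod_lie, lie_zero]
    rfl
  have h1 := inv (1, 0) (0, sl2E)
  have h2 := inv (1, 0) (0, sl2F)
  have h3 := inv (0, sl2E) (0, sl2E)
  have h4 := inv (0, sl2F) (0, sl2F)
  rw [eC, eE] at h1
  rw [eC, eF] at h2
  rw [eE] at h3
  rw [eF] at h4
  simp only [map_smul, map_zero, Pi.smul_apply, Pi.zero_apply, smul_apply, zero_apply, smul_eq_mul,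
    zero_add] at h1 h2 h3 h4
  exact ⟨by linear_combination h1 / 2, by linear_combination -h2 / 2, by linear_combination h3 / 4, by linear_combination -h4 / 4, hH⟩

lemma KillingAction.metric_center_ne_zero (h : KillingAction X G z₀)
    (hsurj : Function.Surjective (evalAt X z₀)) (hc : X (1, 0) z₀ ≠ 0)
    (hk : ∀ a, X a z₀ = 0 ↔ ∃ t : ℂ, a = t • ((0, sl2H) : ℂ × sl2)) :
    G z₀ (X (1, 0) z₀) (X (1, 0) z₀) ≠ 0 := by
  intro h0
  refine hc (h.nondeg _ fun w => ?_)
  obtain ⟨p, rfl⟩ := hsurj w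
  obtain ⟨m1, m2, -, -, m5⟩ := h.metric_of_isotropy_H hk
  change G z₀ _ (X p z₀) = 0
  rw [KillingAction.decomp p z₀]
  simp only [map_add, map_smul, h0, m1, m2, m5, map_zero, smul_zero, add_zero]

lemma KillingAction.exists_normal_form (h : KillingAction X G z₀) (hE : Module.finrank ℂ E = 3) :
    ∃ Φ : (ℂ × sl2) ≃ₗ⁅ℂ⁆ (ℂ × sl2),
      (∃ v : sl2, (v = sl2H ∨ v = sl2E) ∧ ∀ a, X (Φ a) z₀ = 0 ↔ ∃ s : ℂ, a = (s, s • v)) ∨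
      ((∀ a, X (Φ a) z₀ = 0 ↔ ∃ s : ℂ, a = (0, s • sl2H)) ∧
        G z₀ (X (Φ (1, 0)) z₀) (X (Φ (1, 0)) z₀) = 1) := by
  obtain ⟨hc, hsurj, k, hk0, hk⟩ := h.isotropy_line hE finrank_prod_sl2 (c := (1, 0))
    (by simp) (fun a => by rw [prod_lie, lie_zero]; rfl)
  have hA : k.2 ≠ 0 := by
    intro h0
    have h1 : k = k.1 • ((1, 0) : ℂ × sl2) := Prod.ext (by simp) (by simp [h0])
    have h2 : X k z₀ = 0 := (hk k).2 ⟨1, (one_smul _ _).symm⟩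
    rw [h1, map_smul, Pi.smul_apply, smul_eq_zero] at h2
    rcases h2 with h2 | h2
    · exact hk0 (by rw [h1, h2, zero_smul])
    · exact hc h2
  obtain ⟨b, τ, hτ, hb⟩ := exists_AdSL_normal hA
  obtain ⟨v, hv, hbv⟩ : ∃ v : sl2, (v = sl2H ∨ v = sl2E) ∧ AdSL b k.2 = τ • v := by
    rcases hb with hb | hb
    · exact ⟨_, Or.inl rfl, hb⟩
    · exact ⟨_, Or.inr rfl, hb⟩
  have key : ∀ (μ : ℂ) (hμ : μ ≠ 0) (a : ℂ × sl2),
      X ((prodEquiv μ hμ (AdSL b)).symm a) z₀ = 0 ↔ ∃ s : ℂ, a = s • ((μ * k.1, τ • v) : ℂ × sl2) := by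
    intro μ hμ a
    rw [hk]
    refine exists_congr fun t => ?_
    rw [LieEquiv.symm_apply_eq, map_smul, prodEquiv_apply, hbv]
  by_cases hk1 : k.1 = 0
  · have hact := fun (μ : ℂ) (hμ : μ ≠ 0) => h.comp (prodEquiv μ hμ (AdSL b)).symm
    have key' : ∀ (μ : ℂ) (hμ : μ ≠ 0) (a : ℂ × sl2),
        X ((prodEquiv μ hμ (AdSL b)).symm a) z₀ = 0 ↔ ∃ s : ℂ, a = s • ((0, v) : ℂ × sl2) := by
      intro μ hμ a
      rw [key, hk1, mul_zero]
      constructor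
      · rintro ⟨s, rfl⟩
        exact ⟨s * τ, Prod.ext (by simp) (by simp [smul_smul])⟩
      · rintro ⟨s, rfl⟩
        exact ⟨s / τ, Prod.ext (by simp) (by simp [smul_smul, div_mul_cancel₀ _ hτ])⟩
    have hs : Function.Surjective
        (evalAt (X ∘ₗ ((prodEquiv 1 one_ne_zero (AdSL b)).symm : (ℂ × sl2) →ₗ[ℂ] ℂ × sl2)) z₀) := by
      intro w
      obtain ⟨a, rfl⟩ := hsurj w
      refine ⟨prodEquiv 1 one_ne_zero (AdSL b) a, ?_⟩
      change X ((prodEquiv 1 one_ne_zero (AdSL b)).symm _) z₀ = X a z₀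
      rw [LieEquiv.symm_apply_apply]
    rcases hv with rfl | rfl
    · have e1 : ∀ μ (hμ : μ ≠ 0), (prodEquiv μ hμ (AdSL b)).symm (1, 0) =
          μ⁻¹ • ((1, 0) : ℂ × sl2) := by
        intro μ hμ
        rw [prodEquiv_symm_apply]
        exact Prod.ext rfl (by simp)
      have hne : G z₀ (X (1, 0) z₀) (X (1, 0) z₀) ≠ 0 := by
        have e2 : (X ∘ₗ ((prodEquiv 1 one_ne_zero (AdSL b)).symm : (ℂ × sl2) →ₗ[ℂ] ℂ × sl2)) (1, 0) =
            X (1, 0) := by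
          change X ((prodEquiv 1 one_ne_zero (AdSL b)).symm (1, 0)) = _
          rw [e1, inv_one, one_smul]
        have := (hact 1 one_ne_zero).metric_center_ne_zero hs (by rwa [e2]) (key' 1 one_ne_zero)
        rwa [e2] at this
      obtain ⟨r, hr⟩ := IsAlgClosed.exists_eq_mul_self (G z₀ (X (1, 0) z₀) (X (1, 0) z₀))
      have hr0 : r ≠ 0 := by
        rintro rfl
        exact hne (by simpa using hr)
      refine ⟨(prodEquiv r hr0 (AdSL b)).symm, Or.inr ⟨fun a => ?_, ?_⟩⟩
      · rw [key']
        refine exists_congr fun s => ?_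
        rw [Prod.smul_mk, smul_zero]
      · rw [e1, map_smul, Pi.smul_apply, map_smul, map_smul, smul_apply, hr]
        simp only [smul_eq_mul]
        field_simp
    · exact ((hact 1 one_ne_zero).isotropy_ne_E hs (key' 1 one_ne_zero)).elim
  · refine ⟨(prodEquiv (τ / k.1) (div_ne_zero hτ hk1) (AdSL b)).symm, Or.inl ⟨v, hv, fun a => ?_⟩⟩
    rw [key, div_mul_cancel₀ _ hk1]
    constructor
    · rintro ⟨s, rfl⟩
      exact ⟨s * τ, Prod.ext rfl (by simp [smul_smul])⟩
    · rintro ⟨s, rfl⟩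
      refine ⟨s / τ, Prod.ext ?_ ?_⟩
      · simp [div_mul_cancel₀ _ hτ]
      · simp [smul_smul, div_mul_cancel₀ _ hτ]

end NormalForm

/-! ### Local isometries from equivariant maps -/

section Frame

variable {E : Type*} [NormedAddCommGroup E] [NormedSpace ℂ E] [FiniteDimensional ℂ E]

/-- The dual frame of a holomorphic frame. -/
lemma exists_dual_frame {Y : Fin 3 → E → E} {z₀ : E} (hY : ∀ i, ContDiffAt ℂ ω (Y i) z₀)
    (hE : Module.finrank ℂ E = 3) (hli : LinearIndependent ℂ (fun i => Y i z₀)) :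
    ∃ θ : Fin 3 → E → E →L[ℂ] ℂ, (∀ i, ContDiffAt ℂ ω (θ i) z₀) ∧
      ∀ᶠ z in 𝓝 z₀, (∀ i j, θ i z (Y j z) = if i = j then 1 else 0) ∧
        ∀ v, ∑ i, θ i z v • Y i z = v := by
  have : CompleteSpace E := FiniteDimensional.complete ℂ E
  let T : E → (Fin 3 → ℂ) →L[ℂ] E := fun z =>
    ∑ i, (ContinuousLinearMap.proj i : (Fin 3 → ℂ) →L[ℂ] ℂ).smulRight (Y i z)
  have hTa : ∀ z c, T z c = ∑ i, c i • Y i z := by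
    intro z c
    simp [T]
  have hT : ContDiffAt ℂ ω T z₀ := by
    refine contDiffAt_clm_of_apply fun c => ?_
    simp only [hTa]
    exact ContDiffAt.sum fun i _ => (hY i).const_smul (c i)
  have hT0 : Function.Injective (T z₀) := by
    rw [injective_iff_map_eq_zero]
    intro c hc
    rw [hTa] at hc
    exact funext (Fintype.linearIndependent_iff.1 hli c hc)
  have hfr : Module.finrank ℂ (Fin 3 → ℂ) = Module.finrank ℂ E := by simp [hE]
  let e : (Fin 3 → ℂ) ≃L[ℂ] E :=
    (LinearEquiv.ofInjectiveOfFinrankEq (T z₀).toLinearMap hT0 hfr).toContinuousLinearEquiv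
  have he : (e : (Fin 3 → ℂ) →L[ℂ] E) = T z₀ := by
    ext c
    rfl
  refine ⟨fun i z => (ContinuousLinearMap.proj i : (Fin 3 → ℂ) →L[ℂ] ℂ).comp (T z).inverse,
    fun i => ?_, ?_⟩
  · refine contDiffAt_const.clm_comp ?_
    have h1 := contDiffAt_map_inverse (n := ω) e
    rw [he] at h1
    exact h1.comp z₀ hT
  · have h1 := ContinuousLinearEquiv.nhds e
    rw [he] at h1
    filter_upwards [hT.continuousAt.eventually h1] with z hz
    obtain ⟨e', he'⟩ := hz
    have e1 : ∀ c, (T z).inverse (T z c) = c := by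
      intro c
      rw [← he', ContinuousLinearMap.inverse_equiv]
      exact e'.symm_apply_apply c
    have e2 : ∀ v, T z ((T z).inverse v) = v := by
      intro v
      rw [← he', ContinuousLinearMap.inverse_equiv]
      exact e'.apply_symm_apply v
    constructor
    · intro i j
      have h2 : Y j z = T z (Pi.single j 1) := by
        rw [hTa]
        simp [Pi.single_apply]
      rw [h2]
      simp [e1, Pi.single_apply]
    · intro v
      conv_rhs => rw [← e2 v, hTa]
      rfl

end Frame

section MetricUnique

set_option synthInstance.maxHeartbeats 200000
set_option maxSynthPendingDepth 3

variable {E : Type*} [NormedAddCommGroup E] [NormedSpace ℂ E] [FiniteDimensional ℂ E]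
variable {L : Type*} [LieRing L] [LieAlgebra ℂ L] {X : L →ₗ[ℂ] E → E}
  {G : E → E →L[ℂ] E →L[ℂ] ℂ} {z₀ : E}

lemma exists_frame_of_surjective (hE : Module.finrank ℂ E = 3)
    (hsurj : Function.Surjective (evalAt X z₀)) :
    ∃ a : Fin 3 → L, LinearIndependent ℂ (fun i => X (a i) z₀) := by
  let b := Module.finBasisOfFinrankEq ℂ E hE
  choose a ha using fun i => hsurj (b i)
  refine ⟨a, ?_⟩
  have : (fun i => X (a i) z₀) = b := funext ha
  rw [this]
  exact b.linearIndependent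

/-- Two metrics with a common transitive algebra of Killing fields are equal if they are equal at
one point. -/
lemma KillingAction.metric_unique (h : KillingAction X G z₀) (hE : Module.finrank ℂ E = 3)
    (hsurj : Function.Surjective (evalAt X z₀)) {G' : E → E →L[ℂ] E →L[ℂ] ℂ}
    (hG' : ContDiffAt ℂ ω G' z₀)
    (hK : ∀ a, ∀ᶠ z in 𝓝 z₀, ∀ u w, fderiv ℂ G' z (X a z) u w + G' z (fderiv ℂ (X a) z u) w +
      G' z u (fderiv ℂ (X a) z w) = 0)
    (h0 : G' z₀ = G z₀) : ∀ᶠ z in 𝓝 z₀, G' z = G z := by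
  obtain ⟨a, ha⟩ := exists_frame_of_surjective hE hsurj
  obtain ⟨θ, hθ, hθ'⟩ := exists_dual_frame (fun i => h.smooth (a i)) hE ha
  obtain ⟨K, hK1, hK2⟩ : ∃ K : ℝ, (∀ᶠ z in 𝓝 z₀, ∀ i, ‖θ i z‖ ≤ K) ∧
      ∀ᶠ z in 𝓝 z₀, ∀ i, ‖fderiv ℂ (X (a i)) z‖ ≤ K := by
    have c1 : ∀ i, ContinuousAt (fun z => ‖θ i z‖) z₀ := fun i => (hθ i).continuousAt.norm
    have c2 : ∀ i, ContinuousAt (fun z => ‖fderiv ℂ (X (a i)) z‖) z₀ := fun i =>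
      ((h.smooth (a i)).fderiv_right (m := ω) le_top).continuousAt.norm
    refine ⟨∑ i, (‖θ i z₀‖ + 1 + (‖fderiv ℂ (X (a i)) z₀‖ + 1)), ?_, ?_⟩
    · rw [eventually_all]
      intro i
      filter_upwards [(c1 i).eventually (eventually_le_nhds (lt_add_one _))] with z hz
      refine hz.trans (le_trans ?_ (Finset.single_le_sum
        (f := fun i => ‖θ i z₀‖ + 1 + (‖fderiv ℂ (X (a i)) z₀‖ + 1)) (fun j _ => by positivity)
        (Finset.mem_univ i)))
      have := norm_nonneg (fderiv ℂ (X (a i)) z₀)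
      linarith
    · rw [eventually_all]
      intro i
      filter_upwards [(c2 i).eventually (eventually_le_nhds (lt_add_one _))] with z hz
      refine hz.trans (le_trans ?_ (Finset.single_le_sum
        (f := fun i => ‖θ i z₀‖ + 1 + (‖fderiv ℂ (X (a i)) z₀‖ + 1)) (fun j _ => by positivity)
        (Finset.mem_univ i)))
      have := norm_nonneg (θ i z₀)
      linarith
  have hKa : ∀ᶠ z in 𝓝 z₀, ∀ i, ∀ u w, fderiv ℂ (fun z => G' z - G z) z (X (a i) z) u w =
      -((G' z - G z) (fderiv ℂ (X (a i)) z u) w + (G' z - G z) u (fderiv ℂ (X (a i)) z w)) := by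
    rw [eventually_all]
    intro i
    filter_upwards [hK (a i), h.killing (a i), hG'.eventually (by simp),
      h.smooth_metric.eventually (by simp)] with z h1 h2 h3 h4 u w
    rw [show fderiv ℂ (fun z => G' z - G z) z = fderiv ℂ G' z - fderiv ℂ G z from
      fderiv_sub (h3.differentiableAt (by simp)) (h4.differentiableAt (by simp))]
    simp only [sub_apply]
    linear_combination h1 u w - h2 u w
  have hfin := eventually_eq_zero_of_norm_fderiv_le (φ := fun z => G' z - G z) (z₀ := z₀)
    (C := 3 * K * (2 * K)) (by simp [h0])
    (by
      filter_upwards [hG'.eventually (by simp), h.smooth_metric.eventually (by simp)] with z h3 h4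
      exact (h3.differentiableAt (by simp)).sub (h4.differentiableAt (by simp)))
    (by
      filter_upwards [hK1, hK2, hKa, hθ'] with z k1 k2 ka hz
      have hK0 : 0 ≤ K := (norm_nonneg _).trans (k1 0)
      set φ := G' z - G z
      refine ContinuousLinearMap.opNorm_le_bound _ (by positivity) fun v =>
        ContinuousLinearMap.opNorm_le_bound _ (by positivity) fun u =>
        ContinuousLinearMap.opNorm_le_bound _ (by positivity) fun w => ?_
      have b1 : ∀ i, ‖fderiv ℂ (fun z => G' z - G z) z (X (a i) z) u w‖ ≤
          2 * K * ‖φ‖ * ‖u‖ * ‖w‖ := by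
        intro i
        rw [ka, norm_neg]
        have c1 : ‖φ (fderiv ℂ (X (a i)) z u) w‖ ≤ ‖φ‖ * (K * ‖u‖) * ‖w‖ :=
          (φ.le_opNorm₂ _ _).trans (by
            gcongr
            exact ((fderiv ℂ (X (a i)) z).le_opNorm u).trans (by gcongr; exact k2 i))
        have c2 : ‖φ u (fderiv ℂ (X (a i)) z w)‖ ≤ ‖φ‖ * ‖u‖ * (K * ‖w‖) :=
          (φ.le_opNorm₂ _ _).trans (by
            gcongr
            exact ((fderiv ℂ (X (a i)) z).le_opNorm w).trans (by gcongr; exact k2 i))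
        refine (norm_add_le _ _).trans ((add_le_add c1 c2).trans (le_of_eq (by ring)))
      have b2 : fderiv ℂ (fun z => G' z - G z) z v u w =
          ∑ i, θ i z v * fderiv ℂ (fun z => G' z - G z) z (X (a i) z) u w := by
        conv_lhs => rw [← hz.2 v]
        simp only [map_sum, map_smul, sum_apply, smul_apply, smul_eq_mul]
      rw [b2]
      refine (norm_sum_le _ _).trans ?_
      have b3 : ∀ i ∈ Finset.univ, ‖θ i z v * fderiv ℂ (fun z => G' z - G z) z (X (a i) z) u w‖ ≤
          (K * ‖v‖) * (2 * K * ‖φ‖ * ‖u‖ * ‖w‖) := by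
        intro i _
        rw [norm_mul]
        gcongr
        · exact ((θ i z).le_opNorm v).trans (by gcongr; exact k1 i)
        · exact b1 i
      refine (Finset.sum_le_sum b3).trans (le_of_eq ?_)
      simp
      ring)
  filter_upwards [hfin] with z hz using sub_eq_zero.1 hz

end MetricUnique

section InverseFunction

variable {E E' : Type*} [NormedAddCommGroup E] [NormedSpace ℂ E] [FiniteDimensional ℂ E]
  [NormedAddCommGroup E'] [NormedSpace ℂ E'] [FiniteDimensional ℂ E']
variable {M : Type*} [TopologicalSpace M] [ChartedSpace E' M] [IsManifold 𝓘(ℂ, E') ω M]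

lemma IsBihol.restrOpen {E₁ M₁ : Type*} [NormedAddCommGroup E₁] [NormedSpace ℂ E₁]
    [TopologicalSpace M₁] [ChartedSpace E₁ M₁]
    {F : OpenPartialHomeomorph M₁ M} (h : IsBihol (E := E₁) (E' := E') F) {s : Set M₁}
    (hs : IsOpen s) : IsBihol (E := E₁) (E' := E') (F.restrOpen s hs) where
  holo := h.holo.mono (by
    rw [OpenPartialHomeomorph.restrOpen_source]
    exact Set.inter_subset_left)
  holo_symm := h.holo_symm.mono (by
    intro y hy
    exact hy.1)

lemma IsBihol.trans {E₁ M₁ E₂ M₂ : Type*} [NormedAddCommGroup E₁] [NormedSpace ℂ E₁]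
    [TopologicalSpace M₁] [ChartedSpace E₁ M₁] [NormedAddCommGroup E₂] [NormedSpace ℂ E₂]
    [TopologicalSpace M₂] [ChartedSpace E₂ M₂]
    {F : OpenPartialHomeomorph M₁ M₂} {F' : OpenPartialHomeomorph M₂ M}
    (h : IsBihol (E := E₁) (E' := E₂) F) (h' : IsBihol (E := E₂) (E' := E') F') :
    IsBihol (E := E₁) (E' := E') (F.trans F') where
  holo := by
    rw [OpenPartialHomeomorph.trans_source]
    exact h'.holo.comp (h.holo.mono Set.inter_subset_left) fun x hx => hx.2
  holo_symm := by
    rw [OpenPartialHomeomorph.trans_target]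
    exact h.holo_symm.comp (h'.holo_symm.mono Set.inter_subset_left) fun x hx => hx.2

/-- The inverse function theorem for maps into a manifold. -/
lemma exists_isBihol {f : E → M} {z₀ : E} (hf : ContMDiffAt 𝓘(ℂ, E) 𝓘(ℂ, E') ω f z₀)
    (hinj : Function.Injective (mfderiv 𝓘(ℂ, E) 𝓘(ℂ, E') f z₀))
    (hfr : Module.finrank ℂ E = Module.finrank ℂ E') :
    ∃ F : OpenPartialHomeomorph E M, IsBihol (E := E) (E' := E') F ∧ z₀ ∈ F.source ∧
      ∀ z ∈ F.source, F z = f z := by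
  have : CompleteSpace E := FiniteDimensional.complete ℂ E
  set c := chartAt E' (f z₀) with hc
  have hcs : f z₀ ∈ c.source := mem_chart_source E' (f z₀)
  have hcb : IsBihol (E := E') (E' := E') (c.symm : OpenPartialHomeomorph E' M) :=
    isBihol_chartAt_symm (f z₀)
  have hcb' : IsBihol (E := E') (E' := E') c := by
    have := hcb.symm
    rwa [OpenPartialHomeomorph.symm_symm] at this
  let φ : E → E' := fun z => c (f z)
  have hφ : ContDiffAt ℂ ω φ z₀ :=
    contMDiffAt_iff_contDiffAt.1 ((hcb'.contMDiffAt hcs).comp z₀ hf)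
  have hφi : Function.Injective (fderiv ℂ φ z₀) := by
    have h1 := mfderiv_comp z₀ (hcb'.mdiff hcs) (hf.mdifferentiableAt (by simp))
    rw [← mfderiv_eq_fderiv]
    change Function.Injective (mfderiv 𝓘(ℂ, E) 𝓘(ℂ, E') (c ∘ f) z₀)
    rw [h1]
    exact (hcb'.mfderiv_injective hcs).comp hinj
  let e : E ≃L[ℂ] E' :=
    (LinearEquiv.ofInjectiveOfFinrankEq (fderiv ℂ φ z₀).toLinearMap hφi hfr).toContinuousLinearEquiv
  have he : (e : E →L[ℂ] E') = fderiv ℂ φ z₀ := by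
    ext v
    rfl
  have hd : HasFDerivAt φ (e : E →L[ℂ] E') z₀ := by
    rw [he]
    exact (hφ.differentiableAt (by simp)).hasFDerivAt
  let F₀ := hφ.toOpenPartialHomeomorph φ hd (by simp)
  have hF₀ : ∀ z, F₀ z = φ z := fun z => rfl
  have hev : ∀ᶠ z in 𝓝 z₀, ContDiffAt ℂ ω φ z ∧
      fderiv ℂ φ z ∈ Set.range ((↑) : (E ≃L[ℂ] E') → E →L[ℂ] E') ∧ f z ∈ c.source := by
    refine (hφ.eventually (by simp)).and (Eventually.and ?_ ?_)
    · have h1 := ContinuousLinearEquiv.nhds e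
      rw [he] at h1
      exact (hφ.fderiv_right (m := ω) le_top).continuousAt.eventually h1
    · exact hf.continuousAt.eventually (c.open_source.mem_nhds hcs)
  obtain ⟨s, hs, hso, hzs⟩ := eventually_nhds_iff.1 hev
  let F₁ := F₀.restrOpen s hso
  have hF₁s : F₁.source = F₀.source ∩ s := F₀.restrOpen_source s hso
  have hF₁ : IsBihol (E := E) (E' := E') F₁ := by
    constructor
    · intro z hz
      rw [hF₁s] at hz
      exact (hs z hz.2).1.contMDiffAt.contMDiffWithinAt
    · intro y hy
      have h1 : F₁.symm y ∈ F₁.source := F₁.map_target hy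
      rw [hF₁s] at h1
      obtain ⟨h2, ⟨e', he'⟩, -⟩ := hs _ h1.2
      refine ((F₁.contDiffAt_symm (f₀' := e') hy ?_ h2).contMDiffAt).contMDiffWithinAt
      rw [he']
      exact (h2.differentiableAt (by simp)).hasFDerivAt
  refine ⟨F₁.trans c.symm, hF₁.trans hcb, ?_, fun z hz => ?_⟩
  · rw [OpenPartialHomeomorph.trans_source, hF₁s]
    refine ⟨⟨hφ.mem_toOpenPartialHomeomorph_source hd (by simp), hzs⟩, ?_⟩
    exact c.map_source hcs
  · rw [OpenPartialHomeomorph.trans_source, hF₁s] at hz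
    exact c.left_inv (hs z hz.1.2).2.2

end InverseFunction

section ExistsIsometry

variable {E E' : Type*} [NormedAddCommGroup E] [NormedSpace ℂ E] [FiniteDimensional ℂ E]
  [NormedAddCommGroup E'] [NormedSpace ℂ E'] [FiniteDimensional ℂ E']
variable {M' : Type*} [TopologicalSpace M'] [ChartedSpace E' M'] [IsManifold 𝓘(ℂ, E') ω M']
variable {L : Type*} [LieRing L] [LieAlgebra ℂ L] {X : L →ₗ[ℂ] E → E}
  {G : E → E →L[ℂ] E →L[ℂ] ℂ} {z₀ : E}

/-- A map which is equivariant under transitive Lie algebras of Killing fields is a local isometry,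
provided its differential at one point is an isometry. -/
lemma KillingAction.exists_isometry (h : KillingAction X G z₀) (hE : Module.finrank ℂ E = 3)
    (hE' : Module.finrank ℂ E' = 3) (hsurj : Function.Surjective (evalAt X z₀))
    (g' : Metric E' M') (X' : L → ∀ y : M', TangentSpace 𝓘(ℂ, E') y)
    (hol : ∀ a y, HolAt (X' a) y) (kil : ∀ a y, KillingAt g' (X' a) y) {f : E → M'}
    (hf : ContMDiffAt 𝓘(ℂ, E) 𝓘(ℂ, E') ω f z₀)
    (hfX : ∀ a, ∀ᶠ z in 𝓝 z₀, mfderiv 𝓘(ℂ, E) 𝓘(ℂ, E') f z (X a z) = X' a (f z))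
    (h0 : ∀ a b, g'.val (f z₀) (X' a (f z₀)) (X' b (f z₀)) = G z₀ (X a z₀) (X b z₀)) :
    ∃ F : OpenPartialHomeomorph E M', IsBihol (E := E) (E' := E') F ∧ z₀ ∈ F.source ∧
      F z₀ = f z₀ ∧ ∀ z ∈ F.source, readMetric g' F z = G z := by
  have hfX0 : ∀ a, mfderiv 𝓘(ℂ, E) 𝓘(ℂ, E') f z₀ (X a z₀) = X' a (f z₀) := fun a =>
    (hfX a).self_of_nhds
  have hinj : Function.Injective (mfderiv 𝓘(ℂ, E) 𝓘(ℂ, E') f z₀) := by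
    refine (injective_iff_map_eq_zero _).2 fun w hw => ?_
    obtain ⟨a, rfl⟩ := hsurj w
    refine h.nondeg _ fun w' => ?_
    obtain ⟨b, rfl⟩ := hsurj w'
    have h1 := h0 a b
    rw [← hfX0 a] at h1
    refine h1.symm.trans ?_
    have h2 : mfderiv 𝓘(ℂ, E) 𝓘(ℂ, E') f z₀ (X a z₀) = 0 := hw
    rw [h2, map_zero, LinearMap.zero_apply]
  obtain ⟨F, hF, hz, hFf⟩ := exists_isBihol hf hinj (hE.trans hE'.symm)
  have hFe : ∀ {z}, z ∈ F.source → F =ᶠ[𝓝 z] f := fun hz => by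
    filter_upwards [F.open_source.mem_nhds hz] with y hy using hFf y hy
  have hread : ∀ a, ∀ᶠ z in 𝓝 z₀, readField F (X' a) z = X a z := by
    intro a
    filter_upwards [hfX a, F.open_source.mem_nhds hz] with z h1 h2
    refine (hF.mpullback_eq_iff h2).2 ?_
    rw [(hFe h2).mfderiv_eq]
    exact h1.trans (congrArg (fun p : M' => (X' a p : E')) (hFf z h2).symm)
  have hu := h.metric_unique hE hsurj (hF.contDiffAt_readMetric hz g')
    (by
      intro a
      filter_upwards [(hread a).eventually_nhds, F.open_source.mem_nhds hz] with z h1 h2 u w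
      have h3 := hF.readMetric_killing h2 (hol a (F z)) (kil a (F z)) u w
      have h4 : readField F (X' a) =ᶠ[𝓝 z] X a := h1
      rwa [h4.fderiv_eq, h4.eq_of_nhds] at h3)
    (by
      ext u w
      obtain ⟨a, rfl⟩ := hsurj u
      obtain ⟨b, rfl⟩ := hsurj w
      have h1 := hF.readMetric_readField hz g' (X' a) (X' b)
      rw [(hread a).self_of_nhds, (hread b).self_of_nhds] at h1
      refine h1.trans (Eq.trans ?_ (h0 a b))
      rw [hFf z₀ hz])
  obtain ⟨s, hs, hso, hzs⟩ := eventually_nhds_iff.1 hu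
  refine ⟨F.restrOpen s hso, hF.restrOpen hso, ?_, hFf z₀ hz, fun z hz' => ?_⟩
  · rw [OpenPartialHomeomorph.restrOpen_source]
    exact ⟨hz, hzs⟩
  · rw [OpenPartialHomeomorph.restrOpen_source] at hz'
    exact hs z hz'.2

variable {M : Type*} [TopologicalSpace M] [ChartedSpace E M] [IsManifold 𝓘(ℂ, E) ω M]

/-- An isometry in a chart gives a local isometry of the manifold. -/
lemma isLocalIsometry_of_readMetric {g : Metric E M} {g' : Metric E' M'} {x : M}
    {F : OpenPartialHomeomorph E M'} (hF : IsBihol (E := E) (E' := E') F)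
    (hFG : ∀ z ∈ F.source, readMetric g' F z = readMetric g (chartAt E x).symm z) :
    IsLocalIsometry g g' ((chartAt E x).trans F) := by
  have hcb' := isBihol_chartAt_symm (E := E) x
  have hcb : IsBihol (E := E) (E' := E) (chartAt E x) := by
    have := hcb'.symm
    rwa [OpenPartialHomeomorph.symm_symm] at this
  have ht := hcb.trans hF
  refine ⟨ht.holo, ht.holo_symm, fun y hy v w => ?_⟩
  rw [OpenPartialHomeomorph.trans_source] at hy
  have e : mfderiv 𝓘(ℂ, E) 𝓘(ℂ, E') ((chartAt E x).trans F) y =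
      (mfderiv 𝓘(ℂ, E) 𝓘(ℂ, E') F (chartAt E x y)).comp
        (mfderiv 𝓘(ℂ, E) 𝓘(ℂ, E) (chartAt E x) y) :=
    mfderiv_comp y (hF.mdiff hy.2) (hcb.mdiff hy.1)
  rw [e]
  have h1 := congrArg (fun T : E →L[ℂ] E →L[ℂ] ℂ => T (mfderiv 𝓘(ℂ, E) 𝓘(ℂ, E) (chartAt E x) y v)
    (mfderiv 𝓘(ℂ, E) 𝓘(ℂ, E) (chartAt E x) y w)) (hFG _ hy.2)
  refine Eq.trans h1 ?_
  refine Eq.trans (readMetric_apply g (chartAt E x).symm (chartAt E x y) _ _) ?_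
  have e2 : (chartAt E x).symm (chartAt E x y) = y := (chartAt E x).left_inv hy.1
  have e3 := fun v : E => hcb.symm_comp hy.1 v
  refine (congrArg₂ (fun a b => (g.val ((chartAt E x).symm (chartAt E x y)) : E →ₗ[ℂ] E →ₗ[ℂ] ℂ) a b)
    (e3 v) (e3 w)).trans ?_
  exact congrArg (fun p : M => (g.val p : E →ₗ[ℂ] E →ₗ[ℂ] ℂ) v w) e2

end ExistsIsometry

section VectorValued

variable {E : Type*} [NormedAddCommGroup E] [NormedSpace ℂ E]
variable {X : Type*} [TopologicalSpace X] [ChartedSpace E X]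
variable {S T R : Type*} [NormedAddCommGroup S] [NormedSpace ℂ S] [NormedAddCommGroup T]
  [NormedSpace ℂ T] [NormedAddCommGroup R] [NormedSpace ℂ R]

/-- The derivative at `x` of the vector-valued function `f` along the tangent vector `v`. -/
def vecDeriv (f : X → S) (x : X) : TangentSpace 𝓘(ℂ, E) x →ₗ[ℂ] S :=
  (mfderiv 𝓘(ℂ, E) 𝓘(ℂ, S) f x).toLinearMap

lemma vecDeriv_comp {F : S → T} {f : X → S} {x : X} {F' : S →L[ℂ] T}
    (hF : HasFDerivAt F F' (f x)) (hf : MDifferentiableAt 𝓘(ℂ, E) 𝓘(ℂ, S) f x)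
    (v : TangentSpace 𝓘(ℂ, E) x) :
    vecDeriv (fun y => F (f y)) x v = F' (vecDeriv f x v) := by
  have h := mfderiv_comp x hF.differentiableAt.mdifferentiableAt hf
  rw [mfderiv_eq_fderiv, hF.fderiv] at h
  exact congrArg (fun L => L v) h

lemma vecDeriv_prodMk {f : X → S} {h : X → T} {x : X}
    (hf : MDifferentiableAt 𝓘(ℂ, E) 𝓘(ℂ, S) f x) (hh : MDifferentiableAt 𝓘(ℂ, E) 𝓘(ℂ, T) h x)
    (v : TangentSpace 𝓘(ℂ, E) x) :
    vecDeriv (fun y => (f y, h y)) x v = (vecDeriv f x v, vecDeriv h x v) := by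
  have hp : MDifferentiableAt 𝓘(ℂ, E) 𝓘(ℂ, S × T) (fun y => (f y, h y)) x := hf.prodMk_space hh
  refine Prod.ext ?_ ?_
  · exact (vecDeriv_comp (F := fun p : S × T => p.1) (f := fun y => (f y, h y))
      (ContinuousLinearMap.fst ℂ S T).hasFDerivAt hp v).symm
  · exact (vecDeriv_comp (F := fun p : S × T => p.2) (f := fun y => (f y, h y))
      (ContinuousLinearMap.snd ℂ S T).hasFDerivAt hp v).symm

lemma vecDeriv_bilin (B : S →L[ℂ] T →L[ℂ] R) {f : X → S} {h : X → T} {x : X}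
    (hf : MDifferentiableAt 𝓘(ℂ, E) 𝓘(ℂ, S) f x) (hh : MDifferentiableAt 𝓘(ℂ, E) 𝓘(ℂ, T) h x)
    (v : TangentSpace 𝓘(ℂ, E) x) :
    vecDeriv (fun y => B (f y) (h y)) x v =
      B (f x) (vecDeriv h x v) + B (vecDeriv f x v) (h x) := by
  have hp : MDifferentiableAt 𝓘(ℂ, E) 𝓘(ℂ, S × T) (fun y => (f y, h y)) x :=
    hf.prodMk_space hh
  have hB := B.isBoundedBilinearMap.hasFDerivAt (f x, h x)
  have h2 := vecDeriv_comp (F := fun p : S × T => B p.1 p.2) (f := fun y => (f y, h y)) hB hp v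
  rw [vecDeriv_prodMk hf hh] at h2
  exact h2

variable [IsManifold 𝓘(ℂ, E) ω X]

lemma HolAt.mdifferentiableAt_vecDeriv {ι : X → S} (hι : ContMDiff 𝓘(ℂ, E) 𝓘(ℂ, S) ω ι)
    {V : ∀ y : X, TangentSpace 𝓘(ℂ, E) y} {x : X} (hV : HolAt V x) :
    MDifferentiableAt 𝓘(ℂ, E) 𝓘(ℂ, S) (fun y => vecDeriv ι y (V y)) x :=
  (hV.push hι).mdifferentiableAt (by simp)

lemma vecDeriv_mlieBracket [CompleteSpace E] {ι : X → S} (hι : ContMDiff 𝓘(ℂ, E) 𝓘(ℂ, S) ω ι)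
    {V W : ∀ y : X, TangentSpace 𝓘(ℂ, E) y} {x : X} (hV : HolAt V x) (hW : HolAt W x) :
    vecDeriv ι x (mlieBracket 𝓘(ℂ, E) V W x) =
      vecDeriv (fun y => vecDeriv ι y (W y)) x (V x) -
      vecDeriv (fun y => vecDeriv ι y (V y)) x (W x) := by
  refine (SeparatingDual.eq_iff_forall_dual_eq (R := ℂ)).2 fun l => ?_
  have hd : ∀ y, MDifferentiableAt 𝓘(ℂ, E) 𝓘(ℂ, S) ι y := fun y =>
    hι.mdifferentiable (by simp) y
  have h1 := dirDeriv_mlieBracket (f := fun y => l (ι y)) hV hW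
    (l.contMDiff.contMDiffAt.comp x hι.contMDiffAt)
  have h2 : ∀ y (v : TangentSpace 𝓘(ℂ, E) y), dirDeriv (fun y => l (ι y)) y v =
      l (vecDeriv ι y v) := fun y v => vecDeriv_comp l.hasFDerivAt (hd y) v
  simp only [h2] at h1
  rw [h1, map_sub]
  exact congrArg₂ _ (vecDeriv_comp l.hasFDerivAt (hW.mdifferentiableAt_vecDeriv hι) _)
    (vecDeriv_comp l.hasFDerivAt (hV.mdifferentiableAt_vecDeriv hι) _)

/-- The derivative of a field in an ambient space along a restricted ambient field. -/
lemma vecDeriv_vecDeriv [CompleteSpace E] {ι : X → S} (hι : ContMDiff 𝓘(ℂ, E) 𝓘(ℂ, S) ω ι)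
    {V W : ∀ y : X, TangentSpace 𝓘(ℂ, E) y} {x : X} (hV : HolAt V x) (hW : HolAt W x)
    {A : S → S} {A' : S →L[ℂ] S} (hA : HasFDerivAt A A' (ι x))
    (hVA : ∀ y, vecDeriv ι y (V y) = A (ι y)) :
    vecDeriv (fun y => vecDeriv ι y (W y)) x (V x) =
      vecDeriv ι x (mlieBracket 𝓘(ℂ, E) V W x) + A' (vecDeriv ι x (W x)) := by
  rw [vecDeriv_mlieBracket hι hV hW]
  simp only [hVA]
  rw [vecDeriv_comp hA (hι.mdifferentiable (by simp) x)]
  abel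

end VectorValued

section HolEmbedding

variable {E : Type*} [NormedAddCommGroup E] [NormedSpace ℂ E]
variable {X : Type*} [TopologicalSpace X] [ChartedSpace E X]
variable {S : Type*} [NormedAddCommGroup S] [NormedSpace ℂ S]

variable (E) in
/-- A holomorphic embedding in a vector space; the charts extend to the ambient space. -/
structure IsHolEmbedding (ι : X → S) : Prop where
  embedding : Topology.IsEmbedding ι
  holo : ContMDiff 𝓘(ℂ, E) 𝓘(ℂ, S) ω ι
  retract : ∀ x, ∃ φ : S → E, ContDiffAt ℂ ω φ (ι x) ∧ ∀ y, φ (ι y) = chartAt E x y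

lemma isHolEmbedding_ιSL : IsHolEmbedding (ℂ × ℂ × ℂ) ιSL where
  embedding := ιSL_embedding
  holo := ιSL_contMDiff
  retract x := by
    have hx := (chartsSL_cover x).choose_spec
    exact ⟨(chartsSL (chartsSL_cover x).choose).φ,
      (chartsSL (chartsSL_cover x).choose).holo_φ.contDiffAt
      ((chartsSL (chartsSL_cover x).choose).isOpen_U.mem_nhds hx), fun y => rfl⟩

lemma isHolEmbedding_ιCS : IsHolEmbedding (ℂ × ℂ × ℂ) ιCS where
  embedding := ιCS_embedding
  holo := ιCS_contMDiff
  retract x := by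
    have hx := (chartsCS_cover x).choose_spec
    exact ⟨(chartsCS (chartsCS_cover x).choose).φ,
      (chartsCS (chartsCS_cover x).choose).holo_φ.contDiffAt
      ((chartsCS (chartsCS_cover x).choose).isOpen_U.mem_nhds hx), fun y => rfl⟩

variable {D N : Type*} [NormedAddCommGroup D] [NormedSpace ℂ D] [TopologicalSpace N]
  [ChartedSpace D N]

/-- Holomorphy of maps into an embedded manifold. -/
lemma IsHolEmbedding.contMDiffAt {ι : X → S} (hι : IsHolEmbedding E ι) {f : N → X} {z : N}
    (h : ContMDiffAt 𝓘(ℂ, D) 𝓘(ℂ, S) ω (fun y => ι (f y)) z) :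
    ContMDiffAt 𝓘(ℂ, D) 𝓘(ℂ, E) ω f z := by
  rw [contMDiffAt_iff_target]
  refine ⟨hι.embedding.isInducing.continuousAt_iff.2 h.continuousAt, ?_⟩
  obtain ⟨φ, hφ, he⟩ := hι.retract (f z)
  have h1 : ContMDiffAt 𝓘(ℂ, D) 𝓘(ℂ, E) ω (fun y => φ (ι (f y))) z :=
    ContMDiffAt.comp (g := φ) z hφ.contMDiffAt h
  refine h1.congr_of_eventuallyEq (Eventually.of_forall fun y => ?_)
  simp [he]

variable [IsManifold 𝓘(ℂ, E) ω X]

/-- Holomorphy of vector fields on an embedded manifold. -/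
lemma IsHolEmbedding.holAt [FiniteDimensional ℂ E] {ι : X → S} (hι : IsHolEmbedding E ι)
    {V : ∀ y : X, TangentSpace 𝓘(ℂ, E) y} {x : X}
    (h : ContMDiffAt 𝓘(ℂ, E) 𝓘(ℂ, S) ω (fun y => vecDeriv ι y (V y)) x) : HolAt V x := by
  obtain ⟨φ, hφ, he⟩ := hι.retract x
  have hcs := isBihol_chartAt_symm (E := E) x
  have hc : IsBihol (E := E) (E' := E) (chartAt E x) := by
    have := hcs.symm
    rwa [OpenPartialHomeomorph.symm_symm] at this
  have hx := mem_chart_source E x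
  have hsx : ContMDiffAt 𝓘(ℂ, E) 𝓘(ℂ, E) ω (chartAt E x).symm (chartAt E x x) :=
    hcs.contMDiffAt (chartAt_mem_symm_source x)
  have hxx := chartAt_symm_self (E := E) x
  let W : E → E := fun z => fderiv ℂ φ (ι ((chartAt E x).symm z))
    (vecDeriv ι ((chartAt E x).symm z) (V ((chartAt E x).symm z)))
  have hW : ContDiffAt ℂ ω W (chartAt E x x) := by
    rw [← contMDiffAt_iff_contDiffAt]
    have h1 : ContMDiffAt 𝓘(ℂ, E) 𝓘(ℂ, S →L[ℂ] E) ω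
        (fun z => fderiv ℂ φ (ι ((chartAt E x).symm z))) (chartAt E x x) := by
      have h3 : ContDiffAt ℂ ω (fderiv ℂ φ) (ι ((chartAt E x).symm (chartAt E x x))) := by
        rw [hxx]
        exact hφ.fderiv_right (m := ω) le_top
      exact ContMDiffAt.comp (g := fderiv ℂ φ) _ h3.contMDiffAt
        (hι.holo.contMDiffAt.comp _ hsx)
    refine h1.clm_apply ?_
    refine ContMDiffAt.comp (g := fun y => vecDeriv ι y (V y)) _ ?_ hsx
    rw [hxx]
    exact h
  have hWH : HolAt (M := E) W (chartAt E x x) := contMDiffAt_vectorSpace_iff_contDiffAt.2 hW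
  have h2 := hWH.mpullback (hc.contMDiffAt hx) (hc.isInvertible hx)
  refine h2.congr ?_
  have hφ' : ∀ᶠ y in 𝓝 x, ContDiffAt ℂ ω φ (ι y) :=
    hι.embedding.continuous.continuousAt.eventually (hφ.eventually (by simp))
  filter_upwards [(chartAt E x).open_source.mem_nhds hx, hφ'] with y hy hφy
  refine ((hc.mpullback_eq_iff hy).2 ?_).symm
  have h3 := mfderiv_comp y (hφy.differentiableAt (by simp)).mdifferentiableAt
    (hι.holo.mdifferentiable (by simp) y)
  have h4 : (φ ∘ ι) = chartAt E x := funext he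
  rw [h4, mfderiv_eq_fderiv] at h3
  rw [h3]
  have h5 : (chartAt E x).symm (chartAt E x y) = y := (chartAt E x).left_inv hy
  exact (congrArg (fun p => fderiv ℂ φ (ι p) (vecDeriv ι p (V p))) h5).symm

/-- A field along which a matrix of frame forms changes by a skew endomorphism is Killing. -/
lemma killingAt_of_form [FiniteDimensional ℂ S] {g : Metric E X} {V : ∀ y : X, TangentSpace 𝓘(ℂ, E) y}
    {x : X} (Q : S →ₗ[ℂ] S →ₗ[ℂ] ℂ) (μ : ∀ y : X, TangentSpace 𝓘(ℂ, E) y →ₗ[ℂ] S)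
    (hg : ∀ y v w, g.val y v w = Q (μ y v) (μ y w)) (K : S → S)
    (hK : ∀ v w : TangentSpace 𝓘(ℂ, E) x, Q (K (μ x v)) (μ x w) + Q (μ x v) (K (μ x w)) = 0)
    (hμ : ∀ W : (∀ y : X, TangentSpace 𝓘(ℂ, E) y), HolAt W x →
      MDifferentiableAt 𝓘(ℂ, E) 𝓘(ℂ, S) (fun y => μ y (W y)) x ∧
      vecDeriv (fun y => μ y (W y)) x (V x) =
        μ x (mlieBracket 𝓘(ℂ, E) V W x) + K (μ x (W x))) :
    KillingAt g V x := by
  intro W Z hW hZ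
  let B : S →L[ℂ] S →L[ℂ] ℂ := LinearMap.toContinuousLinearMap
    ((LinearMap.toContinuousLinearMap (𝕜 := ℂ) (E := S) (F' := ℂ)).toLinearMap.comp Q)
  have hB : ∀ a b, Q a b = B a b := fun _ _ => rfl
  have h1 := vecDeriv_bilin B (hμ W hW).1 (hμ Z hZ).1 (V x)
  simp only [hg]
  simp only [hB] at hK ⊢
  refine h1.trans ?_
  rw [(hμ W hW).2, (hμ Z hZ).2]
  simp only [map_add, _root_.add_apply]
  linear_combination hK (W x) (Z x)

end HolEmbedding

section AmbientProducts

/-- The product of matrices, as a continuous bilinear map. -/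
def mulM : Mat2 →L[ℂ] Mat2 →L[ℂ] Mat2 :=
  LinearMap.toContinuousLinearMap
    ((LinearMap.toContinuousLinearMap (𝕜 := ℂ) (E := Mat2) (F' := Mat2)).toLinearMap.comp
      (LinearMap.mul ℂ (Matrix (Fin 2) (Fin 2) ℂ)))

lemma mulM_apply (A B : Mat2) (i j : Fin 2) : mulM A B i j = A i 0 * B 0 j + A i 1 * B 1 j := by
  change (Matrix.of A * Matrix.of B) i j = _
  rw [Matrix.mul_apply, Fin.sum_univ_two]
  rfl

/-- The adjugate of a matrix, as a continuous linear map. -/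
def adjM : Mat2 →L[ℂ] Mat2 :=
  LinearMap.toContinuousLinearMap
    { toFun := fun A => ![![A 1 1, -A 0 1], ![-A 1 0, A 0 0]]
      map_add' := fun A B => by
        ext i j
        fin_cases i <;> fin_cases j <;> simp <;> ring
      map_smul' := fun t A => by
        ext i j
        fin_cases i <;> fin_cases j <;> simp }

lemma adjM_00 (A : Mat2) : adjM A 0 0 = A 1 1 := rfl
lemma adjM_01 (A : Mat2) : adjM A 0 1 = -A 0 1 := rfl
lemma adjM_10 (A : Mat2) : adjM A 1 0 = -A 1 0 := rfl
lemma adjM_11 (A : Mat2) : adjM A 1 1 = A 0 0 := rfl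

/-- A traceless matrix as an element of `Mat2`. -/
def sl2.toMat : sl2 →ₗ[ℂ] Mat2 := (LieAlgebra.SpecialLinear.sl (Fin 2) ℂ).toSubmodule.subtype

lemma sl2.toMat_apply (u : sl2) (i j : Fin 2) : sl2.toMat u i j = u.1 i j := rfl

lemma Mat2.ext {A B : Mat2} (h : ∀ i j, A i j = B i j) : A = B := funext fun i => funext fun j => h i j

end AmbientProducts

section FieldsSL

lemma vecDeriv_ιSL (a : SL2) (w : TangentSpace 𝓘(ℂ, ℂ × ℂ × ℂ) a) :
    vecDeriv ιSL a w = mulM (ιSL a) (sl2.toMat (maurerCartan a w)) := by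
  change dιSL a w = (a : Matrix (Fin 2) (Fin 2) ℂ) * (maurerCartan a w).1
  rw [maurerCartan_val, ← Matrix.mul_assoc, ← Matrix.SpecialLinearGroup.coe_mul, mul_inv_cancel,
    Matrix.SpecialLinearGroup.coe_one, one_mul]
  rfl

lemma toMat_maurerCartan (a : SL2) (w : TangentSpace 𝓘(ℂ, ℂ × ℂ × ℂ) a) :
    sl2.toMat (maurerCartan a w) = mulM (adjM (ιSL a)) (vecDeriv ιSL a w) := by
  change (maurerCartan a w).1 = _
  rw [maurerCartan_val, Matrix.SpecialLinearGroup.SL2_inv_expl]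
  refine Mat2.ext fun i j => ?_
  rw [mulM_apply, Matrix.mul_apply, Fin.sum_univ_two]
  fin_cases i <;> rfl

/-- The endomorphism `x ↦ - u x + s x v` of the space of matrices. -/
def ambSL (v : sl2) (p : ℂ × sl2) : Mat2 →L[ℂ] Mat2 :=
  p.1 • mulM.flip (sl2.toMat v) - mulM (sl2.toMat p.2)

lemma ambSL_apply (v : sl2) (p : ℂ × sl2) (x : Mat2) :
    ambSL v p x = p.1 • mulM x (sl2.toMat v) - mulM (sl2.toMat p.2) x := rfl

/-- The vector field `x ↦ - u x + s x v` on `SL(2, ℂ)`. -/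
def fieldSL (v : sl2) (p : ℂ × sl2) (a : SL2) : TangentSpace 𝓘(ℂ, ℂ × ℂ × ℂ) a :=
  (LinearEquiv.ofBijective (maurerCartan a) (maurerCartan_bijective a)).symm
    (p.1 • v - AdSL a⁻¹ p.2)

lemma maurerCartan_fieldSL (v : sl2) (p : ℂ × sl2) (a : SL2) :
    maurerCartan a (fieldSL v p a) = p.1 • v - AdSL a⁻¹ p.2 :=
  LinearEquiv.apply_symm_apply (LinearEquiv.ofBijective (maurerCartan a) (maurerCartan_bijective a)) _

lemma vecDeriv_fieldSL (v : sl2) (p : ℂ × sl2) (a : SL2) :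
    vecDeriv ιSL a (fieldSL v p a) = ambSL v p (ιSL a) := by
  rw [vecDeriv_ιSL, maurerCartan_fieldSL, map_sub, map_smul, map_sub, map_smul, ambSL_apply]
  congr 1
  change (a : Matrix (Fin 2) (Fin 2) ℂ) * (AdSL a⁻¹ p.2).1 = p.2.1 * (a : Matrix (Fin 2) (Fin 2) ℂ)
  rw [AdSL_val, inv_inv, ← Matrix.mul_assoc, ← Matrix.mul_assoc, ← Matrix.SpecialLinearGroup.coe_mul,
    mul_inv_cancel, Matrix.SpecialLinearGroup.coe_one, one_mul]

lemma holAt_fieldSL (v : sl2) (p : ℂ × sl2) (a : SL2) : HolAt (fieldSL v p) a := by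
  refine isHolEmbedding_ιSL.holAt ?_
  simp only [vecDeriv_fieldSL]
  exact (ambSL v p).contMDiff.contMDiffAt.comp a ιSL_contMDiff.contMDiffAt

lemma mlieBracket_fieldSL (v : sl2) (p r : ℂ × sl2) (a : SL2) :
    mlieBracket 𝓘(ℂ, ℂ × ℂ × ℂ) (fieldSL v p) (fieldSL v r) a = fieldSL v ⁅p, r⁆ a := by
  refine dιSL_injective a ?_
  change vecDeriv ιSL a _ = vecDeriv ιSL a _
  rw [vecDeriv_mlieBracket ιSL_contMDiff (holAt_fieldSL v p a) (holAt_fieldSL v r a)]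
  simp only [vecDeriv_fieldSL]
  have hd := ιSL_contMDiff.mdifferentiable (by simp) a
  rw [vecDeriv_comp (ambSL v r).hasFDerivAt hd, vecDeriv_comp (ambSL v p).hasFDerivAt hd,
    vecDeriv_fieldSL, vecDeriv_fieldSL, prod_lie]
  refine Mat2.ext fun i j => ?_
  have h : ∀ k l, sl2.toMat ⁅p.2, r.2⁆ k l =
      (p.2.1 k 0 * r.2.1 0 l + p.2.1 k 1 * r.2.1 1 l) -
      (r.2.1 k 0 * p.2.1 0 l + r.2.1 k 1 * p.2.1 1 l) := by
    intro k l
    rw [sl2.toMat_apply, sl2_lie_val, Matrix.sub_apply, Matrix.mul_apply, Matrix.mul_apply,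
      Fin.sum_univ_two, Fin.sum_univ_two]
  simp only [ambSL_apply, Pi.sub_apply, Pi.smul_apply, mulM_apply, h, sl2.toMat_apply, smul_eq_mul]
  ring

lemma killingAt_fieldSL (q : LinearMap.BilinForm ℂ sl2) (hs : ∀ X Y, q X Y = q Y X)
    (hn : ∀ X, (∀ Y, q X Y = 0) → X = 0) (v : sl2) (p : ℂ × sl2)
    (hv : ∀ X Y, p.1 * (q ⁅v, X⁆ Y + q X ⁅v, Y⁆) = 0) (a : SL2) :
    KillingAt (leftInvariant q hs hn) (fieldSL v p) a := by
  obtain ⟨P, hP⟩ := sl2.toMat.exists_leftInverse_of_injective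
    (Submodule.ker_subtype (LieAlgebra.SpecialLinear.sl (Fin 2) ℂ).toSubmodule)
  have hP' : ∀ X : sl2, P (sl2.toMat X) = X := fun X => congrArg (fun L => L X) hP
  have hK : ∀ X : sl2, p.1 • (mulM (sl2.toMat X) (sl2.toMat v) - mulM (sl2.toMat v) (sl2.toMat X)) =
      sl2.toMat (-(p.1 • ⁅v, X⁆)) := by
    intro X
    rw [map_neg, map_smul, ← smul_neg]
    congr 1
    refine (neg_sub (mulM (sl2.toMat v) (sl2.toMat X)) _).symm.trans (congrArg Neg.neg ?_)
    exact (sl2_lie_val v X).symm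
  refine killingAt_of_form (q.compl₁₂ P P) (fun y => sl2.toMat.comp (maurerCartan y)) ?_
    (fun A => p.1 • (mulM A (sl2.toMat v) - mulM (sl2.toMat v) A)) ?_ ?_
  · intro y w z
    simp only [LinearMap.compl₁₂_apply, LinearMap.comp_apply, hP']
    rfl
  · intro w z
    simp only [LinearMap.compl₁₂_apply, LinearMap.comp_apply, hP', hK, map_neg, map_smul,
      LinearMap.neg_apply, LinearMap.smul_apply, smul_eq_mul]
    linear_combination - hv (maurerCartan a w) (maurerCartan a z)
  · intro W hW
    have hd := ιSL_contMDiff.mdifferentiable (by simp) a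
    have hda : MDifferentiableAt 𝓘(ℂ, ℂ × ℂ × ℂ) 𝓘(ℂ, Mat2) (fun y => adjM (ιSL y)) a :=
      MDifferentiableAt.comp (g := adjM) a adjM.differentiableAt.mdifferentiableAt hd
    have hdW := hW.mdifferentiableAt_vecDeriv ιSL_contMDiff
    simp only [LinearMap.comp_apply, toMat_maurerCartan]
    refine ⟨?_, ?_⟩
    · exact (MDifferentiableAt.comp (g := mulM) a mulM.differentiableAt.mdifferentiableAt
        hda).clm_apply hdW
    · rw [vecDeriv_bilin mulM hda hdW,
        vecDeriv_vecDeriv ιSL_contMDiff (holAt_fieldSL v p a) hW (ambSL v p).hasFDerivAt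
          (vecDeriv_fieldSL v p), vecDeriv_comp adjM.hasFDerivAt hd, vecDeriv_fieldSL, map_add,
        add_assoc]
      congr 1
      have ht : sl2.toMat p.2 1 1 = - sl2.toMat p.2 0 0 := sl2_11 _
      have ht' : sl2.toMat v 1 1 = - sl2.toMat v 0 0 := sl2_11 _
      refine Mat2.ext fun i j => ?_
      fin_cases i <;> fin_cases j <;>
      simp only [ambSL_apply, Pi.sub_apply, Pi.smul_apply, Pi.add_apply, mulM_apply, smul_eq_mul,
        Fin.zero_eta, Fin.mk_one, Fin.isValue, adjM_00, adjM_01, adjM_10, adjM_11, ht, ht']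
      · ring1
      · ring1
      · ring1
      · ring1

end FieldsSL

section FieldsCS

/-- The linear map `(z, A) ↦ (0, [A, u])`. -/
def linCS (u : sl2) : (ℂ × Mat2) →L[ℂ] ℂ × Mat2 :=
  (ContinuousLinearMap.inr ℂ ℂ Mat2).comp ((mulM.flip (sl2.toMat u) - mulM (sl2.toMat u)).comp
    (ContinuousLinearMap.snd ℂ ℂ Mat2))

lemma linCS_apply (u : sl2) (x : ℂ × Mat2) :
    linCS u x = (0, mulM x.2 (sl2.toMat u) - mulM (sl2.toMat u) x.2) := rfl

/-- The affine map `(z, A) ↦ (s, [A, u])`. -/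
def ambCS (p : ℂ × sl2) (x : ℂ × Mat2) : ℂ × Mat2 := (p.1, 0) + linCS p.2 x

lemma ambCS_apply (p : ℂ × sl2) (x : ℂ × Mat2) :
    ambCS p x = (p.1, mulM x.2 (sl2.toMat p.2) - mulM (sl2.toMat p.2) x.2) := by
  rw [ambCS, linCS_apply, Prod.mk_add_mk, add_zero, zero_add]

lemma hasFDerivAt_ambCS (p : ℂ × sl2) (x : ℂ × Mat2) : HasFDerivAt (ambCS p) (linCS p.2) x :=
  (linCS p.2).hasFDerivAt.const_add _

lemma exists_fieldCS (p : ℂ × sl2) (y : ℂ × S2) : ∃ w, dιCS y w = ambCS p (ιCS y) := by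
  have h : sl2.toMat p.2 1 1 = - sl2.toMat p.2 0 0 := sl2_11 _
  obtain ⟨h1, h2⟩ := y.2.eqs
  refine dιCS_surj y _ ?_ ?_ <;>
  simp only [ambCS_apply, Pi.sub_apply, mulM_apply, ιCS, h1, h] <;> ring

/-- The vector field `(z, A) ↦ (s, [A, u])` on `ℂ × S₂`. -/
def fieldCS (p : ℂ × sl2) (y : ℂ × S2) : TangentSpace 𝓘(ℂ, ℂ × ℂ × ℂ) y := (exists_fieldCS p y).choose

lemma vecDeriv_fieldCS (p : ℂ × sl2) (y : ℂ × S2) :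
    vecDeriv ιCS y (fieldCS p y) = ambCS p (ιCS y) := (exists_fieldCS p y).choose_spec

lemma holAt_fieldCS (p : ℂ × sl2) (y : ℂ × S2) : HolAt (fieldCS p) y := by
  refine isHolEmbedding_ιCS.holAt ?_
  simp only [vecDeriv_fieldCS]
  have h : ContDiff ℂ ω (ambCS p) := contDiff_const.add (linCS p.2).contDiff
  exact h.contMDiff.contMDiffAt.comp y ιCS_contMDiff.contMDiffAt

lemma mlieBracket_fieldCS (p r : ℂ × sl2) (y : ℂ × S2) :
    mlieBracket 𝓘(ℂ, ℂ × ℂ × ℂ) (fieldCS p) (fieldCS r) y = fieldCS ⁅p, r⁆ y := by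
  refine dιCS_injective y ?_
  change vecDeriv ιCS y _ = vecDeriv ιCS y _
  rw [vecDeriv_mlieBracket ιCS_contMDiff (holAt_fieldCS p y) (holAt_fieldCS r y)]
  simp only [vecDeriv_fieldCS]
  have hd := ιCS_contMDiff.mdifferentiable (by simp) y
  rw [vecDeriv_comp (hasFDerivAt_ambCS r _) hd, vecDeriv_comp (hasFDerivAt_ambCS p _) hd,
    vecDeriv_fieldCS, vecDeriv_fieldCS, prod_lie]
  simp only [linCS_apply, ambCS_apply]
  refine Prod.ext (sub_self _) (Mat2.ext fun i j => ?_)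
  have h : ∀ k l, sl2.toMat ⁅p.2, r.2⁆ k l =
      (p.2.1 k 0 * r.2.1 0 l + p.2.1 k 1 * r.2.1 1 l) -
      (r.2.1 k 0 * p.2.1 0 l + r.2.1 k 1 * p.2.1 1 l) := by
    intro k l
    rw [sl2.toMat_apply, sl2_lie_val, Matrix.sub_apply, Matrix.mul_apply, Matrix.mul_apply,
      Fin.sum_univ_two, Fin.sum_univ_two]
  simp only [Prod.snd_sub, Pi.sub_apply, mulM_apply, h, sl2.toMat_apply]
  ring

lemma killingAt_fieldCS (c : ℂ) (hc : c ≠ 0) (p : ℂ × sl2) (y : ℂ × S2) :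
    KillingAt (productMetric c hc) (fieldCS p) y := by
  refine killingAt_of_form (ambientForm c) dιCS (fun _ _ _ => rfl) (linCS p.2) ?_ ?_
  · intro v w
    simp only [ambientForm_apply, linCS_apply, Pi.sub_apply, mulM_apply]
    ring
  · intro W hW
    exact ⟨hW.mdifferentiableAt_vecDeriv ιCS_contMDiff,
      vecDeriv_vecDeriv ιCS_contMDiff (holAt_fieldCS p y) hW (hasFDerivAt_ambCS p _)
        (vecDeriv_fieldCS p)⟩

end FieldsCS

section Potential

variable {E : Type*} [NormedAddCommGroup E] [NormedSpace ℂ E] [FiniteDimensional ℂ E]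
variable {L : Type*} [LieRing L] [LieAlgebra ℂ L] {X : L →ₗ[ℂ] E → E}
  {G : E → E →L[ℂ] E →L[ℂ] ℂ} {z₀ : E}

namespace KillingAction

lemma exists_local_frame (h : KillingAction X G z₀) (hE : Module.finrank ℂ E = 3)
    (hsurj : Function.Surjective (evalAt X z₀)) :
    ∃ (p : Fin 3 → L) (θ : Fin 3 → E → E →L[ℂ] ℂ), (∀ i, ContDiffAt ℂ ω (θ i) z₀) ∧
      ∀ᶠ z in 𝓝 z₀, ∀ v, ∑ i, θ i z v • X (p i) z = v := by
  obtain ⟨p, hp⟩ := exists_frame_of_surjective hE hsurj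
  obtain ⟨θ, hθ, hθ'⟩ := exists_dual_frame (Y := fun i => X (p i)) (fun i => h.smooth _) hE hp
  exact ⟨p, θ, hθ, hθ'.mono fun z hz => hz.2⟩

lemma eventually_const (h : KillingAction X G z₀) (hE : Module.finrank ℂ E = 3)
    (hsurj : Function.Surjective (evalAt X z₀)) {φ : E → ℂ} (hφ : ContDiffAt ℂ ω φ z₀)
    (h0 : ∀ a, ∀ᶠ z in 𝓝 z₀, fderiv ℂ φ z (X a z) = 0) : ∀ᶠ z in 𝓝 z₀, φ z = φ z₀ := by
  obtain ⟨p, θ, -, hθ⟩ := h.exists_local_frame hE hsurj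
  refine eventually_eq_const_of_fderiv_eq_zero
    ((hφ.eventually (by simp)).mono fun z hz => hz.differentiableAt (by simp)) ?_
  filter_upwards [hθ, eventually_all.2 fun i => h0 (p i)] with z h1 h2
  ext v
  rw [← h1 v, map_sum]
  simp [h2]

/-- A function with prescribed derivatives along the Killing fields. -/
lemma exists_potential (h : KillingAction X G z₀) (hE : Module.finrank ℂ E = 3)
    (hsurj : Function.Surjective (evalAt X z₀)) (B : L →ₗ[ℂ] E → ℂ)
    (hB : ∀ a, ContDiffAt ℂ ω (B a) z₀)
    (hker : ∀ᶠ z in 𝓝 z₀, ∀ a, X a z = 0 → B a z = 0)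
    (hco : ∀ a b, ∀ᶠ z in 𝓝 z₀,
      fderiv ℂ (B b) z (X a z) - fderiv ℂ (B a) z (X b z) = B ⁅a, b⁆ z) :
    ∃ τ : E → ℂ, ContDiffAt ℂ ω τ z₀ ∧ τ z₀ = 0 ∧
      ∀ a, ∀ᶠ z in 𝓝 z₀, fderiv ℂ τ z (X a z) = B a z := by
  obtain ⟨p, θ, hθ, hp⟩ := h.exists_local_frame hE hsurj
  let β : E → E →L[ℂ] ℂ := fun z => ∑ i, B (p i) z • θ i z
  have hβ : ContDiffAt ℂ ω β z₀ := ContDiffAt.sum fun i _ => (hB _).smul (hθ i)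
  have hβX : ∀ᶠ z in 𝓝 z₀, ∀ a, β z (X a z) = B a z := by
    filter_upwards [hp, hker] with z h1 h2 a
    have h3 : X (a - ∑ i, θ i z (X a z) • p i) z = 0 := by
      rw [map_sub, map_sum]
      simp only [map_smul, Pi.sub_apply, Finset.sum_apply, Pi.smul_apply]
      rw [h1, sub_self]
    have h4 := h2 _ h3
    rw [map_sub, map_sum] at h4
    simp only [map_smul, Pi.sub_apply, Finset.sum_apply, Pi.smul_apply, smul_eq_mul] at h4
    rw [sub_eq_zero.1 h4]
    simp only [β, sum_apply, smul_apply, smul_eq_mul]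
    exact Finset.sum_congr rfl fun i _ => mul_comm _ _
  have hsym : ∀ i j, ∀ᶠ z in 𝓝 z₀, fderiv ℂ β z (X (p i) z) (X (p j) z) =
      fderiv ℂ β z (X (p j) z) (X (p i) z) := by
    intro i j
    filter_upwards [hβX.eventually_nhds, hβ.eventually (by simp), hco (p i) (p j),
      h.bracket (p i) (p j), (h.smooth (p i)).eventually (by simp),
      (h.smooth (p j)).eventually (by simp)] with z h1 h2 h3 h4 h5 h6
    have key : ∀ k, ContDiffAt ℂ ω (X (p k)) z → ∀ v, fderiv ℂ (B (p k)) z v =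
        fderiv ℂ β z v (X (p k) z) + β z (fderiv ℂ (X (p k)) z v) := by
      intro k hk v
      have e : B (p k) =ᶠ[𝓝 z] fun z => β z (X (p k) z) := h1.mono fun w hw => (hw (p k)).symm
      rw [e.fderiv_eq, fderiv_clm_apply (h2.differentiableAt (by simp))
        (hk.differentiableAt (by simp))]
      simp [add_comm]
    rw [key j h6, key i h5, ← h1.self_of_nhds, h4, map_sub] at h3
    linear_combination h3
  obtain ⟨τ, hτ, hτ0, hτβ⟩ := exists_primitive hβ.analyticAt (by
    filter_upwards [hp, eventually_all.2 fun i => eventually_all.2 fun j => hsym i j]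
      with z h1 h2 x y
    rw [← h1 x, ← h1 y]
    simp only [map_sum, sum_apply, map_smul, smul_apply, smul_eq_mul]
    simp only [Finset.mul_sum]
    rw [Finset.sum_comm]
    refine Finset.sum_congr rfl fun i _ => ?_
    refine Finset.sum_congr rfl fun j _ => ?_
    rw [h2 i j]
    ring)
  refine ⟨τ, hτ.contDiffAt, hτ0, fun a => ?_⟩
  filter_upwards [hτβ, hβX] with z h1 h2
  rw [h1.fderiv, h2]

end KillingAction

end Potential

section Kernel

variable {E : Type*} [NormedAddCommGroup E] [NormedSpace ℂ E] [FiniteDimensional ℂ E]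
variable {X : (ℂ × sl2) →ₗ[ℂ] E → E}
  {G : E → E →L[ℂ] E →L[ℂ] ℂ} {z₀ : E}

/-- The holomorphic family of isotropy lines, up to normalization. -/
lemma KillingAction.exists_kernel (h : KillingAction X G z₀) (hE : Module.finrank ℂ E = 3)
    (hsurj : Function.Surjective (evalAt X z₀)) {k₀ : ℂ × sl2} (hk0 : k₀ ≠ 0)
    (hX0 : X k₀ z₀ = 0) : ∃ γ a b c : E → ℂ,
      ContDiffAt ℂ ω γ z₀ ∧ ContDiffAt ℂ ω a z₀ ∧ ContDiffAt ℂ ω b z₀ ∧ ContDiffAt ℂ ω c z₀ ∧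
      (γ z₀, sl2mk (a z₀) (b z₀) (c z₀)) = k₀ ∧
      (∀ᶠ z in 𝓝 z₀, ∀ p, X p z = 0 → ∃ s : ℂ, p = s • (γ z, sl2mk (a z) (b z) (c z))) ∧
      ∀ m, ∀ᶠ z in 𝓝 z₀, ∃ l : ℂ, (fderiv ℂ γ z (X m z), sl2mk (fderiv ℂ a z (X m z))
        (fderiv ℂ b z (X m z)) (fderiv ℂ c z (X m z))) =
        l • (γ z, sl2mk (a z) (b z) (c z)) + ⁅(γ z, sl2mk (a z) (b z) (c z)), m⁆ := by
  obtain ⟨p, θ, hθ, hp⟩ := h.exists_local_frame hE hsurj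
  let t : Fin 3 → E → ℂ := fun i z => θ i z (X k₀ z)
  have ht : ∀ i, ContDiffAt ℂ ω (t i) z₀ := fun i => (hθ i).clm_apply (h.smooth _)
  have ht0 : ∀ i, t i z₀ = 0 := fun i => by simp [t, hX0]
  let w : (ℂ × sl2 →ₗ[ℂ] ℂ) → E → ℂ := fun l z => l k₀ - ∑ i, t i z * l (p i)
  have hw : ∀ l, ContDiffAt ℂ ω (w l) z₀ := fun l =>
    contDiffAt_const.sub (ContDiffAt.sum fun i _ => (ht i).mul contDiffAt_const)
  let k : E → ℂ × sl2 := fun z => k₀ - ∑ i, t i z • p i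
  have hwk : ∀ l z, w l z = l (k z) := fun l z => by simp [w, k]
  let l0 : ℂ × sl2 →ₗ[ℂ] ℂ := LinearMap.fst ℂ ℂ sl2
  let l1 : Fin 2 → Fin 2 → (ℂ × sl2 →ₗ[ℂ] ℂ) := fun i j =>
    { toFun := fun x => x.2.1 i j
      map_add' := fun _ _ => rfl
      map_smul' := fun _ _ => rfl }
  have hk : ∀ z, (w l0 z, sl2mk (w (l1 0 0) z) (w (l1 0 1) z) (w (l1 1 0) z)) = k z := by
    intro z
    simp only [hwk]
    exact Prod.ext rfl (sl2mk_eta (k z).2)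
  have hXk : ∀ᶠ z in 𝓝 z₀, X (k z) z = 0 := by
    filter_upwards [hp] with z hz
    simp only [k, map_sub, map_sum, map_smul, Pi.sub_apply, Finset.sum_apply, Pi.smul_apply]
    rw [hz, sub_self]
  have hkz0 : k z₀ = k₀ := by simp [k, ht0]
  have hkne : ∀ᶠ z in 𝓝 z₀, k z ≠ 0 := by
    have hcases : ∃ l, w l z₀ ≠ 0 := by
      by_contra! hl
      refine hk0 ?_
      rw [← hkz0, ← hk z₀]
      refine Prod.ext (hl _) ?_
      simp only [hl, sl2mk_zero]
      rfl
    obtain ⟨l, hl⟩ := hcases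
    filter_upwards [(hw l).continuousAt.eventually_ne hl] with z hz h0
    rw [hwk, h0, map_zero] at hz
    exact hz rfl
  have hker : ∀ᶠ z in 𝓝 z₀, ∀ p, X p z = 0 → ∃ s : ℂ, p = s • k z := by
    filter_upwards [hp, hXk, hkne] with z h1 h2 h3 r hr
    have hs : Function.Surjective (evalAt X z) := fun v =>
      ⟨∑ i, θ i z v • p i, by
        rw [map_sum]
        simp only [map_smul]
        exact h1 v⟩
    have hfd : FiniteDimensional ℂ (ℂ × sl2) :=
      Module.finite_of_finrank_pos (by rw [finrank_prod_sl2]; norm_num)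
    have hr1 := LinearMap.finrank_range_add_finrank_ker (evalAt X z)
    rw [LinearMap.range_eq_top.2 hs, finrank_top, hE, finrank_prod_sl2] at hr1
    have hr2 : Module.finrank ℂ (LinearMap.ker (evalAt X z)) = 1 := by omega
    obtain ⟨s, hs⟩ := (finrank_eq_one_iff_of_nonzero' (⟨k z, h2⟩ : LinearMap.ker (evalAt X z))
      (fun h0 => h3 (congrArg Subtype.val h0))).1 hr2 ⟨r, hr⟩
    exact ⟨s, (congrArg Subtype.val hs).symm⟩
  refine ⟨w l0, w (l1 0 0), w (l1 0 1), w (l1 1 0), hw _, hw _, hw _, hw _, ?_, ?_, ?_⟩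
  · rw [hk, hkz0]
  · simp only [hk]
    exact hker
  · intro m
    simp only [hk]
    filter_upwards [hp, hXk.eventually_nhds, hker, eventually_all.2 fun i =>
      (ht i).eventually (by simp), (h.smooth k₀).eventually (by simp), eventually_all.2 fun i =>
      (h.smooth (p i)).eventually (by simp), h.bracket m k₀, eventually_all.2 fun i =>
      h.bracket m (p i)] with z h1 h2 h3 h4 h5 h6 h7 h8
    have hdw : ∀ l, fderiv ℂ (w l) z (X m z) = l (-∑ i, fderiv ℂ (t i) z (X m z) • p i) := by
      intro l
      have e : HasFDerivAt (w l) (-∑ i, l (p i) • fderiv ℂ (t i) z) z :=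
        (HasFDerivAt.fun_sum (u := Finset.univ) fun i _ =>
          ((h4 i).differentiableAt (by simp)).hasFDerivAt.mul_const (l (p i))).const_sub (l k₀)
      rw [e.fderiv]
      simp only [neg_apply, sum_apply, smul_apply, smul_eq_mul, map_neg, map_sum, map_smul]
      congr 1
      exact Finset.sum_congr rfl fun i _ => mul_comm _ _
    have hd : (fderiv ℂ (w l0) z (X m z), sl2mk (fderiv ℂ (w (l1 0 0)) z (X m z))
        (fderiv ℂ (w (l1 0 1)) z (X m z)) (fderiv ℂ (w (l1 1 0)) z (X m z))) =
        -∑ i, fderiv ℂ (t i) z (X m z) • p i := by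
      simp only [hdw]
      generalize -∑ i, fderiv ℂ (t i) z (X m z) • p i = n
      exact Prod.ext rfl (sl2mk_eta n.2)
    have hF : HasFDerivAt (fun y => X k₀ y - ∑ i, t i y • X (p i) y)
        (fderiv ℂ (X k₀) z - ∑ i, (t i z • fderiv ℂ (X (p i)) z +
          (fderiv ℂ (t i) z).smulRight (X (p i) z))) z :=
      (h5.differentiableAt (by simp)).hasFDerivAt.sub (HasFDerivAt.fun_sum fun i _ =>
        ((h4 i).differentiableAt (by simp)).hasFDerivAt.smul
          ((h6 i).differentiableAt (by simp)).hasFDerivAt)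
    have hF0 : (fun y => X k₀ y - ∑ i, t i y • X (p i) y) =ᶠ[𝓝 z] fun _ => 0 := by
      filter_upwards [h2] with y hy
      simpa [k] using hy
    have hF1 := hF.fderiv
    rw [hF0.fderiv_eq, fderiv_const_apply] at hF1
    have hF2 := congrArg (fun T : E →L[ℂ] E => T (X m z)) hF1
    simp only [_root_.zero_apply, sub_apply, sum_apply, _root_.add_apply, smul_apply,
      ContinuousLinearMap.smulRight_apply] at hF2
    have hbr : X ⁅m, k z⁆ z = X ⁅m, k₀⁆ z - ∑ i, t i z • X ⁅m, p i⁆ z := by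
      simp only [k, lie_sub, lie_sum, lie_smul, map_sub, map_sum, map_smul, Pi.sub_apply,
        Finset.sum_apply, Pi.smul_apply]
    have hDk : fderiv ℂ (X m) z (X k₀ z) - ∑ i, t i z • fderiv ℂ (X m) z (X (p i) z) = 0 := by
      have := congrArg (fderiv ℂ (X m) z) hF0.eq_of_nhds
      simpa only [map_sub, map_sum, map_smul, map_zero] using this
    obtain ⟨l, hl⟩ := h3 (-(∑ i, fderiv ℂ (t i) z (X m z) • p i) + ⁅m, k z⁆) (by
      simp only [map_add, map_neg, map_sum, map_smul, Pi.add_apply, Pi.neg_apply,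
        Finset.sum_apply, Pi.smul_apply]
      rw [hbr, h7]
      simp only [h8, smul_sub, Finset.sum_sub_distrib, Finset.sum_add_distrib] at hF2 hDk ⊢
      have e := sub_eq_zero.1 hDk
      rw [e]
      refine Eq.trans ?_ hF2.symm
      abel)
    refine ⟨l, ?_⟩
    rw [hd, ← hl, ← lie_skew m (k z)]
    abel

end Kernel

section IsotropyFamily

variable {E : Type*} [NormedAddCommGroup E] [NormedSpace ℂ E]

lemma fderiv_mul_apply {u n : E → ℂ} {z : E} (hu : DifferentiableAt ℂ u z)
    (hn : DifferentiableAt ℂ n z) (v : E) :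
    fderiv ℂ (fun z => u z * n z) z v = u z * fderiv ℂ n z v + fderiv ℂ u z v * n z := by
  rw [fderiv_fun_mul hu hn]
  simp [mul_comm]

/-- Holomorphic square roots. -/
lemma exists_sqrt {N : E → ℂ} {z₀ : E} (hN : ContDiffAt ℂ ω N z₀) (hN0 : N z₀ = 1) :
    ∃ n : E → ℂ, ContDiffAt ℂ ω n z₀ ∧ n z₀ = 1 ∧
      ∀ᶠ z in 𝓝 z₀, n z ≠ 0 ∧ n z ^ 2 = N z ∧ ∀ v, 2 * n z * fderiv ℂ n z v = fderiv ℂ N z v := by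
  have hn : ContDiffAt ℂ ω (fun z => Complex.exp (Complex.log (N z) / 2)) z₀ :=
    ((hN.analyticAt.clog (by rw [hN0]; exact Complex.one_mem_slitPlane)).contDiffAt.div_const 2).cexp
  refine ⟨fun z => Complex.exp (Complex.log (N z) / 2), hn, by simp [hN0], ?_⟩
  have hsq : ∀ᶠ z in 𝓝 z₀, N z = Complex.exp (Complex.log (N z) / 2) *
      Complex.exp (Complex.log (N z) / 2) := by
    filter_upwards [hN.continuousAt.eventually_ne (by rw [hN0]; exact one_ne_zero)] with z hz
    rw [← Complex.exp_add, add_halves, Complex.exp_log hz]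
  filter_upwards [hsq.eventually_nhds, hn.eventually (by simp)] with z h1 h2
  refine ⟨Complex.exp_ne_zero _, by rw [sq]; exact h1.self_of_nhds.symm, fun v => ?_⟩
  have h3 : N =ᶠ[𝓝 z] fun z => Complex.exp (Complex.log (N z) / 2) *
      Complex.exp (Complex.log (N z) / 2) := h1
  have hd := h2.differentiableAt (by simp)
  rw [h3.fderiv_eq, fderiv_mul_apply hd hd]
  ring

variable [FiniteDimensional ℂ E]
variable {X : (ℂ × sl2) →ₗ[ℂ] E → E}
  {G : E → E →L[ℂ] E →L[ℂ] ℂ} {z₀ : E}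

/-- A holomorphic equivariant family `(ε, (a, b; c, -a))` of generators of the isotropy lines. -/
structure IsotropyFamily (X : (ℂ × sl2) →ₗ[ℂ] E → E) (z₀ : E) (ε : ℂ) (a b c : E → ℂ) : Prop where
  smooth_a : ContDiffAt ℂ ω a z₀
  smooth_b : ContDiffAt ℂ ω b z₀
  smooth_c : ContDiffAt ℂ ω c z₀
  ker : ∀ᶠ z in 𝓝 z₀, ∀ p, X p z = 0 → ∃ s : ℂ, p = (s * ε, s • sl2mk (a z) (b z) (c z))
  da : ∀ m, ∀ᶠ z in 𝓝 z₀, fderiv ℂ a z (X m z) = b z * m.2.1 1 0 - m.2.1 0 1 * c z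
  db : ∀ m, ∀ᶠ z in 𝓝 z₀, fderiv ℂ b z (X m z) = 2 * (a z * m.2.1 0 1 - m.2.1 0 0 * b z)
  dc : ∀ m, ∀ᶠ z in 𝓝 z₀, fderiv ℂ c z (X m z) = 2 * (c z * m.2.1 0 0 - m.2.1 1 0 * a z)
  inv : ∀ᶠ z in 𝓝 z₀, a z ^ 2 + b z * c z = a z₀ ^ 2 + b z₀ * c z₀

lemma KillingAction.exists_isotropyFamily (h : KillingAction X G z₀) (hE : Module.finrank ℂ E = 3)
    (hsurj : Function.Surjective (evalAt X z₀)) {ε : ℂ} {v : sl2}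
    (hv : ε = 1 ∨ ε = 0 ∧ v = sl2H) (hX0 : X (ε, v) z₀ = 0) :
    ∃ a b c : E → ℂ, IsotropyFamily X z₀ ε a b c ∧ sl2mk (a z₀) (b z₀) (c z₀) = v := by
  obtain ⟨γ, a, b, c, hγ, ha, hb, hc, h0, hker, hd⟩ := h.exists_kernel hE hsurj (k₀ := (ε, v))
    (by
      intro h0
      rcases hv with rfl | ⟨-, rfl⟩
      · exact one_ne_zero (congrArg Prod.fst h0)
      · exact sl2H_ne_zero (congrArg Prod.snd h0)) hX0
  have hγ0 : γ z₀ = ε := congrArg Prod.fst h0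
  have hv0 : sl2mk (a z₀) (b z₀) (c z₀) = v := congrArg Prod.snd h0
  have hd' : ∀ m, ∀ᶠ z in 𝓝 z₀, ∃ l : ℂ, fderiv ℂ γ z (X m z) = l * γ z ∧
      fderiv ℂ a z (X m z) = l * a z + (b z * m.2.1 1 0 - m.2.1 0 1 * c z) ∧
      fderiv ℂ b z (X m z) = l * b z + 2 * (a z * m.2.1 0 1 - m.2.1 0 0 * b z) ∧
      fderiv ℂ c z (X m z) = l * c z + 2 * (c z * m.2.1 0 0 - m.2.1 1 0 * a z) := by
    intro m
    filter_upwards [hd m] with z ⟨l, hl⟩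
    rw [prod_lie] at hl
    refine ⟨l, ?_, ?_⟩
    · have := congrArg Prod.fst hl
      simpa using this
    · have h2 := congrArg (fun p : ℂ × sl2 => p.2) hl
      simp only [Prod.snd_add, Prod.smul_snd] at h2
      rw [← sl2mk_eta m.2, sl2mk_lie, sl2mk_smul, sl2mk_add] at h2
      exact ⟨congrArg (fun u : sl2 => u.1 0 0) h2, congrArg (fun u : sl2 => u.1 0 1) h2,
        congrArg (fun u : sl2 => u.1 1 0) h2⟩
  have hnorm : ∃ n : E → ℂ, ContDiffAt ℂ ω n z₀ ∧ n z₀ = 1 ∧ ∀ m, ∀ᶠ z in 𝓝 z₀, ∀ l : ℂ,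
      fderiv ℂ γ z (X m z) = l * γ z →
      fderiv ℂ a z (X m z) = l * a z + (b z * m.2.1 1 0 - m.2.1 0 1 * c z) →
      fderiv ℂ b z (X m z) = l * b z + 2 * (a z * m.2.1 0 1 - m.2.1 0 0 * b z) →
      fderiv ℂ c z (X m z) = l * c z + 2 * (c z * m.2.1 0 0 - m.2.1 1 0 * a z) →
      fderiv ℂ n z (X m z) = l * n z := by
    rcases hv with rfl | ⟨rfl, rfl⟩
    · exact ⟨γ, hγ, hγ0, fun m => Eventually.of_forall fun z l h1 _ _ _ => h1⟩
    · have ha0 : a z₀ = 1 := congrArg (fun u : sl2 => u.1 0 0) hv0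
      have hb0 : b z₀ = 0 := congrArg (fun u : sl2 => u.1 0 1) hv0
      obtain ⟨n, hn, hn0, hn'⟩ := exists_sqrt (N := fun z => a z * a z + b z * c z)
        ((ha.mul ha).add (hb.mul hc)) (by simp [ha0, hb0])
      refine ⟨n, hn, hn0, fun m => ?_⟩
      filter_upwards [hn', ha.eventually (by simp), hb.eventually (by simp),
        hc.eventually (by simp)] with z ⟨h1, h2, h3⟩ h4 h5 h6 l _ e1 e2 e3
      have da := h4.differentiableAt (by simp)
      have db := h5.differentiableAt (by simp)
      have dc := h6.differentiableAt (by simp)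
      have h7 := h3 (X m z)
      rw [fderiv_fun_add (da.fun_mul da) (db.fun_mul dc), _root_.add_apply, fderiv_mul_apply da da,
        fderiv_mul_apply db dc, e1, e2, e3] at h7
      refine mul_left_cancel₀ (mul_ne_zero two_ne_zero h1) (h7.trans ?_)
      linear_combination -2 * l * h2
  obtain ⟨n, hn, hn0, hdn⟩ := hnorm
  have hne : ∀ᶠ z in 𝓝 z₀, n z ≠ 0 := hn.continuousAt.eventually_ne (by rw [hn0]; exact one_ne_zero)
  have hn1 : n z₀ ≠ 0 := by rw [hn0]; exact one_ne_zero
  have hdiv : ∀ {u : E → ℂ}, ContDiffAt ℂ ω u z₀ → ∀ᶠ z in 𝓝 z₀, ∀ v,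
      fderiv ℂ u z v = u z / n z * fderiv ℂ n z v + fderiv ℂ (fun z => u z / n z) z v * n z := by
    intro u hu
    filter_upwards [hne.eventually_nhds, hn.eventually (by simp),
      (hu.div hn hn1).eventually (by simp)] with z h1 h2 h3 v
    have h3' : ContDiffAt ℂ ω (fun z => u z / n z) z := h3
    rw [← fderiv_mul_apply (h3'.differentiableAt (by simp)) (h2.differentiableAt (by simp))]
    have e : u =ᶠ[𝓝 z] fun z => u z / n z * n z :=
      h1.mono fun y hy => (div_mul_cancel₀ _ hy).symm
    rw [e.fderiv_eq]
  have hγn : ∀ᶠ z in 𝓝 z₀, γ z / n z = ε := by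
    have := h.eventually_const hE hsurj (hγ.div hn hn1) (fun m => by
      filter_upwards [hd' m, hdn m, hdiv hγ, hne] with z ⟨l, e0, e1, e2, e3⟩ h2 h3 h4
      have h5 := h3 (X m z)
      rw [h2 l e0 e1 e2 e3, e0] at h5
      refine (mul_eq_zero.1 ?_).resolve_right h4
      linear_combination -h5 - l * div_mul_cancel₀ (γ z) h4)
    simpa [hγ0, hn0] using this
  have hda : ∀ m, ∀ᶠ z in 𝓝 z₀, fderiv ℂ (fun z => a z / n z) z (X m z) =
      b z / n z * m.2.1 1 0 - m.2.1 0 1 * (c z / n z) := fun m => by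
    filter_upwards [hd' m, hdn m, hdiv ha, hne] with z ⟨l, e0, e1, e2, e3⟩ h2 h3 h4
    have h5 := h3 (X m z)
    rw [h2 l e0 e1 e2 e3, e1] at h5
    refine mul_right_cancel₀ h4 ?_
    field_simp at h5 ⊢
    linear_combination -h5
  have hdb : ∀ m, ∀ᶠ z in 𝓝 z₀, fderiv ℂ (fun z => b z / n z) z (X m z) =
      2 * (a z / n z * m.2.1 0 1 - m.2.1 0 0 * (b z / n z)) := fun m => by
    filter_upwards [hd' m, hdn m, hdiv hb, hne] with z ⟨l, e0, e1, e2, e3⟩ h2 h3 h4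
    have h5 := h3 (X m z)
    rw [h2 l e0 e1 e2 e3, e2] at h5
    refine mul_right_cancel₀ h4 ?_
    field_simp at h5 ⊢
    linear_combination -h5
  have hdc : ∀ m, ∀ᶠ z in 𝓝 z₀, fderiv ℂ (fun z => c z / n z) z (X m z) =
      2 * (c z / n z * m.2.1 0 0 - m.2.1 1 0 * (a z / n z)) := fun m => by
    filter_upwards [hd' m, hdn m, hdiv hc, hne] with z ⟨l, e0, e1, e2, e3⟩ h2 h3 h4
    have h5 := h3 (X m z)
    rw [h2 l e0 e1 e2 e3, e3] at h5
    refine mul_right_cancel₀ h4 ?_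
    field_simp at h5 ⊢
    linear_combination -h5
  have sa : ContDiffAt ℂ ω (fun z => a z / n z) z₀ := ha.div hn hn1
  have sb : ContDiffAt ℂ ω (fun z => b z / n z) z₀ := hb.div hn hn1
  have sc : ContDiffAt ℂ ω (fun z => c z / n z) z₀ := hc.div hn hn1
  refine ⟨fun z => a z / n z, fun z => b z / n z, fun z => c z / n z,
    ⟨sa, sb, sc, ?_, hda, hdb, hdc, ?_⟩, by simpa [hn0] using hv0⟩
  · filter_upwards [hker, hne, hγn] with z h1 h2 h3 p hp
    obtain ⟨s, rfl⟩ := h1 p hp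
    refine ⟨s * n z, Prod.ext ?_ ?_⟩
    · rw [← h3]
      change s * γ z = _
      field_simp
    · change s • sl2mk _ _ _ = _
      rw [sl2mk_smul, sl2mk_smul]
      congr 1 <;> field_simp
  · have := h.eventually_const hE hsurj (φ := fun z => a z / n z * (a z / n z) +
      b z / n z * (c z / n z)) ((sa.mul sa).add (sb.mul sc)) (fun m => by
        filter_upwards [hda m, hdb m, hdc m, sa.eventually (by simp), sb.eventually (by simp),
          sc.eventually (by simp)] with z e1 e2 e3 h4 h5 h6
        have da := h4.differentiableAt (by simp)
        have db := h5.differentiableAt (by simp)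
        have dc := h6.differentiableAt (by simp)
        rw [fderiv_fun_add (da.fun_mul da) (db.fun_mul dc), _root_.add_apply]
        rw [fderiv_mul_apply da da, fderiv_mul_apply db dc, e1, e2, e3]
        ring)
    filter_upwards [this] with z hz
    linear_combination hz

end IsotropyFamily

section DirectionalDerivatives

variable {E : Type*} [NormedAddCommGroup E] [NormedSpace ℂ E]

/-- The function `f` is differentiable at `z`, with derivative `d` in the direction `w`. -/
def HasDir (f : E → ℂ) (z w : E) (d : ℂ) : Prop := DifferentiableAt ℂ f z ∧ fderiv ℂ f z w = d

namespace HasDir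

variable {f h : E → ℂ} {z w : E} {d e : ℂ}

lemma const (k : ℂ) : HasDir (fun _ => k) z w 0 := ⟨differentiableAt_const k, by simp⟩

lemma add (hf : HasDir f z w d) (hh : HasDir h z w e) : HasDir (fun z => f z + h z) z w (d + e) :=
  ⟨hf.1.fun_add hh.1, by rw [fderiv_fun_add hf.1 hh.1, _root_.add_apply, hf.2, hh.2]⟩

lemma sub (hf : HasDir f z w d) (hh : HasDir h z w e) : HasDir (fun z => f z - h z) z w (d - e) :=
  ⟨hf.1.fun_sub hh.1, by rw [fderiv_fun_sub hf.1 hh.1, _root_.sub_apply, hf.2, hh.2]⟩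

lemma neg (hf : HasDir f z w d) : HasDir (fun z => -f z) z w (-d) :=
  ⟨hf.1.fun_neg, by rw [fderiv_fun_neg, _root_.neg_apply, hf.2]⟩

lemma mul (hf : HasDir f z w d) (hh : HasDir h z w e) :
    HasDir (fun z => f z * h z) z w (f z * e + d * h z) :=
  ⟨hf.1.fun_mul hh.1, by rw [fderiv_mul_apply hf.1 hh.1, hf.2, hh.2]⟩

lemma inv (hf : HasDir f z w d) (h0 : f z ≠ 0) : HasDir (fun z => (f z)⁻¹) z w (-d / f z ^ 2) := by
  have h1 := (hasDerivAt_inv h0).comp_hasFDerivAt z hf.1.hasFDerivAt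
  refine ⟨h1.differentiableAt, ?_⟩
  have h2 := h1.fderiv
  change fderiv ℂ (Inv.inv ∘ f) z w = _
  rw [h2, smul_apply, hf.2, smul_eq_mul]
  ring

lemma cexp (hf : HasDir f z w d) :
    HasDir (fun z => Complex.exp (f z)) z w (Complex.exp (f z) * d) := by
  have h1 := hf.1.hasFDerivAt.cexp
  refine ⟨h1.differentiableAt, ?_⟩
  rw [h1.fderiv, smul_apply, hf.2, smul_eq_mul]

end HasDir

lemma HasDir.of {f : E → ℂ} {z w : E} {d : ℂ} (hf : ContDiffAt ℂ ω f z)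
    (h : fderiv ℂ f z w = d) : HasDir f z w d := ⟨hf.differentiableAt (by simp), h⟩

end DirectionalDerivatives

section LocalModels

variable {E : Type*} [NormedAddCommGroup E] [NormedSpace ℂ E] [FiniteDimensional ℂ E]
variable {X : (ℂ × sl2) →ₗ[ℂ] E → E}
  {G : E → E →L[ℂ] E →L[ℂ] ℂ} {z₀ : E}

/-- The functions `p, q, r, s` are the entries of an equivariant map to `SL(2, ℂ)`. -/
structure EquivariantEntries (X : (ℂ × sl2) →ₗ[ℂ] E → E) (z₀ : E) (v : sl2) (p q r s : E → ℂ) :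
    Prop where
  smooth_p : ContDiffAt ℂ ω p z₀
  smooth_q : ContDiffAt ℂ ω q z₀
  smooth_r : ContDiffAt ℂ ω r z₀
  smooth_s : ContDiffAt ℂ ω s z₀
  p_zero : p z₀ = 1
  q_zero : q z₀ = 0
  r_zero : r z₀ = 0
  s_zero : s z₀ = 1
  det : ∀ᶠ z in 𝓝 z₀, p z * s z - q z * r z = 1
  dp : ∀ m, ∀ᶠ z in 𝓝 z₀, fderiv ℂ p z (X m z) =
    m.1 * (p z * v.1 0 0 + q z * v.1 1 0) - (m.2.1 0 0 * p z + m.2.1 0 1 * r z)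
  dq : ∀ m, ∀ᶠ z in 𝓝 z₀, fderiv ℂ q z (X m z) =
    m.1 * (p z * v.1 0 1 - q z * v.1 0 0) - (m.2.1 0 0 * q z + m.2.1 0 1 * s z)
  dr : ∀ m, ∀ᶠ z in 𝓝 z₀, fderiv ℂ r z (X m z) =
    m.1 * (r z * v.1 0 0 + s z * v.1 1 0) - (m.2.1 1 0 * p z - m.2.1 0 0 * r z)
  ds : ∀ m, ∀ᶠ z in 𝓝 z₀, fderiv ℂ s z (X m z) =
    m.1 * (r z * v.1 0 1 - s z * v.1 0 0) - (m.2.1 1 0 * q z - m.2.1 0 0 * s z)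

lemma KillingAction.exists_entries_E (h : KillingAction X G z₀) (hE : Module.finrank ℂ E = 3)
    (hsurj : Function.Surjective (evalAt X z₀)) {a b c : E → ℂ}
    (hA : IsotropyFamily X z₀ 1 a b c) (h0 : sl2mk (a z₀) (b z₀) (c z₀) = sl2E) :
    ∃ p q r s, EquivariantEntries X z₀ sl2E p q r s := by
  have ha0 : a z₀ = 0 := congrArg (fun u : sl2 => u.1 0 0) h0
  have hb0 : b z₀ = 1 := congrArg (fun u : sl2 => u.1 0 1) h0
  have hc0 : c z₀ = 0 := congrArg (fun u : sl2 => u.1 1 0) h0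
  obtain ⟨ρ, hρ, hρ0, hρ'⟩ := exists_sqrt hA.smooth_b hb0
  have hne := hρ'.mono fun z hz => hz.1
  have hρ1 : ρ z₀ ≠ 0 := by rw [hρ0]; exact one_ne_zero
  have hb1 : b z₀ ≠ 0 := by rw [hb0]; exact one_ne_zero
  have hinv : ∀ᶠ z in 𝓝 z₀, a z ^ 2 + b z * c z = 0 := by
    filter_upwards [hA.inv] with z hz
    rw [hz, ha0, hc0]
    ring
  have hdρ : ∀ m, ∀ᶠ z in 𝓝 z₀, HasDir ρ z (X m z) ((a z * m.2.1 0 1 - m.2.1 0 0 * b z) / ρ z) := by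
    intro m
    filter_upwards [hρ', hA.db m, hρ.eventually (by simp)] with z ⟨h1, h2, h3⟩ h4 h5
    refine HasDir.of h5 ?_
    have h6 := h3 (X m z)
    rw [h4] at h6
    field_simp
    linear_combination h6 / 2
  let B : (ℂ × sl2) →ₗ[ℂ] E → ℂ :=
    { toFun := fun m z => m.1 - m.2.1 0 1 * (b z)⁻¹
      map_add' := fun m n => funext fun z => by
        simp only [Prod.fst_add, Prod.snd_add, sl2_add_val, Pi.add_apply]
        ring
      map_smul' := fun t m => funext fun z => by
        simp only [Prod.smul_fst, Prod.smul_snd, sl2_smul_val, Pi.smul_apply, smul_eq_mul,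
          RingHom.id_apply]
        ring }
  obtain ⟨τ, hτ, hτ0, hτX⟩ := h.exists_potential hE hsurj B
    (fun m => contDiffAt_const.sub (contDiffAt_const.mul (hA.smooth_b.inv hb1)))
    (by
      filter_upwards [hA.ker, hA.smooth_b.continuousAt.eventually_ne hb1] with z h1 h2 m hm
      obtain ⟨s, rfl⟩ := h1 m hm
      change s * 1 - s * b z * (b z)⁻¹ = 0
      field_simp
      ring)
    (by
      intro m n
      have key : ∀ k l, ∀ᶠ z in 𝓝 z₀, fderiv ℂ (B k) z (X l z) =
          0 - ((k.2.1 0 1) * (-(2 * (a z * l.2.1 0 1 - l.2.1 0 0 * b z)) / b z ^ 2) +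
            0 * (b z)⁻¹) := by
        intro k l
        filter_upwards [hA.db l, hA.smooth_b.continuousAt.eventually_ne hb1,
          hA.smooth_b.eventually (by simp)] with z h1 h2 h3
        exact ((HasDir.const k.1).sub ((HasDir.const (k.2.1 0 1)).mul ((HasDir.of h3 h1).inv h2))).2
      filter_upwards [key n m, key m n, hA.smooth_b.continuousAt.eventually_ne hb1] with z h1 h2 h3
      rw [h1, h2, prod_lie, ← sl2mk_eta m.2, ← sl2mk_eta n.2, sl2mk_lie]
      simp only [B, LinearMap.coe_mk, AddHom.coe_mk, sl2mk_00, sl2mk_01]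
      field_simp
      ring)
  have hdτ : ∀ m, ∀ᶠ z in 𝓝 z₀, HasDir τ z (X m z) (m.1 - m.2.1 0 1 * (b z)⁻¹) := by
    intro m
    filter_upwards [hτX m, hτ.eventually (by simp)] with z h1 h2 using HasDir.of h2 h1
  have sa := hA.smooth_a
  refine ⟨ρ, fun z => ρ z * τ z, fun z => -(a z * (ρ z)⁻¹), fun z => (1 - a z * τ z) * (ρ z)⁻¹,
    hρ, hρ.mul hτ, (sa.mul (hρ.inv hρ1)).neg, (contDiffAt_const.sub (sa.mul hτ)).mul (hρ.inv hρ1),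
    hρ0, by simp [hτ0], by simp [ha0], by simp [ha0, hρ0], ?_, ?_, ?_, ?_, ?_⟩
  · filter_upwards [hne] with z hz
    field_simp
    ring
  · intro m
    filter_upwards [hρ', hdρ m] with z ⟨h1, h2, _⟩ h3
    rw [h3.2, ← h2]
    simp only [sl2E, sl2mk_00, sl2mk_10]
    field_simp
    ring
  · intro m
    filter_upwards [hρ', hdρ m, hdτ m] with z ⟨h1, h2, _⟩ h3 h4
    rw [(h3.mul h4).2, ← h2]
    simp only [sl2E, sl2mk_00, sl2mk_01]
    field_simp
    ring
  · intro m
    filter_upwards [hρ', hdρ m, hA.da m, sa.eventually (by simp), hinv] with z ⟨h1, h2, _⟩ h3 h4 h5 h6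
    rw [((HasDir.of h5 h4).mul (h3.inv h1)).neg.2]
    simp only [sl2E, sl2mk_00, sl2mk_10]
    rw [← h2] at h6 ⊢
    field_simp
    linear_combination (m.2.1 0 1) * h6
  · intro m
    filter_upwards [hρ', hdρ m, hdτ m, hA.da m, sa.eventually (by simp), hinv]
      with z ⟨h1, h2, _⟩ h3 h4 h5 h6 h7
    rw [(((HasDir.const 1).sub ((HasDir.of h6 h5).mul h4)).mul (h3.inv h1)).2]
    simp only [sl2E, sl2mk_00, sl2mk_01]
    rw [← h2] at h7 ⊢
    field_simp
    linear_combination (m.2.1 0 1 * τ z) * h7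

lemma KillingAction.exists_entries_H (h : KillingAction X G z₀) (hE : Module.finrank ℂ E = 3)
    (hsurj : Function.Surjective (evalAt X z₀)) {a b c : E → ℂ}
    (hA : IsotropyFamily X z₀ 1 a b c) (h0 : sl2mk (a z₀) (b z₀) (c z₀) = sl2H) :
    ∃ p q r s, EquivariantEntries X z₀ sl2H p q r s := by
  have ha0 : a z₀ = 1 := congrArg (fun u : sl2 => u.1 0 0) h0
  have hb0 : b z₀ = 0 := congrArg (fun u : sl2 => u.1 0 1) h0
  have hc0 : c z₀ = 0 := congrArg (fun u : sl2 => u.1 1 0) h0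
  have sa := hA.smooth_a
  have sb := hA.smooth_b
  have sc := hA.smooth_c
  obtain ⟨n, hn, hn0, hn'⟩ := exists_sqrt (N := fun z => (1 + a z) * 2⁻¹) (z₀ := z₀)
    ((contDiffAt_const.add sa).mul contDiffAt_const) (by rw [ha0]; norm_num)
  have hn1 : n z₀ ≠ 0 := by rw [hn0]; exact one_ne_zero
  have hna : ∀ᶠ z in 𝓝 z₀, n z ≠ 0 ∧ a z = 2 * n z ^ 2 - 1 ∧
      b z * c z = 4 * n z ^ 2 * (1 - n z ^ 2) := by
    filter_upwards [hn', hA.inv] with z ⟨h1, h2, _⟩ h3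
    have h4 : a z = 2 * n z ^ 2 - 1 := by rw [h2]; ring
    refine ⟨h1, h4, ?_⟩
    rw [ha0, hb0] at h3
    rw [h4] at h3
    linear_combination h3
  have hdn : ∀ m, ∀ᶠ z in 𝓝 z₀, HasDir n z (X m z)
      ((b z * m.2.1 1 0 - m.2.1 0 1 * c z) / (4 * n z)) := by
    intro m
    filter_upwards [hn', hA.da m, hn.eventually (by simp), sa.eventually (by simp)]
      with z ⟨h1, h2, h3⟩ h4 h5 h6
    refine HasDir.of h5 ?_
    have h7 := h3 (X m z)
    rw [(((HasDir.const 1).add (HasDir.of h6 h4)).mul (HasDir.const 2⁻¹)).2] at h7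
    field_simp at h7 ⊢
    linear_combination h7
  have hda : ∀ m, ∀ᶠ z in 𝓝 z₀, HasDir a z (X m z) (b z * m.2.1 1 0 - m.2.1 0 1 * c z) := fun m => by
    filter_upwards [hA.da m, sa.eventually (by simp)] with z h1 h2 using HasDir.of h2 h1
  have hdb : ∀ m, ∀ᶠ z in 𝓝 z₀, HasDir b z (X m z)
      (2 * (a z * m.2.1 0 1 - m.2.1 0 0 * b z)) := fun m => by
    filter_upwards [hA.db m, sb.eventually (by simp)] with z h1 h2 using HasDir.of h2 h1
  have hdc : ∀ m, ∀ᶠ z in 𝓝 z₀, HasDir c z (X m z)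
      (2 * (c z * m.2.1 0 0 - m.2.1 1 0 * a z)) := fun m => by
    filter_upwards [hA.dc m, sc.eventually (by simp)] with z h1 h2 using HasDir.of h2 h1
  let B : (ℂ × sl2) →ₗ[ℂ] E → ℂ :=
    { toFun := fun m z => (m.1 - m.2.1 0 0) -
        (m.2.1 0 1 * c z + m.2.1 1 0 * b z) * ((n z)⁻¹ * (n z)⁻¹ * 4⁻¹)
      map_add' := fun m n => funext fun z => by
        simp only [Prod.fst_add, Prod.snd_add, sl2_add_val, Pi.add_apply]
        ring
      map_smul' := fun t m => funext fun z => by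
        simp only [Prod.smul_fst, Prod.smul_snd, sl2_smul_val, Pi.smul_apply, smul_eq_mul,
          RingHom.id_apply]
        ring }
  have hni := hn.inv hn1
  obtain ⟨τ, hτ, hτ0, hτX⟩ := h.exists_potential hE hsurj B
    (fun m => contDiffAt_const.sub (((contDiffAt_const.mul sc).add (contDiffAt_const.mul sb)).mul
      ((hni.mul hni).mul contDiffAt_const)))
    (by
      filter_upwards [hA.ker, hna] with z h1 ⟨h2, h3, h4⟩ m hm
      obtain ⟨s, rfl⟩ := h1 m hm
      change (s * 1 - s * a z) - (s * b z * c z + s * c z * b z) * ((n z)⁻¹ * (n z)⁻¹ * 4⁻¹) = 0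
      rw [h3]
      field_simp
      linear_combination -2 * s * h4)
    (by
      intro k l
      filter_upwards [hdb l, hdc l, hdn l, hdb k, hdc k, hdn k, hna]
        with z b1 c1 n1 b2 c2 n2 ⟨h3, h4, h5⟩
      have h1 := ((HasDir.const (l.1 - l.2.1 0 0)).sub ((((HasDir.const (l.2.1 0 1)).mul c2).add
          ((HasDir.const (l.2.1 1 0)).mul b2)).mul (((n2.inv h3).mul (n2.inv h3)).mul
            (HasDir.const 4⁻¹)))).2
      have h2 := ((HasDir.const (k.1 - k.2.1 0 0)).sub ((((HasDir.const (k.2.1 0 1)).mul c1).add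
          ((HasDir.const (k.2.1 1 0)).mul b1)).mul (((n1.inv h3).mul (n1.inv h3)).mul
            (HasDir.const 4⁻¹)))).2
      refine (congrArg₂ (· - ·) h1 h2).trans ?_
      rw [prod_lie, ← sl2mk_eta k.2, ← sl2mk_eta l.2, sl2mk_lie]
      simp only [B, LinearMap.coe_mk, AddHom.coe_mk, sl2mk_00, sl2mk_01, sl2mk_10]
      rw [h4]
      field_simp
      linear_combination -4 * (k.2.1 0 1 * l.2.1 1 0 - l.2.1 0 1 * k.2.1 1 0) * h5)
  have hdτ : ∀ m, ∀ᶠ z in 𝓝 z₀, HasDir τ z (X m z) ((m.1 - m.2.1 0 0) -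
        (m.2.1 0 1 * c z + m.2.1 1 0 * b z) * ((n z)⁻¹ * (n z)⁻¹ * 4⁻¹)) := by
    intro m
    filter_upwards [hτX m, hτ.eventually (by simp)] with z h1 h2 using HasDir.of h2 h1
  refine ⟨fun z => n z * Complex.exp (τ z), fun z => -(b z * (2 * n z)⁻¹ * Complex.exp (-τ z)),
    fun z => c z * (2 * n z)⁻¹ * Complex.exp (τ z), fun z => n z * Complex.exp (-τ z),
    hn.mul hτ.cexp, ((sb.mul ((contDiffAt_const.mul hn).inv (by simpa using hn1))).mul
      hτ.neg.cexp).neg, (sc.mul ((contDiffAt_const.mul hn).inv (by simpa using hn1))).mul hτ.cexp,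
    hn.mul hτ.neg.cexp, by simp [hτ0, hn0], by simp [hb0], by simp [hc0], by simp [hτ0, hn0],
    ?_, ?_, ?_, ?_, ?_⟩
  · filter_upwards [hna] with z ⟨h1, h2, h3⟩
    have he := Complex.exp_ne_zero (τ z)
    rw [Complex.exp_neg]
    field_simp
    linear_combination h3
  · intro m
    filter_upwards [hna, hdn m, hdτ m] with z ⟨h1, h2, h3⟩ h4 h5
    rw [(h4.mul h5.cexp).2]
    simp only [sl2H_eq, sl2mk_00, sl2mk_10]
    field_simp
    ring
  · intro m
    filter_upwards [hna, hdn m, hdτ m, hdb m] with z ⟨h1, h2, h3⟩ h4 h5 h6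
    rw [((h6.mul (((HasDir.const 2).mul h4).inv (mul_ne_zero two_ne_zero h1))).mul
      h5.neg.cexp).neg.2]
    simp only [sl2H_eq, sl2mk_00, sl2mk_01]
    rw [h2]
    field_simp
    linear_combination -4 * Complex.exp (-τ z) * (m.2.1 0 1) * h3
  · intro m
    filter_upwards [hna, hdn m, hdτ m, hdc m] with z ⟨h1, h2, h3⟩ h4 h5 h6
    rw [((h6.mul (((HasDir.const 2).mul h4).inv (mul_ne_zero two_ne_zero h1))).mul h5.cexp).2]
    simp only [sl2H_eq, sl2mk_00, sl2mk_10]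
    rw [h2]
    field_simp
    linear_combination -4 * Complex.exp (τ z) * (m.2.1 1 0) * h3
  · intro m
    filter_upwards [hna, hdn m, hdτ m] with z ⟨h1, h2, h3⟩ h4 h5
    rw [(h4.mul h5.neg.cexp).2]
    simp only [sl2H_eq, sl2mk_00, sl2mk_01]
    field_simp
    ring

end LocalModels

section MapsToModels

variable {E E' S Y : Type*} [NormedAddCommGroup E] [NormedSpace ℂ E]
  [NormedAddCommGroup E'] [NormedSpace ℂ E'] [NormedAddCommGroup S] [NormedSpace ℂ S]
  [TopologicalSpace Y] [ChartedSpace E' Y]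

/-- The differential of a map to an embedded manifold. -/
lemma IsHolEmbedding.eventually_mfderiv {ι : Y → S} (hι : IsHolEmbedding E' ι)
    (hinj : ∀ y : Y, Function.Injective (vecDeriv (E := E') ι y)) {f : E → Y} {F : E → S} {z₀ : E}
    (hF : ContDiffAt ℂ ω F z₀) (hf : ∀ᶠ z in 𝓝 z₀, ι (f z) = F z) :
    ContMDiffAt 𝓘(ℂ, E) 𝓘(ℂ, E') ω f z₀ ∧ ∀ᶠ z in 𝓝 z₀,
      ∀ (w : E) (V : TangentSpace 𝓘(ℂ, E') (f z)), fderiv ℂ F z w = vecDeriv ι (f z) V →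
        mfderiv 𝓘(ℂ, E) 𝓘(ℂ, E') f z w = V := by
  have key : ∀ z, ContDiffAt ℂ ω F z → (∀ᶠ y in 𝓝 z, ι (f y) = F y) →
      ContMDiffAt 𝓘(ℂ, E) 𝓘(ℂ, E') ω f z := fun z h1 h2 =>
    hι.contMDiffAt (h1.contMDiffAt.congr_of_eventuallyEq h2)
  refine ⟨key z₀ hF hf, ?_⟩
  filter_upwards [hF.eventually (by simp), hf.eventually_nhds] with z h1 h2 w V hV
  have h3 := key z h1 h2
  refine hinj _ (Eq.trans ?_ hV)
  have h4 := mfderiv_comp z (hι.holo.mdifferentiable (by simp) (f z))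
    (h3.mdifferentiableAt (by simp))
  have h5 : ι ∘ f =ᶠ[𝓝 z] F := h2
  rw [h5.mfderiv_eq, mfderiv_eq_fderiv] at h4
  exact (congrArg (fun T => T w) h4).symm

variable [FiniteDimensional ℂ E] {X : (ℂ × sl2) →ₗ[ℂ] E → E}
  {G : E → E →L[ℂ] E →L[ℂ] ℂ} {z₀ : E}

lemma hasFDerivAt_mat2 {p q r s : E → ℂ} {z : E} (hp : DifferentiableAt ℂ p z)
    (hq : DifferentiableAt ℂ q z) (hr : DifferentiableAt ℂ r z) (hs : DifferentiableAt ℂ s z)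
    (w : E) : fderiv ℂ (fun z => (![![p z, q z], ![r z, s z]] : Mat2)) z w =
      ![![fderiv ℂ p z w, fderiv ℂ q z w], ![fderiv ℂ r z w, fderiv ℂ s z w]] := by
  have hd : DifferentiableAt ℂ (fun z => (![![p z, q z], ![r z, s z]] : Mat2)) z := by
    refine differentiableAt_pi.2 fun i => differentiableAt_pi.2 fun j => ?_
    fin_cases i <;> fin_cases j <;> assumption
  refine Mat2.ext fun i j => ?_
  have h1 := ((ContinuousLinearMap.proj j : (Fin 2 → ℂ) →L[ℂ] ℂ).comp
    (ContinuousLinearMap.proj i : Mat2 →L[ℂ] (Fin 2 → ℂ))).hasFDerivAt.comp z hd.hasFDerivAt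
  have h2 := congrArg (fun T => T w) h1.fderiv
  fin_cases i <;> fin_cases j <;> exact h2.symm

lemma EquivariantEntries.exists_map {v : sl2} {p q r s : E → ℂ}
    (h : EquivariantEntries X z₀ v p q r s) : ∃ f : E → SL2, f z₀ = 1 ∧
      ContMDiffAt 𝓘(ℂ, E) 𝓘(ℂ, ℂ × ℂ × ℂ) ω f z₀ ∧ ∀ m, ∀ᶠ z in 𝓝 z₀,
        mfderiv 𝓘(ℂ, E) 𝓘(ℂ, ℂ × ℂ × ℂ) f z (X m z) = fieldSL v m (f z) := by
  classical
  let F : E → Mat2 := fun z => ![![p z, q z], ![r z, s z]]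
  have hF : ContDiffAt ℂ ω F z₀ := by
    refine contDiffAt_pi.2 fun i => contDiffAt_pi.2 fun j => ?_
    fin_cases i <;> fin_cases j
    exacts [h.smooth_p, h.smooth_q, h.smooth_r, h.smooth_s]
  let f : E → SL2 := fun z => if hz : p z * s z - q z * r z = 1 then
    ⟨!![p z, q z; r z, s z], by rw [Matrix.det_fin_two_of]; exact hz⟩ else 1
  have hf : ∀ᶠ z in 𝓝 z₀, ιSL (f z) = F z := by
    filter_upwards [h.det] with z hz
    have e : f z = ⟨!![p z, q z; r z, s z], by rw [Matrix.det_fin_two_of]; exact hz⟩ := dif_pos hz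
    rw [e]
    rfl
  obtain ⟨h1, h2⟩ := isHolEmbedding_ιSL.eventually_mfderiv dιSL_injective hF hf
  refine ⟨f, ?_, h1, fun m => ?_⟩
  · refine ιSL_embedding.injective (hf.self_of_nhds.trans ?_)
    simp only [F, h.p_zero, h.q_zero, h.r_zero, h.s_zero]
    refine Mat2.ext fun i j => ?_
    fin_cases i <;> fin_cases j <;> simp [ιSL]
  · filter_upwards [h2, hf, h.dp m, h.dq m, h.dr m, h.ds m, h.smooth_p.eventually (by simp),
      h.smooth_q.eventually (by simp), h.smooth_r.eventually (by simp),
      h.smooth_s.eventually (by simp)] with z k1 k2 e1 e2 e3 e4 s1 s2 s3 s4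
    refine k1 _ _ ?_
    rw [vecDeriv_fieldSL, k2]
    refine (hasFDerivAt_mat2 (s1.differentiableAt (by simp)) (s2.differentiableAt (by simp))
      (s3.differentiableAt (by simp)) (s4.differentiableAt (by simp)) _).trans ?_
    rw [e1, e2, e3, e4]
    have t1 := sl2_11 v
    have t2 := sl2_11 m.2
    refine Mat2.ext fun i j => ?_
    rw [ambSL_apply, Pi.sub_apply, Pi.sub_apply, Pi.smul_apply, Pi.smul_apply, mulM_apply,
      mulM_apply]
    simp only [sl2.toMat_apply, F]
    fin_cases i <;> fin_cases j <;> simp [t1, t2, -mul_eq_mul_left_iff] <;> ring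

lemma KillingAction.exists_map_CS (h : KillingAction X G z₀) (hE : Module.finrank ℂ E = 3)
    (hsurj : Function.Surjective (evalAt X z₀)) {a b c : E → ℂ}
    (hA : IsotropyFamily X z₀ 0 a b c) (h0 : sl2mk (a z₀) (b z₀) (c z₀) = sl2H) :
    ∃ f : E → ℂ × S2, f z₀ = (0, S2.base) ∧
      ContMDiffAt 𝓘(ℂ, E) 𝓘(ℂ, ℂ × ℂ × ℂ) ω f z₀ ∧ ∀ m, ∀ᶠ z in 𝓝 z₀,
        mfderiv 𝓘(ℂ, E) 𝓘(ℂ, ℂ × ℂ × ℂ) f z (X m z) = fieldCS m (f z) := by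
  classical
  have ha0 : a z₀ = 1 := congrArg (fun u : sl2 => u.1 0 0) h0
  have hb0 : b z₀ = 0 := congrArg (fun u : sl2 => u.1 0 1) h0
  have hc0 : c z₀ = 0 := congrArg (fun u : sl2 => u.1 1 0) h0
  have sa := hA.smooth_a
  have sb := hA.smooth_b
  have sc := hA.smooth_c
  let B : (ℂ × sl2) →ₗ[ℂ] E → ℂ :=
    { toFun := fun m _ => m.1
      map_add' := fun m n => rfl
      map_smul' := fun t m => rfl }
  obtain ⟨ζ, hζ, hζ0, hζX⟩ := h.exists_potential hE hsurj B (fun m => contDiffAt_const)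
    (by
      filter_upwards [hA.ker] with z h1 m hm
      obtain ⟨s, rfl⟩ := h1 m hm
      exact mul_zero s)
    (fun m n => Eventually.of_forall fun z => by
      have : ∀ k, fderiv ℂ (B k) z = 0 := fun k => fderiv_const_apply _
      rw [this, this, prod_lie]
      simp [B])
  let F₂ : E → Mat2 := fun z => ![![a z, b z], ![c z, -a z]]
  have hF₂ : ContDiffAt ℂ ω F₂ z₀ := by
    refine contDiffAt_pi.2 fun i => contDiffAt_pi.2 fun j => ?_
    fin_cases i <;> fin_cases j
    exacts [sa, sb, sc, sa.neg]
  let f : E → ℂ × S2 := fun z => (ζ z, if hz : a z ^ 2 + b z * c z = 1 then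
    ⟨!![a z, b z; c z, -a z], by simp [Matrix.trace_fin_two], by
      rw [Matrix.det_fin_two_of]
      linear_combination -hz⟩ else S2.base)
  have hf : ∀ᶠ z in 𝓝 z₀, ιCS (f z) = (ζ z, F₂ z) := by
    filter_upwards [hA.inv] with z hz
    have hz' : a z ^ 2 + b z * c z = 1 := by rw [hz, ha0, hb0]; ring
    simp only [f, dif_pos hz']
    rfl
  obtain ⟨h1, h2⟩ := isHolEmbedding_ιCS.eventually_mfderiv dιCS_injective
    (F := fun z => (ζ z, F₂ z)) (hζ.prodMk hF₂) hf
  refine ⟨f, ?_, h1, fun m => ?_⟩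
  · refine ιCS_embedding.injective (hf.self_of_nhds.trans ?_)
    simp only [F₂, ha0, hb0, hc0, hζ0]
    refine Prod.ext rfl (Mat2.ext fun i j => ?_)
    fin_cases i <;> fin_cases j <;> simp [ιCS, S2.base]
  · filter_upwards [h2, hf, hA.da m, hA.db m, hA.dc m, hζX m, sa.eventually (by simp),
      sb.eventually (by simp), sc.eventually (by simp), hζ.eventually (by simp),
      hF₂.eventually (by simp)] with z k1 k2 e1 e2 e3 e4 s1 s2 s3 s4 s5
    refine k1 _ _ ?_
    rw [vecDeriv_fieldCS, k2, ambCS_apply]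
    have d1 := s1.differentiableAt (by simp)
    have e5 : fderiv ℂ (fun z => (ζ z, F₂ z)) z (X m z) =
        (fderiv ℂ ζ z (X m z), fderiv ℂ F₂ z (X m z)) := by
      rw [DifferentiableAt.fderiv_prodMk (s4.differentiableAt (by simp))
        (s5.differentiableAt (by simp))]
      rfl
    rw [e5, e4]
    refine Prod.ext rfl ?_
    refine (hasFDerivAt_mat2 d1 (s2.differentiableAt (by simp))
      (s3.differentiableAt (by simp)) d1.fun_neg _).trans ?_
    rw [fderiv_fun_neg, _root_.neg_apply, e1, e2, e3]
    have t2 := sl2_11 m.2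
    refine Mat2.ext fun i j => ?_
    simp only [Pi.sub_apply, mulM_apply, sl2.toMat_apply, F₂]
    fin_cases i <;> fin_cases j <;> simp [t2] <;> ring

end MapsToModels

section ModelIsometries

variable {E : Type*} [NormedAddCommGroup E] [NormedSpace ℂ E] [FiniteDimensional ℂ E]
  {X : (ℂ × sl2) →ₗ[ℂ] E → E} {G : E → E →L[ℂ] E →L[ℂ] ℂ} {z₀ : E}

lemma AdSL_one (u : sl2) : AdSL 1 u = u := by
  ext i j
  rw [AdSL_val]
  simp

lemma finrank_C3' : Module.finrank ℂ (ℂ × ℂ × ℂ) = 3 := by simp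

lemma KillingAction.center_spec (h : KillingAction X G z₀) (hE : Module.finrank ℂ E = 3) :
    X (1, 0) z₀ ≠ 0 ∧ Function.Surjective (evalAt X z₀) := by
  obtain ⟨h1, h2, -⟩ := h.isotropy_line hE finrank_prod_sl2 (c := (1, 0))
    (by simp) (fun a => by rw [prod_lie, lie_zero]; rfl)
  exact ⟨h1, h2⟩

/-- A metric with diagonal isotropy is locally a left invariant metric on `SL(2, ℂ)`. -/
lemma KillingAction.exists_isometry_SL2 (h : KillingAction X G z₀) (hE : Module.finrank ℂ E = 3)
    {v : sl2} (hv : v = sl2H ∨ v = sl2E)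
    (hk : ∀ a, X a z₀ = 0 ↔ ∃ s : ℂ, a = (s, s • v)) :
    ∃ (q : LinearMap.BilinForm ℂ sl2) (hs : ∀ X Y, q X Y = q Y X)
      (hn : ∀ X, (∀ Y, q X Y = 0) → X = 0), (∀ X Y, q ⁅v, X⁆ Y + q X ⁅v, Y⁆ = 0) ∧
      ∃ F : OpenPartialHomeomorph E SL2, IsBihol (E := E) (E' := ℂ × ℂ × ℂ) F ∧ z₀ ∈ F.source ∧
        ∀ z ∈ F.source, readMetric (leftInvariant q hs hn) F z = G z := by
  obtain ⟨-, hsurj⟩ := h.center_spec hE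
  have hk1 : X (1, v) z₀ = 0 := (hk _).2 ⟨1, by rw [one_smul]⟩
  have hred : ∀ p, X p z₀ = X (0, p.2 - p.1 • v) z₀ := by
    intro p
    have h1 : p = p.1 • ((1, v) : ℂ × sl2) + (0, p.2 - p.1 • v) :=
      Prod.ext (by simp) (by simp)
    conv_lhs => rw [h1]
    rw [map_add, map_smul, Pi.add_apply, Pi.smul_apply, hk1, smul_zero, zero_add]
  let X₀ : sl2 →ₗ[ℂ] E := (evalAt X z₀).comp (LinearMap.inr ℂ ℂ sl2)
  have hX₀ : ∀ u, X₀ u = X (0, u) z₀ := fun u => rfl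
  let q : LinearMap.BilinForm ℂ sl2 := LinearMap.mk₂ ℂ (fun u w => G z₀ (X₀ u) (X₀ w))
    (by simp) (by simp) (by simp) (by simp)
  have hq : ∀ u w, q u w = G z₀ (X (0, u) z₀) (X (0, w) z₀) := fun _ _ => rfl
  have hqs : ∀ u w, q u w = q w u := fun u w => h.symm _ _ _
  have hqn : ∀ u, (∀ w, q u w = 0) → u = 0 := by
    intro u hu
    have h1 : X (0, u) z₀ = 0 := by
      refine h.nondeg _ fun w => ?_
      obtain ⟨p, rfl⟩ := hsurj w
      change G z₀ _ (X p z₀) = 0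
      rw [hred p, ← hq]
      exact hu _
    obtain ⟨s, hs⟩ := (hk _).1 h1
    have h2 : (0 : ℂ) = s := congrArg Prod.fst hs
    have h3 : u = s • v := congrArg Prod.snd hs
    rw [h3, ← h2, zero_smul]
  have hqv : ∀ u w, q ⁅v, u⁆ w + q u ⁅v, w⁆ = 0 := by
    intro u w
    have := h.invariant hk1 (0, u) (0, w)
    rw [prod_lie, prod_lie] at this
    exact this
  refine ⟨q, hqs, hqn, hqv, ?_⟩
  obtain ⟨a, b, c, hA, hA0⟩ := h.exists_isotropyFamily hE hsurj (Or.inl rfl) hk1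
  have hent : ∃ p q r s, EquivariantEntries X z₀ v p q r s := by
    rcases hv with rfl | rfl
    · exact h.exists_entries_H hE hsurj hA hA0
    · exact h.exists_entries_E hE hsurj hA hA0
  obtain ⟨e1, e2, e3, e4, he⟩ := hent
  obtain ⟨f, hf0, hf, hfX⟩ := he.exists_map
  obtain ⟨F, hF1, hF2, -, hF4⟩ := h.exists_isometry hE finrank_C3' hsurj (leftInvariant q hqs hqn)
    (fieldSL v) (fun p y => holAt_fieldSL v p y)
    (fun p y => killingAt_fieldSL q hqs hqn v p (fun u w => by rw [hqv, mul_zero]) y) hf hfX (by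
      intro p r
      rw [hf0]
      change q (maurerCartan 1 (fieldSL v p 1)) (maurerCartan 1 (fieldSL v r 1)) = _
      rw [maurerCartan_fieldSL, maurerCartan_fieldSL, inv_one, AdSL_one, AdSL_one, hred p, hred r,
        ← hq, ← neg_sub, ← neg_sub (r.1 • v), map_neg, map_neg, LinearMap.neg_apply])
  exact ⟨F, hF1, hF2, hF4⟩

/-- A metric with split isotropy is locally a product. -/
lemma KillingAction.exists_isometry_CS (h : KillingAction X G z₀) (hE : Module.finrank ℂ E = 3)
    (hk : ∀ a, X a z₀ = 0 ↔ ∃ s : ℂ, a = (0, s • sl2H))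
    (h1 : G z₀ (X (1, 0) z₀) (X (1, 0) z₀) = 1) :
    ∃ (c : ℂ) (hc : c ≠ 0) (F : OpenPartialHomeomorph E (ℂ × S2)),
      IsBihol (E := E) (E' := ℂ × ℂ × ℂ) F ∧ z₀ ∈ F.source ∧
        ∀ z ∈ F.source, readMetric (productMetric c hc) F z = G z := by
  obtain ⟨-, hsurj⟩ := h.center_spec hE
  have hk' : ∀ a, X a z₀ = 0 ↔ ∃ t : ℂ, a = t • ((0, sl2H) : ℂ × sl2) := by
    intro a
    rw [hk]
    refine exists_congr fun s => ?_
    rw [Prod.smul_mk, smul_zero]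
  obtain ⟨m1, m2, m3, m4, m5⟩ := h.metric_of_isotropy_H hk'
  set e := G z₀ (X (0, sl2E) z₀) (X (0, sl2F) z₀) with he
  have hG : ∀ p r, G z₀ (X p z₀) (X r z₀) = p.1 * r.1 +
      e * (p.2.1 0 1 * r.2.1 1 0 + p.2.1 1 0 * r.2.1 0 1) := by
    intro p r
    rw [KillingAction.decomp p z₀, KillingAction.decomp r z₀]
    have m1' := (h.symm z₀ (X (0, sl2E) z₀) (X (1, 0) z₀)).trans m1
    have m2' := (h.symm z₀ (X (0, sl2F) z₀) (X (1, 0) z₀)).trans m2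
    have he' : G z₀ (X (0, sl2F) z₀) (X (0, sl2E) z₀) = e := h.symm _ _ _
    simp only [m5, smul_zero, zero_add, map_add, map_smul, _root_.add_apply, smul_apply, h1, m1, m2,
      m3, m4, ← he, m1', m2', he', smul_eq_mul]
    ring
  have he0 : e ≠ 0 := by
    intro h0
    have h2 : X (0, sl2E) z₀ = 0 := by
      refine h.nondeg _ fun w => ?_
      obtain ⟨p, rfl⟩ := hsurj w
      change G z₀ _ (X p z₀) = 0
      rw [hG, h0]
      simp
    obtain ⟨s, hs⟩ := (hk _).1 h2
    have h3 : sl2E = s • sl2H := congrArg Prod.snd hs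
    have h4 := congrArg (fun u : sl2 => u.1 0 1) h3
    simp [sl2E, sl2H_eq, sl2mk_smul] at h4
  have hc : -e / 2 ≠ 0 := div_ne_zero (neg_ne_zero.2 he0) two_ne_zero
  refine ⟨-e / 2, hc, ?_⟩
  obtain ⟨a, b, c, hA, hA0⟩ := h.exists_isotropyFamily hE hsurj (Or.inr ⟨rfl, rfl⟩)
    ((hk' _).2 ⟨1, (one_smul _ _).symm⟩)
  obtain ⟨f, hf0, hf, hfX⟩ := h.exists_map_CS hE hsurj hA hA0
  obtain ⟨F, hF1, hF2, -, hF4⟩ := h.exists_isometry hE finrank_C3' hsurj (productMetric (-e / 2) hc)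
    fieldCS (fun p y => holAt_fieldCS p y) (fun p y => killingAt_fieldCS _ hc p y) hf hfX (by
      intro p r
      rw [hf0, hG]
      change ambientForm (-e / 2) (vecDeriv ιCS (0, S2.base) (fieldCS p (0, S2.base)))
        (vecDeriv ιCS (0, S2.base) (fieldCS r (0, S2.base))) = _
      rw [vecDeriv_fieldCS, vecDeriv_fieldCS, ambientForm_apply, ambCS_apply, ambCS_apply]
      have t1 := sl2_11 p.2
      have t2 := sl2_11 r.2
      simp [mulM_apply, sl2.toMat_apply, ιCS, S2.base, t1, t2]
      ring)
  exact ⟨F, hF1, hF2, hF4⟩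

end ModelIsometries

section LocalModels

variable {M : Type*} [TopologicalSpace M] [ChartedSpace C3 M] [IsManifold 𝓘(ℂ, C3) ω M]

lemma LocallyHomogeneous.locallyModelledOn {E' M' : Type*} [NormedAddCommGroup E']
    [NormedSpace ℂ E'] [TopologicalSpace M'] [ChartedSpace E' M'] [IsManifold 𝓘(ℂ, E') ω M']
    {g : Metric C3 M} (hom : LocallyHomogeneous g) {g' : Metric E' M'} {x₀ : M}
    {f : OpenPartialHomeomorph M M'} (hf : IsLocalIsometry g g' f) (hx : x₀ ∈ f.source) :
    LocallyModelledOn g g' := by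
  intro x
  obtain ⟨φ, hφ, hxφ, hφx⟩ := hom x x₀
  refine ⟨φ.trans f, hφ.trans hf, ?_⟩
  rw [OpenPartialHomeomorph.trans_source]
  exact ⟨hxφ, by rw [Set.mem_preimage, hφx]; exact hx⟩

/-- Transport of the isotropy by local homogeneity. -/
lemma LocallyHomogeneous.exists_isotropy_equiv {g : Metric C3 M} (hom : LocallyHomogeneous g) {x₀ : M}
    (ψ : KillingAlgebra g x₀ ≃ₗ⁅ℂ⁆ ℂ × sl2) (x : M) :
    ∃ ψ' : KillingAlgebra g x ≃ₗ⁅ℂ⁆ ℂ × sl2, ∀ a, ∃ b, ψ' a = ψ b ∧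
      (a ∈ KillingAlgebra.isotropy g x ↔ b ∈ KillingAlgebra.isotropy g x₀) := by
  obtain ⟨φ, hφ, hxφ, hφx⟩ := hom x₀ x
  subst hφx
  refine ⟨(hφ.pullEquiv hxφ).trans ψ, fun a => ⟨hφ.pullEquiv hxφ a, rfl, ?_⟩⟩
  exact (hφ.pullEquiv_mem_isotropy hxφ a).symm

lemma exists_local_model (g : Metric C3 M) (hom : LocallyHomogeneous g) {x₀ : M}
    (ψ : KillingAlgebra g x₀ ≃ₗ⁅ℂ⁆ ℂ × sl2) :
    (∃ (q : LinearMap.BilinForm ℂ sl2) (hs : ∀ X Y, q X Y = q Y X)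
      (hn : ∀ X, (∀ Y, q X Y = 0) → X = 0) (v : sl2), (v = sl2H ∨ v = sl2E) ∧
      (∀ X Y, q ⁅v, X⁆ Y + q X ⁅v, Y⁆ = 0) ∧ LocallyModelledOn g (leftInvariant q hs hn) ∧
      ∃ ψ' : KillingAlgebra g x₀ ≃ₗ⁅ℂ⁆ ℂ × sl2,
        ∀ a, a ∈ KillingAlgebra.isotropy g x₀ ↔ ∃ s : ℂ, ψ' a = (s, s • v)) ∨
    ∃ (c : ℂ) (hc : c ≠ 0), LocallyModelledOn g (productMetric c hc) ∧
      ∃ ψ' : KillingAlgebra g x₀ ≃ₗ⁅ℂ⁆ ℂ × sl2,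
        ∀ a, a ∈ KillingAlgebra.isotropy g x₀ ↔ ∃ s : ℂ, ψ' a = (0, s • sl2H) := by
  have hE : Module.finrank ℂ C3 = 3 := by simp
  have hact := (killingAction_read g x₀).comp ψ.symm
  obtain ⟨Φ, hΦ⟩ := hact.exists_normal_form hE
  have hact' := hact.comp Φ
  have hiso : ∀ a, a ∈ KillingAlgebra.isotropy g x₀ ↔
      KillingAlgebra.read g x₀ (ψ.symm (Φ ((ψ.trans Φ.symm) a))) (chartAt C3 x₀ x₀) = 0 := by
    intro a
    have : ψ.symm (Φ ((ψ.trans Φ.symm) a)) = a := by simp [LieEquiv.trans_apply]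
    rw [this, KillingAlgebra.read_eq_zero_iff]
    rfl
  rcases hΦ with ⟨v, hv, hk⟩ | ⟨hk, h1⟩
  · left
    obtain ⟨q, hs, hn, hq, F, hF, hF0, hFG⟩ := hact'.exists_isometry_SL2 hE hv hk
    refine ⟨q, hs, hn, v, hv, hq, hom.locallyModelledOn (isLocalIsometry_of_readMetric hF hFG)
      (x₀ := x₀) ?_, ψ.trans Φ.symm, fun a => (hiso a).trans (hk _)⟩
    rw [OpenPartialHomeomorph.trans_source]
    exact ⟨mem_chart_source _ _, hF0⟩
  · right
    obtain ⟨c, hc, F, hF, hF0, hFG⟩ := hact'.exists_isometry_CS hE hk h1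
    refine ⟨c, hc, hom.locallyModelledOn (isLocalIsometry_of_readMetric hF hFG)
      (x₀ := x₀) ?_, ψ.trans Φ.symm, fun a => (hiso a).trans (hk _)⟩
    rw [OpenPartialHomeomorph.trans_source]
    exact ⟨mem_chart_source _ _, hF0⟩

end LocalModels

section ConnectedSL2

/-- Upper and lower triangular unipotent matrices. -/
def upperSL (t : ℂ) : SL2 := ⟨!![1, t; 0, 1], by rw [Matrix.det_fin_two_of]; ring⟩

def lowerSL (t : ℂ) : SL2 := ⟨!![1, 0; t, 1], by rw [Matrix.det_fin_two_of]; ring⟩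

lemma SL2_ext {a b : SL2} (h1 : a.1 0 0 = b.1 0 0) (h2 : a.1 0 1 = b.1 0 1)
    (h3 : a.1 1 0 = b.1 1 0) (h4 : a.1 1 1 = b.1 1 1) : a = b := by
  refine Subtype.ext (Matrix.ext fun i j => ?_)
  fin_cases i <;> fin_cases j <;> assumption

lemma SL2_det (a : SL2) : a.1 0 0 * a.1 1 1 - a.1 0 1 * a.1 1 0 = 1 := by
  have := a.2
  rwa [Matrix.det_fin_two] at this

lemma SL2_mul_val (a b : SL2) (i j : Fin 2) :
    (a * b).1 i j = a.1 i 0 * b.1 0 j + a.1 i 1 * b.1 1 j := by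
  change (a.1 * b.1) i j = _
  rw [Matrix.mul_apply, Fin.sum_univ_two]

lemma exists_unipotent_factors (a : SL2) :
    ∃ x y z w, upperSL x * lowerSL y * upperSL z * lowerSL w = a := by
  have key : ∀ b : SL2, b.1 1 0 ≠ 0 → ∃ x y z, upperSL x * lowerSL y * upperSL z = b := by
    intro b hb
    have hd := SL2_det b
    refine ⟨(b.1 0 0 - 1) / b.1 1 0, b.1 1 0, (b.1 1 1 - 1) / b.1 1 0, ?_⟩
    apply SL2_ext <;> simp only [SL2_mul_val] <;> simp [upperSL, lowerSL] <;> field_simp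
    · ring
    · linear_combination hd
    · ring
  by_cases h : a.1 1 0 = 0
  · have hd := SL2_det a
    have hd' : a.1 1 1 ≠ 0 := by
      intro h0
      rw [h, h0] at hd
      simp at hd
    obtain ⟨x, y, z, hxyz⟩ := key (a * lowerSL 1) (by
      rw [SL2_mul_val, h]
      simpa [lowerSL] using hd')
    refine ⟨x, y, z, -1, ?_⟩
    rw [hxyz, mul_assoc]
    have : lowerSL 1 * lowerSL (-1) = 1 := by
      apply SL2_ext <;> simp only [SL2_mul_val] <;> simp [lowerSL]
    rw [this, mul_one]
  · obtain ⟨x, y, z, hxyz⟩ := key a h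
    refine ⟨x, y, z, 0, ?_⟩
    have : lowerSL 0 = 1 := by apply SL2_ext <;> simp [lowerSL]
    rw [hxyz, this, mul_one]

lemma continuous_SL2_mk {Z : Type*} [TopologicalSpace Z] {f : Z → SL2}
    (h : ∀ i j, Continuous fun z => (f z).1 i j) : Continuous f :=
  ιSL_embedding.continuous_iff.2 (continuous_pi fun i => continuous_pi fun j => h i j)

lemma continuous_upperSL : Continuous upperSL := by
  refine continuous_SL2_mk fun i j => ?_
  fin_cases i <;> fin_cases j <;> simp [upperSL] <;> fun_prop

lemma continuous_lowerSL : Continuous lowerSL := by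
  refine continuous_SL2_mk fun i j => ?_
  fin_cases i <;> fin_cases j <;> simp [lowerSL] <;> fun_prop

instance preconnectedSpace_SL2 : PreconnectedSpace SL2 := by
  have hs : Function.Surjective fun t : ℂ × ℂ × ℂ × ℂ =>
      upperSL t.1 * lowerSL t.2.1 * upperSL t.2.2.1 * lowerSL t.2.2.2 := by
    intro a
    obtain ⟨x, y, z, w, h⟩ := exists_unipotent_factors a
    exact ⟨(x, y, z, w), h⟩
  refine hs.denseRange.preconnectedSpace ?_
  have h1 := continuous_upperSL
  have h2 := continuous_lowerSL
  fun_prop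

end ConnectedSL2

section ConstantMaps

variable {E : Type*} [NormedAddCommGroup E] [NormedSpace ℂ E] [FiniteDimensional ℂ E]
variable {X : Type*} [TopologicalSpace X] [ChartedSpace E X] [IsManifold 𝓘(ℂ, E) ω X]
variable {S : Type*} [NormedAddCommGroup S] [NormedSpace ℂ S]

lemma eq_of_vecDeriv_eq_zero [PreconnectedSpace X] {f : X → S}
    (hf : ContMDiff 𝓘(ℂ, E) 𝓘(ℂ, S) ω f) (h0 : ∀ x (v : TangentSpace 𝓘(ℂ, E) x), vecDeriv f x v = 0)
    (x y : X) : f x = f y := by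
  refine IsLocallyConstant.apply_eq_of_preconnectedSpace
    ((IsLocallyConstant.iff_eventually_eq f).2 fun x => ?_) x y
  have hcs := isBihol_chartAt_symm (E := E) x
  have ht : ∀ᶠ z in 𝓝 (chartAt E x x), z ∈ (chartAt E x).symm.source :=
    (chartAt E x).symm.open_source.mem_nhds (chartAt_mem_symm_source x)
  have h1 := eventually_eq_const_of_fderiv_eq_zero (φ := f ∘ (chartAt E x).symm)
    (z₀ := chartAt E x x) (by
      filter_upwards [ht] with z hz
      exact ((hf.mdifferentiable (by simp) _).comp z (hcs.mdiff hz)).differentiableAt) (by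
      filter_upwards [ht] with z hz
      have h2 := mfderiv_comp z (hf.mdifferentiable (by simp) ((chartAt E x).symm z)) (hcs.mdiff hz)
      rw [mfderiv_eq_fderiv] at h2
      rw [h2]
      ext v
      exact h0 _ _)
  filter_upwards [(chartAt E x).continuousAt (mem_chart_source E x) |>.eventually h1,
    (chartAt E x).open_source.mem_nhds (mem_chart_source E x)] with y hy hy'
  simpa only [Function.comp_apply, (chartAt E x).left_inv hy', chartAt_symm_self] using hy

end ConstantMaps

section Automorphisms

lemma sl2mk_eq (a b c : ℂ) : sl2mk a b c = a • sl2H + b • sl2E + c • sl2F := by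
  rw [sl2H_eq, sl2E, sl2F]
  simp only [sl2mk_smul, sl2mk_add]
  congr 1 <;> ring

lemma sl2_hom_ext {V : Type*} [AddCommGroup V] [Module ℂ V] {S T : sl2 →ₗ[ℂ] V}
    (hH : S sl2H = T sl2H) (hE : S sl2E = T sl2E) (hF : S sl2F = T sl2F) : S = T := by
  ext u
  induction u using sl2_induction with | h a b c => ?_
  simp only [sl2mk_eq, map_add, map_smul, hH, hE, hF]

lemma AdSL_mul (a b : SL2) (u : sl2) : AdSL (a * b) u = AdSL a (AdSL b u) := by
  refine Subtype.ext ?_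
  rw [AdSL_val, AdSL_val, AdSL_val, mul_inv_rev, Matrix.SpecialLinearGroup.coe_mul,
    Matrix.SpecialLinearGroup.coe_mul]
  simp only [Matrix.mul_assoc]

lemma AdSL_inv_apply (b : SL2) (u : sl2) : AdSL b⁻¹ (AdSL b u) = u := by
  rw [← AdSL_mul, inv_mul_cancel, AdSL_one]

lemma AdSL_apply_inv (b : SL2) (u : sl2) : AdSL b (AdSL b⁻¹ u) = u := by
  rw [← AdSL_mul, mul_inv_cancel, AdSL_one]

lemma diagSL_add (s t : ℂ) : diagSL (s + t) = diagSL s * diagSL t := by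
  apply SL2_ext <;> rw [SL2_mul_val] <;> simp [diagSL, Complex.exp_add, mul_comm]

lemma diagSL_zero : diagSL 0 = 1 := by
  apply SL2_ext <;> simp [diagSL]

lemma diagSL_inv (t : ℂ) : (diagSL t)⁻¹ = diagSL (-t) :=
  inv_eq_of_mul_eq_one_right (by rw [← diagSL_add, add_neg_cancel, diagSL_zero])

lemma AdSL_diagSL (t : ℂ) (u : sl2) : AdSL (diagSL t) u =
    sl2mk (u.1 0 0) (Complex.exp (2 * t) * u.1 0 1) (Complex.exp (-(2 * t)) * u.1 1 0) := by
  have h2 : Complex.exp (2 * t) = Complex.exp t * Complex.exp t := by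
    rw [← Complex.exp_add]; congr 1; ring
  have h3 : Complex.exp (-(2 * t)) = Complex.exp (-t) * Complex.exp (-t) := by
    rw [← Complex.exp_add]; congr 1; ring
  have h4 : Complex.exp t * Complex.exp (-t) = 1 := by
    rw [← Complex.exp_add, add_neg_cancel, Complex.exp_zero]
  rw [h2, h3]
  apply sl2_ext <;>
  · rw [AdSL_val, diagSL_inv]
    simp only [Matrix.mul_apply, Fin.sum_univ_two, sl2mk_00, sl2mk_01, sl2mk_10]
    simp [diagSL]
    try linear_combination u.1 0 0 * h4
    try ring

/-- Automorphisms of `sl(2, ℂ)` are inner. -/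
lemma exists_eq_AdSL (α : sl2 →ₗ⁅ℂ⁆ sl2) (hα : Function.Injective α) :
    ∃ b : SL2, ∀ u, α u = AdSL b u := by
  have hE0 : α sl2E ≠ 0 := fun h => sl2E_ne_zero (hα (h.trans (map_zero α).symm))
  have hHE : ⁅α sl2H, α sl2E⁆ = (2 : ℂ) • α sl2E := by rw [← LieHom.map_lie, lie_H_E, map_smul]
  have hdet : (α sl2H).1 0 0 ^ 2 + (α sl2H).1 0 1 * (α sl2H).1 1 0 = 1 := by
    rw [← sl2mk_eta (α sl2H), ← sl2mk_eta (α sl2E), sl2mk_lie, sl2mk_smul] at hHE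
    have e1 := congrArg (fun u : sl2 => u.1 0 0) hHE
    have e2 := congrArg (fun u : sl2 => u.1 0 1) hHE
    have e3 := congrArg (fun u : sl2 => u.1 1 0) hHE
    simp only [sl2mk_00, sl2mk_01, sl2mk_10] at e1 e2 e3
    set a := (α sl2H).1 0 0
    set b := (α sl2H).1 0 1
    set c := (α sl2H).1 1 0
    set x := (α sl2E).1 0 0 with hx
    set y := (α sl2E).1 0 1 with hy
    set w := (α sl2E).1 1 0 with hw
    have ht : 2 * a * x + b * w + c * y = 0 := by
      linear_combination (-a) * e1 - c / 2 * e2 - b / 2 * e3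
    have k1 : (a ^ 2 + b * c - 1) * x = 0 := by
      linear_combination e1 / 2 + b / 4 * e3 - c / 4 * e2 + a / 2 * ht
    have k2 : (a ^ 2 + b * c - 1) * y = 0 := by
      linear_combination e2 / 2 - b / 2 * e1 + a / 2 * e2 + b / 2 * ht
    have k3 : (a ^ 2 + b * c - 1) * w = 0 := by
      linear_combination e3 / 2 + c / 2 * e1 - a / 2 * e3 + c / 2 * ht
    by_contra hne
    have hne' : a ^ 2 + b * c - 1 ≠ 0 := fun h => hne (by linear_combination h)
    refine hE0 ?_
    rw [← sl2mk_eta (α sl2E), ← hx, ← hy, ← hw, (mul_eq_zero.1 k1).resolve_left hne',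
      (mul_eq_zero.1 k2).resolve_left hne', (mul_eq_zero.1 k3).resolve_left hne', sl2mk_zero]
  obtain ⟨b, hb⟩ := exists_AdSL_eq_H hdet
  have hH := hb
  have hE' : ⁅sl2H, AdSL b (α sl2E)⁆ = (2 : ℂ) • AdSL b (α sl2E) := by
    rw [← hH, ← LieEquiv.map_lie, hHE, map_smul]
  have hF' : ⁅sl2H, AdSL b (α sl2F)⁆ = (-2 : ℂ) • AdSL b (α sl2F) := by
    rw [← hH, ← LieEquiv.map_lie, ← LieHom.map_lie, lie_H_F, map_smul, map_smul]
  have hEF : ⁅AdSL b (α sl2E), AdSL b (α sl2F)⁆ = sl2H := by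
    rw [← LieEquiv.map_lie, ← LieHom.map_lie, lie_E_F, hH]
  rw [sl2H_eq, ← sl2mk_eta (AdSL b (α sl2E)), sl2mk_lie, sl2mk_smul] at hE'
  rw [sl2H_eq, ← sl2mk_eta (AdSL b (α sl2F)), sl2mk_lie, sl2mk_smul] at hF'
  rw [sl2H_eq, ← sl2mk_eta (AdSL b (α sl2E)), ← sl2mk_eta (AdSL b (α sl2F)), sl2mk_lie] at hEF
  have e1 := congrArg (fun u : sl2 => u.1 0 0) hE'
  have e2 := congrArg (fun u : sl2 => u.1 1 0) hE'
  have f1 := congrArg (fun u : sl2 => u.1 0 0) hF'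
  have f2 := congrArg (fun u : sl2 => u.1 0 1) hF'
  have h1 := congrArg (fun u : sl2 => u.1 0 0) hEF
  simp only [sl2mk_00, sl2mk_01, sl2mk_10] at e1 e2 f1 f2 h1
  have e1' : (AdSL b (α sl2E)).1 0 0 = 0 := by linear_combination -e1 / 2
  have e2' : (AdSL b (α sl2E)).1 1 0 = 0 := by linear_combination -e2 / 4
  have f1' : (AdSL b (α sl2F)).1 0 0 = 0 := by linear_combination f1 / 2
  have f2' : (AdSL b (α sl2F)).1 0 1 = 0 := by linear_combination f2 / 4
  obtain ⟨r, hr⟩ := IsAlgClosed.exists_eq_mul_self ((AdSL b (α sl2E)).1 0 1)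
  rw [e2', f2', hr] at h1
  have hr0 : r ≠ 0 := by
    rintro rfl
    simp at h1
  have hF1 : (AdSL b (α sl2F)).1 1 0 = r⁻¹ * r⁻¹ := by
    field_simp
    linear_combination h1
  have h2 : Complex.exp (2 * Complex.log r) = r * r := by
    rw [two_mul, Complex.exp_add, Complex.exp_log hr0]
  have hd : ∀ u : sl2, AdSL (diagSL (Complex.log r)) u =
      sl2mk (u.1 0 0) (r * r * u.1 0 1) (r⁻¹ * r⁻¹ * u.1 1 0) := by
    intro u
    rw [AdSL_diagSL, Complex.exp_neg, h2, mul_inv]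
  set d := diagSL (Complex.log r)
  have key : ∀ u, AdSL b (α u) = AdSL d u := by
    have : (AdSL b : sl2 ≃ₗ[ℂ] sl2).toLinearMap.comp (α : sl2 →ₗ[ℂ] sl2) =
        (AdSL d : sl2 ≃ₗ[ℂ] sl2).toLinearMap := by
      apply sl2_hom_ext
      · change AdSL b (α sl2H) = AdSL d sl2H
        rw [hH, hd, sl2H_eq]
        simp
      · change AdSL b (α sl2E) = AdSL d sl2E
        rw [hd]
        apply sl2_ext
        · rw [e1']; rfl
        · rw [hr]; simp [sl2E]
        · rw [e2']; simp [sl2E]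
      · change AdSL b (α sl2F) = AdSL d sl2F
        rw [hd]
        apply sl2_ext
        · rw [f1']; rfl
        · rw [f2']; simp [sl2F]
        · rw [hF1]; simp [sl2F]
    exact fun u => congrArg (fun l => l u) this
  exact ⟨b⁻¹ * d, fun u => by rw [AdSL_mul, ← key, AdSL_inv_apply]⟩

lemma lieHom_prod_fst (j : sl2 →ₗ⁅ℂ⁆ ℂ × sl2) (u : sl2) : (j u).1 = 0 := by
  have h : ∀ u w, (j ⁅u, w⁆).1 = 0 := fun u w => by rw [LieHom.map_lie, prod_lie]
  have h0 : (LinearMap.fst ℂ ℂ sl2).comp (j : sl2 →ₗ[ℂ] ℂ × sl2) = 0 := by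
    apply sl2_hom_ext
    · have := h sl2E sl2F
      rwa [lie_E_F] at this
    · have := h sl2H sl2E
      rw [lie_H_E, map_smul] at this
      exact (mul_eq_zero.1 this).resolve_left two_ne_zero
    · have := h sl2H sl2F
      rw [lie_H_F, map_smul] at this
      exact (mul_eq_zero.1 this).resolve_left (by norm_num)
  exact congrArg (fun l => l u) h0

end Automorphisms

section KillingFamilies

variable {E E' : Type*} [NormedAddCommGroup E] [NormedSpace ℂ E] [CompleteSpace E]
  [NormedAddCommGroup E'] [NormedSpace ℂ E'] [CompleteSpace E']
variable {M M' : Type*} [TopologicalSpace M] [ChartedSpace E M] [IsManifold 𝓘(ℂ, E) ω M]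
  [TopologicalSpace M'] [ChartedSpace E' M'] [IsManifold 𝓘(ℂ, E') ω M']
variable {L L' : Type*} [LieRing L] [LieAlgebra ℂ L] [LieRing L'] [LieAlgebra ℂ L']

variable (L) in
/-- A Lie algebra acting by global Killing fields. -/
structure KillingFamily (g : Metric E M) where
  field : L →ₗ[ℂ] ∀ y : M, TangentSpace 𝓘(ℂ, E) y
  holAt : ∀ p y, HolAt (field p) y
  killingAt : ∀ p y, KillingAt g (field p) y
  bracket : ∀ p r y, mlieBracket 𝓘(ℂ, E) (field p) (field r) y = field ⁅p, r⁆ y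

namespace KillingFamily

variable {g : Metric E M} {g' : Metric E' M'} (F : KillingFamily L g) (F' : KillingFamily L' g')

lemma mem (p : L) (y : M) : F.field p ∈ localKilling g y :=
  Eventually.of_forall fun z => ⟨F.holAt p z, F.killingAt p z⟩

/-- The germ at `y` of a global Killing field. -/
def germ (y : M) : L →ₗ⁅ℂ⁆ KillingAlgebra g y where
  toFun p := KillingAlgebra.germ g y ⟨F.field p, F.mem p y⟩
  map_add' p r := by
    rw [← map_add]
    exact congrArg _ (Subtype.ext (map_add F.field p r))
  map_smul' t p := by
    rw [RingHom.id_apply, ← map_smul]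
    exact congrArg _ (Subtype.ext (map_smul F.field t p))
  map_lie' {p r} := by
    rw [KillingAlgebra.germ_lie, KillingAlgebra.germ_eq_iff]
    exact Eventually.of_forall fun z => (F.bracket p r z).symm

lemma germ_apply (y : M) (p : L) :
    F.germ y p = KillingAlgebra.germ g y ⟨F.field p, F.mem p y⟩ := rfl

lemma germ_eq_iff {y : M} {p r : L} : F.germ y p = F.germ y r ↔
    ∀ᶠ z in 𝓝 y, F.field p z = F.field r z := KillingAlgebra.germ_eq_iff

lemma eval_germ (y : M) (p : L) : KillingAlgebra.eval g y (F.germ y p) = F.field p y := rfl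

/-- The global Killing fields exhaust the local Killing fields. -/
def Complete : Prop := ∀ y, Function.Bijective (F.germ y)

variable {F F'}

/-- A local isometry identifies complete families of Killing fields. -/
lemma Complete.exists_lieEquiv (hF : F.Complete) (hF' : F'.Complete) {f : OpenPartialHomeomorph M M'}
    (hf : IsLocalIsometry g g' f) {x : M} (hx : x ∈ f.source) :
    ∃ α : L' ≃ₗ⁅ℂ⁆ L, ∀ p, ∀ᶠ y in 𝓝 x,
      mfderiv 𝓘(ℂ, E) 𝓘(ℂ, E') f y (F.field (α p) y) = F'.field p (f y) := by
  let α : L' ≃ₗ⁅ℂ⁆ L := ((LieEquiv.ofBijective (F'.germ (f x)) (hF' (f x))).trans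
    (hf.pullEquiv hx)).trans (LieEquiv.ofBijective (F.germ x) (hF x)).symm
  refine ⟨α, fun p => ?_⟩
  have h : F.germ x (α p) = hf.pullEquiv hx (F'.germ (f x) p) :=
    LieEquiv.apply_symm_apply (LieEquiv.ofBijective (F.germ x) (hF x)) _
  rw [germ_apply, germ_apply, hf.pullEquiv_germ, KillingAlgebra.germ_eq_iff] at h
  filter_upwards [h, f.open_source.mem_nhds hx] with y hy hys
  exact (hf.isBihol.mpullback_eq_iff hys).1 hy.symm

end KillingFamily

/-- A biholomorphism preserving the metric is an isometry. -/
lemma isLocalIsometry_toOpenPartialHomeomorph {g : Metric E M} {g' : Metric E' M'}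
    (φ : Diffeomorph 𝓘(ℂ, E) 𝓘(ℂ, E') M M' ω)
    (h : ∀ x (v w : TangentSpace 𝓘(ℂ, E) x), g'.val (φ x) (mfderiv 𝓘(ℂ, E) 𝓘(ℂ, E') φ x v)
      (mfderiv 𝓘(ℂ, E) 𝓘(ℂ, E') φ x w) = g.val x v w) :
    IsLocalIsometry g g' φ.toHomeomorph.toOpenPartialHomeomorph :=
  ⟨φ.contMDiff.contMDiffOn, φ.symm.contMDiff.contMDiffOn, fun x _ => h x⟩

/-- An isometry acts on a complete family of Killing fields by one Lie algebra automorphism. -/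
lemma KillingFamily.Complete.exists_automorphism [PreconnectedSpace M] [Nonempty M] {g : Metric E M}
    {F : KillingFamily L g} (hF : F.Complete) (φ : Diffeomorph 𝓘(ℂ, E) 𝓘(ℂ, E) M M ω)
    (h : ∀ x (v w : TangentSpace 𝓘(ℂ, E) x), g.val (φ x) (mfderiv 𝓘(ℂ, E) 𝓘(ℂ, E) φ x v)
      (mfderiv 𝓘(ℂ, E) 𝓘(ℂ, E) φ x w) = g.val x v w) :
    ∃ α : L ≃ₗ⁅ℂ⁆ L, ∀ p y,
      mfderiv 𝓘(ℂ, E) 𝓘(ℂ, E) φ y (F.field (α p) y) = F.field p (φ y) := by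
  have hφ := isLocalIsometry_toOpenPartialHomeomorph φ h
  choose α hα using fun x : M => hF.exists_lieEquiv hF hφ (Set.mem_univ x)
  have hα' : ∀ x p, ∀ᶠ y in 𝓝 x,
    mfderiv 𝓘(ℂ, E) 𝓘(ℂ, E) φ y (F.field (α x p) y) = F.field p (φ y) := hα
  have hc : ∀ p x y, α x p = α y p := by
    intro p
    refine IsLocallyConstant.apply_eq_of_preconnectedSpace
      ((IsLocallyConstant.iff_eventually_eq fun x => α x p).2 fun x => ?_)
    filter_upwards [eventually_eventually_nhds.2 (hα' x p)] with y hy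
    refine (hF y).1 (F.germ_eq_iff.2 ?_)
    filter_upwards [hy, hα' y p] with z hz hz'
    exact hφ.isBihol.mfderiv_injective (Set.mem_univ z) (hz'.trans hz.symm)
  obtain ⟨x₀⟩ := ‹Nonempty M›
  refine ⟨α x₀, fun p y => ?_⟩
  rw [hc p x₀ y]
  exact (hα' y p).self_of_nhds

/-- A family with injective germs is complete if the Killing algebras have the right dimension. -/
lemma KillingFamily.complete_of_injective {g : Metric E M} (F : KillingFamily L g)
    (hi : ∀ y, Function.Injective (F.germ y)) (h0 : Module.finrank ℂ L ≠ 0)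
    (hd : ∀ y, Module.finrank ℂ (KillingAlgebra g y) = Module.finrank ℂ L) : F.Complete := by
  intro y
  have : FiniteDimensional ℂ L := Module.finite_of_finrank_pos (Nat.pos_of_ne_zero h0)
  have : FiniteDimensional ℂ (KillingAlgebra g y) :=
    Module.finite_of_finrank_pos (by rw [hd]; exact Nat.pos_of_ne_zero h0)
  exact ⟨hi y, (LinearMap.injective_iff_surjective_of_finrank_eq_finrank
    (f := (F.germ y : L →ₗ[ℂ] KillingAlgebra g y)) (hd y).symm).1 (hi y)⟩

end KillingFamilies

lemma sl2_eq_zero_of_lie {u : sl2} (h : ∀ w : sl2, ⁅u, w⁆ = 0) : u = 0 := by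
  induction u using sl2_induction with | h a b c => ?_
  have h1 := h sl2E
  have h2 := h sl2H
  rw [sl2E, sl2mk_lie] at h1
  rw [sl2H_eq, sl2mk_lie] at h2
  have e1 := congrArg (fun u : sl2 => u.1 0 0) h1
  have e2 := congrArg (fun u : sl2 => u.1 0 1) h1
  have e3 := congrArg (fun u : sl2 => u.1 0 1) h2
  simp only [sl2mk_00, sl2mk_01] at e1 e2 e3
  have z0 : (0 : sl2).1 0 0 = 0 := rfl
  have z1 : (0 : sl2).1 0 1 = 0 := rfl
  rw [z0] at e1
  rw [z1] at e2 e3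
  rw [← sl2mk_zero]
  congr 1
  · linear_combination e2 / 2
  · linear_combination -e3 / 2
  · linear_combination -e1

/-- A homomorphism from `ℂ ⊕ sl(2, ℂ)` is injective if it is not zero on both summands. -/
lemma injective_of_prod {L : Type*} [LieRing L] [LieAlgebra ℂ L] (j : ℂ × sl2 →ₗ⁅ℂ⁆ L) {s : ℂ}
    {u : sl2} (hs : j (s, 0) ≠ 0) (hu : j (0, u) ≠ 0) : Function.Injective j := by
  have h1 := sl2_injective_or_zero ((j : ℂ × sl2 →ₗ[ℂ] L).comp (LinearMap.inr ℂ ℂ sl2)) (by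
    intro u w hw
    change j (0, ⁅u, w⁆) = 0
    have := prod_lie (0, u) (0, w)
    rw [← this, LieHom.map_lie]
    have hw' : j (0, w) = 0 := hw
    rw [hw', lie_zero])
  have h2 : ∀ w, j (0, w) = 0 → w = 0 := by
    intro w hw
    rcases h1 with h1 | h1
    · exact h1 ((hw : _ = _).trans (map_zero ((j : ℂ × sl2 →ₗ[ℂ] L).comp (LinearMap.inr ℂ ℂ sl2))).symm)
    · exact absurd (congrArg (fun l => l u) h1) hu
  rw [injective_iff_map_eq_zero]
  rintro ⟨t, w⟩ hw
  have hw0 : w = 0 := by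
    refine sl2_eq_zero_of_lie fun x => h2 _ ?_
    have := prod_lie (t, w) (0, x)
    rw [← this, LieHom.map_lie, hw, zero_lie]
  subst hw0
  have : s • ((t, 0) : ℂ × sl2) = t • (s, 0) := by simp [mul_comm]
  have h3 := congrArg j this
  rw [map_smul, map_smul, hw, smul_zero] at h3
  rw [(smul_eq_zero.1 h3.symm).resolve_right hs]
  rfl

section TraceForm

/-- The form `tr (X Y)` on `sl(2, ℂ)`. -/
def trForm : LinearMap.BilinForm ℂ sl2 :=
  LinearMap.mk₂ ℂ (fun X Y => 2 * X.1 0 0 * Y.1 0 0 + X.1 0 1 * Y.1 1 0 + X.1 1 0 * Y.1 0 1)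
    (fun X X' Y => by simp only [sl2_add_val]; ring)
    (fun c X Y => by simp only [sl2_smul_val, smul_eq_mul]; ring)
    (fun X Y Y' => by simp only [sl2_add_val]; ring)
    (fun c X Y => by simp only [sl2_smul_val, smul_eq_mul]; ring)

lemma trForm_apply (X Y : sl2) :
    trForm X Y = 2 * X.1 0 0 * Y.1 0 0 + X.1 0 1 * Y.1 1 0 + X.1 1 0 * Y.1 0 1 := rfl

lemma trForm_eq_trace (X Y : sl2) : trForm X Y = (X.1 * Y.1).trace := by
  rw [Matrix.trace_fin_two, Matrix.mul_apply, Matrix.mul_apply, Fin.sum_univ_two, Fin.sum_univ_two,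
    trForm_apply, sl2_11, sl2_11]
  ring

lemma trForm_AdSL (b : SL2) (X Y : sl2) : trForm (AdSL b X) (AdSL b Y) = trForm X Y := by
  rw [trForm_eq_trace, trForm_eq_trace, AdSL_val, AdSL_val, ← Matrix.trace_mul_comm]
  have : b.1 * Y.1 * (b⁻¹).1 * (b.1 * X.1 * (b⁻¹).1) = b.1 * (Y.1 * X.1) * (b⁻¹).1 := by
    calc _ = b.1 * Y.1 * ((b⁻¹).1 * b.1) * X.1 * (b⁻¹).1 := by simp only [Matrix.mul_assoc]
      _ = _ := by rw [SL2_inv_mul, Matrix.mul_one]; simp only [Matrix.mul_assoc]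
  rw [this, Matrix.trace_mul_comm, ← Matrix.mul_assoc, SL2_inv_mul, Matrix.one_mul,
    Matrix.trace_mul_comm]

lemma trForm_AdSL_left (b : SL2) (X Y : sl2) : trForm (AdSL b X) Y = trForm X (AdSL b⁻¹ Y) := by
  rw [← trForm_AdSL b X, AdSL_apply_inv]

lemma trForm_lie (u X Y : sl2) : trForm ⁅u, X⁆ Y + trForm X ⁅u, Y⁆ = 0 := by
  induction u using sl2_induction with | h a b c => ?_
  induction X using sl2_induction with | h x y z => ?_
  induction Y using sl2_induction with | h x' y' z' => ?_
  simp only [sl2mk_lie, trForm_apply, sl2mk_00, sl2mk_01, sl2mk_10]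
  ring

lemma exists_trForm_ne_zero {v : sl2} (hv : v ≠ 0) : ∃ X, trForm v X ≠ 0 := by
  by_contra! h
  refine hv ?_
  have h1 := h sl2H
  have h2 := h sl2E
  have h3 := h sl2F
  rw [sl2H_eq] at h1
  simp [trForm_apply, sl2E, sl2F] at h1 h2 h3
  rw [← sl2mk_eta v, h1, h2, h3, sl2mk_zero]

end TraceForm

section InvariantForms

variable {q : LinearMap.BilinForm ℂ sl2} {v : sl2}

/-- The symmetric forms invariant under a one-parameter subgroup. -/
lemma exists_form (hs : ∀ X Y, q X Y = q Y X) (hv' : v = sl2H ∨ v = sl2E)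
    (hv : ∀ X Y, q ⁅v, X⁆ Y + q X ⁅v, Y⁆ = 0) :
    ∃ r s : ℂ, ∀ X Y, q X Y = r * trForm X Y + s * (trForm v X * trForm v Y) := by
  have hexp : ∀ X Y, q X Y = X.1 0 0 * Y.1 0 0 * q sl2H sl2H + X.1 0 1 * Y.1 0 1 * q sl2E sl2E +
      X.1 1 0 * Y.1 1 0 * q sl2F sl2F + (X.1 0 0 * Y.1 0 1 + X.1 0 1 * Y.1 0 0) * q sl2H sl2E +
      (X.1 0 0 * Y.1 1 0 + X.1 1 0 * Y.1 0 0) * q sl2H sl2F +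
      (X.1 0 1 * Y.1 1 0 + X.1 1 0 * Y.1 0 1) * q sl2E sl2F := by
    intro X Y
    conv_lhs => rw [← sl2mk_eta X, ← sl2mk_eta Y, sl2mk_eq, sl2mk_eq]
    simp only [map_add, map_smul, LinearMap.add_apply, LinearMap.smul_apply, smul_eq_mul,
      hs sl2E sl2H, hs sl2F sl2H, hs sl2F sl2E]
    ring
  rcases hv' with rfl | rfl
  · have h1 := hv sl2E sl2E
    have h2 := hv sl2F sl2F
    have h3 := hv sl2H sl2E
    have h4 := hv sl2H sl2F
    simp only [lie_H_E, lie_H_F, lie_self, map_zero, map_smul, LinearMap.zero_apply,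
      LinearMap.smul_apply, smul_eq_mul] at h1 h2 h3 h4
    refine ⟨q sl2E sl2F, (q sl2H sl2H - 2 * q sl2E sl2F) / 4, fun X Y => ?_⟩
    rw [hexp, sl2H_eq]
    rw [sl2H_eq] at h3 h4
    simp only [trForm_apply, sl2mk_00, sl2mk_01, sl2mk_10]
    linear_combination X.1 0 1 * Y.1 0 1 * h1 / 4 - X.1 1 0 * Y.1 1 0 * h2 / 4 +
      (X.1 0 0 * Y.1 0 1 + X.1 0 1 * Y.1 0 0) * h3 / 2 -
      (X.1 0 0 * Y.1 1 0 + X.1 1 0 * Y.1 0 0) * h4 / 2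
  · have h1 := hv sl2E sl2H
    have h2 := hv sl2F sl2F
    have h3 := hv sl2E sl2F
    have h4 := hv sl2H sl2F
    simp only [lie_E_H, lie_E_F, lie_self, map_zero, map_smul, LinearMap.zero_apply,
      LinearMap.smul_apply, smul_eq_mul] at h1 h2 h3 h4
    rw [hs sl2E sl2H] at h3
    rw [hs sl2F sl2H] at h2
    refine ⟨q sl2E sl2F, q sl2F sl2F, fun X Y => ?_⟩
    rw [hexp]
    have e : ∀ Z, trForm sl2E Z = Z.1 1 0 := fun Z => by simp [trForm_apply, sl2E]
    rw [e, e, trForm_apply]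
    linear_combination -X.1 0 1 * Y.1 0 1 * h1 / 2 +
      (X.1 0 0 * Y.1 1 0 + X.1 1 0 * Y.1 0 0) * h2 / 2 +
      (X.1 0 0 * Y.1 0 1 + X.1 0 1 * Y.1 0 0) * h3 +
      X.1 0 0 * Y.1 0 0 * h4

end InvariantForms

section FamilySL

/-- The Killing fields `x ↦ -u x + s x v` of a left invariant metric. -/
def familySL (q : LinearMap.BilinForm ℂ sl2) (hs : ∀ X Y, q X Y = q Y X)
    (hn : ∀ X, (∀ Y, q X Y = 0) → X = 0) (v : sl2) (hv : ∀ X Y, q ⁅v, X⁆ Y + q X ⁅v, Y⁆ = 0) :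
    KillingFamily (ℂ × sl2) (leftInvariant q hs hn) where
  field :=
    { toFun := fieldSL v
      map_add' := fun p r => funext fun a => by
        refine (maurerCartan_bijective a).1 ?_
        change _ = maurerCartan a (fieldSL v p a + fieldSL v r a)
        rw [map_add, maurerCartan_fieldSL, maurerCartan_fieldSL, maurerCartan_fieldSL, Prod.fst_add,
          Prod.snd_add, map_add]
        module
      map_smul' := fun t p => funext fun a => by
        refine (maurerCartan_bijective a).1 ?_
        change _ = maurerCartan a (t • fieldSL v p a)
        rw [map_smul, maurerCartan_fieldSL, maurerCartan_fieldSL, Prod.smul_fst, Prod.smul_snd,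
          map_smul, smul_eq_mul]
        module }
  holAt := holAt_fieldSL v
  killingAt p := killingAt_fieldSL q hs hn v p fun X Y => by rw [hv, mul_zero]
  bracket := mlieBracket_fieldSL v

variable {q : LinearMap.BilinForm ℂ sl2} {hs : ∀ X Y, q X Y = q Y X}
  {hn : ∀ X, (∀ Y, q X Y = 0) → X = 0} {v : sl2} {hv : ∀ X Y, q ⁅v, X⁆ Y + q X ⁅v, Y⁆ = 0}

lemma familySL_field (p : ℂ × sl2) (a : SL2) : (familySL q hs hn v hv).field p a = fieldSL v p a :=
  rfl

lemma familySL_germ_injective (hv0 : v ≠ 0) (a : SL2) :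
    Function.Injective ((familySL q hs hn v hv).germ a) := by
  have key : ∀ p, (familySL q hs hn v hv).germ a p = 0 → p.1 • v - AdSL a⁻¹ p.2 = 0 := by
    intro p hp
    have h1 := congrArg (fun x => maurerCartan a (KillingAlgebra.eval _ a x)) hp
    rw [KillingFamily.eval_germ, map_zero, map_zero, familySL_field, maurerCartan_fieldSL] at h1
    exact h1
  refine injective_of_prod _ (s := 1) (u := sl2H) (fun h => hv0 ?_) (fun h => sl2H_ne_zero ?_)
  · simpa using key _ h
  · have := key _ h
    simpa using this

/-- In a complete family the right translation is unique up to scale. -/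
lemma exists_smul_of_skew (hc : (familySL q hs hn v hv).Complete) {w : sl2}
    (hw : ∀ X Y, q ⁅w, X⁆ Y + q X ⁅w, Y⁆ = 0) : ∃ t : ℂ, w = t • v := by
  let F := familySL q hs hn v hv
  let F' := familySL q hs hn w hw
  obtain ⟨⟨s, u⟩, hsu⟩ := (hc 1).2 (F'.germ 1 (1, 0))
  have h0 : ∀ x, F'.germ 1 (0, x) = F.germ 1 (0, x) := by
    intro x
    refine KillingAlgebra.germ_eq_iff.2 (Eventually.of_forall fun y => ?_)
    refine (maurerCartan_bijective y).1 ?_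
    change maurerCartan y (fieldSL w (0, x) y) = maurerCartan y (fieldSL v (0, x) y)
    rw [maurerCartan_fieldSL, maurerCartan_fieldSL, zero_smul, zero_smul]
  have hu : u = 0 := by
    refine sl2_eq_zero_of_lie fun x => ?_
    have h1 : F.germ 1 ⁅(s, u), (0, x)⁆ = F.germ 1 0 := by
      rw [LieHom.map_lie, hsu, ← h0, ← LieHom.map_lie, prod_lie, zero_lie]
      exact (map_zero (F'.germ 1)).trans (map_zero (F.germ 1)).symm
    have h2 := (hc 1).1 h1
    rw [prod_lie] at h2
    exact congrArg Prod.snd h2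
  subst hu
  refine ⟨s, ?_⟩
  have h1 := congrArg (fun x => maurerCartan 1 (KillingAlgebra.eval _ 1 x)) hsu
  rw [KillingFamily.eval_germ, KillingFamily.eval_germ] at h1
  change maurerCartan 1 (fieldSL v _ 1) = maurerCartan 1 (fieldSL w _ 1) at h1
  rw [maurerCartan_fieldSL, maurerCartan_fieldSL, map_zero, sub_zero, sub_zero] at h1
  simpa using h1.symm

lemma form_coefficient_ne_zero (hc : (familySL q hs hn v hv).Complete) {r s : ℂ}
    (h : ∀ X Y, q X Y = r * trForm X Y + s * (trForm v X * trForm v Y)) : s ≠ 0 := by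
  rintro rfl
  have hw : ∀ w X Y : sl2, q ⁅w, X⁆ Y + q X ⁅w, Y⁆ = 0 := by
    intro w X Y
    rw [h, h]
    linear_combination r * trForm_lie w X Y
  obtain ⟨t, ht⟩ := exists_smul_of_skew hc (hw sl2H)
  obtain ⟨t', ht'⟩ := exists_smul_of_skew hc (hw sl2E)
  have h1 := lie_H_E
  rw [ht, ht', smul_lie, lie_smul, lie_self, smul_zero, smul_zero, ← ht'] at h1
  exact smul_ne_zero two_ne_zero sl2E_ne_zero h1.symm

end FamilySL

section Translations

lemma SL2_inv_entry (b : SL2) (i j : Fin 2) : (b⁻¹).1 i j = adjM (ιSL b) i j := by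
  rw [Matrix.SpecialLinearGroup.SL2_inv_expl]
  fin_cases i <;> fin_cases j <;> rfl

lemma ιSL_mul (a b : SL2) : ιSL (a * b) = mulM (ιSL a) (ιSL b) :=
  Mat2.ext fun i j => by rw [mulM_apply]; exact SL2_mul_val a b i j

lemma ιSL_inv (a : SL2) : ιSL a⁻¹ = adjM (ιSL a) := Mat2.ext fun i j => SL2_inv_entry a i j

lemma mulM_assoc (A B C : Mat2) : mulM (mulM A B) C = mulM A (mulM B C) :=
  Matrix.mul_assoc (Matrix.of A) (Matrix.of B) (Matrix.of C)

lemma contMDiff_translation (a p : SL2) :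
    ContMDiff 𝓘(ℂ, ℂ × ℂ × ℂ) 𝓘(ℂ, ℂ × ℂ × ℂ) ω fun x : SL2 => a * x * p := by
  intro x
  refine isHolEmbedding_ιSL.contMDiffAt ?_
  have h : ContMDiffAt 𝓘(ℂ, ℂ × ℂ × ℂ) 𝓘(ℂ, Mat2) ω
      (fun y : SL2 => (mulM.flip (ιSL p)) (mulM (ιSL a) (ιSL y))) x :=
    (mulM.flip (ιSL p)).contMDiff.contMDiffAt.comp x
      ((mulM (ιSL a)).contMDiff.contMDiffAt.comp x ιSL_contMDiff.contMDiffAt)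
  refine h.congr_of_eventuallyEq (Eventually.of_forall fun y => ?_)
  simp only [ιSL_mul, ContinuousLinearMap.flip_apply]

/-- The diffeomorphism `x ↦ a x p` of `SL(2, ℂ)`. -/
def translation (a p : SL2) : Diffeomorph 𝓘(ℂ, ℂ × ℂ × ℂ) 𝓘(ℂ, ℂ × ℂ × ℂ) SL2 SL2 ω where
  toFun x := a * x * p
  invFun x := a⁻¹ * x * p⁻¹
  left_inv x := by group
  right_inv x := by group
  contMDiff_toFun := contMDiff_translation a p
  contMDiff_invFun := contMDiff_translation a⁻¹ p⁻¹

lemma translation_apply (a p x : SL2) : translation a p x = a * x * p := rfl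

lemma maurerCartan_mfderiv {φ : SL2 → SL2} {x : SL2} (a p : SL2) (hφ : ∀ x, φ x = a * x * p)
    (w : TangentSpace 𝓘(ℂ, ℂ × ℂ × ℂ) x) :
    maurerCartan (φ x) (mfderiv 𝓘(ℂ, ℂ × ℂ × ℂ) 𝓘(ℂ, ℂ × ℂ × ℂ) φ x w) =
      AdSL p⁻¹ (maurerCartan x w) := by
  obtain rfl : φ = fun x => a * x * p := funext hφ
  have h1 : vecDeriv ιSL (a * x * p)
      (mfderiv 𝓘(ℂ, ℂ × ℂ × ℂ) 𝓘(ℂ, ℂ × ℂ × ℂ) (fun x => a * x * p) x w) =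
      vecDeriv (fun x => ιSL (a * x * p)) x w := by
    have := mfderiv_comp x (g := ιSL) (f := fun x : SL2 => a * x * p)
      (ιSL_contMDiff.mdifferentiable (by simp) _)
      ((contMDiff_translation a p).mdifferentiable (by simp) x)
    exact (congrArg (fun l => l w) this).symm
  have h2 : vecDeriv (fun x => ιSL (a * x * p)) x w =
      mulM (mulM (ιSL a) (vecDeriv ιSL x w)) (ιSL p) := by
    have e : (fun x => ιSL (a * x * p)) = fun x =>
        ((mulM.flip (ιSL p)).comp (mulM (ιSL a))) (ιSL x) := by
      funext y
      simp only [ιSL_mul, ContinuousLinearMap.comp_apply, ContinuousLinearMap.flip_apply]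
    rw [e]
    exact vecDeriv_comp ((mulM.flip (ιSL p)).comp (mulM (ιSL a))).hasFDerivAt
      (ιSL_contMDiff.mdifferentiable (by simp) x) w
  refine Subtype.ext ?_
  change sl2.toMat (maurerCartan (a * x * p) _) = sl2.toMat (AdSL p⁻¹ (maurerCartan x w))
  rw [toMat_maurerCartan, h1, h2, vecDeriv_ιSL, ← ιSL_inv]
  change ((a * x * p)⁻¹).1 * (a.1 * (x.1 * (maurerCartan x w).1) * p.1) =
    (p⁻¹).1 * (maurerCartan x w).1 * ((p⁻¹)⁻¹).1
  rw [inv_inv, mul_inv_rev, mul_inv_rev, Matrix.SpecialLinearGroup.coe_mul,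
    Matrix.SpecialLinearGroup.coe_mul]
  calc _ = (p⁻¹).1 * ((x⁻¹).1 * (((a⁻¹).1 * a.1) * x.1)) * (maurerCartan x w).1 * p.1 := by
        simp only [Matrix.mul_assoc]
    _ = _ := by rw [SL2_inv_mul, Matrix.one_mul, SL2_inv_mul, Matrix.mul_one]

lemma isometry_translation (q : LinearMap.BilinForm ℂ sl2) (hs : ∀ X Y, q X Y = q Y X)
    (hn : ∀ X, (∀ Y, q X Y = 0) → X = 0) (a p : SL2)
    (hp : ∀ X Y, q (AdSL p⁻¹ X) (AdSL p⁻¹ Y) = q X Y) (x : SL2)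
    (v w : TangentSpace 𝓘(ℂ, ℂ × ℂ × ℂ) x) :
    (leftInvariant q hs hn).val (translation a p x)
      (mfderiv 𝓘(ℂ, ℂ × ℂ × ℂ) 𝓘(ℂ, ℂ × ℂ × ℂ) (translation a p) x v)
      (mfderiv 𝓘(ℂ, ℂ × ℂ × ℂ) 𝓘(ℂ, ℂ × ℂ × ℂ) (translation a p) x w) =
    (leftInvariant q hs hn).val x v w := by
  change q (maurerCartan _ _) (maurerCartan _ _) = q (maurerCartan x v) (maurerCartan x w)
  rw [← hp (maurerCartan x v)]
  congr 1
  · exact congrArg q (maurerCartan_mfderiv a p (fun _ => rfl) v)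
  · exact maurerCartan_mfderiv a p (fun _ => rfl) w

end Translations

section IsometriesSL

variable {q : LinearMap.BilinForm ℂ sl2} {hs : ∀ X Y, q X Y = q Y X}
  {hn : ∀ X, (∀ Y, q X Y = 0) → X = 0} {v : sl2} {hv : ∀ X Y, q ⁅v, X⁆ Y + q X ⁅v, Y⁆ = 0}

/-- The fields of the first model are all Killing fields if the Killing algebra has dimension `4`. -/
lemma familySL_complete (hv0 : v ≠ 0) {a : SL2}
    (hd : Module.finrank ℂ (KillingAlgebra (leftInvariant q hs hn) a) = 4) :
    (familySL q hs hn v hv).Complete := by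
  refine KillingFamily.complete_of_injective _ (familySL_germ_injective hv0)
    (by rw [finrank_prod_sl2]; norm_num) fun y => ?_
  rw [finrank_prod_sl2, ← hd]
  have h := isLocalIsometry_toOpenPartialHomeomorph (translation (y * a⁻¹) 1)
    (isometry_translation q hs hn (y * a⁻¹) 1 fun X Y => by rw [inv_one, AdSL_one, AdSL_one])
  have e := (h.pullEquiv (x := a) (Set.mem_univ a)).toLinearEquiv.finrank_eq
  have hy : translation (y * a⁻¹) 1 a = y := by rw [translation_apply]; group
  change Module.finrank ℂ (KillingAlgebra (leftInvariant q hs hn) (translation (y * a⁻¹) 1 a)) = _ at e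
  rwa [hy] at e

/-- The isometries of a left invariant metric. -/
lemma exists_translation (hc : (familySL q hs hn v hv).Complete)
    (φ : Diffeomorph 𝓘(ℂ, ℂ × ℂ × ℂ) 𝓘(ℂ, ℂ × ℂ × ℂ) SL2 SL2 ω)
    (hφ : ∀ x (z w : TangentSpace 𝓘(ℂ, ℂ × ℂ × ℂ) x), (leftInvariant q hs hn).val (φ x)
      (mfderiv 𝓘(ℂ, ℂ × ℂ × ℂ) 𝓘(ℂ, ℂ × ℂ × ℂ) φ x z)
      (mfderiv 𝓘(ℂ, ℂ × ℂ × ℂ) 𝓘(ℂ, ℂ × ℂ × ℂ) φ x w) = (leftInvariant q hs hn).val x z w) :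
    ∃ a p : SL2, (∀ x, φ x = a * x * p) ∧ ∀ X Y, q (AdSL p⁻¹ X) (AdSL p⁻¹ Y) = q X Y := by
  obtain ⟨α, hα⟩ := hc.exists_automorphism φ hφ
  let j : sl2 →ₗ⁅ℂ⁆ ℂ × sl2 := 
    { toLinearMap := (α.toLinearEquiv : ℂ × sl2 →ₗ[ℂ] ℂ × sl2).comp (LinearMap.inr ℂ ℂ sl2)
      map_lie' := fun {u w} => by
        change α (0, ⁅u, w⁆) = ⁅α (0, u), α (0, w)⁆
        rw [← LieEquiv.map_lie, prod_lie] }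
  have hj : ∀ u, α (0, u) = (0, (j u).2) := fun u => Prod.ext (lieHom_prod_fst j u) rfl
  let β : sl2 →ₗ⁅ℂ⁆ sl2 :=
    { toLinearMap := (LinearMap.snd ℂ ℂ sl2).comp (j : sl2 →ₗ[ℂ] ℂ × sl2)
      map_lie' := fun {u w} => by
        change (j ⁅u, w⁆).2 = ⁅(j u).2, (j w).2⁆
        rw [LieHom.map_lie, prod_lie] }
  have hβ : ∀ u, α (0, u) = (0, β u) := hj
  obtain ⟨b, hb⟩ := exists_eq_AdSL β (by
    intro u w h
    have : α (0, u) = α (0, w) := by rw [hβ, hβ, h]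
    exact congrArg Prod.snd (α.injective this))
  have hφd := fun x => φ.contMDiff.mdifferentiable (by simp) x
  have hιd := fun x => ιSL_contMDiff.mdifferentiable (by simp) x
  have hιφ : ContMDiff 𝓘(ℂ, ℂ × ℂ × ℂ) 𝓘(ℂ, Mat2) ω fun y => ιSL (φ y) :=
    ιSL_contMDiff.comp φ.contMDiff
  have hvd : ∀ y u, vecDeriv (fun y => ιSL (φ y)) y (fieldSL v (0, AdSL b u) y) =
      -mulM (sl2.toMat u) (ιSL (φ y)) := by
    intro y u
    have h1 := mfderiv_comp y (g := ιSL) (f := φ) (hιd _) (hφd y)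
    have h2 := congrArg (fun l => l (fieldSL v (0, AdSL b u) y)) h1
    have h3 := hα (0, u) y
    rw [hβ, hb] at h3
    have h4 := congrArg (vecDeriv ιSL (φ y)) h3
    refine Eq.trans (h2.trans h4) ?_
    rw [familySL_field, vecDeriv_fieldSL, ambSL_apply, zero_smul, zero_sub]
  let H : SL2 → Mat2 := fun y => mulM (adjM (ιSL y)) (mulM (ιSL b) (ιSL (φ y)))
  have hH : ContMDiff 𝓘(ℂ, ℂ × ℂ × ℂ) 𝓘(ℂ, Mat2) ω H := by
    have h1 : ContMDiff 𝓘(ℂ, ℂ × ℂ × ℂ) 𝓘(ℂ, Mat2 →L[ℂ] Mat2) ω fun y => mulM (adjM (ιSL y)) :=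
      (mulM.comp adjM).contMDiff.comp ιSL_contMDiff
    exact h1.clm_apply ((mulM (ιSL b)).contMDiff.comp hιφ)
  have hconst := eq_of_vecDeriv_eq_zero hH (by
    intro y w
    obtain ⟨u, rfl⟩ : ∃ u, fieldSL v (0, AdSL b u) y = w := by
      refine ⟨AdSL b⁻¹ (AdSL y (-maurerCartan y w)), (maurerCartan_bijective y).1 ?_⟩
      rw [maurerCartan_fieldSL]
      simp only [AdSL_apply_inv, AdSL_inv_apply, zero_smul, zero_sub, neg_neg]
    have hA : MDifferentiableAt 𝓘(ℂ, ℂ × ℂ × ℂ) 𝓘(ℂ, Mat2) (fun y => adjM (ιSL y)) y :=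
      (adjM.contMDiff.comp ιSL_contMDiff).mdifferentiable (by simp) y
    have hB : MDifferentiableAt 𝓘(ℂ, ℂ × ℂ × ℂ) 𝓘(ℂ, Mat2) (fun y => mulM (ιSL b) (ιSL (φ y))) y :=
      ((mulM (ιSL b)).contMDiff.comp hιφ).mdifferentiable (by simp) y
    refine (vecDeriv_bilin mulM hA hB _).trans ?_
    rw [vecDeriv_comp (mulM (ιSL b)).hasFDerivAt (hιφ.mdifferentiable (by simp) y),
      vecDeriv_comp adjM.hasFDerivAt (hιd y), hvd, vecDeriv_fieldSL, ambSL_apply, zero_smul, zero_sub]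
    have hAd : mulM (sl2.toMat (AdSL b u)) (ιSL b) = mulM (ιSL b) (sl2.toMat u) := by
      change (b.1 * u.1 * (b⁻¹).1) * b.1 = b.1 * u.1
      rw [Matrix.mul_assoc, SL2_inv_mul, Matrix.mul_one]
    have hadj : adjM (-mulM (sl2.toMat (AdSL b u)) (ιSL y)) =
        mulM (adjM (ιSL y)) (sl2.toMat (AdSL b u)) := by
      have ht : sl2.toMat (AdSL b u) 1 1 = -sl2.toMat (AdSL b u) 0 0 := sl2_11 (AdSL b u)
      refine Mat2.ext fun i j => ?_
      fin_cases i <;> fin_cases j <;>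
      simp only [Fin.zero_eta, Fin.mk_one, Fin.isValue, Pi.neg_apply, adjM_00, adjM_01,
        adjM_10, adjM_11, mulM_apply, ht] <;> ring1
    have hAd' : ∀ Z, mulM (sl2.toMat (AdSL b u)) (mulM (ιSL b) Z) =
        mulM (ιSL b) (mulM (sl2.toMat u) Z) := fun Z => by rw [← mulM_assoc, hAd, mulM_assoc]
    rw [hadj, map_neg, map_neg, mulM_assoc, hAd']
    exact neg_add_cancel _)
  have hval : ∀ y, H y = ιSL (y⁻¹ * (b * φ y)) := by
    intro y
    rw [ιSL_mul, ιSL_mul, ιSL_inv]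
  refine ⟨b⁻¹, b * φ 1, fun x => ?_, fun X Y => ?_⟩
  · have h1 := hconst x 1
    rw [hval, hval] at h1
    have h2 := ιSL_embedding.injective h1
    rw [inv_one, one_mul] at h2
    rw [← h2]
    group
  · have hform : ∀ x, φ x = b⁻¹ * x * (b * φ 1) := by
      intro x
      have h1 := hconst x 1
      rw [hval, hval] at h1
      have h2 := ιSL_embedding.injective h1
      rw [inv_one, one_mul] at h2
      rw [← h2]
      group
    obtain ⟨z, rfl⟩ := (maurerCartan_bijective 1).2 X
    obtain ⟨w, rfl⟩ := (maurerCartan_bijective 1).2 Y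
    rw [← maurerCartan_mfderiv _ _ hform z, ← maurerCartan_mfderiv _ _ hform w]
    exact hφ 1 z w

/-- An isometry normalizes the right translations by isometries. -/
lemma AdSL_eq_or_neg (hc : (familySL q hs hn v hv).Complete) (hv' : v = sl2H ∨ v = sl2E)
    (hv0 : v ≠ 0) {p : SL2} (hp : ∀ X Y, q (AdSL p X) (AdSL p Y) = q X Y) :
    AdSL p v = v ∨ AdSL p v = -v := by
  obtain ⟨r, s, hrs⟩ := exists_form hs hv' hv
  have hs0 := form_coefficient_ne_zero hc hrs
  obtain ⟨t, ht⟩ := exists_smul_of_skew hc (w := AdSL p v) (by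
    intro X Y
    have h := hv (AdSL p⁻¹ X) (AdSL p⁻¹ Y)
    rw [← hp, ← hp (AdSL p⁻¹ X)] at h
    simpa only [LieEquiv.map_lie, AdSL_apply_inv] using h)
  obtain ⟨X, hX⟩ := exists_trForm_ne_zero hv0
  have h1 := hp (AdSL p⁻¹ X) (AdSL p⁻¹ X)
  rw [AdSL_apply_inv, hrs, hrs (AdSL p⁻¹ X), trForm_AdSL, ← trForm_AdSL_left, ht, map_smul,
    LinearMap.smul_apply, smul_eq_mul] at h1
  have h2 : s * (trForm v X * trForm v X) * (t * t - 1) = 0 := by linear_combination -h1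
  have h3 := (mul_eq_zero.1 h2).resolve_left (mul_ne_zero hs0 (mul_ne_zero hX hX))
  rcases mul_self_eq_one_iff.1 (sub_eq_zero.1 h3) with h4 | h4
  · left; rw [ht, h4, one_smul]
  · right; rw [ht, h4, neg_smul, one_smul]

lemma form_AdSL_of_fixed (hs : ∀ X Y, q X Y = q Y X) (hv : ∀ X Y, q ⁅v, X⁆ Y + q X ⁅v, Y⁆ = 0)
    (hv' : v = sl2H ∨ v = sl2E) {p : SL2} (hp : AdSL p v = v) (X Y : sl2) :
    q (AdSL p X) (AdSL p Y) = q X Y := by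
  obtain ⟨r, s, hrs⟩ := exists_form hs hv' hv
  have h : ∀ Z, trForm v (AdSL p Z) = trForm v Z := by
    intro Z
    conv_lhs => rw [← hp]
    exact trForm_AdSL p v Z
  rw [hrs, hrs, trForm_AdSL, h, h]

end IsometriesSL

section Components

variable {E : Type*} [NormedAddCommGroup E] [NormedSpace ℂ E]
variable {M : Type*} [TopologicalSpace M] [ChartedSpace E M] [IsManifold 𝓘(ℂ, E) ω M]

lemma id_mem_isometries (g : Metric E M) : ContinuousMap.id M ∈ isometries g := by
  refine ⟨Diffeomorph.refl 𝓘(ℂ, E) M ω, fun _ => rfl, fun x v w => ?_⟩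
  have h : mfderiv 𝓘(ℂ, E) 𝓘(ℂ, E) (Diffeomorph.refl 𝓘(ℂ, E) M ω) x =
      ContinuousLinearMap.id ℂ (TangentSpace 𝓘(ℂ, E) x) := mfderiv_id
  rw [h]
  rfl

/-- Continuous invariants with finitely many values are constant on the identity component. -/
lemma eq_id_of_mem_isometryComponent {g : Metric E M} {S : Type*} [TopologicalSpace S] [T1Space S]
    {Θ : C(M, M) → S} (hΘ : Continuous Θ) {T : Set S} (hT : T.Finite)
    (h : ∀ f ∈ isometries g, Θ f ∈ T) {f : C(M, M)} (hf : f ∈ isometryComponent g) :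
    Θ f = Θ (ContinuousMap.id M) :=
  (isPreconnected_connectedComponentIn (F := isometries g)
    (x := ContinuousMap.id M)).constant_of_mapsTo hT.isDiscrete hΘ.continuousOn
    (fun f hf => h f (connectedComponentIn_subset _ _ hf)) hf
    (mem_connectedComponentIn (id_mem_isometries g))

/-- Connected families of isometries through the identity lie in the identity component. -/
lemma mem_isometryComponent_of_family {g : Metric E M} {P : Type*} [TopologicalSpace P]
    [PreconnectedSpace P] (Φ : C(P × M, M)) (hΦ : ∀ p, Φ.curry p ∈ isometries g) {p₀ : P}
    (h0 : ∀ x, Φ (p₀, x) = x) (p : P) : Φ.curry p ∈ isometryComponent g := by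
  have h1 : ContinuousMap.id M ∈ Set.range Φ.curry := ⟨p₀, ContinuousMap.ext h0⟩
  refine (isPreconnected_range Φ.curry.continuous).subset_connectedComponentIn h1 ?_ ⟨p, rfl⟩
  rintro _ ⟨r, rfl⟩
  exact hΦ r

end Components

section OneParameter

/-- The properties of one-parameter subgroups that determine the isometries. -/
structure IsCentralizerFlow (v : sl2) (h : ℂ → SL2) : Prop where
  oneParameter : IsOneParameterSubgroup h v
  continuous : Continuous h
  zero : h 0 = 1
  fix : ∀ t, AdSL (h t) v = v
  linear : ∃ c s : ℂ, s ≠ 0 ∧ (h 1).1 = c • (1 : Matrix (Fin 2) (Fin 2) ℂ) + s • v.1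
  centralizer : ∀ p, AdSL p v = v → ∃ (t : ℂ) (e : SL2), (∀ x, e * x = x * e) ∧
    (∀ u, AdSL e u = u) ∧ p = e * h t

lemma AdSL_eq_self_iff {p : SL2} {v : sl2} : AdSL p v = v ↔ p.1 * v.1 = v.1 * p.1 := by
  constructor
  · intro h
    conv_rhs => rw [← h, AdSL_val, Matrix.mul_assoc, SL2_inv_mul, Matrix.mul_one]
  · intro h
    refine Subtype.ext ?_
    rw [AdSL_val, h, Matrix.mul_assoc, SL2_mul_inv, Matrix.mul_one]

lemma isCentralizerFlow_diagSL : IsCentralizerFlow sl2H diagSL where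
  oneParameter t := by
    have h : t • sl2H.1 = Matrix.diagonal ![t, -t] := by
      ext i j
      fin_cases i <;> fin_cases j <;> simp [sl2H]
    rw [h, Matrix.exp_diagonal]
    ext i j
    fin_cases i <;> fin_cases j <;> simp [diagSL, Pi.coe_exp, Complex.exp_eq_exp_ℂ]
  continuous := by
    refine continuous_SL2_mk fun i j => ?_
    fin_cases i <;> fin_cases j <;> simp [diagSL] <;> fun_prop
  zero := diagSL_zero
  fix t := by
    rw [AdSL_diagSL, sl2H_eq]
    simp
  linear := by
    refine ⟨(Complex.exp 1 + Complex.exp (-1)) / 2, (Complex.exp 1 - Complex.exp (-1)) / 2, ?_, ?_⟩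
    · intro h
      have h1 : Complex.exp 1 = Complex.exp (-1) := by linear_combination 2 * h
      have h2 : Real.exp 1 = Real.exp (-1) := by
        have : ((Real.exp 1 : ℝ) : ℂ) = ((Real.exp (-1) : ℝ) : ℂ) := by
          push_cast
          exact h1
        exact_mod_cast this
      have := Real.exp_injective h2
      norm_num at this
    · ext i j
      fin_cases i <;> fin_cases j <;> simp [diagSL, sl2H] <;> ring
  centralizer p hp := by
    rw [AdSL_eq_self_iff] at hp
    have h1 := congrFun (congrFun hp 0) 1
    have h2 := congrFun (congrFun hp 1) 0
    simp [Matrix.mul_apply, sl2H] at h1 h2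
    have h1' : p.1 0 1 = 0 := by linear_combination -h1 / 2
    have h2' : p.1 1 0 = 0 := by linear_combination h2 / 2
    have hd := SL2_det p
    rw [h1', h2'] at hd
    have h0 : p.1 0 0 ≠ 0 := by
      intro h0
      rw [h0] at hd
      simp at hd
    refine ⟨Complex.log (p.1 0 0), 1, fun x => by rw [one_mul, mul_one], AdSL_one, ?_⟩
    rw [one_mul]
    apply SL2_ext
    · simp [diagSL, Complex.exp_log h0]
    · simp [diagSL, h1']
    · simp [diagSL, h2']
    · have h3 : p.1 1 1 = (p.1 0 0)⁻¹ := by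
        field_simp
        linear_combination hd
      rw [h3]
      simp [diagSL, Complex.exp_neg, Complex.exp_log h0]

lemma isCentralizerFlow_upperSL : IsCentralizerFlow sl2E upperSL where
  oneParameter t := by
    have h2 : ∀ n, 2 ≤ n → (t • sl2E.1) ^ n = 0 := by
      intro n hn
      refine pow_eq_zero_of_le hn ?_
      rw [pow_two]
      ext i j
      fin_cases i <;> fin_cases j <;> simp [Matrix.mul_apply, sl2E, sl2mk]
    rw [NormedSpace.exp_eq_tsum ℂ]
    dsimp only
    rw [tsum_eq_sum (s := Finset.range 2) fun n hn => by
      rw [h2 n (by simpa [Nat.lt_iff_add_one_le] using hn), smul_zero]]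
    ext i j
    rw [Finset.sum_range_succ, Finset.sum_range_one]
    fin_cases i <;> fin_cases j <;> simp [upperSL, sl2E, sl2mk]
  continuous := continuous_upperSL
  zero := by apply SL2_ext <;> simp [upperSL]
  fix t := by
    rw [AdSL_eq_self_iff]
    ext i j
    fin_cases i <;> fin_cases j <;> simp [Matrix.mul_apply, upperSL, sl2E, sl2mk]
  linear := by
    refine ⟨1, 1, one_ne_zero, ?_⟩
    ext i j
    fin_cases i <;> fin_cases j <;> simp [upperSL, sl2E, sl2mk]
  centralizer p hp := by
    rw [AdSL_eq_self_iff] at hp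
    have h1 := congrFun (congrFun hp 0) 1
    have h2 := congrFun (congrFun hp 0) 0
    simp [Matrix.mul_apply, sl2E, sl2mk] at h1 h2
    have hd := SL2_det p
    rw [← h2, ← h1] at hd
    have hd' : p.1 0 0 * p.1 0 0 = 1 := by linear_combination hd
    let e : SL2 := ⟨!![p.1 0 0, 0; 0, p.1 0 0], by rw [Matrix.det_fin_two_of, hd']; ring⟩
    refine ⟨p.1 0 0 * p.1 0 1, e, fun x => ?_, fun u => AdSL_eq_self_iff.2 ?_, ?_⟩
    · apply SL2_ext <;> rw [SL2_mul_val, SL2_mul_val] <;> simp [e, mul_comm]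
    · ext i j
      fin_cases i <;> fin_cases j <;> simp [Matrix.mul_apply, e, mul_comm]
    · apply SL2_ext <;> rw [SL2_mul_val] <;> simp [e, upperSL, ← h1, ← h2]
      · rw [← mul_assoc, hd', one_mul]

lemma exists_centralizerFlow {v : sl2} (hv : v = sl2H ∨ v = sl2E) : ∃ h, IsCentralizerFlow v h := by
  rcases hv with rfl | rfl
  · exact ⟨_, isCentralizerFlow_diagSL⟩
  · exact ⟨_, isCentralizerFlow_upperSL⟩

end OneParameter

section ComponentSL

variable {q : LinearMap.BilinForm ℂ sl2} {hs : ∀ X Y, q X Y = q Y X}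
  {hn : ∀ X, (∀ Y, q X Y = 0) → X = 0} {v : sl2} {hv : ∀ X Y, q ⁅v, X⁆ Y + q X ⁅v, Y⁆ = 0}

/-- The identity component of the isometry group of a left invariant metric. -/
lemma mem_isometryComponent_SL2_iff (hc : (familySL q hs hn v hv).Complete)
    (hv' : v = sl2H ∨ v = sl2E) {h : ℂ → SL2} (hh : IsCentralizerFlow v h) (f : C(SL2, SL2)) :
    f ∈ isometryComponent (leftInvariant q hs hn) ↔
      ∃ (t : ℂ) (a : SL2), ∀ x, f x = a * x * (h t)⁻¹ := by
  have hv0 : v ≠ 0 := by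
    rcases hv' with rfl | rfl
    · exact sl2H_ne_zero
    · exact sl2E_ne_zero
  constructor
  · intro hf
    obtain ⟨c, s, hs0, hcs⟩ := hh.linear
    let Θ : C(SL2, SL2) → Mat2 := fun f => ιSL ((f 1)⁻¹ * f (h 1))
    have hΘ : Continuous Θ :=
      ιSL_embedding.continuous.comp ((continuous_eval_const 1).inv.mul (continuous_eval_const (h 1)))
    let A : ℂ → Mat2 := fun k => fun i j =>
      (c • (1 : Matrix (Fin 2) (Fin 2) ℂ) + (k * s) • v.1) i j
    have key : ∀ (f : C(SL2, SL2)) (a p : SL2), (∀ x, f x = a * x * p) → ∀ k : ℂ,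
        AdSL p⁻¹ v = k • v → Θ f = A k := by
      intro f a p hap k hk
      have h1 : (f 1)⁻¹ * f (h 1) = p⁻¹ * h 1 * p := by
        rw [hap, hap]
        group
      have h2 : (p⁻¹).1 * v.1 * p.1 = k • v.1 := by
        have := congrArg Subtype.val hk
        rwa [AdSL_val, inv_inv] at this
      change (fun i j => ((f 1)⁻¹ * f (h 1)).1 i j) = _
      rw [h1, Matrix.SpecialLinearGroup.coe_mul, Matrix.SpecialLinearGroup.coe_mul, hcs,
        Matrix.mul_add, Matrix.add_mul, Matrix.mul_smul, Matrix.smul_mul, Matrix.mul_one,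
        SL2_inv_mul, Matrix.mul_smul, Matrix.smul_mul, h2, smul_smul, mul_comm s k]
    have hex : ∀ f ∈ isometries (leftInvariant q hs hn), ∃ a p : SL2, (∀ x, f x = a * x * p) ∧
        (AdSL p⁻¹ v = (1 : ℂ) • v ∨ AdSL p⁻¹ v = (-1 : ℂ) • v) := by
      rintro f ⟨φ, hφf, hφ⟩
      obtain ⟨a, p, hap, hp⟩ := exists_translation hc φ hφ
      refine ⟨a, p, fun x => by rw [← hφf, hap], ?_⟩
      rw [one_smul, neg_smul, one_smul]
      exact AdSL_eq_or_neg hc hv' hv0 hp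
    have hid := eq_id_of_mem_isometryComponent hΘ (T := {A 1, A (-1)}) (by simp) (by
      intro f hf
      obtain ⟨a, p, hap, hp | hp⟩ := hex f hf
      · exact Or.inl (key f a p hap 1 hp)
      · exact Or.inr (key f a p hap (-1) hp)) hf
    rw [key (ContinuousMap.id SL2) 1 1 (fun x => by simp) 1 (by rw [inv_one, AdSL_one, one_smul])]
      at hid
    obtain ⟨a, p, hap, hp⟩ := hex f (connectedComponentIn_subset _ _ hf)
    have hp1 : AdSL p⁻¹ v = v := by
      rcases hp with hp | hp
      · rw [hp, one_smul]
      · rw [key f a p hap (-1) hp] at hid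
        refine absurd ?_ hv0
        refine Subtype.ext (Matrix.ext fun i j => ?_)
        have h1 := congrFun (congrFun hid i) j
        simp only [A, Matrix.add_apply, Matrix.smul_apply, smul_eq_mul] at h1
        have h2 : s * v.1 i j = 0 := by linear_combination -h1 / 2
        exact (mul_eq_zero.1 h2).resolve_left hs0
    obtain ⟨t, e, he, -, hpe⟩ := hh.centralizer _ hp1
    refine ⟨t, a * e⁻¹, fun x => ?_⟩
    have hp2 : p = (h t)⁻¹ * e⁻¹ := by rw [← mul_inv_rev, ← hpe, inv_inv]
    have he' : ∀ x, e⁻¹ * x = x * e⁻¹ := fun x => by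
      rw [inv_mul_eq_iff_eq_mul, ← mul_assoc, he, mul_assoc, mul_inv_cancel, mul_one]
    rw [hap, hp2, ← he' (h t)⁻¹, mul_assoc a e⁻¹ x, he' x]
    simp only [mul_assoc]
  · rintro ⟨t, a, hf⟩
    let Φ : C((ℂ × SL2) × SL2, SL2) := ⟨fun z => z.1.2 * z.2 * (h z.1.1)⁻¹, by
      have := hh.continuous
      fun_prop⟩
    have h1 : f = Φ.curry (t, a) := ContinuousMap.ext hf
    rw [h1]
    refine mem_isometryComponent_of_family Φ (fun z => ?_) (p₀ := (0, 1)) (fun x => ?_) _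
    · refine ⟨translation z.2 (h z.1)⁻¹, fun _ => rfl, isometry_translation q hs hn _ _ ?_⟩
      rw [inv_inv]
      exact form_AdSL_of_fixed hs hv hv' (hh.fix z.1)
    · change 1 * x * (h 0)⁻¹ = x
      rw [hh.zero, inv_one, one_mul, mul_one]

lemma stabilizer_SL2_iff (hc : (familySL q hs hn v hv).Complete)
    (hv' : v = sl2H ∨ v = sl2E) {h : ℂ → SL2} (hh : IsCentralizerFlow v h) (f : C(SL2, SL2))
    (hf : f ∈ isometryComponent (leftInvariant q hs hn)) :
    f 1 = 1 ↔ ∃ t : ℂ, ∀ x, f x = h t * x * (h t)⁻¹ := by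
  obtain ⟨t, a, hfa⟩ := (mem_isometryComponent_SL2_iff hc hv' hh f).1 hf
  constructor
  · intro h1
    rw [hfa, mul_one, mul_inv_eq_one] at h1
    exact ⟨t, fun x => by rw [hfa, h1]⟩
  · rintro ⟨t, ht⟩
    rw [ht, mul_one, mul_inv_cancel]

end ComponentSL

section SphereElements

/-- A point of `S₂` as an element of `sl(2, ℂ)`. -/
def S2.toSl2 (A : S2) : sl2 := ⟨A.1, A.2.1⟩

lemma S2.toSl2_val (A : S2) : A.toSl2.1 = A.1 := rfl

lemma S2.toSl2_injective : Function.Injective S2.toSl2 :=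
  fun _ _ h => Subtype.ext (congrArg (fun u : sl2 => u.1) h)

lemma S2.toSl2_conj (a : SL2) (A : S2) : (S2.conj a A).toSl2 = AdSL a A.toSl2 := rfl

lemma S2.sq_toSl2 (A : S2) : A.toSl2.1 0 0 ^ 2 + A.toSl2.1 0 1 * A.toSl2.1 1 0 = 1 := by
  have h := A.eqs.2
  rw [toSl2_val]
  linear_combination h

lemma S2.toSl2_ne_zero (A : S2) : A.toSl2 ≠ 0 := by
  intro h
  have h1 := A.sq_toSl2
  rw [h] at h1
  have z : ∀ i j, (0 : sl2).1 i j = 0 := fun _ _ => rfl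
  simp [z] at h1

lemma S2.conj_mul (a b : SL2) (A : S2) : S2.conj (a * b) A = S2.conj a (S2.conj b A) :=
  S2.toSl2_injective (by rw [toSl2_conj, toSl2_conj, toSl2_conj, AdSL_mul])

lemma S2.conj_one (A : S2) : S2.conj 1 A = A :=
  S2.toSl2_injective (by rw [toSl2_conj, AdSL_one])

lemma S2.exists_conj_eq_base (A : S2) : ∃ a, S2.conj a A = S2.base := by
  obtain ⟨b, hb⟩ := exists_AdSL_eq_H A.sq_toSl2
  exact ⟨b, S2.toSl2_injective hb⟩

lemma continuous_S2_conj : Continuous fun z : SL2 × S2 => S2.conj z.1 z.2 := by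
  refine Continuous.subtype_mk ?_ _
  have h1 : Continuous fun z : SL2 × S2 => (z.1 : Matrix (Fin 2) (Fin 2) ℂ) :=
    continuous_subtype_val.comp continuous_fst
  have hi : Continuous fun z : SL2 × S2 => (z.1⁻¹ : SL2) := continuous_fst.inv
  have h2 : Continuous fun z : SL2 × S2 => ((z.1⁻¹ : SL2) : Matrix (Fin 2) (Fin 2) ℂ) :=
    continuous_subtype_val.comp hi
  exact (h1.matrix_mul (continuous_subtype_val.comp continuous_snd)).matrix_mul h2

lemma S2.conj_base_surjective : Function.Surjective fun a : SL2 => S2.conj a S2.base := by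
  intro A
  obtain ⟨a, ha⟩ := A.exists_conj_eq_base
  refine ⟨a⁻¹, ?_⟩
  change S2.conj a⁻¹ S2.base = A
  rw [← ha, ← S2.conj_mul, inv_mul_cancel, S2.conj_one]

instance preconnectedSpace_S2 : PreconnectedSpace S2 := by
  have hc : Continuous fun a : SL2 => S2.conj a S2.base :=
    Continuous.comp (g := fun z : SL2 × S2 => S2.conj z.1 z.2) (f := fun a => (a, S2.base))
      continuous_S2_conj (continuous_id.prodMk continuous_const)
  refine ⟨?_⟩
  rw [← S2.conj_base_surjective.range_eq]
  exact isPreconnected_range hc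

/-- Commuting elements of `S₂` are equal or opposite. -/
lemma eq_or_neg_of_lie_eq_zero {u w : sl2} (hu : u.1 0 0 ^ 2 + u.1 0 1 * u.1 1 0 = 1)
    (hw : w.1 0 0 ^ 2 + w.1 0 1 * w.1 1 0 = 1) (h : ⁅u, w⁆ = 0) : w = u ∨ w = -u := by
  obtain ⟨b, hb⟩ := exists_AdSL_eq_H hu
  have h1 : AdSL b w = sl2H ∨ AdSL b w = -sl2H := by
    have h2 : ⁅sl2H, AdSL b w⁆ = 0 := by rw [← hb, ← LieEquiv.map_lie, h, map_zero]
    have hd : (AdSL b w).1 0 0 ^ 2 + (AdSL b w).1 0 1 * (AdSL b w).1 1 0 = 1 := by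
      have e : ∀ x : sl2, trForm x x = 2 * (x.1 0 0 ^ 2 + x.1 0 1 * x.1 1 0) := fun x => by
        rw [trForm_apply]; ring
      have := e (AdSL b w)
      rw [trForm_AdSL, e, hw] at this
      linear_combination -this / 2
    generalize AdSL b w = x at h2 hd
    induction x using sl2_induction with | h x y z => ?_
    rw [sl2H_eq, sl2mk_lie] at h2
    have e1 := congrArg (fun u : sl2 => u.1 0 1) h2
    have e2 := congrArg (fun u : sl2 => u.1 1 0) h2
    have z : ∀ i j, (0 : sl2).1 i j = 0 := fun _ _ => rfl
    simp [z] at e1 e2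
    simp [e1, e2] at hd
    rcases hd with hd | hd
    · left; rw [hd, e1, e2, sl2H_eq]
    · right; rw [hd, e1, e2, sl2H_eq, eq_neg_iff_add_eq_zero, sl2mk_add, ← sl2mk_zero]
      congr 1 <;> ring
  rcases h1 with h1 | h1
  · left
    exact (AdSL b).injective (h1.trans hb.symm)
  · right
    refine (AdSL b).injective ?_
    change AdSL b w = AdSL b (-u)
    rw [h1, map_neg, hb]

end SphereElements

section FamilyCS

lemma ambCS_toSl2 (p : ℂ × sl2) (y : ℂ × S2) :
    ambCS p (ιCS y) = (p.1, sl2.toMat ⁅y.2.toSl2, p.2⁆) := by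
  rw [ambCS_apply]
  rfl

/-- The Killing fields `(z, A) ↦ (s, [A, u])` of a product metric. -/
def familyCS (c : ℂ) (hc : c ≠ 0) : KillingFamily (ℂ × sl2) (productMetric c hc) where
  field :=
    { toFun := fieldCS
      map_add' := fun p r => funext fun y => by
        refine dιCS_injective y ?_
        change vecDeriv ιCS y _ = vecDeriv ιCS y (fieldCS p y + fieldCS r y)
        rw [map_add, vecDeriv_fieldCS, vecDeriv_fieldCS, vecDeriv_fieldCS, ambCS_toSl2, ambCS_toSl2,
          ambCS_toSl2]
        refine Prod.ext rfl ?_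
        change sl2.toMat ⁅_, p.2 + r.2⁆ = _ + _
        rw [lie_add, map_add]
      map_smul' := fun t p => funext fun y => by
        refine dιCS_injective y ?_
        change vecDeriv ιCS y _ = vecDeriv ιCS y (t • fieldCS p y)
        rw [map_smul, vecDeriv_fieldCS, vecDeriv_fieldCS, ambCS_toSl2, ambCS_toSl2]
        refine Prod.ext rfl ?_
        change sl2.toMat ⁅_, t • p.2⁆ = t • _
        rw [lie_smul, map_smul] }
  holAt := holAt_fieldCS
  killingAt := killingAt_fieldCS c hc
  bracket := mlieBracket_fieldCS

variable {c : ℂ} {hc : c ≠ 0}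

lemma fieldCS_eq_zero_iff (p : ℂ × sl2) (y : ℂ × S2) :
    fieldCS p y = 0 ↔ p.1 = 0 ∧ ⁅y.2.toSl2, p.2⁆ = 0 := by
  have h : fieldCS p y = 0 ↔ vecDeriv ιCS y (fieldCS p y) = 0 :=
    ⟨fun h => by rw [h, map_zero], fun h => dιCS_injective y (h.trans (map_zero _).symm)⟩
  rw [h, vecDeriv_fieldCS, ambCS_toSl2, Prod.mk_eq_zero]
  refine and_congr_right fun _ => ⟨fun h => ?_, fun h => by rw [h, map_zero]⟩
  exact Subtype.ext h

lemma familyCS_germ_injective (y : ℂ × S2) : Function.Injective ((familyCS c hc).germ y) := by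
  have key : ∀ p, (familyCS c hc).germ y p = 0 → p.1 = 0 ∧ ⁅y.2.toSl2, p.2⁆ = 0 := by
    intro p hp
    refine (fieldCS_eq_zero_iff p y).1 ?_
    have h1 := congrArg (fun x => KillingAlgebra.eval _ y x) hp
    rw [KillingFamily.eval_germ, map_zero] at h1
    exact h1
  obtain ⟨u, hu⟩ : ∃ u : sl2, ⁅y.2.toSl2, u⁆ ≠ 0 := by
    by_contra! h
    exact y.2.toSl2_ne_zero (sl2_eq_zero_of_lie h)
  exact injective_of_prod _ (s := 1) (u := u) (fun h => one_ne_zero (key _ h).1)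
    (fun h => hu (key _ h).2)

end FamilyCS

section MotionsCS

/-- The linear map `(z, B) ↦ (z, a B a⁻¹)`. -/
def conjCS (a : SL2) : (ℂ × Mat2) →L[ℂ] ℂ × Mat2 :=
  (ContinuousLinearMap.fst ℂ ℂ Mat2).prod
    (((mulM.flip (ιSL a⁻¹)).comp (mulM (ιSL a))).comp (ContinuousLinearMap.snd ℂ ℂ Mat2))

lemma ιCS_motion (t : ℂ) (a : SL2) (p : ℂ × S2) :
    ιCS (p.1 + t, S2.conj a p.2) = (t, 0) + conjCS a (ιCS p) := by
  refine Prod.ext (add_comm _ _) ?_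
  refine Eq.trans ?_ (zero_add _).symm
  rfl

lemma contMDiff_motion (t : ℂ) (a : SL2) : ContMDiff 𝓘(ℂ, ℂ × ℂ × ℂ) 𝓘(ℂ, ℂ × ℂ × ℂ) ω
    fun p : ℂ × S2 => ((p.1 + t, S2.conj a p.2) : ℂ × S2) := by
  intro p
  refine isHolEmbedding_ιCS.contMDiffAt ?_
  simp only [ιCS_motion]
  have h : ContDiff ℂ ω fun x : ℂ × Mat2 => ((t, 0) : ℂ × Mat2) + conjCS a x :=
    contDiff_const.add (conjCS a).contDiff
  exact h.contMDiff.contMDiffAt.comp p ιCS_contMDiff.contMDiffAt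

/-- The diffeomorphism `(z, A) ↦ (z + t, a A a⁻¹)`. -/
def motion (t : ℂ) (a : SL2) :
    Diffeomorph 𝓘(ℂ, ℂ × ℂ × ℂ) 𝓘(ℂ, ℂ × ℂ × ℂ) (ℂ × S2) (ℂ × S2) ω where
  toFun p := (p.1 + t, S2.conj a p.2)
  invFun p := (p.1 + -t, S2.conj a⁻¹ p.2)
  left_inv p := by simp [← S2.conj_mul, S2.conj_one]
  right_inv p := by simp [← S2.conj_mul, S2.conj_one]
  contMDiff_toFun := contMDiff_motion t a
  contMDiff_invFun := contMDiff_motion (-t) a⁻¹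

lemma motion_apply (t : ℂ) (a : SL2) (p : ℂ × S2) : motion t a p = (p.1 + t, S2.conj a p.2) := rfl

lemma vecDeriv_ιCS_mfderiv {φ : ℂ × S2 → ℂ × S2} {p : ℂ × S2}
    (hφ : MDifferentiableAt 𝓘(ℂ, ℂ × ℂ × ℂ) 𝓘(ℂ, ℂ × ℂ × ℂ) φ p)
    (w : TangentSpace 𝓘(ℂ, ℂ × ℂ × ℂ) p) :
    vecDeriv ιCS (φ p) (mfderiv 𝓘(ℂ, ℂ × ℂ × ℂ) 𝓘(ℂ, ℂ × ℂ × ℂ) φ p w) =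
      vecDeriv (fun p => ιCS (φ p)) p w := by
  have := mfderiv_comp p (g := ιCS) (f := φ) (ιCS_contMDiff.mdifferentiable (by simp) _) hφ
  exact (congrArg (fun l => l w) this).symm

lemma vecDeriv_motion (t : ℂ) (a : SL2) (p : ℂ × S2) (w : TangentSpace 𝓘(ℂ, ℂ × ℂ × ℂ) p) :
    vecDeriv ιCS (motion t a p) (mfderiv 𝓘(ℂ, ℂ × ℂ × ℂ) 𝓘(ℂ, ℂ × ℂ × ℂ) (motion t a) p w) =
      conjCS a (vecDeriv ιCS p w) := by
  refine (vecDeriv_ιCS_mfderiv (φ := motion t a)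
    ((contMDiff_motion t a).mdifferentiable (by simp) p) w).trans ?_
  simp only [motion_apply, ιCS_motion]
  exact vecDeriv_comp (F := fun x : ℂ × Mat2 => ((t, 0) : ℂ × Mat2) + conjCS a x)
    ((conjCS a).hasFDerivAt.const_add _) (ιCS_contMDiff.mdifferentiable (by simp) p) w

lemma ambientForm_conjCS (c : ℂ) (a : SL2) (x y : ℂ × Mat2) :
    ambientForm c (conjCS a x) (conjCS a y) = ambientForm c x y := by
  change x.1 * y.1 + c / 2 * ((a.1 * Matrix.of x.2 * (a⁻¹).1) * (a.1 * Matrix.of y.2 * (a⁻¹).1)).trace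
    = x.1 * y.1 + c / 2 * (Matrix.of x.2 * Matrix.of y.2).trace
  have : (a.1 * Matrix.of x.2 * (a⁻¹).1) * (a.1 * Matrix.of y.2 * (a⁻¹).1) =
      a.1 * (Matrix.of x.2 * Matrix.of y.2) * (a⁻¹).1 := by
    calc _ = a.1 * Matrix.of x.2 * ((a⁻¹).1 * a.1) * Matrix.of y.2 * (a⁻¹).1 := by
          simp only [Matrix.mul_assoc]
      _ = _ := by rw [SL2_inv_mul, Matrix.mul_one]; simp only [Matrix.mul_assoc]
  rw [this, Matrix.trace_mul_comm, ← Matrix.mul_assoc, SL2_inv_mul, Matrix.one_mul]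

lemma isometry_motion (c : ℂ) (hc : c ≠ 0) (t : ℂ) (a : SL2) (p : ℂ × S2)
    (v w : TangentSpace 𝓘(ℂ, ℂ × ℂ × ℂ) p) :
    (productMetric c hc).val (motion t a p)
      (mfderiv 𝓘(ℂ, ℂ × ℂ × ℂ) 𝓘(ℂ, ℂ × ℂ × ℂ) (motion t a) p v)
      (mfderiv 𝓘(ℂ, ℂ × ℂ × ℂ) 𝓘(ℂ, ℂ × ℂ × ℂ) (motion t a) p w) =
    (productMetric c hc).val p v w := by
  change ambientForm c (vecDeriv ιCS _ _) (vecDeriv ιCS _ _) = ambientForm c (vecDeriv ιCS p v)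
    (vecDeriv ιCS p w)
  refine Eq.trans ?_ (ambientForm_conjCS c a _ _)
  rw [← vecDeriv_motion t a p v, ← vecDeriv_motion t a p w]

end MotionsCS

/-- The automorphisms of `ℂ ⊕ sl(2, ℂ)`. -/
lemma exists_prod_automorphism (α : (ℂ × sl2) ≃ₗ⁅ℂ⁆ ℂ × sl2) :
    ∃ (μ : ℂ) (b : SL2), μ ≠ 0 ∧ ∀ s u, α (s, u) = (μ * s, AdSL b u) := by
  let j : sl2 →ₗ⁅ℂ⁆ ℂ × sl2 :=
    { toLinearMap := (α.toLinearEquiv : ℂ × sl2 →ₗ[ℂ] ℂ × sl2).comp (LinearMap.inr ℂ ℂ sl2)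
      map_lie' := fun {u w} => by
        change α (0, ⁅u, w⁆) = ⁅α (0, u), α (0, w)⁆
        rw [← LieEquiv.map_lie, prod_lie] }
  let β : sl2 →ₗ⁅ℂ⁆ sl2 :=
    { toLinearMap := (LinearMap.snd ℂ ℂ sl2).comp (j : sl2 →ₗ[ℂ] ℂ × sl2)
      map_lie' := fun {u w} => by
        change (j ⁅u, w⁆).2 = ⁅(j u).2, (j w).2⁆
        rw [LieHom.map_lie, prod_lie] }
  have hβ : ∀ u, α (0, u) = (0, β u) := fun u => Prod.ext (lieHom_prod_fst j u) rfl
  obtain ⟨b, hb⟩ := exists_eq_AdSL β (by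
    intro u w h
    have : α (0, u) = α (0, w) := by rw [hβ, hβ, h]
    exact congrArg Prod.snd (α.injective this))
  have hc : (α (1, 0)).2 = 0 := by
    refine sl2_eq_zero_of_lie fun w => ?_
    obtain ⟨x, hx'⟩ := α.surjective (0, w)
    have hx : α x = (0, w) := hx'
    have h1 : ⁅α (1, 0), α x⁆ = 0 := by
      rw [← LieEquiv.map_lie, prod_lie, zero_lie]
      exact map_zero α
    rw [hx, prod_lie] at h1
    exact congrArg Prod.snd h1
  have hc' : α (1, 0) = ((α (1, 0)).1, 0) := Prod.ext rfl hc
  refine ⟨(α (1, 0)).1, b, fun h0 => ?_, fun s u => ?_⟩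
  · rw [h0] at hc'
    have h1 := α.injective (hc'.trans (map_zero α).symm)
    exact one_ne_zero (congrArg Prod.fst h1)
  · have h1 : ((s, u) : ℂ × sl2) = s • (1, 0) + (0, u) := by simp
    rw [h1, map_add, map_smul, hc', hβ, hb]
    simp [mul_comm]

section IsometriesCS

variable {c : ℂ} {hc : c ≠ 0}

lemma lie_lie_of_sphere {A B : sl2} (hA : A.1 0 0 ^ 2 + A.1 0 1 * A.1 1 0 = 1)
    (hB : trForm A B = 0) : ⁅A, ⁅A, B⁆⁆ = (4 : ℂ) • B := by
  induction A using sl2_induction with | h a b c => ?_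
  induction B using sl2_induction with | h x y z => ?_
  simp only [trForm_apply, sl2mk_00, sl2mk_01, sl2mk_10] at hA hB
  rw [sl2mk_lie, sl2mk_lie, sl2mk_smul]
  congr 1
  · linear_combination 4 * x * hA - 2 * a * hB
  · linear_combination 4 * y * hA - 2 * b * hB
  · linear_combination 4 * z * hA - 2 * c * hB

lemma fieldCS_surjective (y : ℂ × S2) (w : TangentSpace 𝓘(ℂ, ℂ × ℂ × ℂ) y) :
    ∃ p, fieldCS p y = w := by
  obtain ⟨h1, h2⟩ := dιCS_mem y w
  let B : sl2 := ⟨Matrix.of (dιCS y w).2, by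
    change Matrix.trace (Matrix.of (dιCS y w).2) = 0
    rw [Matrix.trace_fin_two]
    exact h1⟩
  have hB : ⁅y.2.toSl2, ⁅y.2.toSl2, B⁆⁆ = (4 : ℂ) • B := by
    refine lie_lie_of_sphere y.2.sq_toSl2 ?_
    rw [trForm_eq_trace, Matrix.trace_fin_two, Matrix.mul_apply, Matrix.mul_apply, Fin.sum_univ_two,
      Fin.sum_univ_two]
    refine Eq.trans ?_ h2
    change y.2.1 0 0 * (dιCS y w).2 0 0 + y.2.1 0 1 * (dιCS y w).2 1 0 +
      (y.2.1 1 0 * (dιCS y w).2 0 1 + y.2.1 1 1 * (dιCS y w).2 1 1) = _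
    ring
  refine ⟨((dιCS y w).1, (4⁻¹ : ℂ) • ⁅y.2.toSl2, B⁆), dιCS_injective y ?_⟩
  refine (vecDeriv_fieldCS _ y).trans ?_
  rw [ambCS_toSl2, lie_smul, hB, smul_smul, inv_mul_cancel₀ (by norm_num), one_smul]
  rfl

/-- The isometries of a product metric. -/
lemma exists_motion (hF : (familyCS c hc).Complete)
    (φ : Diffeomorph 𝓘(ℂ, ℂ × ℂ × ℂ) 𝓘(ℂ, ℂ × ℂ × ℂ) (ℂ × S2) (ℂ × S2) ω)
    (hφ : ∀ x (z w : TangentSpace 𝓘(ℂ, ℂ × ℂ × ℂ) x), (productMetric c hc).val (φ x)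
      (mfderiv 𝓘(ℂ, ℂ × ℂ × ℂ) 𝓘(ℂ, ℂ × ℂ × ℂ) φ x z)
      (mfderiv 𝓘(ℂ, ℂ × ℂ × ℂ) 𝓘(ℂ, ℂ × ℂ × ℂ) φ x w) = (productMetric c hc).val x z w) :
    ∃ (μ t ε : ℂ) (b : SL2), (μ = 1 ∨ μ = -1) ∧ (ε = 1 ∨ ε = -1) ∧
      ∀ p, (φ p).1 = μ * p.1 + t ∧ (φ p).2.toSl2 = ε • AdSL b p.2.toSl2 := by
  obtain ⟨α, hα⟩ := hF.exists_automorphism φ hφ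
  obtain ⟨μ, b₀, hμ0, hμb⟩ := exists_prod_automorphism α
  obtain ⟨b, rfl⟩ : ∃ b, b₀ = b⁻¹ := ⟨b₀⁻¹, (inv_inv _).symm⟩
  have hφd := fun x => φ.contMDiff.mdifferentiable (by simp) x
  have hV : ∀ p y, vecDeriv (fun y => ιCS (φ y)) y (fieldCS (α p) y) = ambCS p (ιCS (φ y)) := by
    intro p y
    rw [← vecDeriv_ιCS_mfderiv (hφd y), ← vecDeriv_fieldCS]
    exact congrArg (vecDeriv ιCS (φ y)) (hα p y)
  have hμ : μ * μ = 1 := by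
    have h2 : ambientForm c (vecDeriv ιCS _ _) (vecDeriv ιCS _ _) =
        ambientForm c (vecDeriv ιCS _ _) (vecDeriv ιCS _ _) :=
      hφ (0, S2.base) (fieldCS (α (1, 0)) (0, S2.base)) (fieldCS (α (1, 0)) (0, S2.base))
    rw [vecDeriv_ιCS_mfderiv (hφd _), hV, vecDeriv_fieldCS, hμb, ambCS_toSl2, ambCS_toSl2, map_zero,
      lie_zero, lie_zero, map_zero, ambientForm_apply, ambientForm_apply] at h2
    simpa using h2.symm
  have hμ' : μ = 1 ∨ μ = -1 := mul_self_eq_one_iff.1 hμ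
  have hε : ∀ y, (φ y).2.toSl2 = AdSL b y.2.toSl2 ∨ (φ y).2.toSl2 = -AdSL b y.2.toSl2 := by
    intro y
    have e : ∀ x : sl2, x.1 0 0 ^ 2 + x.1 0 1 * x.1 1 0 = trForm x x / 2 := fun x => by
      rw [trForm_apply]; ring
    refine eq_or_neg_of_lie_eq_zero ?_ (φ y).2.sq_toSl2 ?_
    · rw [e, trForm_AdSL, ← e]
      exact y.2.sq_toSl2
    · have h0 : fieldCS (α (0, AdSL b y.2.toSl2)) y = 0 := by
        rw [fieldCS_eq_zero_iff, hμb, AdSL_inv_apply, mul_zero, lie_self]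
        exact ⟨rfl, rfl⟩
      have h1 := hV (0, AdSL b y.2.toSl2) y
      rw [h0, map_zero, ← vecDeriv_fieldCS] at h1
      have h2 := (fieldCS_eq_zero_iff _ _).1 (dιCS_injective _ (h1.symm.trans (map_zero _).symm))
      rw [← lie_skew, h2.2, neg_zero]
  let D : ℂ × S2 → ℂ := fun y => ((φ y).2.1 * (b.1 * y.2.1 * (b⁻¹).1)).trace
  have hD : ∀ y, D y = trForm (φ y).2.toSl2 (AdSL b y.2.toSl2) := fun y => by
    rw [trForm_eq_trace]
    rfl
  have hDc : Continuous D := by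
    have h1 : Continuous fun y : ℂ × S2 => y.2.1 := continuous_subtype_val.comp continuous_snd
    have h2 : Continuous fun y => (φ y).2.1 := h1.comp φ.continuous
    exact (h2.matrix_mul ((continuous_const.matrix_mul h1).matrix_mul continuous_const)).matrix_trace
  have hsq : ∀ y : ℂ × S2, trForm (AdSL b y.2.toSl2) (AdSL b y.2.toSl2) = 2 := by
    intro y
    rw [trForm_AdSL, trForm_apply]
    linear_combination 2 * y.2.sq_toSl2
  have hDv : ∀ y, D y = 2 ∨ D y = -2 := by
    intro y
    rw [hD]
    rcases hε y with h | h
    · left; rw [h, hsq]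
    · right; rw [h, map_neg, LinearMap.neg_apply, hsq]
  have hDε : ∀ y, (φ y).2.toSl2 = (D y / 2) • AdSL b y.2.toSl2 := by
    intro y
    rw [hD]
    rcases hε y with h | h
    · rw [h, hsq, div_self two_ne_zero, one_smul]
    · rw [h, map_neg, LinearMap.neg_apply, hsq, neg_div, div_self two_ne_zero, neg_smul, one_smul]
  have hDk : ∀ y, D y = D (0, S2.base) := fun y =>
    isPreconnected_univ.constant_of_mapsTo (T := {2, -2}) (Set.toFinite _).isDiscrete
      hDc.continuousOn (fun y _ => hDv y) (Set.mem_univ y) (Set.mem_univ _)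
  have hι : ContMDiff 𝓘(ℂ, ℂ × ℂ × ℂ) 𝓘(ℂ, ℂ × Mat2) ω fun y => ιCS (φ y) :=
    ιCS_contMDiff.comp φ.contMDiff
  let l : (ℂ × Mat2) × (ℂ × Mat2) →L[ℂ] ℂ :=
    (ContinuousLinearMap.fst ℂ ℂ Mat2).comp (ContinuousLinearMap.fst ℂ _ _) -
      μ • (ContinuousLinearMap.fst ℂ ℂ Mat2).comp (ContinuousLinearMap.snd ℂ _ _)
  let τ : ℂ × S2 → ℂ := fun y => l (ιCS (φ y), ιCS y)
  have hτ := eq_of_vecDeriv_eq_zero (f := τ) (l.contMDiff.comp (hι.prodMk_space ιCS_contMDiff)) (by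
    intro y w
    obtain ⟨p, rfl⟩ := fieldCS_surjective y w
    obtain ⟨r, hr⟩ := α.surjective p
    have hr' : α r = p := hr
    have hd := hι.mdifferentiable (by simp) y
    have hd' := ιCS_contMDiff.mdifferentiable (by simp) y
    refine (vecDeriv_comp l.hasFDerivAt (hd.prodMk_space hd') _).trans ?_
    rw [vecDeriv_prodMk hd hd', ← hr', hV, vecDeriv_fieldCS, ambCS_toSl2, ambCS_toSl2]
    change r.1 - μ * (α r).1 = 0
    rw [show r = (r.1, r.2) from rfl, hμb]
    linear_combination -r.1 * hμ)
  refine ⟨μ, τ (0, S2.base), D (0, S2.base) / 2, b, hμ', ?_, fun y => ⟨?_, ?_⟩⟩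
  · rcases hDv (0, S2.base) with h | h
    · left; rw [h]; norm_num
    · right; rw [h]; norm_num
  · rw [← hτ y]
    change _ = μ * y.1 + ((φ y).1 - μ * y.1)
    ring
  · rw [← hDk y, ← hDε]

end IsometriesCS

section ComponentCS

variable {c : ℂ} {hc : c ≠ 0}

lemma familyCS_complete {y₀ : ℂ × S2}
    (hd : Module.finrank ℂ (KillingAlgebra (productMetric c hc) y₀) = 4) :
    (familyCS c hc).Complete := by
  have h0 : ∀ y : ℂ × S2, Module.finrank ℂ (KillingAlgebra (productMetric c hc) (0, S2.base)) =
      Module.finrank ℂ (KillingAlgebra (productMetric c hc) y) := by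
    intro y
    obtain ⟨a, ha⟩ := y.2.exists_conj_eq_base
    have h := isLocalIsometry_toOpenPartialHomeomorph (motion (-y.1) a)
      (isometry_motion c hc (-y.1) a)
    have e := (h.pullEquiv (x := y) (Set.mem_univ y)).toLinearEquiv.finrank_eq
    have hy : motion (-y.1) a y = (0, S2.base) := by
      rw [motion_apply, ha, add_neg_cancel]
    change Module.finrank ℂ (KillingAlgebra (productMetric c hc) (motion (-y.1) a y)) = _ at e
    rwa [hy] at e
  refine KillingFamily.complete_of_injective _ familyCS_germ_injective
    (by rw [finrank_prod_sl2]; norm_num) fun y => ?_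
  rw [finrank_prod_sl2, ← h0, h0 y₀, hd]

/-- Three points of the sphere spanning a nonzero volume. -/
def S2.second : S2 := ⟨!![0, 1; 1, 0], by simp [Matrix.trace_fin_two], by simp⟩

def S2.third : S2 := ⟨!![0, Complex.I; -Complex.I, 0], by simp [Matrix.trace_fin_two], by simp⟩

lemma S2.val_eq_of_toSl2 {A B : S2} {ε : ℂ} {b : SL2} (h : A.toSl2 = ε • AdSL b B.toSl2) :
    A.1 = ε • (b.1 * B.1 * (b⁻¹).1) := congrArg (fun u : sl2 => u.1) h

/-- The identity component of the isometry group of the product metric. -/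
lemma mem_isometryComponent_CS_iff (hF : (familyCS c hc).Complete) (f : C(ℂ × S2, ℂ × S2)) :
    f ∈ isometryComponent (productMetric c hc) ↔
      ∃ (t : ℂ) (a : SL2), ∀ p, f p = (p.1 + t, S2.conj a p.2) := by
  constructor
  · intro hf
    let Θ : C(ℂ × S2, ℂ × S2) → ℂ × ℂ := fun f => ((f (1, S2.base)).1 - (f (0, S2.base)).1,
      ((f (0, S2.base)).2.1 * (f (0, S2.second)).2.1 * (f (0, S2.third)).2.1).trace)
    have hΘ : Continuous Θ := by
      have h1 : ∀ x : ℂ × S2, Continuous fun f : C(ℂ × S2, ℂ × S2) => (f x).1 := fun x =>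
        continuous_fst.comp (continuous_eval_const x)
      have h2 : ∀ x : ℂ × S2, Continuous fun f : C(ℂ × S2, ℂ × S2) => (f x).2.1 := fun x =>
        continuous_subtype_val.comp (continuous_snd.comp (continuous_eval_const x))
      exact ((h1 _).sub (h1 _)).prodMk
        (((h2 _).matrix_mul (h2 _)).matrix_mul (h2 _)).matrix_trace
    have hex : ∀ f ∈ isometries (productMetric c hc), ∃ (μ t ε : ℂ) (b : SL2),
        (μ = 1 ∨ μ = -1) ∧ (ε = 1 ∨ ε = -1) ∧
        ∀ p, (f p).1 = μ * p.1 + t ∧ (f p).2.toSl2 = ε • AdSL b p.2.toSl2 := by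
      rintro f ⟨φ, hφf, hφ⟩
      obtain ⟨μ, t, ε, b, h1, h2, h3⟩ := exists_motion hF φ hφ
      exact ⟨μ, t, ε, b, h1, h2, fun p => by rw [← hφf]; exact h3 p⟩
    have key : ∀ (f : C(ℂ × S2, ℂ × S2)) (μ t ε : ℂ) (b : SL2), (ε = 1 ∨ ε = -1) →
        (∀ p, (f p).1 = μ * p.1 + t ∧ (f p).2.toSl2 = ε • AdSL b p.2.toSl2) →
        Θ f = (μ, ε * (-2 * Complex.I)) := by
      intro f μ t ε b hε h
      have hm : ∀ A : S2, (f (0, A)).2.1 = ε • (b.1 * A.1 * (b⁻¹).1) := fun A =>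
        S2.val_eq_of_toSl2 (h (0, A)).2
      have hprod : ∀ X Y Z : Matrix (Fin 2) (Fin 2) ℂ, ((b.1 * X * (b⁻¹).1) * (b.1 * Y * (b⁻¹).1) *
          (b.1 * Z * (b⁻¹).1)).trace = (X * Y * Z).trace := by
        intro X Y Z
        have : (b.1 * X * (b⁻¹).1) * (b.1 * Y * (b⁻¹).1) * (b.1 * Z * (b⁻¹).1) =
            b.1 * (X * Y * Z) * (b⁻¹).1 := by
          calc _ = b.1 * X * ((b⁻¹).1 * b.1) * Y * ((b⁻¹).1 * b.1) * Z * (b⁻¹).1 := by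
                simp only [Matrix.mul_assoc]
            _ = _ := by rw [SL2_inv_mul, Matrix.mul_one, Matrix.mul_one]; simp only [Matrix.mul_assoc]
        rw [this, Matrix.trace_mul_comm, ← Matrix.mul_assoc, SL2_inv_mul, Matrix.one_mul]
      refine Prod.ext ?_ ?_
      · change (f (1, S2.base)).1 - (f (0, S2.base)).1 = μ
        rw [(h _).1, (h _).1]
        ring
      · change ((f (0, S2.base)).2.1 * (f (0, S2.second)).2.1 * (f (0, S2.third)).2.1).trace =
          ε * (-2 * Complex.I)
        rw [hm, hm, hm]
        simp only [Matrix.smul_mul, Matrix.mul_smul, Matrix.trace_smul, hprod, smul_eq_mul]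
        have h3 : (S2.base.1 * S2.second.1 * S2.third.1).trace = -2 * Complex.I := by
          simp [S2.base, S2.second, S2.third, Matrix.trace_fin_two]
          ring
        rw [h3]
        rcases hε with rfl | rfl <;> ring
    have hid := eq_id_of_mem_isometryComponent hΘ
      (T := {(1, 1 * (-2 * Complex.I)), (1, -1 * (-2 * Complex.I)), (-1, 1 * (-2 * Complex.I)),
        (-1, -1 * (-2 * Complex.I))}) (Set.toFinite _) (by
      intro f hf
      obtain ⟨μ, t, ε, b, hμ, hε, h⟩ := hex f hf
      rw [key f μ t ε b hε h]
      rcases hμ with rfl | rfl <;> rcases hε with rfl | rfl <;> simp) hf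
    rw [key (ContinuousMap.id _) 1 0 1 1 (Or.inl rfl) (fun p => by simp [AdSL_one])] at hid
    obtain ⟨μ, t, ε, b, hμ, hε, h⟩ := hex f (connectedComponentIn_subset _ _ hf)
    rw [key f μ t ε b hε h] at hid
    have h1 : μ = 1 := congrArg Prod.fst hid
    have h2 : ε = 1 := mul_right_cancel₀ (by simp) (congrArg Prod.snd hid)
    subst h1 h2
    refine ⟨t, b, fun p => Prod.ext ?_ ?_⟩
    · rw [(h p).1, one_mul]
    · refine S2.toSl2_injective ?_
      rw [(h p).2, one_smul, S2.toSl2_conj]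
  · rintro ⟨t, a, hf⟩
    let Φ : C((ℂ × SL2) × (ℂ × S2), ℂ × S2) :=
      ⟨fun z => (z.2.1 + z.1.1, S2.conj z.1.2 z.2.2),
        Continuous.prodMk (by fun_prop) (Continuous.comp (g := fun z : SL2 × S2 => S2.conj z.1 z.2)
          (f := fun z : (ℂ × SL2) × (ℂ × S2) => (z.1.2, z.2.2)) continuous_S2_conj (by fun_prop))⟩
    have h1 : f = Φ.curry (t, a) := ContinuousMap.ext hf
    rw [h1]
    refine mem_isometryComponent_of_family Φ (fun z => ?_) (p₀ := (0, 1)) (fun x => ?_) _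
    · exact ⟨motion z.1 z.2, fun _ => rfl, isometry_motion c hc _ _⟩
    · exact Prod.ext (add_zero _) (S2.conj_one _)

lemma S2.conj_congr {a b : SL2} (h : ∀ u, AdSL a u = AdSL b u) (A : S2) :
    S2.conj a A = S2.conj b A :=
  S2.toSl2_injective (by rw [toSl2_conj, toSl2_conj, h])

lemma S2.conj_base_eq_iff (a : SL2) : S2.conj a S2.base = S2.base ↔ AdSL a sl2H = sl2H :=
  ⟨fun h => congrArg S2.toSl2 h, fun h => S2.toSl2_injective h⟩

lemma stabilizer_CS_iff (hF : (familyCS c hc).Complete) (f : C(ℂ × S2, ℂ × S2))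
    (hf : f ∈ isometryComponent (productMetric c hc)) :
    f (0, S2.base) = (0, S2.base) ↔ ∃ t : ℂ, ∀ p, f p = (p.1, S2.conj (diagSL t) p.2) := by
  obtain ⟨t, a, hfa⟩ := (mem_isometryComponent_CS_iff hF f).1 hf
  constructor
  · intro h1
    have h2 := (hfa _).symm.trans h1
    have ht : t = 0 := (zero_add t).symm.trans (congrArg Prod.fst h2)
    obtain ⟨s, e, -, he, hae⟩ := isCentralizerFlow_diagSL.centralizer a
      ((S2.conj_base_eq_iff a).1 (congrArg Prod.snd h2))
    refine ⟨s, fun p => (hfa p).trans (Prod.ext ?_ (S2.conj_congr (fun u => ?_) p.2))⟩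
    · exact (congrArg (fun x => p.1 + x) ht).trans (add_zero _)
    · rw [hae, AdSL_mul, he]
  · rintro ⟨s, hs⟩
    exact (hs _).trans (Prod.ext rfl ((S2.conj_base_eq_iff _).2 (isCentralizerFlow_diagSL.fix s)))

end ComponentCS

section Exclusion

variable {E E' : Type*} [NormedAddCommGroup E] [NormedSpace ℂ E] [CompleteSpace E]
  [NormedAddCommGroup E'] [NormedSpace ℂ E'] [CompleteSpace E']
variable {M M' : Type*} [TopologicalSpace M] [ChartedSpace E M] [IsManifold 𝓘(ℂ, E) ω M]
  [TopologicalSpace M'] [ChartedSpace E' M'] [IsManifold 𝓘(ℂ, E') ω M']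
variable {L L' : Type*} [LieRing L] [LieAlgebra ℂ L] [LieRing L'] [LieAlgebra ℂ L']

/-- A local isometry carries families of Killing fields into a complete family. -/
lemma KillingFamily.Complete.exists_lieHom {g : Metric E M} {g' : Metric E' M'}
    {F : KillingFamily L g} (hF : F.Complete) (F' : KillingFamily L' g')
    {f : OpenPartialHomeomorph M M'} (hf : IsLocalIsometry g g' f) {x : M} (hx : x ∈ f.source)
    (hi : Function.Injective (F'.germ (f x))) :
    ∃ α : L' →ₗ⁅ℂ⁆ L, Function.Injective α ∧ ∀ p,
      mfderiv 𝓘(ℂ, E) 𝓘(ℂ, E') f x (F.field (α p) x) = F'.field p (f x) := by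
  let e := (LieEquiv.ofBijective (F.germ x) (hF x)).symm
  let α : L' →ₗ⁅ℂ⁆ L := (e : KillingAlgebra g x →ₗ⁅ℂ⁆ L).comp
    ((hf.pullEquiv hx : KillingAlgebra g' (f x) →ₗ⁅ℂ⁆ KillingAlgebra g x).comp (F'.germ (f x)))
  refine ⟨α, fun p r h => ?_, fun p => ?_⟩
  · exact hi ((hf.pullEquiv hx).injective (e.injective h))
  have h : F.germ x (α p) = hf.pullEquiv hx (F'.germ (f x) p) :=
    LieEquiv.apply_symm_apply (LieEquiv.ofBijective (F.germ x) (hF x)) _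
  rw [← F.eval_germ, h]
  exact hf.mfderiv_eval_pullEquiv hx _

/-- The restriction to `sl(2, ℂ)` of an injective endomorphism of `ℂ ⊕ sl(2, ℂ)`. -/
lemma exists_restriction (j : sl2 →ₗ⁅ℂ⁆ ℂ × sl2) (hj : Function.Injective j) :
    ∃ b, ∀ u, j u = (0, AdSL b u) := by
  let β : sl2 →ₗ⁅ℂ⁆ sl2 :=
    { toLinearMap := (LinearMap.snd ℂ ℂ sl2).comp (j : sl2 →ₗ[ℂ] ℂ × sl2)
      map_lie' := fun {u w} => by
        change (j ⁅u, w⁆).2 = ⁅(j u).2, (j w).2⁆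
        rw [LieHom.map_lie, prod_lie] }
  have hβ : ∀ u, j u = (0, β u) := fun u => Prod.ext (lieHom_prod_fst j u) rfl
  obtain ⟨b, hb⟩ := exists_eq_AdSL β fun u w h => hj (by rw [hβ, hβ, h])
  exact ⟨b, fun u => by rw [hβ, hb]⟩

/-- The inclusion of `sl(2, ℂ)` in `ℂ ⊕ sl(2, ℂ)`. -/
def inclSl2 : sl2 →ₗ⁅ℂ⁆ ℂ × sl2 :=
  { toLinearMap := LinearMap.inr ℂ ℂ sl2
    map_lie' := fun {u w} => (prod_lie (0, u) (0, w)).symm }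

lemma inclSl2_injective : Function.Injective inclSl2 := fun _ _ h => congrArg Prod.snd h

lemma fieldSL_eq_zero {v u : sl2} {a : SL2} (h : fieldSL v (0, u) a = 0) : u = 0 := by
  have h1 := congrArg (maurerCartan a) h
  rw [maurerCartan_fieldSL, map_zero] at h1
  simpa using h1

/-- The restriction of a Killing family to a subalgebra. -/
def KillingFamily.comp {g : Metric E M} (F : KillingFamily L g) (j : L' →ₗ⁅ℂ⁆ L) :
    KillingFamily L' g where
  field := F.field.comp (j : L' →ₗ[ℂ] L)
  holAt p y := F.holAt (j p) y
  killingAt p y := F.killingAt (j p) y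
  bracket p r y := by
    change mlieBracket 𝓘(ℂ, E) (F.field (j p)) (F.field (j r)) y = F.field (j ⁅p, r⁆) y
    rw [F.bracket, LieHom.map_lie]

/-- The two local models exclude each other. -/
lemma not_isLocalIsometry_CS {q : LinearMap.BilinForm ℂ sl2} {hs : ∀ X Y, q X Y = q Y X}
    {hn : ∀ X, (∀ Y, q X Y = 0) → X = 0} {v : sl2} {hv : ∀ X Y, q ⁅v, X⁆ Y + q X ⁅v, Y⁆ = 0}
    (hF : (familySL q hs hn v hv).Complete) {c : ℂ} {hc : c ≠ 0}
    {f : OpenPartialHomeomorph SL2 (ℂ × S2)}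
    (hf : IsLocalIsometry (leftInvariant q hs hn) (productMetric c hc) f) {x : SL2}
    (hx : x ∈ f.source) : False := by
  obtain ⟨α, hα, h⟩ := hF.exists_lieHom ((familyCS c hc).comp inclSl2) hf hx
    ((familyCS_germ_injective (f x)).comp inclSl2_injective)
  obtain ⟨b, hb⟩ := exists_restriction α hα
  have h1 := h (f x).2.toSl2
  have h2 : ((familyCS c hc).comp inclSl2).field (f x).2.toSl2 (f x) = 0 :=
    (fieldCS_eq_zero_iff (0, (f x).2.toSl2) (f x)).2 ⟨rfl, lie_self _⟩
  rw [h2, hb] at h1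
  have h3 := fieldSL_eq_zero
    (hf.isBihol.mfderiv_injective hx (h1.trans (map_zero _).symm))
  exact (f x).2.toSl2_ne_zero ((map_eq_zero_iff _ (AdSL b).injective).1 h3)

lemma not_isLocalIsometry_SL2 {q : LinearMap.BilinForm ℂ sl2} {hs : ∀ X Y, q X Y = q Y X}
    {hn : ∀ X, (∀ Y, q X Y = 0) → X = 0} {c : ℂ} {hc : c ≠ 0} (hF : (familyCS c hc).Complete)
    {f : OpenPartialHomeomorph (ℂ × S2) SL2}
    (hf : IsLocalIsometry (productMetric c hc) (leftInvariant q hs hn) f) {x : ℂ × S2}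
    (hx : x ∈ f.source) : False := by
  let F' := familySL q hs hn 0 (fun X Y => by simp)
  obtain ⟨α, hα, h⟩ := hF.exists_lieHom (F'.comp inclSl2) hf hx (by
    rw [injective_iff_map_eq_zero]
    intro u hu
    have h1 := congrArg (KillingAlgebra.eval _ (f x)) hu
    rw [KillingFamily.eval_germ, map_zero] at h1
    exact fieldSL_eq_zero h1)
  obtain ⟨b, hb⟩ := exists_restriction α hα
  have h1 := h (AdSL b⁻¹ x.2.toSl2)
  have h2 : (familyCS c hc).field (α (AdSL b⁻¹ x.2.toSl2)) x = 0 := by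
    rw [hb, AdSL_apply_inv]
    exact (fieldCS_eq_zero_iff (0, x.2.toSl2) x).2 ⟨rfl, lie_self _⟩
  rw [h2, map_zero] at h1
  have h3 : AdSL b⁻¹ x.2.toSl2 = 0 := fieldSL_eq_zero h1.symm
  exact x.2.toSl2_ne_zero ((map_eq_zero_iff _ (AdSL b⁻¹).injective).1 h3)

end Exclusion

section KillingForm

lemma killingForm_lie (v X Y : sl2) :
    killingForm ℂ sl2 ⁅v, X⁆ Y + killingForm ℂ sl2 X ⁅v, Y⁆ = 0 := by
  have h := LieModule.traceForm_apply_lie_apply ℂ sl2 sl2 X v Y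
  rw [← lie_skew, map_neg, LinearMap.neg_apply]
  change -killingForm ℂ sl2 ⁅X, v⁆ Y + _ = 0
  rw [show killingForm ℂ sl2 ⁅X, v⁆ Y = killingForm ℂ sl2 X ⁅v, Y⁆ from h]
  ring

lemma killingForm_symm (X Y : sl2) : killingForm ℂ sl2 X Y = killingForm ℂ sl2 Y X :=
  LieModule.traceForm_comm ℂ sl2 sl2 X Y

lemma killingForm_H : killingForm ℂ sl2 sl2H sl2H = 8 := by
  rw [killingForm_apply_apply, ← LinearMap.trace_conj' _ sl2Equiv]
  have h : sl2Equiv.conj ((LieAlgebra.ad ℂ sl2 sl2H) ∘ₗ (LieAlgebra.ad ℂ sl2 sl2H)) =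
      LinearMap.prodMap 0 (LinearMap.prodMap ((4 : ℂ) • LinearMap.id) ((4 : ℂ) • LinearMap.id)) := by
    refine LinearMap.ext fun z => ?_
    rw [LinearEquiv.conj_apply_apply]
    change sl2Equiv ⁅sl2H, ⁅sl2H, sl2mk z.1 z.2.1 z.2.2⁆⁆ = (0, (4 : ℂ) • z.2.1, (4 : ℂ) • z.2.2)
    rw [sl2H_eq, sl2mk_lie, sl2mk_lie]
    change (_, _, _) = _
    simp only [sl2mk_00, sl2mk_01, sl2mk_10, Prod.mk.injEq, smul_eq_mul]
    refine ⟨?_, ?_, ?_⟩ <;> ring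
  rw [h, LinearMap.trace_prodMap', LinearMap.trace_prodMap']
  simp
  norm_num

lemma killingForm_eq (X Y : sl2) : killingForm ℂ sl2 X Y = 4 * trForm X Y := by
  obtain ⟨r, s, h⟩ := exists_form killingForm_symm (Or.inl rfl) (killingForm_lie sl2H)
  obtain ⟨r', s', h'⟩ := exists_form killingForm_symm (Or.inr rfl) (killingForm_lie sl2E)
  have h1 := (h' sl2H sl2H).symm.trans killingForm_H
  have h2 := (h sl2H sl2H).symm.trans killingForm_H
  have h3 := (h sl2F sl2F).symm.trans (h' sl2F sl2F)
  have h4 := (h sl2E sl2F).symm.trans (h' sl2E sl2F)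
  rw [sl2H_eq] at h1 h2 h3 h4
  simp [trForm_apply, sl2E, sl2F] at h1 h2 h3 h4
  rw [h]
  have hr : r = 4 := by linear_combination h4 + h1 / 2
  have hs : s = 0 := by linear_combination h2 / 4 - hr / 2
  rw [hr, hs]
  ring

lemma killingForm_AdSL (b : SL2) (X Y : sl2) :
    killingForm ℂ sl2 (AdSL b X) (AdSL b Y) = killingForm ℂ sl2 X Y := by
  rw [killingForm_eq, killingForm_eq, trForm_AdSL]

lemma killingForm_nondeg (X : sl2) (h : ∀ Y, killingForm ℂ sl2 X Y = 0) : X = 0 := by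
  by_contra hX
  obtain ⟨Y, hY⟩ := exists_trForm_ne_zero hX
  have := h Y
  rw [killingForm_eq] at this
  exact hY ((mul_eq_zero.1 this).resolve_left (by norm_num))

/-- The left invariant metric on `SL(2, ℂ)` given by the Killing form. -/
def killingMetric : Metric (ℂ × ℂ × ℂ) SL2 :=
  leftInvariant (killingForm ℂ sl2) killingForm_symm killingForm_nondeg

end KillingForm

section TransportedMetric

variable {E E' : Type*} [NormedAddCommGroup E] [NormedSpace ℂ E] [CompleteSpace E]
  [NormedAddCommGroup E'] [NormedSpace ℂ E'] [CompleteSpace E']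
variable {M M' : Type*} [TopologicalSpace M] [ChartedSpace E M] [IsManifold 𝓘(ℂ, E) ω M]
  [TopologicalSpace M'] [ChartedSpace E' M'] [IsManifold 𝓘(ℂ, E') ω M']

lemma localKilling_congr {g : Metric E M} {x : M} {V W : ∀ y : M, TangentSpace 𝓘(ℂ, E) y}
    (hV : V ∈ localKilling g x) (h : ∀ᶠ y in 𝓝 x, W y = V y) : W ∈ localKilling g x := by
  have hV' : ∀ᶠ y in 𝓝 x, HolAt V y ∧ KillingAt g V y := hV
  change ∀ᶠ y in 𝓝 x, _
  filter_upwards [hV', eventually_eventually_nhds.2 h] with y hy hW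
  refine ⟨hy.1.congr hW, fun U Z hU hZ => ?_⟩
  have e : ∀ U : (∀ y : M, TangentSpace 𝓘(ℂ, E) y),
      mlieBracket 𝓘(ℂ, E) W U y = mlieBracket 𝓘(ℂ, E) V U y := fun U =>
    Filter.EventuallyEq.mlieBracket_vectorField_eq hW (EventuallyEq.refl _ _)
  rw [e, e, hW.self_of_nhds]
  exact hy.2 U Z hU hZ

lemma IsLocalIsometry.transition {g : Metric E M} {q m : Metric E' M'}
    (hm : ∀ T : OpenPartialHomeomorph M' M', IsLocalIsometry q q T → IsLocalIsometry m m T)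
    {f₁ f₂ : OpenPartialHomeomorph M M'} (h₁ : IsLocalIsometry g q f₁) (h₂ : IsLocalIsometry g q f₂)
    {x : M} (hx₁ : x ∈ f₁.source) (hx₂ : x ∈ f₂.source) (v w : TangentSpace 𝓘(ℂ, E) x) :
    m.val (f₁ x) (mfderiv 𝓘(ℂ, E) 𝓘(ℂ, E') f₁ x v) (mfderiv 𝓘(ℂ, E) 𝓘(ℂ, E') f₁ x w) =
      m.val (f₂ x) (mfderiv 𝓘(ℂ, E) 𝓘(ℂ, E') f₂ x v) (mfderiv 𝓘(ℂ, E) 𝓘(ℂ, E') f₂ x w) := by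
  set T := f₁.symm.trans f₂ with hT
  have hT' : IsLocalIsometry m m T := hm T (h₁.symm.trans h₂)
  have e : f₁.symm (f₁ x) = x := f₁.left_inv hx₁
  have hxT : f₁ x ∈ T.source := by
    rw [hT, OpenPartialHomeomorph.trans_source]
    refine ⟨f₁.map_source hx₁, ?_⟩
    rw [Set.mem_preimage, e]
    exact hx₂
  have h3 : (T ∘ f₁) =ᶠ[𝓝 x] f₂ := by
    filter_upwards [f₁.open_source.mem_nhds hx₁] with y hy
    exact congrArg f₂ (f₁.left_inv hy)
  have h4 := mfderiv_comp x (hT'.isBihol.mdiff hxT) (h₁.isBihol.mdiff hx₁)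
  have h5 : (mfderiv 𝓘(ℂ, E) 𝓘(ℂ, E') (T ∘ f₁) x : E →L[ℂ] E') =
      mfderiv 𝓘(ℂ, E) 𝓘(ℂ, E') f₂ x := h3.mfderiv_eq (I := 𝓘(ℂ, E)) (I' := 𝓘(ℂ, E'))
  have h6 : ∀ v : E, (mfderiv 𝓘(ℂ, E') 𝓘(ℂ, E') T (f₁ x)
      (mfderiv 𝓘(ℂ, E) 𝓘(ℂ, E') f₁ x v : E') : E') = mfderiv 𝓘(ℂ, E) 𝓘(ℂ, E') f₂ x v := fun v =>
    congrArg (fun L : E →L[ℂ] E' => L v) (h4.symm.trans h5)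
  refine (hT'.isometry _ hxT _ _).symm.trans ?_
  refine (congrArg₂ (fun a b => (m.val (T (f₁ x)) : E' →ₗ[ℂ] E' →ₗ[ℂ] ℂ) a b)
    (h6 v) (h6 w)).trans ?_
  exact congrArg (fun p : M' => (m.val p : E' →ₗ[ℂ] E' →ₗ[ℂ] ℂ)
    (mfderiv 𝓘(ℂ, E) 𝓘(ℂ, E') f₂ x v) (mfderiv 𝓘(ℂ, E) 𝓘(ℂ, E') f₂ x w)) h3.self_of_nhds

/-- A metric on the model preserved by the local isometries of the model induces a metric on every
manifold with that local model. -/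
lemma LocallyModelledOn.exists_metric {g : Metric E M} {q : Metric E' M'}
    (hmod : LocallyModelledOn g q) (m : Metric E' M')
    (hm : ∀ T : OpenPartialHomeomorph M' M', IsLocalIsometry q q T → IsLocalIsometry m m T) :
    ∃ κ : Metric E M, ∀ f : OpenPartialHomeomorph M M', IsLocalIsometry g q f →
      IsLocalIsometry κ m f := by
  choose F hF hxF using hmod
  have key : ∀ f : OpenPartialHomeomorph M M', IsLocalIsometry g q f → ∀ x ∈ f.source,
      ∀ v w : TangentSpace 𝓘(ℂ, E) x,
      m.val (f x) (mfderiv 𝓘(ℂ, E) 𝓘(ℂ, E') f x v) (mfderiv 𝓘(ℂ, E) 𝓘(ℂ, E') f x w) =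
      m.val (F x x) (mfderiv 𝓘(ℂ, E) 𝓘(ℂ, E') (F x) x v)
        (mfderiv 𝓘(ℂ, E) 𝓘(ℂ, E') (F x) x w) := fun f hf x hx v w =>
    hf.transition hm (hF x) hx (hxF x) v w
  refine ⟨{ val := fun x => (m.val (F x x)).compl₁₂
              (mfderiv 𝓘(ℂ, E) 𝓘(ℂ, E') (F x) x : TangentSpace 𝓘(ℂ, E) x →ₗ[ℂ] _)
              (mfderiv 𝓘(ℂ, E) 𝓘(ℂ, E') (F x) x : TangentSpace 𝓘(ℂ, E) x →ₗ[ℂ] _)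
            symm := fun x v w => m.symm _ _ _
            nondeg := fun x v h => ?_
            holo := fun V W x hV hW => ?_ }, fun f hf => ⟨hf.holo, hf.holo_symm, fun x hx v w => key f hf x hx v w⟩⟩
  · have hb := (hF x).isBihol
    refine hb.mfderiv_injective (hxF x) ((m.nondeg _ _ fun w => ?_).trans (map_zero _).symm)
    have h1 := h (mfderiv 𝓘(ℂ, E') 𝓘(ℂ, E) (F x).symm (F x x) w : E)
    exact (congrArg (fun b => (m.val (F x x) : E' →ₗ[ℂ] E' →ₗ[ℂ] ℂ)
      (mfderiv 𝓘(ℂ, E) 𝓘(ℂ, E') (F x) x v) b) (hb.comp_symm (hxF x) w)).symm.trans h1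
  · have hb := (hF x).isBihol
    have e : (F x).symm (F x x) = x := (F x).left_inv (hxF x)
    have push : ∀ U : (∀ y : M, TangentSpace 𝓘(ℂ, E) y), HolAt U x →
        HolAt (mpullback 𝓘(ℂ, E') 𝓘(ℂ, E) (F x).symm U) (F x x) := fun U hU =>
      HolAt.mpullback (by rw [e]; exact hU)
        (hb.symm.contMDiffAt (x := F x x) ((F x).map_source (hxF x)))
        (hb.symm.isInvertible (x := F x x) ((F x).map_source (hxF x)))
    refine ContMDiffAt.congr_of_eventuallyEq
      ((m.holo _ _ (F x x) (push V hV) (push W hW)).comp x (hb.contMDiffAt (hxF x))) ?_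
    filter_upwards [(F x).open_source.mem_nhds (hxF x)] with y hy
    refine (key (F x) (hF x) y hy (V y) (W y)).symm.trans ?_
    exact (congrArg₂ (fun a b => (m.val (F x y) : E' →ₗ[ℂ] E' →ₗ[ℂ] ℂ) a b)
      (hb.mpullback_symm_apply hy V) (hb.mpullback_symm_apply hy W)).symm

/-- Local Killing fields are pulled back from a complete family on the model. -/
lemma KillingFamily.Complete.localKilling_le {L : Type*} [LieRing L] [LieAlgebra ℂ L]
    {g κ : Metric E M} {q m : Metric E' M'} {F : KillingFamily L q} (hF : F.Complete)
    (hm : ∀ p y, KillingAt m (F.field p) y)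
    {f : OpenPartialHomeomorph M M'} (hf : IsLocalIsometry g q f) (hκ : IsLocalIsometry κ m f)
    {x : M} (hx : x ∈ f.source) : localKilling g x ≤ localKilling κ x := by
  intro V hV
  obtain ⟨a, ha⟩ := (hf.pullEquiv hx).surjective (KillingAlgebra.germ g x ⟨V, hV⟩)
  obtain ⟨p, rfl⟩ := (hF (f x)).2 a
  have ha' := (hf.pullEquiv_germ hx ⟨F.field p, F.mem p (f x)⟩).symm.trans ha
  rw [KillingAlgebra.germ_eq_iff] at ha'
  exact localKilling_congr (hκ.mpullback_mem hx
    (Eventually.of_forall fun y => ⟨F.holAt p y, hm p y⟩)) (ha'.mono fun y hy => hy.symm)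

end TransportedMetric

/-- The local isometries of the first model preserve the metric given by the Killing form. -/
lemma isLocalIsometry_killingMetric {q : LinearMap.BilinForm ℂ sl2} {hs : ∀ X Y, q X Y = q Y X}
    {hn : ∀ X, (∀ Y, q X Y = 0) → X = 0} {v : sl2} {hv : ∀ X Y, q ⁅v, X⁆ Y + q X ⁅v, Y⁆ = 0}
    (hF : (familySL q hs hn v hv).Complete) (T : OpenPartialHomeomorph SL2 SL2)
    (hT : IsLocalIsometry (leftInvariant q hs hn) (leftInvariant q hs hn) T) :
    IsLocalIsometry killingMetric killingMetric T := by
  refine ⟨hT.holo, hT.holo_symm, fun y hy X Y => ?_⟩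
  obtain ⟨α, hα⟩ := hF.exists_lieEquiv hF hT hy
  obtain ⟨μ, b, -, hb⟩ := exists_prod_automorphism α
  have h1 : ∀ u : sl2, maurerCartan (T y) (mfderiv 𝓘(ℂ, ℂ × ℂ × ℂ) 𝓘(ℂ, ℂ × ℂ × ℂ) T y
      (fieldSL v (0, AdSL b u) y)) = -AdSL (T y)⁻¹ u := by
    intro u
    have h2 : mfderiv 𝓘(ℂ, ℂ × ℂ × ℂ) 𝓘(ℂ, ℂ × ℂ × ℂ) T y (fieldSL v (α (0, u)) y) =
      fieldSL v (0, u) (T y) := (hα (0, u)).self_of_nhds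
    rw [hb, mul_zero] at h2
    rw [h2, maurerCartan_fieldSL, zero_smul, zero_sub]
  have h3 : ∀ X : TangentSpace 𝓘(ℂ, ℂ × ℂ × ℂ) y, ∃ u : sl2, X = fieldSL v (0, AdSL b u) y := by
    intro X
    refine ⟨-AdSL b⁻¹ (AdSL y (maurerCartan y X)), (maurerCartan_bijective y).1 ?_⟩
    rw [maurerCartan_fieldSL, map_neg, AdSL_apply_inv, map_neg, AdSL_inv_apply, zero_smul,
      zero_sub, neg_neg]
  obtain ⟨u, rfl⟩ := h3 X
  obtain ⟨w, rfl⟩ := h3 Y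
  change killingForm ℂ sl2 (maurerCartan (T y) _) (maurerCartan (T y) _) =
    killingForm ℂ sl2 (maurerCartan y _) (maurerCartan y _)
  rw [h1, h1, maurerCartan_fieldSL, maurerCartan_fieldSL]
  simp only [zero_smul, zero_sub, map_neg, LinearMap.neg_apply, neg_neg]
  rw [killingForm_AdSL, killingForm_AdSL, killingForm_AdSL]

section Coframe

variable {E W : Type*} [NormedAddCommGroup E] [NormedSpace ℂ E] [CompleteSpace E]
  [NormedAddCommGroup W] [NormedSpace ℂ W]

/-- The connection `∇_u v = (1 / 2) [u, v]` for the fields `u`, `v` that are constant in the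
coframe `θ`, read in the coordinates. -/
def coframeConnection (br : W →L[ℂ] W →L[ℂ] W) (θ : E → E →L[ℂ] W) (z u v : E) : E :=
  (θ z).inverse ((2⁻¹ : ℂ) • br (θ z u) (θ z v) + fderiv ℂ θ z u v)

variable {br : W →L[ℂ] W →L[ℂ] W} {θ : E → E →L[ℂ] W} {z₀ : E}

lemma eventually_isInvertible (hθ : ContinuousAt θ z₀) (hi : (θ z₀).IsInvertible) :
    ∀ᶠ z in 𝓝 z₀, (θ z).IsInvertible := by
  obtain ⟨e, he⟩ := hi
  have h := hθ.eventually (he ▸ e.nhds)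
  exact h.mono fun z ⟨e', he'⟩ => ⟨e', he'⟩

lemma coframe_connection {z : E} (hi : (θ z).IsInvertible) (u v : E) :
    θ z (coframeConnection br θ z u v) = (2⁻¹ : ℂ) • br (θ z u) (θ z v) + fderiv ℂ θ z u v := by
  obtain ⟨e, he⟩ := hi
  rw [coframeConnection, ← he, ContinuousLinearMap.inverse_equiv]
  exact e.apply_symm_apply _

/-- The connection of a coframe satisfying the Maurer-Cartan equation is the Levi-Civita connection
of the metric `b (θ ·) (θ ·)`, for an invariant form `b`. -/
lemma coframe_christoffel (hd : DifferentiableAt ℂ θ z₀) (hi : (θ z₀).IsInvertible)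
    (hMC : ∀ u v, fderiv ℂ θ z₀ u v - fderiv ℂ θ z₀ v u = -br (θ z₀ u) (θ z₀ v))
    (b : W →L[ℂ] W →L[ℂ] ℂ) (hs : ∀ x y, b x y = b y x) (ha : ∀ x y, br x y = -br y x)
    (hb : ∀ x y z, b (br x y) z + b y (br x z) = 0) (u v w : E) :
    2 * b (θ z₀ (coframeConnection br θ z₀ u v)) (θ z₀ w) =
      fderiv ℂ (fun z => b (θ z v) (θ z w)) z₀ u + fderiv ℂ (fun z => b (θ z u) (θ z w)) z₀ v -
      fderiv ℂ (fun z => b (θ z u) (θ z v)) z₀ w := by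
  have hD : ∀ x y t : E, fderiv ℂ (fun z => b (θ z x) (θ z y)) z₀ t =
      b (fderiv ℂ θ z₀ t x) (θ z₀ y) + b (θ z₀ x) (fderiv ℂ θ z₀ t y) := by
    intro x y t
    have hx : ∀ x, HasFDerivAt (fun z => θ z x) ((fderiv ℂ θ z₀).flip x) z₀ := fun x => by
      have := hd.hasFDerivAt.clm_apply (hasFDerivAt_const x z₀)
      simpa using this
    rw [(b.hasFDerivAt_of_bilinear (hx x) (hx y)).fderiv]
    simp [add_comm]
  have m1 : ∀ s t y, b (fderiv ℂ θ z₀ s t) y = b (fderiv ℂ θ z₀ t s) y - b (br (θ z₀ s) (θ z₀ t)) y := by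
    intro s t y
    have h := congrArg (fun l => b l y) (hMC s t)
    simp only [map_sub, map_neg, sub_apply, neg_apply] at h
    linear_combination h
  have a1 : b (br (θ z₀ w) (θ z₀ u)) (θ z₀ v) = b (br (θ z₀ u) (θ z₀ v)) (θ z₀ w) := by
    have h1 := hb (θ z₀ u) (θ z₀ v) (θ z₀ w)
    rw [ha (θ z₀ u) (θ z₀ w), map_neg, hs (θ z₀ v)] at h1
    linear_combination -h1
  have a2 : b (br (θ z₀ w) (θ z₀ v)) (θ z₀ u) = -b (br (θ z₀ u) (θ z₀ v)) (θ z₀ w) := by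
    have h1 := hb (θ z₀ v) (θ z₀ w) (θ z₀ u)
    rw [ha (θ z₀ v) (θ z₀ w), ha (θ z₀ v) (θ z₀ u), map_neg, map_neg, neg_apply,
      hs (θ z₀ w)] at h1
    linear_combination -h1
  rw [coframe_connection hi, hD, hD, hD]
  simp only [map_add, map_smul, add_apply, smul_apply,
    smul_eq_mul]
  rw [hs (θ z₀ v) (fderiv ℂ θ z₀ u w), hs (θ z₀ u) (fderiv ℂ θ z₀ v w),
    hs (θ z₀ u) (fderiv ℂ θ z₀ w v)]
  have e1 := m1 u v (θ z₀ w)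
  have e2 := m1 w u (θ z₀ v)
  have e3 := m1 w v (θ z₀ u)
  linear_combination e1 + e2 + e3 - a1 - a2

lemma coframeConnection_differentiableAt (hθ : ContDiffAt ℂ ω θ z₀) (hi : (θ z₀).IsInvertible)
    (u v : E) : DifferentiableAt ℂ (fun z => coframeConnection br θ z u v) z₀ := by
  have h1 : DifferentiableAt ℂ (fun z => (θ z).inverse) z₀ :=
    ((hi.contDiffAt_map_inverse (n := ω)).comp z₀ hθ).differentiableAt (by simp)
  have h2 : DifferentiableAt ℂ θ z₀ := hθ.differentiableAt (by simp)
  have h3 : DifferentiableAt ℂ (fderiv ℂ θ) z₀ :=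
    (hθ.fderiv_right (m := 1) le_top).differentiableAt (by simp)
  have h4 : ∀ x, DifferentiableAt ℂ (fun z => θ z x) z₀ := fun x =>
    h2.clm_apply (differentiableAt_const x)
  exact h1.clm_apply (((((br.differentiableAt (x := θ z₀ u)).comp z₀ (h4 u)).clm_apply
    (h4 v)).const_smul _).add ((h3.clm_apply (differentiableAt_const u)).clm_apply
      (differentiableAt_const v)))

/-- The curvature of the connection of a coframe satisfying the Maurer-Cartan equation. -/
lemma coframe_curvature (hθ : ContDiffAt ℂ ω θ z₀) (hi : (θ z₀).IsInvertible)
    (hMC : ∀ᶠ z in 𝓝 z₀, ∀ u v, fderiv ℂ θ z u v - fderiv ℂ θ z v u = -br (θ z u) (θ z v))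
    (hj : ∀ x y z, br x (br y z) = br (br x y) z + br y (br x z)) (u v w : E) :
    θ z₀ (chartCurvature (coframeConnection br θ) z₀ u v w) =
      -(4⁻¹ : ℂ) • br (br (θ z₀ u) (θ z₀ v)) (θ z₀ w) := by
  have hd : DifferentiableAt ℂ θ z₀ := hθ.differentiableAt (by simp)
  have hd2 : DifferentiableAt ℂ (fderiv ℂ θ) z₀ :=
    (hθ.fderiv_right (m := 1) le_top).differentiableAt (by simp)
  have hx : ∀ x, HasFDerivAt (fun z => θ z x) ((fderiv ℂ θ z₀).flip x) z₀ := fun x => by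
    have := hd.hasFDerivAt.clm_apply (hasFDerivAt_const x z₀)
    simpa using this
  have key : ∀ u v w, θ z₀ (fderiv ℂ (fun z => coframeConnection br θ z v w) z₀ u) +
      fderiv ℂ θ z₀ u (coframeConnection br θ z₀ v w) =
      (2⁻¹ : ℂ) • (br (fderiv ℂ θ z₀ u v) (θ z₀ w) + br (θ z₀ v) (fderiv ℂ θ z₀ u w)) +
        fderiv ℂ (fderiv ℂ θ) z₀ u v w := by
    intro u v w
    have h1 := hd.hasFDerivAt.clm_apply
      (coframeConnection_differentiableAt (br := br) hθ hi v w).hasFDerivAt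
    have h2 : HasFDerivAt (fun z => fderiv ℂ θ z v w)
        (((fderiv ℂ (fderiv ℂ θ) z₀).flip v).flip w) z₀ := by
      have := (hd2.hasFDerivAt.clm_apply (hasFDerivAt_const v z₀)).clm_apply
        (hasFDerivAt_const w z₀)
      simpa using this
    have h3 := ((br.hasFDerivAt_of_bilinear (hx v) (hx w)).const_smul (2⁻¹ : ℂ)).add h2
    have h4 : (fun z => θ z (coframeConnection br θ z v w)) =ᶠ[𝓝 z₀]
        fun z => (2⁻¹ : ℂ) • br (θ z v) (θ z w) + fderiv ℂ θ z v w :=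
      (eventually_isInvertible hd.continuousAt hi).mono fun z hz => coframe_connection hz v w
    have h5 := congrArg (fun l : E →L[ℂ] W => l u) (h1.unique (h3.congr_of_eventuallyEq h4))
    simp at h5
    rw [h5]
    module
  have hsymm : fderiv ℂ (fderiv ℂ θ) z₀ u v w = fderiv ℂ (fderiv ℂ θ) z₀ v u w :=
    congrArg (fun l : E →L[ℂ] W => l w)
      ((hθ.isSymmSndFDerivAt_of_omega) u v)
  have k1 := key u v w
  have k2 := key v u w
  rw [hsymm] at k1
  have mc := congrArg (fun x => br x (θ z₀ w)) (hMC.self_of_nhds u v)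
  have jac := hj (θ z₀ u) (θ z₀ v) (θ z₀ w)
  rw [chartCurvature, map_sub, map_add, map_sub,
    coframe_connection hi u (coframeConnection br θ z₀ v w),
    coframe_connection hi v (coframeConnection br θ z₀ u w), coframe_connection hi v w,
    coframe_connection hi u w]
  simp only [map_add, map_smul, map_sub, map_neg, sub_apply, neg_apply] at mc ⊢
  linear_combination (norm := module) k1 - k2 + (2⁻¹ : ℂ) • mc + (4⁻¹ : ℂ) • jac

end Coframe

section LeftCoframe

/-- The Lie bracket of `sl(2, ℂ)` in coordinates. -/
def coordLie : (ℂ × ℂ × ℂ) →L[ℂ] (ℂ × ℂ × ℂ) →L[ℂ] ℂ × ℂ × ℂ :=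
  (LinearMap.mk₂ ℂ (fun x y => sl2Equiv ⁅sl2Equiv.symm x, sl2Equiv.symm y⁆)
    (fun x x' y => by rw [map_add, add_lie, map_add])
    (fun t x y => by rw [map_smul, smul_lie, map_smul])
    (fun x y y' => by rw [map_add, lie_add, map_add])
    (fun t x y => by rw [map_smul, lie_smul, map_smul])).toContinuousBilinearMap

lemma coordLie_apply (X Y : sl2) : coordLie (sl2Equiv X) (sl2Equiv Y) = sl2Equiv ⁅X, Y⁆ := by
  change sl2Equiv ⁅sl2Equiv.symm (sl2Equiv X), sl2Equiv.symm (sl2Equiv Y)⁆ = _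
  rw [LinearEquiv.symm_apply_apply, LinearEquiv.symm_apply_apply]

/-- The Killing form of `sl(2, ℂ)` in coordinates. -/
def coordKilling : (ℂ × ℂ × ℂ) →L[ℂ] (ℂ × ℂ × ℂ) →L[ℂ] ℂ :=
  ((killingForm ℂ sl2).compl₁₂ (sl2Equiv.symm : _ →ₗ[ℂ] sl2)
    (sl2Equiv.symm : _ →ₗ[ℂ] sl2)).toContinuousBilinearMap

lemma coordKilling_apply (X Y : sl2) :
    coordKilling (sl2Equiv X) (sl2Equiv Y) = killingForm ℂ sl2 X Y := by
  change killingForm ℂ sl2 (sl2Equiv.symm (sl2Equiv X)) (sl2Equiv.symm (sl2Equiv Y)) = _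
  rw [LinearEquiv.symm_apply_apply, LinearEquiv.symm_apply_apply]

lemma coord_induction {p : ℂ × ℂ × ℂ → Prop} (h : ∀ X, p (sl2Equiv X)) (x : ℂ × ℂ × ℂ) : p x := by
  rw [← sl2Equiv.apply_symm_apply x]
  exact h _

lemma coordLie_skew (x y : ℂ × ℂ × ℂ) : coordLie x y = -coordLie y x := by
  induction x using coord_induction with | h X => ?_
  induction y using coord_induction with | h Y => ?_
  rw [coordLie_apply, coordLie_apply, ← lie_skew, map_neg]

lemma coordLie_jacobi (x y z : ℂ × ℂ × ℂ) :
    coordLie x (coordLie y z) = coordLie (coordLie x y) z + coordLie y (coordLie x z) := by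
  induction x using coord_induction with | h X => ?_
  induction y using coord_induction with | h Y => ?_
  induction z using coord_induction with | h Z => ?_
  simp only [coordLie_apply]
  rw [leibniz_lie, map_add]

lemma coordKilling_symm (x y : ℂ × ℂ × ℂ) : coordKilling x y = coordKilling y x :=
  killingForm_symm _ _

lemma coordKilling_lie (x y z : ℂ × ℂ × ℂ) :
    coordKilling (coordLie x y) z + coordKilling y (coordLie x z) = 0 := by
  induction x using coord_induction with | h X => ?_
  induction y using coord_induction with | h Y => ?_
  induction z using coord_induction with | h Z => ?_
  simp only [coordLie_apply, coordKilling_apply]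
  exact killingForm_lie X Y Z

lemma coordKilling_nondeg {x : ℂ × ℂ × ℂ} (h : ∀ y, coordKilling x y = 0) : x = 0 := by
  induction x using coord_induction with | h X => ?_
  rw [killingForm_nondeg X fun Y => by rw [← coordKilling_apply]; exact h _, map_zero]

/-- The Lagrange identity for the Killing form of `sl(2, ℂ)`. -/
lemma coordKilling_curvature (x y : ℂ × ℂ × ℂ) :
    coordKilling (coordLie (coordLie x y) y) x =
      2⁻¹ * (coordKilling x x * coordKilling y y - coordKilling x y ^ 2) := by
  induction x using coord_induction with | h X => ?_
  induction y using coord_induction with | h Y => ?_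
  simp only [coordLie_apply, coordKilling_apply, killingForm_eq]
  induction X using sl2_induction with | h a b c => ?_
  induction Y using sl2_induction with | h a' b' c' => ?_
  simp only [sl2mk_lie, trForm_apply, sl2mk_00, sl2mk_01, sl2mk_10]
  ring

/-- The coordinates of a matrix in `sl(2, ℂ)`. -/
def coordMat : Mat2 →L[ℂ] ℂ × ℂ × ℂ :=
  LinearMap.toContinuousLinearMap
    { toFun := fun A => (A 0 0, A 0 1, A 1 0)
      map_add' := fun _ _ => rfl
      map_smul' := fun _ _ => rfl }

lemma coordMat_apply (A : Mat2) : coordMat A = (A 0 0, A 0 1, A 1 0) := rfl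

lemma coordMat_toMat (X : sl2) : coordMat (sl2.toMat X) = sl2Equiv X := rfl

variable {E : Type*} [NormedAddCommGroup E] [NormedSpace ℂ E]

/-- The form `A⁻¹ dA` for a map `A` to the unimodular matrices. -/
def leftCoframe (A : E → Mat2) (z : E) : E →L[ℂ] ℂ × ℂ × ℂ :=
  coordMat ∘L (mulM (adjM (A z))) ∘L fderiv ℂ A z

variable {A : E → Mat2} {z : E}

lemma leftCoframe_contDiffAt (hA : ContDiffAt ℂ ω A z) : ContDiffAt ℂ ω (leftCoframe A) z := by
  have h1 : ContDiffAt ℂ ω (fderiv ℂ A) z := hA.fderiv_right (m := ω) le_top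
  have h2 : ContDiffAt ℂ ω (fun z => mulM (adjM (A z))) z :=
    (mulM ∘L adjM).contDiff.contDiffAt.comp z hA
  exact contDiffAt_const.clm_comp (h2.clm_comp h1)

lemma adjM_mulM_mulM (A X Y : Mat2) : mulM (adjM (mulM A X)) (mulM A Y) =
    (A 0 0 * A 1 1 - A 0 1 * A 1 0) • mulM (adjM X) Y := by
  refine Mat2.ext fun i j => ?_
  rw [Pi.smul_apply, Pi.smul_apply, mulM_apply, mulM_apply]
  fin_cases i <;>
  · simp only [Fin.zero_eta, Fin.mk_one, adjM_00, adjM_01, adjM_10, adjM_11, mulM_apply,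
      smul_eq_mul]
    ring

lemma adjM_mulM_self (A Y : Mat2) : mulM (adjM A) (mulM A Y) =
    (A 0 0 * A 1 1 - A 0 1 * A 1 0) • Y := by
  refine Mat2.ext fun i j => ?_
  rw [Pi.smul_apply, Pi.smul_apply, mulM_apply]
  fin_cases i <;>
  · simp only [Fin.zero_eta, Fin.mk_one, adjM_00, adjM_01, adjM_10, adjM_11, mulM_apply,
      smul_eq_mul]
    ring

lemma coordMat_adjM_toMat (X Y : sl2) :
    coordMat (mulM (adjM (sl2.toMat X)) (sl2.toMat Y)) -
      coordMat (mulM (adjM (sl2.toMat Y)) (sl2.toMat X)) = -sl2Equiv ⁅X, Y⁆ := by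
  induction X using sl2_induction with | h a b c => ?_
  induction Y using sl2_induction with | h a' b' c' => ?_
  rw [sl2mk_lie, ← coordMat_toMat]
  simp only [coordMat_apply, Prod.mk_sub_mk, Prod.neg_mk, mulM_apply, adjM_00, adjM_01, adjM_10, adjM_11, sl2.toMat_apply, sl2mk_00, sl2mk_01,
    sl2mk_10, sl2mk_11, Prod.mk.injEq]
  refine ⟨?_, ?_, ?_⟩ <;> ring

lemma leftCoframe_apply (hdet : A z 0 0 * A z 1 1 - A z 0 1 * A z 1 0 = 1) {u : E} {X : sl2}
    (hX : fderiv ℂ A z u = mulM (A z) (sl2.toMat X)) : leftCoframe A z u = sl2Equiv X := by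
  change coordMat (mulM (adjM (A z)) (fderiv ℂ A z u)) = _
  rw [hX, adjM_mulM_self, hdet, one_smul, coordMat_toMat]

/-- The Maurer-Cartan equation. -/
lemma leftCoframe_maurerCartan (hA : ContDiffAt ℂ ω A z)
    (hdet : A z 0 0 * A z 1 1 - A z 0 1 * A z 1 0 = 1)
    (hX : ∀ u, ∃ X : sl2, fderiv ℂ A z u = mulM (A z) (sl2.toMat X)) (u v : E) :
    fderiv ℂ (leftCoframe A) z u v - fderiv ℂ (leftCoframe A) z v u =
      -coordLie (leftCoframe A z u) (leftCoframe A z v) := by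
  have h1 : DifferentiableAt ℂ (fderiv ℂ A) z :=
    (hA.fderiv_right (m := 1) le_top).differentiableAt (by simp)
  have hd : DifferentiableAt ℂ A z := hA.differentiableAt (by simp)
  have key : ∀ u v, fderiv ℂ (leftCoframe A) z u v =
      coordMat (mulM (adjM (fderiv ℂ A z u)) (fderiv ℂ A z v)) +
      coordMat (mulM (adjM (A z)) (fderiv ℂ (fderiv ℂ A) z u v)) := by
    intro u v
    have h2 : HasFDerivAt (fun z => leftCoframe A z v) ((fderiv ℂ (leftCoframe A) z).flip v) z := by
      have := ((leftCoframe_contDiffAt hA).differentiableAt (by simp)).hasFDerivAt.clm_apply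
        (hasFDerivAt_const v z)
      simpa using this
    have h3 : HasFDerivAt (fun z => fderiv ℂ A z v) ((fderiv ℂ (fderiv ℂ A) z).flip v) z := by
      have := h1.hasFDerivAt.clm_apply (hasFDerivAt_const v z)
      simpa using this
    have h4 := coordMat.hasFDerivAt.comp z (mulM.hasFDerivAt_of_bilinear
      (adjM.hasFDerivAt.comp z hd.hasFDerivAt) h3)
    have h5 := congrArg (fun l : E →L[ℂ] ℂ × ℂ × ℂ => l u) (h2.unique h4)
    refine h5.trans ?_
    rw [add_comm, ← map_add]
    rfl
  obtain ⟨X, hu⟩ := hX u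
  obtain ⟨Y, hv⟩ := hX v
  have hs : fderiv ℂ (fderiv ℂ A) z u v = fderiv ℂ (fderiv ℂ A) z v u :=
    hA.isSymmSndFDerivAt_of_omega u v
  rw [key, key, hs, leftCoframe_apply hdet hu, leftCoframe_apply hdet hv, coordLie_apply, hu, hv,
    adjM_mulM_mulM, adjM_mulM_mulM, hdet, one_smul, one_smul, ← coordMat_adjM_toMat]
  abel

end LeftCoframe

section KillingCurvature

variable {M : Type*} [TopologicalSpace M] [ChartedSpace C3 M] [IsManifold 𝓘(ℂ, C3) ω M]

/-- The coframe of a chart given by a local isometry to `SL(2, ℂ)` with the Killing metric. -/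
lemma IsLocalIsometry.exists_coframe {κ : Metric C3 M} {f : OpenPartialHomeomorph M SL2}
    (hf : IsLocalIsometry κ killingMetric f) (x : M) {z₀ : C3}
    (hz : z₀ ∈ (extChartAt 𝓘(ℂ, C3) x).target)
    (hx : (extChartAt 𝓘(ℂ, C3) x).symm z₀ ∈ f.source) :
    ∃ θ : C3 → C3 →L[ℂ] ℂ × ℂ × ℂ, ContDiffAt ℂ ω θ z₀ ∧ ∀ᶠ z in 𝓝 z₀, (θ z).IsInvertible ∧
      (∀ u v, fderiv ℂ θ z u v - fderiv ℂ θ z v u = -coordLie (θ z u) (θ z v)) ∧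
      ∀ u v, chartMetric κ x z u v = coordKilling (θ z u) (θ z v) := by
  set φ := extChartAt 𝓘(ℂ, C3) x with hφ
  let A : C3 → Mat2 := fun z => ιSL (f (φ.symm z))
  have hev : ∀ᶠ z in 𝓝 z₀, z ∈ φ.target ∧ φ.symm z ∈ f.source := by
    obtain ⟨h1, h2, -⟩ := chart_aux x hz
    exact (show ∀ᶠ z in 𝓝 z₀, z ∈ φ.target from h1).and (h2.continuousAt.eventually (f.open_source.mem_nhds hx))
  have hA : ∀ z, z ∈ φ.target ∧ φ.symm z ∈ f.source → ContDiffAt ℂ ω A z := by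
    intro z h
    rw [← contMDiffAt_iff_contDiffAt]
    exact (ιSL_contMDiff (f (φ.symm z))).comp z
      ((hf.isBihol.contMDiffAt h.2).comp z (chart_aux x h.1).2.1)
  let X : C3 → C3 → sl2 := fun z u => maurerCartan (f (φ.symm z))
    (mfderiv 𝓘(ℂ, C3) 𝓘(ℂ, ℂ × ℂ × ℂ) f (φ.symm z) (mfderiv 𝓘(ℂ, C3) 𝓘(ℂ, C3) φ.symm z u))
  have hX : ∀ z, z ∈ φ.target ∧ φ.symm z ∈ f.source → ∀ u,
      fderiv ℂ A z u = mulM (A z) (sl2.toMat (X z u)) := by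
    intro z h u
    have hc := (chart_aux x h.1).2.1.mdifferentiableAt (by simp)
    have h1 := mfderiv_comp z (hf.isBihol.mdiff h.2) hc
    have h2 := mfderiv_comp z ((ιSL_contMDiff (f (φ.symm z))).mdifferentiableAt
      (by simp)) ((hf.isBihol.mdiff h.2).comp z hc)
    rw [h1] at h2
    rw [← mfderiv_eq_fderiv]
    refine (congrArg (fun l : C3 →L[ℂ] Mat2 => l u) h2).trans ?_
    exact vecDeriv_ιSL (f (φ.symm z)) _
  have hdet : ∀ z, A z 0 0 * A z 1 1 - A z 0 1 * A z 1 0 = 1 := fun z => by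
    have := (f (φ.symm z)).2
    rwa [Matrix.det_fin_two] at this
  have hθ : ∀ z, z ∈ φ.target ∧ φ.symm z ∈ f.source → ∀ u,
      leftCoframe A z u = sl2Equiv (X z u) := fun z h u =>
    leftCoframe_apply (hdet z) (hX z h u)
  refine ⟨leftCoframe A, leftCoframe_contDiffAt (hA z₀ hev.self_of_nhds),
    hev.mono fun z h => ⟨?_, ?_, fun u v => ?_⟩⟩
  · have hi : Function.Injective (leftCoframe A z) := by
      intro u v huv
      rw [hθ z h, hθ z h] at huv
      exact (chart_aux x h.1).2.2.injective (hf.isBihol.mfderiv_injective h.2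
        ((maurerCartan_bijective _).1 (sl2Equiv.injective huv)))
    have hr : Module.finrank ℂ C3 = Module.finrank ℂ (ℂ × ℂ × ℂ) := by simp
    exact ⟨(LinearEquiv.ofInjectiveOfFinrankEq (leftCoframe A z).toLinearMap hi
      hr).toContinuousLinearEquiv, ContinuousLinearMap.ext fun _ => rfl⟩
  · exact leftCoframe_maurerCartan (hA z h) (hdet z) fun u => ⟨_, hX z h u⟩
  · rw [hθ z h, hθ z h, coordKilling_apply]
    exact (hf.isometry _ h.2 _ _).symm

/-- A metric locally isometric to the Killing metric of `SL(2, ℂ)` has constant sectional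
curvature. -/
lemma LocallyModelledOn.hasConstantSectionalCurvature {κ : Metric C3 M}
    (h : LocallyModelledOn κ killingMetric) : HasConstantSectionalCurvature κ (-8⁻¹) := by
  intro x
  have hex : ∀ z₀ : C3, ∃ θ : C3 → C3 →L[ℂ] ℂ × ℂ × ℂ, z₀ ∈ (extChartAt 𝓘(ℂ, C3) x).target →
      ContDiffAt ℂ ω θ z₀ ∧ ∀ᶠ z in 𝓝 z₀, (θ z).IsInvertible ∧
      (∀ u v, fderiv ℂ θ z u v - fderiv ℂ θ z v u = -coordLie (θ z u) (θ z v)) ∧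
      ∀ u v, chartMetric κ x z u v = coordKilling (θ z u) (θ z v) := by
    intro z₀
    obtain ⟨f, hf, hx⟩ := h ((extChartAt 𝓘(ℂ, C3) x).symm z₀)
    by_cases hz : z₀ ∈ (extChartAt 𝓘(ℂ, C3) x).target
    · obtain ⟨θ, hθ⟩ := hf.exists_coframe x hz hx
      exact ⟨θ, fun _ => hθ⟩
    · exact ⟨0, fun h => absurd h hz⟩
  choose Θ hΘ using hex
  have hchr : ∀ (z : C3) (θ : C3 → C3 →L[ℂ] ℂ × ℂ × ℂ), DifferentiableAt ℂ θ z →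
      (∀ᶠ y in 𝓝 z, (θ y).IsInvertible ∧
      (∀ u v, fderiv ℂ θ y u v - fderiv ℂ θ y v u = -coordLie (θ y u) (θ y v)) ∧
      ∀ u v, chartMetric κ x y u v = coordKilling (θ y u) (θ y v)) → ∀ u v w : C3,
      2 * chartMetric κ x z (coframeConnection coordLie θ z u v) w =
      fderiv ℂ (fun z => chartMetric κ x z v w) z u +
      fderiv ℂ (fun z => chartMetric κ x z u w) z v -
      fderiv ℂ (fun z => chartMetric κ x z u v) z w := by
    intro z θ hd hθ u v w
    have hfd : ∀ u v, fderiv ℂ (fun z => chartMetric κ x z u v) z =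
        fderiv ℂ (fun z => coordKilling (θ z u) (θ z v)) z := fun u v =>
      Filter.EventuallyEq.fderiv_eq (hθ.mono fun y hy => hy.2.2 u v)
    rw [hfd, hfd, hfd, hθ.self_of_nhds.2.2]
    exact coframe_christoffel hd hθ.self_of_nhds.1 hθ.self_of_nhds.2.1 coordKilling
      coordKilling_symm coordLie_skew coordKilling_lie u v w
  refine ⟨fun z => coframeConnection coordLie (Θ z) z, fun z hz u v w =>
    hchr z (Θ z) ((hΘ z hz).1.differentiableAt (by simp)) (hΘ z hz).2 u v w, ?_⟩
  rintro z rfl u v hne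
  set z := extChartAt 𝓘(ℂ, C3) x x
  have hz : z ∈ (extChartAt 𝓘(ℂ, C3) x).target := mem_extChartAt_target x
  obtain ⟨hs, hev⟩ := hΘ z hz
  have hΓ : ∀ᶠ y in 𝓝 z, ∀ u v, coframeConnection coordLie (Θ y) y u v =
      coframeConnection coordLie (Θ z) y u v := by
    filter_upwards [(isOpen_extChartAt_target x).mem_nhds hz, eventually_eventually_nhds.2 hev,
      hs.eventually (by simp)] with y hy hy' hsy u v
    have hi := hy'.self_of_nhds.1
    have hg := hy'.self_of_nhds.2.2
    have h0 : ∀ w, coordKilling (Θ z y (coframeConnection coordLie (Θ y) y u v -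
        coframeConnection coordLie (Θ z) y u v)) w = 0 := by
      intro w
      obtain ⟨w, rfl⟩ := hi.surjective w
      have h1 := hchr y (Θ y) ((hΘ y hy).1.differentiableAt (by simp)) (hΘ y hy).2 u v w
      have h2 := hchr y (Θ z) (hsy.differentiableAt (by simp)) hy' u v w
      rw [hg] at h1 h2
      rw [map_sub, map_sub, sub_apply]
      linear_combination (h1 - h2) / 2
    have h3 := coordKilling_nondeg h0
    exact sub_eq_zero.1 (hi.injective (h3.trans (map_zero _).symm))
  have hcurv : chartCurvature (fun z => coframeConnection coordLie (Θ z) z) z u v v =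
      chartCurvature (coframeConnection coordLie (Θ z)) z u v v := by
    have hfd : ∀ a b, fderiv ℂ (fun y => coframeConnection coordLie (Θ y) y a b) z =
        fderiv ℂ (fun y => coframeConnection coordLie (Θ z) y a b) z := fun a b =>
      Filter.EventuallyEq.fderiv_eq (hΓ.mono fun y hy => hy a b)
    rw [chartCurvature, chartCurvature, hfd, hfd]
  have hi := hev.self_of_nhds.1
  have hg := hev.self_of_nhds.2.2
  rw [div_eq_iff hne, hcurv, hg, coframe_curvature hs hi (hev.mono fun y hy => hy.2.1)
    coordLie_jacobi, map_smul, smul_apply, coordKilling_curvature, hg, hg, hg, smul_eq_mul]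
  ring

end KillingCurvature

section Dichotomy

variable {M : Type*} [TopologicalSpace M] [ChartedSpace C3 M] [IsManifold 𝓘(ℂ, C3) ω M]
variable {g : Metric C3 M}

lemma IsLocalIsometry.finrank_killingAlgebra {E' M' : Type*} [NormedAddCommGroup E']
    [NormedSpace ℂ E'] [CompleteSpace E'] [TopologicalSpace M'] [ChartedSpace E' M']
    [IsManifold 𝓘(ℂ, E') ω M'] {g' : Metric E' M'} {f : OpenPartialHomeomorph M M'}
    (hf : IsLocalIsometry g g' f) {x : M} (hx : x ∈ f.source)
    (dim : Module.finrank ℂ (KillingAlgebra g x) = 4) :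
    Module.finrank ℂ (KillingAlgebra g' (f x)) = 4 :=
  (hf.pullEquiv hx).toLinearEquiv.finrank_eq.trans dim

/-- A property of the isotropy at one point of a locally homogeneous manifold holds at every
point. -/
lemma LocallyHomogeneous.isotropy_line (hom : LocallyHomogeneous g) {x₀ : M} {ℓ : ℂ → ℂ × sl2}
    {ψ : KillingAlgebra g x₀ ≃ₗ⁅ℂ⁆ ℂ × sl2}
    (hψ : ∀ a, a ∈ KillingAlgebra.isotropy g x₀ ↔ ∃ s, ψ a = ℓ s) (x : M) :
    ∃ ψ' : KillingAlgebra g x ≃ₗ⁅ℂ⁆ ℂ × sl2,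
      ∀ a, a ∈ KillingAlgebra.isotropy g x ↔ ∃ s, ψ' a = ℓ s := by
  obtain ⟨ψ', h⟩ := hom.exists_isotropy_equiv ψ x
  refine ⟨ψ', fun a => ?_⟩
  obtain ⟨b, hb, hab⟩ := h a
  rw [hab, hψ, hb]

section First

variable {q : LinearMap.BilinForm ℂ sl2} {hs : ∀ X Y, q X Y = q Y X}
  {hn : ∀ X, (∀ Y, q X Y = 0) → X = 0} {v : sl2} {hv : ∀ X Y, q ⁅v, X⁆ Y + q X ⁅v, Y⁆ = 0}

/-- The metric of constant curvature of the first model. -/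
lemma LocallyModelledOn.exists_killingMetric (hmod : LocallyModelledOn g (leftInvariant q hs hn))
    (hF : (familySL q hs hn v hv).Complete) :
    ∃ κ : Metric C3 M, ComesFromKillingForm g (leftInvariant q hs hn) κ ∧
      (∃ k : ℂ, k ≠ 0 ∧ HasConstantSectionalCurvature κ k) ∧
      ∀ x : M, localKilling g x ≤ localKilling κ x := by
  obtain ⟨κ, hκ⟩ := hmod.exists_metric killingMetric (isLocalIsometry_killingMetric hF)
  refine ⟨κ, fun f hf x hx X Y => ((hκ f hf).isometry x hx X Y).symm, ⟨-8⁻¹, by norm_num,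
    LocallyModelledOn.hasConstantSectionalCurvature fun x => ?_⟩, fun x => ?_⟩
  · obtain ⟨f, hf, hx⟩ := hmod x
    exact ⟨f, hκ f hf, hx⟩
  · obtain ⟨f, hf, hx⟩ := hmod x
    refine hF.localKilling_le (fun p y => ?_) hf (hκ f hf) hx
    refine killingAt_fieldSL _ killingForm_symm killingForm_nondeg v p (fun X Y => ?_) y
    rw [killingForm_lie, mul_zero]

lemma LocallyModelledOn.not_productMetric [Nonempty M]
    (hmod : LocallyModelledOn g (leftInvariant q hs hn)) (hF : (familySL q hs hn v hv).Complete)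
    (c : ℂ) (hc : c ≠ 0) : ¬ LocallyModelledOn g (productMetric c hc) := by
  intro h
  obtain ⟨x⟩ := ‹Nonempty M›
  obtain ⟨f, hf, hx⟩ := hmod x
  obtain ⟨f', hf', hx'⟩ := h x
  refine not_isLocalIsometry_CS hF (hf.symm.trans hf') (x := f x) ?_
  rw [OpenPartialHomeomorph.trans_source]
  refine ⟨f.map_source hx, ?_⟩
  rw [Set.mem_preimage, f.left_inv hx]
  exact hx'

end First

lemma LocallyModelledOn.not_leftInvariant [Nonempty M] {c : ℂ} {hc : c ≠ 0}
    (hmod : LocallyModelledOn g (productMetric c hc)) (hF : (familyCS c hc).Complete)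
    (q : LinearMap.BilinForm ℂ sl2) (hs : ∀ X Y, q X Y = q Y X)
    (hn : ∀ X, (∀ Y, q X Y = 0) → X = 0) : ¬ LocallyModelledOn g (leftInvariant q hs hn) := by
  intro h
  obtain ⟨x⟩ := ‹Nonempty M›
  obtain ⟨f, hf, hx⟩ := hmod x
  obtain ⟨f', hf', hx'⟩ := h x
  refine not_isLocalIsometry_SL2 hF (hf.symm.trans hf') (x := f x) ?_
  rw [OpenPartialHomeomorph.trans_source]
  refine ⟨f.map_source hx, ?_⟩
  rw [Set.mem_preimage, f.left_inv hx]
  exact hx'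

end Dichotomy

end HolRiem

end

theorem mainTheorem9 {M : Type*} [TopologicalSpace M] [T2Space M] [ConnectedSpace M]
    [ChartedSpace HolRiem.C3 M] [IsManifold 𝓘(ℂ, HolRiem.C3) ω M]
    (g : HolRiem.Metric HolRiem.C3 M) (hom : HolRiem.LocallyHomogeneous g) (x₀ : M)
    (dim : Module.finrank ℂ (HolRiem.KillingAlgebra g x₀) = 4)
    (ss : HolRiem.HasNontrivialSemisimplePart (HolRiem.KillingAlgebra g x₀)) :
    (∀ x : M, Nonempty (HolRiem.KillingAlgebra g x ≃ₗ⁅ℂ⁆ ℂ × HolRiem.sl2)) ∧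
    ((∃ (q : LinearMap.BilinForm ℂ HolRiem.sl2) (hs : ∀ X Y, q X Y = q Y X)
        (hn : ∀ X, (∀ Y, q X Y = 0) → X = 0) (v : HolRiem.sl2) (h : ℂ → HolRiem.SL2),
        HolRiem.IsFirstModel g (HolRiem.leftInvariant q hs hn) v h ∧
        (∃ κ : HolRiem.Metric HolRiem.C3 M,
          HolRiem.ComesFromKillingForm g (HolRiem.leftInvariant q hs hn) κ ∧
          (∃ k : ℂ, k ≠ 0 ∧ HolRiem.HasConstantSectionalCurvature κ k) ∧
          ∀ x : M, HolRiem.localKilling g x ≤ HolRiem.localKilling κ x) ∧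
        ∀ (c : ℂ) (hc : c ≠ 0),
          ¬ HolRiem.LocallyModelledOn g (HolRiem.productMetric c hc)) ∨
     (∃ (c : ℂ) (hc : c ≠ 0),
        HolRiem.IsSecondModel g (HolRiem.productMetric c hc) ∧
        ∀ (q : LinearMap.BilinForm ℂ HolRiem.sl2) (hs : ∀ X Y, q X Y = q Y X)
          (hn : ∀ X, (∀ Y, q X Y = 0) → X = 0),
          ¬ HolRiem.LocallyModelledOn g (HolRiem.leftInvariant q hs hn))) := by
  obtain ⟨ψ⟩ := HolRiem.nonempty_equiv_of_finrank_four dim ss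
  refine ⟨fun x => (hom.exists_isotropy_equiv ψ x).nonempty, ?_⟩
  rcases HolRiem.exists_local_model g hom ψ with ⟨q, hs, hn, v, hv', hv, hmod, ψ', hψ'⟩ |
    ⟨c, hc, hmod, ψ', hψ'⟩
  · obtain ⟨f, hf, hx⟩ := hmod x₀
    have hv0 : v ≠ 0 := by
      rcases hv' with rfl | rfl
      · exact HolRiem.sl2H_ne_zero
      · exact HolRiem.sl2E_ne_zero
    have hF := HolRiem.familySL_complete (hv := hv) hv0 (hf.finrank_killingAlgebra hx dim)
    obtain ⟨h, hh⟩ := HolRiem.exists_centralizerFlow hv'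
    exact Or.inl ⟨q, hs, hn, v, h, ⟨hv0, hh.oneParameter, hmod,
      HolRiem.mem_isometryComponent_SL2_iff hF hv' hh, HolRiem.stabilizer_SL2_iff hF hv' hh,
      hom.isotropy_line hψ'⟩, hmod.exists_killingMetric hF, hmod.not_productMetric hF⟩
  · obtain ⟨f, hf, hx⟩ := hmod x₀
    have hF := HolRiem.familyCS_complete (hf.finrank_killingAlgebra hx dim)
    exact Or.inr ⟨c, hc, ⟨hmod, HolRiem.mem_isometryComponent_CS_iff hF,
      HolRiem.stabilizer_CS_iff hF, hom.isotropy_line hψ'⟩, hmod.not_leftInvariant hF⟩
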